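/- Let $S^2$ be the unit sphere of $\mathbb{R}^3$ centered at the origin, with the spherical distance $|ab|$ and the usual surface area. A set $C\subset S^2$ is *convex* if it contains no pair of antipodes and, with any two points $a,b$, the shorter great circle arc $ab$; a *convex body* is a closed convex set with non-empty interior. A hemisphere $K$ (closed) *supports* a convex body $C$ if $C\subseteq K$ and $C\cap \mathrm{bd}(K)\neq\emptyset$. For different hemispheres $G,H$ whose centers are not antipodes, the *thickness* of the lune $G\cap H$ is the distance of the centers of the two semicircles $\mathrm{bd}(G)\cap H$ and $\mathrm{bd}(H)\cap G$. The *width* of $C$ determined by a supporting hemisphere $K$ is the minimum thickness of a lune $K\cap K^*$ over all hemispheres $K^*\ne K$ supporting $C$, and the *thickness* $\Delta(C)$ is the minimum of these widths over all supporting hemispheres $K$ of $C$. A convex body $C$ is *reduced* if $\Delta(R)<\Delta(C)$ for each convex body $R\subsetneq C$. A *spherically convex $n$-gon* ($n\ge 3$) is the convex hull of $n$ points of $S^2$ that lie in a common convex set and none of which belongs to the convex hull of the remaining ones; it is *regular* if its sides have equal length and its interior angles have equal measure. **Theorem.** Let $V$ be a reduced spherically convex $n$-gon that is not regular. Then there is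 a regular spherically convex $n$-gon $W$ with $\Delta(W)=\Delta(V)$, and every such $W$ satisfies $$\mathrm{area}(V)<\mathrm{area}(W).$$ -/

import Mathlib

open Real Set Metric MeasureTheory
open scoped InnerProductSpace

noncomputable section

namespace SphericalGeometry

/-- Three-dimensional Euclidean space. -/
abbrev E3 : Type := EuclideanSpace ℝ (Fin 3)

/-- The unit sphere of `E3` centered at the origin. The antipode of `p` is `-p`. -/
abbrev S2 : Type := sphere (0 : E3) 1

/-- The spherical distance `|ab|`: the length of the shorter great circle arc from `a` to `b`,
which is the angle between the two unit vectors. -/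
def sphDist (a b : S2) : ℝ := InnerProductGeometry.angle (a : E3) (b : E3)

/-- The arc `ab`, for `a`, `b` that are not antipodes: the shorter part of the great circle
through `a` and `b`, i.e. the points of the sphere in the convex cone spanned by `a` and `b`
(and the single point `a` if `a = b`). -/
def arc (a b : S2) : Set S2 :=
  {p | ∃ s t : ℝ, 0 ≤ s ∧ 0 ≤ t ∧ (p : E3) = s • (a : E3) + t • (b : E3)}

/-- A set is convex if it contains no pair of antipodes, and contains with any two points the
arc joining them. -/
def IsConvex (C : Set S2) : Prop :=
  (∀ a ∈ C, -a ∉ C) ∧ ∀ a ∈ C, ∀ b ∈ C, arc a b ⊆ C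

/-- A convex body is a closed convex set with non-empty interior (in the sphere). -/
def IsConvexBody (C : Set S2) : Prop :=
  IsConvex C ∧ IsClosed C ∧ (interior C).Nonempty

/-- The spherical disk of center `k` and radius `r`. -/
def disk (k : S2) (r : ℝ) : Set S2 := {p | sphDist p k ≤ r}

/-- The spherical circle of center `k` and radius `r`, the boundary of the disk. -/
def circle (k : S2) (r : ℝ) : Set S2 := {p | sphDist p k = r}

/-- The hemisphere of center `k`. -/
def hemisphere (k : S2) : Set S2 := disk k (π / 2)

/-- The great circle bounding the hemisphere of center `k`. -/
def greatCircle (k : S2) : Set S2 := circle k (π / 2)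

/-- The component of `q` orthogonal to `p`. For `q ≠ p, -p` it is non-zero, and it is tangent at
`p` to the arc `pq`, pointing towards `q`; its direction is that of the center of the great
semicircle in which the hemisphere of center `q` meets the great circle bounding the hemisphere of
center `p`. -/
def tangentTo (p q : S2) : E3 := (q : E3) - ⟪(p : E3), (q : E3)⟫_ℝ • (p : E3)

/-- The thickness of the lune `G ∩ H`, where `G`, `H` are the hemispheres of centers `g`, `h`
(with `h ≠ g, -g`): the distance of the centers of the semicircles `G/H = bd G ∩ H` and
`H/G = bd H ∩ G`. These centers are the unit vectors in the directions `tangentTo g h` and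
`tangentTo h g`, and angles do not depend on the lengths of the vectors. -/
def luneThickness (g h : S2) : ℝ :=
  InnerProductGeometry.angle (tangentTo g h) (tangentTo h g)

/-- The hemisphere of center `k` supports `C` (at some point). -/
def Supports (k : S2) (C : Set S2) : Prop :=
  C ⊆ hemisphere k ∧ (greatCircle k ∩ C).Nonempty

/-- The width of `C` determined by the supporting hemisphere `K` of center `k`: the minimum (which
is attained if `C` is a convex body) of the thickness of the lune `K ∩ K'` over all hemispheres
`K' ≠ K` supporting `C`. -/
def width (k : S2) (C : Set S2) : ℝ :=
  sInf {τ | ∃ k' : S2, k' ≠ k ∧ k' ≠ -k ∧ Supports k' C ∧ τ = luneThickness k k'}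

/-- The thickness `Δ(C)`: the minimum (attained if `C` is a convex body) of the widths of `C`
determined by its supporting hemispheres. -/
def thickness (C : Set S2) : ℝ :=
  sInf {w | ∃ k : S2, Supports k C ∧ w = width k C}

/-- A convex body `C` is reduced if every convex body properly contained in `C` has smaller
thickness. -/
def IsReduced (C : Set S2) : Prop :=
  IsConvexBody C ∧ ∀ R : Set S2, IsConvexBody R → R ⊂ C → thickness R < thickness C

/-- The convex hull of a subset of a convex set: the intersection of all convex sets
containing it. -/
def hull (A : Set S2) : Set S2 := ⋂₀ {D | IsConvex D ∧ A ⊆ D}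

/-- The points `v i` are `n ≥ 3` points, lying in a common convex set, none of which belongs to the
convex hull of the remaining ones. (In particular they are distinct.) The indices are taken
modulo `n`. -/
def InConvexPosition (n : ℕ) (v : ZMod n → S2) : Prop :=
  3 ≤ n ∧ (∃ D : Set S2, IsConvex D ∧ range v ⊆ D) ∧ ∀ i, v i ∉ hull (v '' {j | j ≠ i})

/-- A spherically convex `n`-gon. -/
def IsPolygon (n : ℕ) (V : Set S2) : Prop :=
  ∃ v : ZMod n → S2, InConvexPosition n v ∧ V = hull (range v)

/-- The determinant of three vectors. -/
def det3 (a b c : E3) : ℝ := Matrix.det (Matrix.of ![a.ofLp, b.ofLp, c.ofLp])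

/-- Points in convex position are listed in counterclockwise order: all the remaining points are
strictly to the left of the oriented great circle from `v i` to `v (i + 1)`. So `v i`, `v (i + 1)`
are the end points of a side of the polygon. -/
def IsCounterclockwise (n : ℕ) (v : ZMod n → S2) : Prop :=
  ∀ i j : ZMod n, j ≠ i → j ≠ i + 1 → 0 < det3 (v i) (v (i + 1)) (v j)

/-- The angle at `p` between the arcs `pa` and `pb`. -/
def sphAngle (a p b : S2) : ℝ := InnerProductGeometry.angle (tangentTo p a) (tangentTo p b)

/-- A regular spherical `n`-gon: a spherically convex `n`-gon with sides of equal length and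
interior angles of equal measure. -/
def IsRegularPolygon (n : ℕ) (W : Set S2) : Prop :=
  ∃ v : ZMod n → S2, InConvexPosition n v ∧ W = hull (range v) ∧ IsCounterclockwise n v ∧
    (∀ i j, sphDist (v i) (v (i + 1)) = sphDist (v j) (v (j + 1))) ∧
    (∀ i j, sphAngle (v (i - 1)) (v i) (v (i + 1)) = sphAngle (v (j - 1)) (v j) (v (j + 1)))

/-- The area of a subset of the sphere: its surface measure (of total mass `4π`). -/
def area (V : Set S2) : ℝ := ((volume : Measure E3).toSphere V).toReal

end SphericalGeometry

end

open Real Set Metric MeasureTheory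
open scoped InnerProductSpace
noncomputable section
namespace SphericalGeometry
set_option linter.unusedSectionVars false

section

/-! ### Vector algebra in three dimensions -/

/-! Polarity turns the problem into one about distances. Let `v i` be the vertices of V and `w i`
the inner unit normals of its sides. A hemisphere supports V exactly if its centre is on the
boundary of the polar polygon spanned by the `w i`, and the thickness of a lune is `π` minus the
distance of the two centres (`luneThickness_eq`). So the thickness `Δ` is `π` minus the diameter of
the polar polygon; `PolarPair.thickness_bound` says that no two vectors of the polar cone are
farther apart.

Reducedness is used by cutting off a small neighbourhood of a vertex `v i`. This enlarges the polar
polygon slightly near the side dual to `v i`, and must produce a pair of points at a distance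
greater than `π - Δ`. In the limit there remains a diametral chord which starts at a point `x i` of
that side and is perpendicular to it (`PolarPair.exists_perp_chord`); a second order argument shows
that its other end is a vertex `w (σ i)` (`PolarPair.exists_eq_vertex`). Diametral chords that do
not cross must share end points, and this forces `n = 2 * g + 1` and `σ i = i + g`
(`ChordSystem.exists_shift`).

By Girard's formula (`PolarPair.area_hull`) the area decreases with the sum of the exterior angles,
so that sum has to be bounded below. Put `c = cos Δ` and let `ψ i` be the angle between `x i` and `w
i`. For `c > 0` the exterior angle at `v i` is `ψ i + ψ (i + g)`, so the sum is `2 * ∑ ψ i`. The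
planes of consecutive chords enclose the angle `chordAngle c (ψ i)`. Their normals, taken with
alternating signs, lead from a vector to its antipode after an odd number `n` of steps, so these
angles add up to at least `π`. As `chordAngle c` is strictly concave, and increasing on the first
half of its interval, Jensen's inequality bounds the mean of the `ψ i` below by the `ψ₀` at which
`chordAngle c` is `π / n` (`le_sum_of_pi_le`), strictly unless all the `ψ i` agree; in that case V
is regular. For the regular polygon of the same thickness half the exterior angle is exactly `ψ₀`
(`RegularFrame.chordAngle_exterior`).

For `c = 0` the points `x i` are not determined and the normals above vanish. Now `w (i + g) = v i`,
so the polygon is its own polar, and the vectors `w (k * g)` form a closed polygon with quarter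
circles as sides, whose angles are the exterior angles of V. The sum of the angles of such cycles is
minimized over a compact set. A variation of two neighbouring vertices shows that a minimizer has
equal angles unless some angle is zero or straight; a zero angle allows two vertices to be removed,
and a straight angle makes the sum at least `2 * π` (`IsOrthogonalCycle.le_turning`).

Regular polygons are described by `RegularFrame`. For odd `n` their thickness is the sum of the
radii of the inscribed and the circumscribed circle, provided that this sum is at most `π / 2`
(`RegularFrame.thickness_eq`). The intermediate value theorem provides one of the required
thickness, and `IsRegularPolygon.exists_frame` shows that every regular polygon has this form. -/

theorem inner_eq_coord (a b : E3) : ⟪a, b⟫_ℝ = a 0 * b 0 + a 1 * b 1 + a 2 * b 2 := by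
  simp [PiLp.inner_apply, Fin.sum_univ_three]; ring

/-- The cross product on `E3`. -/
def cross (a b : E3) : E3 :=
  !₂[a 1 * b 2 - a 2 * b 1, a 2 * b 0 - a 0 * b 2, a 0 * b 1 - a 1 * b 0]

theorem det3_eq (a b c : E3) : det3 a b c = a 0 * (b 1 * c 2 - b 2 * c 1)
    - a 1 * (b 0 * c 2 - b 2 * c 0) + a 2 * (b 0 * c 1 - b 1 * c 0) := by
  simp [det3, Matrix.det_fin_three]; ring

@[simp] theorem cross_zero (a b : E3) : cross a b 0 = a 1 * b 2 - a 2 * b 1 := rfl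
@[simp] theorem cross_one (a b : E3) : cross a b 1 = a 2 * b 0 - a 0 * b 2 := rfl
@[simp] theorem cross_two (a b : E3) : cross a b 2 = a 0 * b 1 - a 1 * b 0 := rfl

theorem ext3 {a b : E3} (h0 : a 0 = b 0) (h1 : a 1 = b 1) (h2 : a 2 = b 2) : a = b := by
  ext i; fin_cases i <;> assumption

theorem inner_cross (a b c : E3) : ⟪a, cross b c⟫_ℝ = det3 a b c := by
  simp only [inner_eq_coord, det3_eq, cross_zero, cross_one, cross_two]; ring

theorem cross_inner (a b c : E3) : ⟪cross a b, c⟫_ℝ = det3 a b c := by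
  simp only [inner_eq_coord, det3_eq, cross_zero, cross_one, cross_two]; ring

/-- Expansion in the basis reciprocal to `a`, `b`, `c`; `cramer'` is the expansion in these vectors
themselves. The factor in front makes independence unnecessary. -/
theorem cramer (a b c k : E3) : det3 a b c • k =
    ⟪k, a⟫_ℝ • cross b c + ⟪k, b⟫_ℝ • cross c a + ⟪k, c⟫_ℝ • cross a b := by
  apply ext3 <;> simp [inner_eq_coord, det3_eq] <;> ring

theorem cramer' (a b c k : E3) : det3 a b c • k =
    det3 k b c • a + det3 a k c • b + det3 a b k • c := by
  apply ext3 <;> simp [det3_eq] <;> ring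

theorem inner_cross_cross (a b c d : E3) : ⟪cross a b, cross c d⟫_ℝ =
    ⟪a, c⟫_ℝ * ⟪b, d⟫_ℝ - ⟪a, d⟫_ℝ * ⟪b, c⟫_ℝ := by
  simp only [inner_eq_coord, cross_zero, cross_one, cross_two]; ring

/-- The planes of two consecutive sides meet in their common vertex. This is what makes polarity of
polygons an involution. -/
theorem cross_cross_cross (a b c : E3) : cross (cross a b) (cross b c) = det3 a b c • b := by
  apply ext3 <;> simp [det3_eq] <;> ring

theorem det3_rotate (a b c : E3) : det3 b c a = det3 a b c := by
  simp only [det3_eq]; ring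

theorem det3_swap (a b c : E3) : det3 b a c = - det3 a b c := by
  simp only [det3_eq]; ring

theorem det3_swap' (a b c : E3) : det3 a c b = - det3 a b c := by
  simp only [det3_eq]; ring

theorem det3_self_left (a b : E3) : det3 a a b = 0 := by simp only [det3_eq]; ring
theorem det3_self_right (a b : E3) : det3 a b b = 0 := by simp only [det3_eq]; ring
theorem det3_self_outer (a b : E3) : det3 a b a = 0 := by simp only [det3_eq]; ring

theorem det3_add_left (a b c d : E3) : det3 (a + b) c d = det3 a c d + det3 b c d := by
  simp only [det3_eq, PiLp.add_apply]; ring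
theorem det3_smul_left (r : ℝ) (a c d : E3) : det3 (r • a) c d = r * det3 a c d := by
  simp only [det3_eq, PiLp.smul_apply, smul_eq_mul]; ring
theorem det3_add_mid (a b c d : E3) : det3 c (a + b) d = det3 c a d + det3 c b d := by
  simp only [det3_eq, PiLp.add_apply]; ring
theorem det3_smul_mid (r : ℝ) (a c d : E3) : det3 c (r • a) d = r * det3 c a d := by
  simp only [det3_eq, PiLp.smul_apply, smul_eq_mul]; ring
theorem det3_add_right (a b c d : E3) : det3 c d (a + b) = det3 c d a + det3 c d b := by
  simp only [det3_eq, PiLp.add_apply]; ring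
theorem det3_smul_right (r : ℝ) (a c d : E3) : det3 c d (r • a) = r * det3 c d a := by
  simp only [det3_eq, PiLp.smul_apply, smul_eq_mul]; ring

/-- The Grassmann–Plücker relation among the determinants with a common first vector. -/
theorem det3_plucker (o e a b c : E3) : det3 o e b * det3 o a c =
    det3 o e a * det3 o b c + det3 o e c * det3 o a b := by
  simp only [det3_eq]; ring

/-- The Gram determinant. -/
theorem det3_sq (a b c : E3) : det3 a b c ^ 2 =
    ⟪a, a⟫_ℝ * ⟪b, b⟫_ℝ * ⟪c, c⟫_ℝ + 2 * ⟪a, b⟫_ℝ * ⟪b, c⟫_ℝ * ⟪a, c⟫_ℝ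
      - ⟪a, a⟫_ℝ * ⟪b, c⟫_ℝ ^ 2 - ⟪b, b⟫_ℝ * ⟪a, c⟫_ℝ ^ 2 - ⟪c, c⟫_ℝ * ⟪a, b⟫_ℝ ^ 2 := by
  simp only [inner_eq_coord, det3_eq]; ring

theorem eq_zero_of_det3_ne_zero {a b c k : E3} (h : det3 a b c ≠ 0) (ha : ⟪k, a⟫_ℝ = 0)
    (hb : ⟪k, b⟫_ℝ = 0) (hc : ⟪k, c⟫_ℝ = 0) : k = 0 := by
  have := cramer a b c k
  rw [ha, hb, hc] at this
  simpa [h] using this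

theorem inner_self_S2 (x : S2) : ⟪(x : E3), (x : E3)⟫_ℝ = 1 := by
  rw [real_inner_self_eq_norm_sq, norm_eq_of_mem_sphere]; norm_num

/-- The point of the sphere in the direction of a non-zero vector. -/
def normalizeS2 (x : E3) (hx : x ≠ 0) : S2 :=
  ⟨‖x‖⁻¹ • x, by simp [norm_smul, hx]⟩

/-! ### Convex polygons and their polars -/

/-- A cyclic sequence of vectors of which every triple in cyclic order is positively oriented. -/
def CyclicPos (n : ℕ) (v : ZMod n → E3) : Prop :=
  ∀ (i : ZMod n) (a b : ℕ), 0 < a → a < b → b < n → 0 < det3 (v i) (v (i + a)) (v (i + b))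

theorem exists_offset {n : ℕ} [NeZero n] (i j : ZMod n) : ∃ a : ℕ, a < n ∧ j = i + a :=
  ⟨(j - i).val, ZMod.val_lt _, by simp⟩

theorem natCast_ne_zero_of_lt {n a : ℕ} (h0 : 0 < a) (h : a < n) : (a : ZMod n) ≠ 0 := by
  intro h'
  rw [ZMod.natCast_eq_zero_iff] at h'
  exact absurd (Nat.le_of_dvd h0 h') (by omega)

theorem offset_ne {n a b : ℕ} {i : ZMod n} (hab : a < b) (hb : b < n) :
    i + (a : ZMod n) ≠ i + (b : ZMod n) := by
  intro h
  have h1 : ((b - a : ℕ) : ZMod n) = 0 := by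
    rw [Nat.cast_sub hab.le]; linear_combination -h
  exact natCast_ne_zero_of_lt (by omega) (by omega) h1

theorem offset_ne_self {n b : ℕ} {i : ZMod n} (h0 : 0 < b) (hb : b < n) :
    i + (b : ZMod n) ≠ i := by
  intro h
  exact natCast_ne_zero_of_lt h0 hb (by linear_combination h)

/-- If every vector but `v i`, `v (i + 1)` is on the left of the plane of these two, then all
triples are positively oriented. -/
theorem cyclicPos_of_local {n : ℕ} {v : ZMod n → E3}
    (h : ∀ i j : ZMod n, j ≠ i → j ≠ i + 1 → 0 < det3 (v i) (v (i + 1)) (v j)) :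
    CyclicPos n v := by
  intro i a b ha hab hb
  induction b, hab using Nat.le_induction with
  | base =>
    have := h (i + a) i (offset_ne_self ha (by omega)).symm (by
      have := offset_ne_self (i := i) (b := a + 1) (by omega) hb
      intro h'; apply this; rw [h'.trans (add_assoc _ _ _)]; push_cast; ring_nf
      have h2 : i = i + a + 1 := h'
      linear_combination -h2)
    rw [det3_rotate] at this
    push_cast at this ⊢
    rw [← add_assoc]; exact this
  | succ b hab ih =>
    have hab : a < b := hab
    have ihb := ih (by omega)
    have hbb : 0 < det3 (v i) (v (i + b)) (v (i + (b + 1 : ℕ))) := by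
      have := h (i + b) i (offset_ne_self (by omega) (by omega)).symm (by
        have := offset_ne_self (i := i) (b := b + 1) (by omega) hb
        intro h'; apply this; push_cast; linear_combination -h')
      rw [det3_rotate] at this
      push_cast at this ⊢
      rw [← add_assoc]; exact this
    have hloc : ∀ c : ℕ, 1 < c → c < n → 0 < det3 (v i) (v (i + 1)) (v (i + c)) := by
      intro c hc hcn
      refine h i _ (offset_ne_self (by omega) hcn) ?_
      have := offset_ne (i := i) hc hcn
      intro h'; apply this; rw [h']; push_cast; ring
    rcases Nat.lt_or_ge 1 a with h1 | h1
    -- The Plücker relation expresses the determinant sought, times a positive one, by products of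
    -- determinants which are positive by the induction hypothesis or by the local assumption.
    · have e := det3_plucker (v i) (v (i + 1)) (v (i + a)) (v (i + b)) (v (i + (b + 1 : ℕ)))
      have p1 := hloc b (by omega) (by omega)
      have p2 := hloc a h1 (by omega)
      have p3 := hloc (b + 1) (by omega) hb
      have : 0 < det3 (v i) (v (i + 1)) (v (i + b)) *
          det3 (v i) (v (i + a)) (v (i + (b + 1 : ℕ))) := by
        rw [e]; positivity
      exact pos_of_mul_pos_right this p1.le
    · obtain rfl : a = 1 := by omega
      have := hloc (b + 1) (by omega) hb
      simpa using this

theorem CyclicPos.local {n : ℕ} [NeZero n] {v : ZMod n → E3} (h : CyclicPos n v) (_hn : 2 ≤ n)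
    (i j : ZMod n) (h1 : j ≠ i) (h2 : j ≠ i + 1) : 0 < det3 (v i) (v (i + 1)) (v j) := by
  obtain ⟨a, ha, rfl⟩ := exists_offset i j
  have h0 : a ≠ 0 := by rintro rfl; simp at h1
  have h1' : a ≠ 1 := by rintro rfl; simp at h2
  simpa using h i 1 a one_pos (by omega) ha

/-- Two cyclic sequences of unit vectors, of which the first spans the cone over a convex polygon
and the second consists of the inner unit normals of its sides. -/
structure PolarPair (n : ℕ) (v w : ZMod n → E3) : Prop where
  three_le : 3 ≤ n
  norm_v : ∀ i, ‖v i‖ = 1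
  norm_w : ∀ i, ‖w i‖ = 1
  inner_left : ∀ i, ⟪v i, w i⟫_ℝ = 0
  inner_right : ∀ i, ⟪v (i + 1), w i⟫_ℝ = 0
  inner_pos : ∀ i j, j ≠ i → j ≠ i + 1 → 0 < ⟪v j, w i⟫_ℝ
  pos_v : CyclicPos n v
  pos_w : CyclicPos n w
  cross_v : ∀ i, ∃ r : ℝ, 0 < r ∧ cross (v i) (v (i + 1)) = r • w i
  cross_w : ∀ i, ∃ r : ℝ, 0 < r ∧ cross (w i) (w (i + 1)) = r • v (i + 1)

/-- The inner unit normal of the side from `v i` to `v (i + 1)`. -/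
def sideNormal {n : ℕ} (v : ZMod n → E3) (i : ZMod n) : E3 :=
  ‖cross (v i) (v (i + 1))‖⁻¹ • cross (v i) (v (i + 1))

/-- The normals inherit the orientation: by `cross_cross_cross` the determinant of the normals `i`,
`i + 1`, `j` is a positive multiple of the inner product of `v (i + 1)` with the normal `j`, which
is positive by convexity. -/
theorem CyclicPos.polarPair {n : ℕ} [NeZero n] {v : ZMod n → E3} (h : CyclicPos n v) (hn : 3 ≤ n)
    (hv : ∀ i, ‖v i‖ = 1) : PolarPair n v (sideNormal v) := by
  have hex : ∀ i : ZMod n, i + 2 ≠ i ∧ i + 2 ≠ i + 1 := fun i => by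
    constructor
    · simpa using offset_ne_self (i := i) (b := 2) (by omega) (by omega)
    · simpa using (offset_ne (i := i) (a := 1) (b := 2) (by omega) (by omega)).symm
  have hc : ∀ i, 0 < ‖cross (v i) (v (i + 1))‖ := by
    intro i
    rw [norm_pos_iff]
    intro h0
    have := h.local (by omega) i (i + 2) (hex i).1 (hex i).2
    rw [← cross_inner, h0, inner_zero_left] at this
    exact this.false
  have hpos : ∀ i j, j ≠ i → j ≠ i + 1 → 0 < ⟪v j, sideNormal v i⟫_ℝ := by
    intro i j h1 h2
    have := h.local (by omega) i j h1 h2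
    rw [sideNormal, real_inner_smul_right, real_inner_comm, cross_inner]
    exact mul_pos (inv_pos.2 (hc i)) this
  have hcw : ∀ i, ∃ r : ℝ, 0 < r ∧
      cross (sideNormal v i) (sideNormal v (i + 1)) = r • v (i + 1) := by
    intro i
    refine ⟨‖cross (v i) (v (i + 1))‖⁻¹ * ‖cross (v (i + 1)) (v (i + 1 + 1))‖⁻¹ *
      det3 (v i) (v (i + 1)) (v (i + 1 + 1)), ?_, ?_⟩
    · have h1 := h.local (by omega) i (i + 2) (hex i).1 (hex i).2
      rw [show i + 2 = i + 1 + 1 by ring] at h1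
      have := hc i
      have := hc (i + 1)
      positivity
    · rw [mul_smul, ← cross_cross_cross]
      apply ext3 <;> simp [sideNormal] <;> ring
  refine ⟨hn, hv, fun i => ?_, fun i => ?_, fun i => ?_, hpos, h, cyclicPos_of_local ?_,
    fun i => ⟨_, hc i, ?_⟩, hcw⟩
  · simp [sideNormal, norm_smul, (hc i).ne']
  · rw [sideNormal, real_inner_smul_right, inner_cross, det3_self_left, mul_zero]
  · rw [sideNormal, real_inner_smul_right, inner_cross, det3_self_outer, mul_zero]
  · intro i j h1 h2
    obtain ⟨r, hr, e⟩ := hcw i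
    rw [← cross_inner, e, real_inner_smul_left]
    exact mul_pos hr (hpos _ _ h2.symm fun h' => h1 (by simpa using h'.symm))
  · rw [sideNormal, smul_smul, mul_inv_cancel₀ (hc i).ne', one_smul]

namespace PolarPair

variable {n : ℕ} {v w : ZMod n → E3}

/-- The sides of the polar polygon have the vertices as normals, up to a shift of the index. Every
statement about sides thereby yields one about vertices. -/
theorem dual (h : PolarPair n v w) : PolarPair n w (fun i => v (i + 1)) where
  three_le := h.three_le
  norm_v := h.norm_w
  norm_w := fun i => h.norm_v _
  inner_left := fun i => by rw [real_inner_comm]; exact h.inner_right i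
  inner_right := fun i => by rw [real_inner_comm]; exact h.inner_left (i + 1)
  inner_pos := fun i j h1 h2 => by
    rw [real_inner_comm]
    exact h.inner_pos _ _ h2.symm fun h' => h1 (by simpa using h'.symm)
  pos_v := h.pos_w
  pos_w := fun i a b ha hab hb => by
    have := h.pos_v (i + 1) a b ha hab hb
    simpa only [add_right_comm i _ 1] using this
  cross_v := h.cross_w
  cross_w := fun i => h.cross_v (i + 1)

theorem inner_self_v (h : PolarPair n v w) (i : ZMod n) : ⟪v i, v i⟫_ℝ = 1 := by
  rw [real_inner_self_eq_norm_sq, h.norm_v]; norm_num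

theorem inner_self_w (h : PolarPair n v w) (i : ZMod n) : ⟪w i, w i⟫_ℝ = 1 := by
  rw [real_inner_self_eq_norm_sq, h.norm_w]; norm_num

theorem inner_nonneg (h : PolarPair n v w) (i j : ZMod n) : 0 ≤ ⟪v j, w i⟫_ℝ := by
  by_cases h1 : j = i
  · rw [h1, h.inner_left]
  by_cases h2 : j = i + 1
  · rw [h2, h.inner_right]
  exact (h.inner_pos i j h1 h2).le

theorem inner_eq_zero_iff (h : PolarPair n v w) (i j : ZMod n) :
    ⟪v j, w i⟫_ℝ = 0 ↔ j = i ∨ j = i + 1 := by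
  constructor
  · intro h0
    by_contra! hc
    exact (h.inner_pos i j hc.1 hc.2).ne' h0
  · rintro (rfl | rfl)
    · exact h.inner_left _
    · exact h.inner_right _

theorem ne_aux (h : PolarPair n v w) (i : ZMod n) : i + 1 ≠ i ∧ i + 2 ≠ i ∧ i + 2 ≠ i + 1 := by
  have := h.three_le
  refine ⟨?_, ?_, ?_⟩
  · simpa using offset_ne_self (i := i) (b := 1) (by omega) (by omega)
  · simpa using offset_ne_self (i := i) (b := 2) (by omega) (by omega)
  · simpa using (offset_ne (i := i) (a := 1) (b := 2) (by omega) (by omega)).symm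

/-- Coordinates in the plane of a side. -/
theorem exists_side_coords (h : PolarPair n v w) (i : ZMod n) :
    ∃ r₁ r₂ : ℝ, 0 < r₁ ∧ 0 < r₂ ∧ ∀ p : E3, ⟪p, w i⟫_ℝ = 0 →
      p = (r₁ * ⟪p, w (i + 1)⟫_ℝ) • v i + (r₂ * ⟪p, w (i - 1)⟫_ℝ) • v (i + 1) := by
  obtain ⟨r1, hr1, e1⟩ := h.cross_w (i - 1)
  obtain ⟨r2, hr2, e2⟩ := h.cross_w i
  rw [sub_add_cancel] at e1
  have hd : 0 < det3 (w (i - 1)) (w i) (w (i + 1)) := by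
    rw [← cross_inner, e1, real_inner_smul_left]
    refine mul_pos hr1 (h.inner_pos _ _ (h.ne_aux _).1.symm ?_)
    intro h'; exact (h.ne_aux i).2.1 (by linear_combination -h')
  set d := det3 (w (i - 1)) (w i) (w (i + 1)) with hdd
  refine ⟨d⁻¹ * r1, d⁻¹ * r2, by positivity, by positivity, fun p hi => ?_⟩
  have hc := cramer (w (i - 1)) (w i) (w (i + 1)) p
  rw [hi, e1, e2, zero_smul, add_zero, smul_smul, smul_smul, ← hdd] at hc
  rw [mul_assoc, mul_assoc, mul_smul d⁻¹, mul_smul d⁻¹, ← smul_add, add_comm, mul_comm r1,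
    mul_comm r2, ← hc, smul_smul, inv_mul_cancel₀ hd.ne', one_smul]

/-- The face of the cone over a polygon cut out by a side. -/
theorem mem_side (h : PolarPair n v w) {p : E3} (hp : ∀ i, 0 ≤ ⟪p, w i⟫_ℝ) {i : ZMod n}
    (hi : ⟪p, w i⟫_ℝ = 0) : ∃ a b : ℝ, 0 ≤ a ∧ 0 ≤ b ∧ p = a • v i + b • v (i + 1) := by
  obtain ⟨r₁, r₂, h1, h2, e⟩ := h.exists_side_coords i
  exact ⟨_, _, mul_nonneg h1.le (hp _), mul_nonneg h2.le (hp _), e p hi⟩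

/-- The face of the polar cone of a polygon at a vertex. -/
theorem mem_polar_side (h : PolarPair n v w) {k : E3} (hk : ∀ i, 0 ≤ ⟪k, v i⟫_ℝ) {i : ZMod n}
    (hi : ⟪k, v i⟫_ℝ = 0) : ∃ a b : ℝ, 0 ≤ a ∧ 0 ≤ b ∧ k = a • w (i - 1) + b • w i := by
  have := h.dual.mem_side (p := k) (fun i => hk _) (i := i - 1) (by simpa using hi)
  simpa using this

/-- A cone given by its faces is spanned by its extreme rays. -/
theorem mem_cone [NeZero n] (h : PolarPair n v w) {p : E3} (hp : ∀ i, 0 ≤ ⟪p, w i⟫_ℝ) :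
    ∃ a : ZMod n → ℝ, (∀ i, 0 ≤ a i) ∧ p = ∑ i, a i • v i := by
  classical
  let F : Finset (ZMod n) := Finset.univ.filter fun i => 0 < ⟪v 0, w i⟫_ℝ
  have hF : F.Nonempty := ⟨1, by
    simp only [F, Finset.mem_filter, Finset.mem_univ, true_and]
    have h0 := h.ne_aux 0
    refine h.inner_pos _ _ ?_ ?_
    · simpa using h0.1.symm
    · intro h'; apply h0.2.1; linear_combination -h'⟩
  -- From `p` one moves in the direction `-v 0` until the first side is met; the point reached lies
  -- in a face of the cone, where `mem_side` applies.
  obtain ⟨i, hiF, hmin⟩ := F.exists_min_image (fun i => ⟪p, w i⟫_ℝ / ⟪v 0, w i⟫_ℝ) hF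
  have hi : 0 < ⟪v 0, w i⟫_ℝ := by simpa [F] using hiF
  set t := ⟪p, w i⟫_ℝ / ⟪v 0, w i⟫_ℝ with ht
  have ht0 : 0 ≤ t := div_nonneg (hp i) hi.le
  obtain ⟨a, b, ha, hb, e⟩ := h.mem_side (p := p - t • v 0) (i := i) (fun j => by
      rw [inner_sub_left, real_inner_smul_left]
      by_cases hj : 0 < ⟪v 0, w j⟫_ℝ
      · have := hmin j (by simpa [F] using hj)
        rw [le_div_iff₀ hj] at this
        linarith
      · have : ⟪v 0, w j⟫_ℝ = 0 := le_antisymm (not_lt.1 hj) (h.inner_nonneg j 0)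
        rw [this]; simpa using hp j) (by
      rw [inner_sub_left, real_inner_smul_left, ht, div_mul_cancel₀ _ hi.ne', sub_self])
  refine ⟨fun j => (if j = 0 then t else 0) + (if j = i then a else 0) +
    (if j = i + 1 then b else 0), fun j => ?_, ?_⟩
  · have : ∀ (P : Prop) [Decidable P] (x : ℝ), 0 ≤ x → 0 ≤ if P then x else 0 := by
      intro P _ x hx; split_ifs <;> simp [hx]
    have h1 := this (j = 0) t ht0
    have h2 := this (j = i) a ha
    have h3 := this (j = i + 1) b hb
    simp only; linarith
  · simp only [add_smul, Finset.sum_add_distrib, ite_smul, zero_smul, Finset.sum_ite_eq',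
      Finset.mem_univ, if_true]
    rw [add_assoc, ← e]; abel

theorem inner_sum_nonneg [NeZero n] {a : ZMod n → ℝ} (ha : ∀ i, 0 ≤ a i) {k : E3}
    (hk : ∀ i, 0 ≤ ⟪k, v i⟫_ℝ) : 0 ≤ ⟪∑ i, a i • v i, k⟫_ℝ := by
  rw [sum_inner]
  exact Finset.sum_nonneg fun i _ => by
    rw [real_inner_smul_left, real_inner_comm]; exact mul_nonneg (ha i) (hk i)

/-- Bipolarity: vectors of the cone and of the polar cone have a non-negative inner product. -/
theorem inner_cone_nonneg [NeZero n] (h : PolarPair n v w) {p k : E3} (hp : ∀ i, 0 ≤ ⟪p, w i⟫_ℝ)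
    (hk : ∀ i, 0 ≤ ⟪k, v i⟫_ℝ) : 0 ≤ ⟪p, k⟫_ℝ := by
  obtain ⟨a, ha, rfl⟩ := h.mem_cone hp
  exact inner_sum_nonneg ha hk

/-- The sum of the vertices is in the interior of the cone. -/
theorem sum_inner_pos [NeZero n] (h : PolarPair n v w) (i : ZMod n) : 0 < ⟪∑ j, v j, w i⟫_ℝ := by
  rw [sum_inner]
  exact Finset.sum_pos' (fun j _ => h.inner_nonneg i j)
    ⟨i + 2, Finset.mem_univ _, h.inner_pos _ _ (h.ne_aux i).2.1 (h.ne_aux i).2.2⟩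

/-- Three consecutive vertices are linearly independent, so a non-zero vector of the polar cone is
not orthogonal to all vertices. -/
theorem sum_inner_pos' [NeZero n] (h : PolarPair n v w) {k : E3} (hk0 : k ≠ 0)
    (hk : ∀ i, 0 ≤ ⟪k, v i⟫_ℝ) : 0 < ⟪∑ j, v j, k⟫_ℝ := by
  rw [sum_inner]
  refine lt_of_le_of_ne (Finset.sum_nonneg fun i _ => by rw [real_inner_comm]; exact hk i) ?_
  intro h0
  have h0 := (Finset.sum_eq_zero_iff_of_nonneg
    (fun i _ => by rw [real_inner_comm]; exact hk i)).1 h0.symm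
  have hd := h.pos_v.local (by have := h.three_le; omega) 0 2 (by simpa using (h.ne_aux 0).2.1)
    (by simpa using (h.ne_aux 0).2.2)
  refine hk0 (eq_zero_of_det3_ne_zero hd.ne' ?_ ?_ ?_) <;>
  · rw [real_inner_comm]; exact h0 _ (Finset.mem_univ _)

end PolarPair

end

section

/-! ### Convex hulls of finite sets on the sphere -/

/-- The combination cannot vanish because `D` contains no antipodes, and its direction is then a
point of the arc from `a` to `b`. -/
theorem IsConvex.cone_add {D : Set S2} (hD : IsConvex D) {a b : S2} (ha : a ∈ D) (hb : b ∈ D)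
    {s t : ℝ} (hs : 0 < s) (ht : 0 < t) :
    ∃ r : ℝ, 0 < r ∧ ∃ d ∈ D, s • (a : E3) + t • (b : E3) = r • (d : E3) := by
  have h0 : s • (a : E3) + t • (b : E3) ≠ 0 := by
    intro h0
    have e : s • (a : E3) = (-t) • (b : E3) := by rw [neg_smul]; exact eq_neg_of_add_eq_zero_left h0
    have hn : s = t := by
      have := congrArg norm e
      simpa [norm_smul, abs_of_pos hs, abs_of_pos ht] using this
    subst hn
    have : a = -b := by
      apply Subtype.ext
      rw [neg_smul, ← smul_neg] at e
      exact smul_right_injective E3 hs.ne' e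
    exact hD.1 b hb (this ▸ ha)
  refine ⟨‖s • (a : E3) + t • (b : E3)‖, norm_pos_iff.2 h0, normalizeS2 _ h0,
    hD.2 a ha b hb ⟨‖s • (a : E3) + t • (b : E3)‖⁻¹ * s, ‖s • (a : E3) + t • (b : E3)‖⁻¹ * t,
      by positivity, by positivity, ?_⟩, ?_⟩
  · simp [normalizeS2, smul_smul]
  · rw [normalizeS2, smul_smul, mul_inv_cancel₀ (norm_ne_zero_iff.2 h0), one_smul]

theorem IsConvex.sum_mem {ι : Type*} {D : Set S2} (hD : IsConvex D) (v : ι → S2) (s : Finset ι)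
    (a : ι → ℝ) (ha : ∀ i, 0 ≤ a i) (hv : ∀ i ∈ s, a i ≠ 0 → v i ∈ D) :
    (∀ i ∈ s, a i = 0) ∨ ∃ r : ℝ, 0 < r ∧ ∃ d ∈ D, ∑ i ∈ s, a i • (v i : E3) = r • (d : E3) := by
  classical
  induction s using Finset.induction_on with
  | empty => left; simp
  | insert j s hj ih =>
    rw [Finset.sum_insert hj]
    rcases (ha j).eq_or_lt with h0 | h0
    · rcases ih fun i hi => hv i (Finset.mem_insert_of_mem hi) with h | h
      · left
        intro i hi
        rcases Finset.mem_insert.1 hi with rfl | hi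
        · exact h0.symm
        · exact h i hi
      · right; rw [← h0, zero_smul, zero_add]; exact h
    · right
      have hjD := hv j (Finset.mem_insert_self _ _) h0.ne'
      rcases ih fun i hi => hv i (Finset.mem_insert_of_mem hi) with h | ⟨r, hr, d, hd, e⟩
      · refine ⟨a j, h0, v j, hjD, ?_⟩
        rw [Finset.sum_eq_zero fun i hi => by rw [h i hi, zero_smul], add_zero]
      · rw [e]; exact hD.cone_add hjD hd h0 hr

theorem eq_of_eq_smul {p d : S2} {r : ℝ} (hr : 0 < r) (h : (p : E3) = r • (d : E3)) : p = d := by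
  have hn := congrArg norm h
  rw [norm_smul, norm_eq_of_mem_sphere, norm_eq_of_mem_sphere, norm_of_nonneg hr.le, mul_one] at hn
  apply Subtype.ext
  rw [h, ← hn, one_smul]

theorem S2_ne_zero (p : S2) : (p : E3) ≠ 0 := by
  rw [← norm_pos_iff, norm_eq_of_mem_sphere]; exact one_pos

/-- A combination of points with non-negative coefficients is in their convex hull. -/
theorem mem_hull_of_sum {ι : Type*} [Fintype ι] {v : ι → S2} {S : Set ι} {a : ι → ℝ}
    (ha : ∀ i, 0 ≤ a i) (hS : ∀ i, a i ≠ 0 → i ∈ S) {p : S2}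
    (hp : (p : E3) = ∑ i, a i • (v i : E3)) : p ∈ hull (v '' S) := by
  rintro D ⟨hD, hvD⟩
  rcases hD.sum_mem v Finset.univ a ha (fun i _ hi => hvD ⟨i, hS i hi, rfl⟩) with
    h | ⟨r, hr, d, hd, e⟩
  · exact absurd (hp.trans (Finset.sum_eq_zero fun i hi => by rw [h i hi, zero_smul]))
      (S2_ne_zero p)
  · rw [eq_of_eq_smul hr (hp.trans e)]; exact hd

/-- The points of the sphere in a cone cut out by half-spaces, one of which contains them strictly,
form a convex set. -/
theorem isConvex_of_inner {ι : Type*} (w : ι → E3) (k : E3) :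
    IsConvex {p : S2 | 0 < ⟪(p : E3), k⟫_ℝ ∧ ∀ i, 0 ≤ ⟪(p : E3), w i⟫_ℝ} := by
  refine ⟨fun a ha ha' => ?_, ?_⟩
  · have h1 := ha.1
    have h2 := ha'.1
    rw [show ((-a : S2) : E3) = -(a : E3) from rfl, inner_neg_left] at h2
    linarith
  · rintro a ha b hb p ⟨s, t, hs, ht, e⟩
    have hin : ∀ x : E3, ⟪(p : E3), x⟫_ℝ = s * ⟪(a : E3), x⟫_ℝ + t * ⟪(b : E3), x⟫_ℝ := by
      intro x; rw [e, inner_add_left, real_inner_smul_left, real_inner_smul_left]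
    refine ⟨?_, fun i => ?_⟩
    · rw [hin]
      have h1 := mul_nonneg hs ha.1.le
      have h2 := mul_nonneg ht hb.1.le
      refine lt_of_le_of_ne (by linarith) fun h0 => ?_
      have hs0 : s = 0 := by
        have : s * ⟪(a : E3), k⟫_ℝ = 0 := by linarith
        exact (mul_eq_zero.1 this).resolve_right ha.1.ne'
      have ht0 : t = 0 := by
        have : t * ⟪(b : E3), k⟫_ℝ = 0 := by linarith
        exact (mul_eq_zero.1 this).resolve_right hb.1.ne'
      exact S2_ne_zero p (by rw [e, hs0, ht0]; simp)
    · rw [hin]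
      have h1 := mul_nonneg hs (ha.2 i)
      have h2 := mul_nonneg ht (hb.2 i)
      linarith

theorem PolarPair.isConvex {n : ℕ} [NeZero n] {v w : ZMod n → E3} (h : PolarPair n v w) :
    IsConvex {p : S2 | ∀ i, 0 ≤ ⟪(p : E3), w i⟫_ℝ} := by
  convert isConvex_of_inner w (∑ i, w i) using 1
  ext p
  refine ⟨fun hp => ⟨?_, hp⟩, fun hp => hp.2⟩
  rw [real_inner_comm]
  exact h.dual.sum_inner_pos' (S2_ne_zero p) hp

theorem PolarPair.hull_eq {n : ℕ} [NeZero n] {v : ZMod n → S2} {w : ZMod n → E3}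
    (h : PolarPair n (fun i => (v i : E3)) w) :
    hull (range v) = {p : S2 | ∀ i, 0 ≤ ⟪(p : E3), w i⟫_ℝ} := by
  apply subset_antisymm
  · exact sInter_subset_of_mem ⟨h.isConvex, by rintro _ ⟨j, rfl⟩ i; exact h.inner_nonneg i j⟩
  · intro p hp
    obtain ⟨a, ha, e⟩ := h.mem_cone hp
    rw [← image_univ]
    exact mem_hull_of_sum ha (fun _ _ => mem_univ _) e

/-- The plane through the two neighbours of a vertex separates it from all the other vertices. -/
theorem PolarPair.inConvexPosition {n : ℕ} [NeZero n] {v : ZMod n → S2} {w : ZMod n → E3}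
    (h : PolarPair n (fun i => (v i : E3)) w) : InConvexPosition n v := by
  have hn := h.three_le
  refine ⟨hn, ⟨_, h.isConvex, by rintro _ ⟨j, rfl⟩ i; exact h.inner_nonneg i j⟩, fun i hi => ?_⟩
  have hD := isConvex_of_inner (fun _ : Unit => cross (v (i - 1)) (v (i + 1))) (∑ i, w i)
  have hmem := hi _ ⟨hD, by
    rintro _ ⟨j, hj, rfl⟩
    refine ⟨?_, fun _ => ?_⟩
    · rw [real_inner_comm]
      exact h.dual.sum_inner_pos' (S2_ne_zero _) fun i => h.inner_nonneg i j
    · rw [inner_cross, ← det3_rotate]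
      obtain ⟨a, ha, rfl⟩ := exists_offset (i - 1) j
      have ha1 : a ≠ 1 := by rintro rfl; exact hj (by push_cast; ring)
      rcases Nat.lt_or_ge 2 a with h2 | h2
      · have := h.pos_v (i - 1) 2 a (by omega) h2 ha
        rw [show i - 1 + ((2 : ℕ) : ZMod n) = i + 1 by push_cast; ring] at this
        exact this.le
      · obtain rfl | rfl : a = 0 ∨ a = 2 := by omega
        · simp [det3_self_outer]
        · rw [show i - 1 + ((2 : ℕ) : ZMod n) = i + 1 by push_cast; ring, det3_self_right]⟩
  have h1 := hmem.2 ()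
  have h2 := h.pos_v (i - 1) 1 2 one_pos (by omega) (by omega)
  rw [show i - 1 + ((1 : ℕ) : ZMod n) = i by push_cast; ring,
    show i - 1 + ((2 : ℕ) : ZMod n) = i + 1 by push_cast; ring] at h2
  rw [inner_cross, det3_swap] at h1
  linarith

/-! ### Listing the vertices of a polygon in counterclockwise order -/

section Ordering

variable {n : ℕ} [NeZero n] {v : ZMod n → S2}

theorem InConvexPosition.sum_ne (h : InConvexPosition n v) {j : ZMod n} {a : ZMod n → ℝ}
    (ha : ∀ i, 0 ≤ a i) (hj : a j = 0) {d : ℝ} (hd : 0 < d) :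
    d • (v j : E3) ≠ ∑ i, a i • (v i : E3) := by
  intro e
  refine h.2.2 j (mem_hull_of_sum (S := {i | i ≠ j}) (a := fun i => d⁻¹ * a i)
    (fun i => mul_nonneg (inv_pos.2 hd).le (ha i)) ?_ ?_)
  · rintro i hi rfl; simp [hj] at hi
  · simp only [mul_smul]
    rw [← Finset.smul_sum, ← e, smul_smul, inv_mul_cancel₀ hd.ne', one_smul]

theorem InConvexPosition.three_ne (h : InConvexPosition n v) {j p q r : ZMod n} (hp : p ≠ j)
    (hq : q ≠ j) (hr : r ≠ j) {a b c d : ℝ} (ha : 0 ≤ a) (hb : 0 ≤ b) (hc : 0 ≤ c) (hd : 0 < d) :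
    d • (v j : E3) ≠ a • (v p : E3) + b • (v q : E3) + c • (v r : E3) := by
  classical
  have := h.sum_ne (j := j) (a := fun i => (if i = p then a else 0) + (if i = q then b else 0) +
    (if i = r then c else 0)) (fun i => by
      have : ∀ (P : Prop) [Decidable P] (x : ℝ), 0 ≤ x → 0 ≤ if P then x else 0 := by
        intro P _ x hx; split_ifs <;> simp [hx]
      have h1 := this (i = p) a ha
      have h2 := this (i = q) b hb
      have h3 := this (i = r) c hc
      linarith) (by simp [hp.symm, hq.symm, hr.symm]) hd
  simpa only [add_smul, Finset.sum_add_distrib, ite_smul, zero_smul, Finset.sum_ite_eq',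
      Finset.mem_univ, if_true] using this

theorem InConvexPosition.eq_zero (h : InConvexPosition n v) {a : ZMod n → ℝ}
    (ha : ∀ i, 0 ≤ a i) (e : ∑ i, a i • (v i : E3) = 0) (i : ZMod n) : a i = 0 := by
  obtain ⟨D, hD, hvD⟩ := h.2.1
  rcases hD.sum_mem v Finset.univ a ha (fun i _ _ => hvD ⟨i, rfl⟩) with h | ⟨r, hr, d, -, e'⟩
  · exact h i (Finset.mem_univ _)
  · rw [e] at e'
    exact absurd e'.symm (smul_ne_zero hr.ne' (S2_ne_zero d))

/-- There is a plane through a vertex which has the other vertices strictly on one side. -/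
theorem InConvexPosition.exists_support (h : InConvexPosition n v) :
    ∃ u : E3, ⟪u, v 0⟫_ℝ = 0 ∧ ∀ j, j ≠ 0 → 0 < ⟪u, v j⟫_ℝ := by
  classical
  -- Weights on the vertices other than `v 0`. Their image under the projection `P` along `v 0` is
  -- compact and convex; the plane which separates it from the origin gives the support.
  let A : Set (ZMod n → ℝ) := stdSimplex ℝ (ZMod n) ∩ {a | a 0 = 0}
  have hAc : IsCompact A := (isCompact_stdSimplex ℝ (ZMod n)).inter_right
    (isClosed_eq (continuous_apply 0) continuous_const)
  have hAx : Convex ℝ A := by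
    refine (convex_stdSimplex ℝ (ZMod n)).inter ?_
    intro a ha b hb s t _ _ _
    simp only [mem_ofPred_eq, Pi.add_apply, Pi.smul_apply, smul_eq_mul] at *
    rw [ha, hb]; ring
  let P : E3 → E3 := fun x => x - ⟪x, (v 0 : E3)⟫_ℝ • (v 0 : E3)
  let f : (ZMod n → ℝ) →ₗ[ℝ] E3 :=
    { toFun := fun a => ∑ i, a i • P (v i)
      map_add' := fun a b => by simp [add_smul, Finset.sum_add_distrib]
      map_smul' := fun r a => by simp [mul_smul, Finset.smul_sum] }
  -- Otherwise a convex combination of the other vertices equals `t • v 0`. For `t > 0` this puts `v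
  -- 0` into the hull of the others; for `t ≤ 0` a non-trivial non-negative combination of the
  -- vertices vanishes, although they lie in a common convex set.
  have hfA : (0 : E3) ∉ f '' A := by
    rintro ⟨a, ⟨⟨ha, hs⟩, ha0⟩, e⟩
    have e : ∑ i, a i • P (v i) = 0 := e
    simp only [P, smul_sub, Finset.sum_sub_distrib, smul_smul] at e
    rw [← Finset.sum_smul, sub_eq_zero] at e
    set t := ∑ i, a i * ⟪(v i : E3), (v 0 : E3)⟫_ℝ
    rcases lt_or_ge 0 t with ht | ht
    · exact h.sum_ne ha ha0 ht e.symm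
    · have hz := h.eq_zero (a := fun i => a i + if i = 0 then -t else 0) (fun i => by
        have := ha i
        split_ifs <;> linarith) (by
        simp only [add_smul, Finset.sum_add_distrib, ite_smul, zero_smul, Finset.sum_ite_eq',
          Finset.mem_univ, if_true, e, neg_smul, add_neg_cancel])
      have : ∑ i, a i = 0 := Finset.sum_eq_zero fun i _ => by
        have h1 := hz i
        have h2 := ha i
        split_ifs at h1 with hi
        · rw [hi]; exact ha0
        · linarith
      rw [hs] at this
      exact one_ne_zero this
  have hcont : Continuous f := f.continuous_of_finiteDimensional
  obtain ⟨g, u, hg, hgu⟩ := geometric_hahn_banach_point_closed (hAx.linear_image f)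
    (hAc.image hcont).isClosed hfA
  rw [map_zero] at hg
  let y : E3 := (InnerProductSpace.toDual ℝ E3).symm g
  have hy : ∀ x, ⟪y, x⟫_ℝ = g x := fun x => InnerProductSpace.toDual_symm_apply
  refine ⟨P y, ?_, fun j hj => ?_⟩
  · simp only [P, inner_sub_left, real_inner_smul_left, inner_self_S2]; ring
  · have := hgu (f (Pi.single j 1)) ⟨_, ⟨⟨fun i => ?_, by simp⟩, by simp [hj.symm]⟩, rfl⟩
    · have e : f (Pi.single j 1) = P (v j) := by
        simp [f, Pi.single_apply, ite_smul]
      rw [e, ← hy] at this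
      have e2 : ⟪P y, v j⟫_ℝ = ⟪y, P (v j)⟫_ℝ := by
        simp only [P, inner_sub_left, inner_sub_right, real_inner_smul_left, real_inner_smul_right]
        rw [real_inner_comm (v 0 : E3) (v j : E3)]; ring
      rw [e2]; linarith
    · by_cases hij : i = j
      · subst hij; simp
      · simp [hij]

/-- The vertices of a convex polygon can be listed in counterclockwise order. -/
theorem InConvexPosition.exists_cyclicPos (h : InConvexPosition n v) :
    ∃ v' : ZMod n → S2, range v' = range v ∧ CyclicPos n (fun i => (v' i : E3)) := by
  classical
  have hn := h.1
  obtain ⟨u, hu0, hu⟩ := h.exists_support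
  set o : E3 := (v 0 : E3) with ho
  have hoo : ⟪o, o⟫_ℝ = 1 := inner_self_S2 _
  have huu : 0 < ⟪u, u⟫_ℝ := by
    rw [real_inner_self_eq_norm_sq]
    have : u ≠ 0 := by
      rintro rfl
      have h1 : (1 : ZMod n) ≠ 0 := by simpa using natCast_ne_zero_of_lt one_pos (show 1 < n by omega)
      simpa using hu 1 h1
    positivity
  set z := cross o u with hz
  have hdet : ∀ a b : E3, det3 o a b * ⟪u, u⟫_ℝ = ⟪u, a⟫_ℝ * ⟪z, b⟫_ℝ - ⟪u, b⟫_ℝ * ⟪z, a⟫_ℝ := by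
    intro a b
    have e4 : ∀ a b : E3, det3 o a b * ⟪u, u⟫_ℝ * ⟪o, o⟫_ℝ = det3 o a b * ⟪u, o⟫_ℝ ^ 2 +
      (⟪u, a⟫_ℝ * ⟪o, o⟫_ℝ - ⟪o, a⟫_ℝ * ⟪u, o⟫_ℝ) * ⟪cross o u, b⟫_ℝ -
      (⟪u, b⟫_ℝ * ⟪o, o⟫_ℝ - ⟪o, b⟫_ℝ * ⟪u, o⟫_ℝ) * ⟪cross o u, a⟫_ℝ := by
      intro a b
      simp only [inner_eq_coord, det3_eq, cross_zero, cross_one, cross_two]; ring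
    have := e4 a b
    rw [hoo, hu0] at this
    linear_combination this
  -- The slope at which `v j` is seen from `v 0` in the frame `o`, `u`, `z`; by `hdet` comparing
  -- slopes amounts to comparing orientations.
  let key : ZMod n → ℝ := fun j => ⟪z, v j⟫_ℝ / ⟪u, v j⟫_ℝ
  have hkey : ∀ a b, a ≠ 0 → b ≠ 0 → key a < key b → 0 < det3 o (v a) (v b) := by
    intro a b ha hb hab
    simp only [key] at hab
    rw [div_lt_div_iff₀ (hu a ha) (hu b hb)] at hab
    have := hdet (v a) (v b)
    refine pos_of_mul_pos_left (b := ⟪u, u⟫_ℝ) ?_ huu.le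
    rw [this]; linarith
  have hinj : ∀ a b, a ≠ 0 → b ≠ 0 → a ≠ b → key a ≠ key b := by
    intro a b ha hb hab he
    simp only [key] at he
    rw [div_eq_div_iff (hu a ha).ne' (hu b hb).ne'] at he
    set y : E3 := ⟪u, v b⟫_ℝ • (v a : E3) - ⟪u, v a⟫_ℝ • (v b : E3) with hy
    have hoz : det3 o u z = ⟪u, u⟫_ℝ := by
      have : det3 o u z = ⟪o, o⟫_ℝ * ⟪u, u⟫_ℝ - ⟪u, o⟫_ℝ ^ 2 := by
        rw [hz]; simp only [inner_eq_coord, det3_eq, cross_zero, cross_one, cross_two]; ring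
      rw [this, hoo, hu0]; ring
    have hyo : y - ⟪y, o⟫_ℝ • o = 0 := by
      refine eq_zero_of_det3_ne_zero (a := o) (b := u) (c := z) (by rw [hoz]; exact huu.ne') ?_ ?_ ?_
      · rw [inner_sub_left, real_inner_smul_left, hoo]; ring
      · rw [inner_sub_left, real_inner_smul_left, hy, inner_sub_left, real_inner_smul_left,
          real_inner_smul_left, real_inner_comm u o, real_inner_comm u (v a : E3),
          real_inner_comm u (v b : E3)]
        rw [hu0]; ring
      · rw [inner_sub_left, real_inner_smul_left, hy, inner_sub_left, real_inner_smul_left,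
          real_inner_smul_left, hz, inner_cross o o u, det3_self_left, ← hz,
          real_inner_comm z (v a : E3), real_inner_comm z (v b : E3)]
        linear_combination he
    rw [sub_eq_zero] at hyo
    rcases le_total 0 ⟪y, o⟫_ℝ with hs | hs
    · refine h.three_ne (j := a) (p := 0) (q := b) (r := b) ha.symm hab.symm hab.symm hs
        (hu a ha).le le_rfl (hu b hb) ?_
      rw [← ho, ← hyo, hy]; simp
    · refine h.three_ne (j := b) (p := 0) (q := a) (r := a) hb.symm hab hab (neg_nonneg.2 hs)
        (hu b hb).le le_rfl (hu a ha) ?_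
      rw [← ho, neg_smul, ← hyo, hy]; simp
  let e := ZMod.finEquiv n
  -- The vertex `v 0` receives a value below all slopes, so that sorting puts it first.
  let f : Fin n → ℝ := fun k => if e k = 0 then -(∑ j, |key j|) - 1 else key (e k)
  have hflt : ∀ k, e k ≠ 0 → f (e.symm 0) < f k := by
    intro k hk
    simp only [f, RingEquiv.apply_symm_apply, if_true, hk, if_false]
    have h1 := Finset.single_le_sum (fun j _ => abs_nonneg (key j)) (Finset.mem_univ (e k))
    have h2 := neg_abs_le (key (e k))
    linarith
  have hfinj : Function.Injective f := by
    intro k l hkl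
    by_contra hne
    have hne' : e k ≠ e l := fun h' => hne (e.injective h')
    by_cases hk : e k = 0
    · have hl : e l ≠ 0 := fun h' => hne' (hk.trans h'.symm)
      have := hflt l hl
      rw [← hk, RingEquiv.symm_apply_apply] at this
      exact this.ne hkl
    · by_cases hl : e l = 0
      · have := hflt k hk
        rw [← hl, RingEquiv.symm_apply_apply] at this
        exact this.ne' hkl
      · simp only [f, hk, hl, if_false] at hkl
        exact hinj _ _ hk hl hne' hkl
  let σ := Tuple.sort f
  have hmono : StrictMono (f ∘ σ) :=
    (Tuple.monotone_sort f).strictMono_of_injective (hfinj.comp σ.injective)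
  let q : Fin n → ZMod n := fun k => e (σ k)
  have hqinj : Function.Injective q := e.injective.comp σ.injective
  have hpos0 : (0 : Fin n) = σ.symm (e.symm 0) := by
    by_contra hne
    have h1 : (0 : Fin n) < σ.symm (e.symm 0) := Fin.pos_iff_ne_zero.2 (Ne.symm hne)
    have h2 := hmono h1
    simp only [Function.comp, Equiv.apply_symm_apply] at h2
    have h3 : e (σ 0) ≠ 0 := by
      intro h0
      apply hne
      rw [← h0, RingEquiv.symm_apply_apply, Equiv.symm_apply_apply]
    exact (hflt _ h3).not_gt h2
  have hq0 : q 0 = 0 := by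
    simp only [q]; rw [hpos0, Equiv.apply_symm_apply, RingEquiv.apply_symm_apply]
  have hqne : ∀ k, k ≠ 0 → q k ≠ 0 := fun k hk h0 => hk (hqinj (h0.trans hq0.symm))
  have hd0 : ∀ a b : Fin n, 0 < a → a < b → 0 < det3 (v (q 0)) (v (q a)) (v (q b)) := by
    intro a b ha hab
    rw [hq0]
    have hb := ha.trans hab
    have h1 := hmono hab
    simp only [Function.comp, f, if_neg (hqne a ha.ne'), if_neg (hqne b hb.ne'), q] at h1
    have hqa := hqne a ha.ne'
    have hqb := hqne b hb.ne'
    exact hkey _ _ hqa hqb h1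
  have hd : ∀ a b c : Fin n, a < b → b < c → 0 < det3 (v (q a)) (v (q b)) (v (q c)) := by
    intro a b c hab hbc
    rcases (Fin.zero_le a).eq_or_lt with rfl | ha
    · exact hd0 b c hab hbc
    -- A wrongly oriented triple would, by `cramer'`, make its middle vertex a non-negative
    -- combination of three others.
    by_contra hle
    rw [not_lt] at hle
    have h1 := hd0 a b ha hab
    have h2 := hd0 b c (ha.trans hab) hbc
    have h3 := hd0 a c ha (hab.trans hbc)
    have e1 := cramer' (v (q 0)) (v (q a)) (v (q c)) (v (q b))
    refine h.three_ne (j := q b) (p := q 0) (q := q a) (r := q c)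
      (fun h' => (ha.trans hab).ne (hqinj h')) (fun h' => hab.ne (hqinj h'))
      (fun h' => hbc.ne' (hqinj h')) ?_ h2.le h1.le h3 e1
    rw [det3_swap]; linarith
  let p : ZMod n → Fin n := fun k => ⟨k.val, ZMod.val_lt k⟩
  refine ⟨fun k => v (q (p k)), ?_, cyclicPos_of_local ?_⟩
  · apply subset_antisymm
    · rintro _ ⟨k, rfl⟩; exact ⟨_, rfl⟩
    · rintro _ ⟨k, rfl⟩
      refine ⟨((σ.symm (e.symm k) : Fin n) : ℕ), ?_⟩
      have : p (((σ.symm (e.symm k) : Fin n) : ℕ) : ZMod n) = σ.symm (e.symm k) := by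
        apply Fin.ext
        simp only [p]
        rw [ZMod.val_natCast, Nat.mod_eq_of_lt (Fin.is_lt _)]
      simp only [q, this, Equiv.apply_symm_apply, RingEquiv.apply_symm_apply]
  · intro i j h1 h2
    have hpi : ∀ {a b : ZMod n}, a ≠ b → (p a).val ≠ (p b).val := fun hab h' =>
      hab (ZMod.val_injective n h')
    have hji := hpi h1
    have hji1 := hpi h2
    by_cases hi : i.val + 1 < n
    · have hv1 : (p (i + 1)).val = i.val + 1 := by
        simp only [p]
        rw [ZMod.val_add_of_lt] <;> rw [ZMod.val_one_eq_one_mod, Nat.mod_eq_of_lt (by omega)]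
        exact hi
      rw [hv1] at hji1
      rcases lt_or_ge j.val i.val with hj | hj
      · rw [det3_rotate]
        exact hd (p j) (p i) (p (i + 1)) hj (by rw [Fin.lt_def, hv1]; exact Nat.lt_succ_self _)
      · have hj' : i.val + 1 < j.val := by
          have a1 : j.val ≠ i.val := hji
          have a2 : j.val ≠ i.val + 1 := hji1
          omega
        exact hd _ _ _ (by rw [Fin.lt_def, hv1]; exact Nat.lt_succ_self _)
          (by rw [Fin.lt_def, hv1]; exact hj')
    · have hi' : i.val = n - 1 := by have := ZMod.val_lt i; omega
      have hv1 : i + 1 = 0 := by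
        have : ((i.val + 1 : ℕ) : ZMod n) = 0 := by
          rw [hi', show n - 1 + 1 = n by omega]; simp
        simpa using this
      rw [hv1] at hji1 ⊢
      have hp0 : p 0 = 0 := by apply Fin.ext; simp [p]
      have := hd (p 0) (p j) (p i) (by
        rw [hp0] at hji1 ⊢
        exact Fin.pos_iff_ne_zero.2 fun h' => hji1 (by rw [h'])) (by
        have a1 : j.val ≠ i.val := hji
        have a2 := ZMod.val_lt j
        rw [Fin.lt_def]; show j.val < i.val
        omega)
      rw [det3_rotate, det3_rotate]
      exact this

end Ordering

end

section

/-! ### Thickness in terms of the polar cone -/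

open InnerProductGeometry in
-- With `r = ⟪g, h⟫` both tangential components have squared length `1 - r ^ 2` and their inner
-- product is `-r * (1 - r ^ 2)`. Thus minimizing thickness means maximizing the distance of centres
-- of supporting hemispheres.
theorem luneThickness_eq {g h : S2} (h1 : h ≠ g) (h2 : h ≠ -g) :
    luneThickness g h = π - angle (g : E3) (h : E3) := by
  have hg := inner_self_S2 g
  have hh := inner_self_S2 h
  have hng : ‖(g : E3)‖ = 1 := norm_eq_of_mem_sphere g
  have hnh : ‖(h : E3)‖ = 1 := norm_eq_of_mem_sphere h
  set r := ⟪(g : E3), (h : E3)⟫_ℝ with hr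
  have hlt : r ^ 2 < 1 := by
    have hle : |r| ≤ 1 := by
      have := abs_real_inner_le_norm (g : E3) (h : E3)
      rwa [hng, hnh, one_mul] at this
    rw [sq_lt_one_iff_abs_lt_one]
    refine lt_of_le_of_ne hle fun he => ?_
    rcases eq_or_eq_neg_of_abs_eq he with he | he
    · exact h1 (Subtype.ext ((inner_eq_one_iff_of_norm_eq_one hng hnh).1 he).symm)
    · refine h2 (Subtype.ext ?_)
      have : ⟪(g : E3), -(h : E3)⟫_ℝ = 1 := by rw [inner_neg_right, ← hr, he]; norm_num
      have := (inner_eq_one_iff_of_norm_eq_one hng (by rwa [norm_neg])).1 this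
      change (h : E3) = -(g : E3)
      rw [this, neg_neg]
  have e1 : ⟪tangentTo g h, tangentTo g h⟫_ℝ = 1 - r ^ 2 := by
    simp only [tangentTo, inner_sub_left, inner_sub_right, real_inner_smul_left,
      real_inner_smul_right, hg, hh, real_inner_comm (g : E3) (h : E3), ← hr]
    ring
  have e2 : ⟪tangentTo h g, tangentTo h g⟫_ℝ = 1 - r ^ 2 := by
    simp only [tangentTo, inner_sub_left, inner_sub_right, real_inner_smul_left,
      real_inner_smul_right, hg, hh, real_inner_comm (g : E3) (h : E3), ← hr]
    ring
  have e3 : ⟪tangentTo g h, tangentTo h g⟫_ℝ = -r * (1 - r ^ 2) := by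
    simp only [tangentTo, inner_sub_left, inner_sub_right, real_inner_smul_left,
      real_inner_smul_right, hg, hh, real_inner_comm (g : E3) (h : E3), ← hr]
    ring
  have hn : ‖tangentTo g h‖ * ‖tangentTo h g‖ = 1 - r ^ 2 := by
    have : ‖tangentTo g h‖ = ‖tangentTo h g‖ := by
      rw [← sq_eq_sq₀ (norm_nonneg _) (norm_nonneg _), ← real_inner_self_eq_norm_sq,
        ← real_inner_self_eq_norm_sq, e1, e2]
    rw [this, ← pow_two, ← real_inner_self_eq_norm_sq, e2]
  rw [luneThickness, angle, e3, hn, angle, hng, hnh, ← hr, mul_div_assoc,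
    div_self (by linarith), mul_one, Real.arccos_neg]
  norm_num

theorem width_nonneg (k : S2) (C : Set S2) : 0 ≤ width k C :=
  Real.sInf_nonneg (by rintro _ ⟨k', _, _, _, rfl⟩; exact InnerProductGeometry.angle_nonneg _ _)

theorem thickness_nonneg (C : Set S2) : 0 ≤ thickness C :=
  Real.sInf_nonneg (by rintro _ ⟨k, _, rfl⟩; exact width_nonneg k C)

theorem thickness_le {C : Set S2} {k k' : S2} (h1 : k' ≠ k) (h2 : k' ≠ -k) (hk : Supports k C)
    (hk' : Supports k' C) : thickness C ≤ π - InnerProductGeometry.angle (k : E3) (k' : E3) := by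
  rw [← luneThickness_eq h1 h2]
  calc thickness C ≤ width k C := csInf_le
        ⟨0, by rintro _ ⟨k, _, rfl⟩; exact width_nonneg k C⟩ ⟨k, hk, rfl⟩
    _ ≤ _ := csInf_le ⟨0, by rintro _ ⟨k', _, _, _, rfl⟩; exact InnerProductGeometry.angle_nonneg _ _⟩
        ⟨k', h1, h2, hk', rfl⟩

/-- The infimum of the empty set of reals is `0`, so a small infimum has a witness only if the sets
are known to be non-empty; this is what `h0` and `h` provide. -/
theorem exists_of_thickness_lt {C : Set S2} {θ : ℝ} (hθ : thickness C < θ)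
    (h0 : ∃ k, Supports k C) (h : ∀ k, Supports k C → ∃ k', k' ≠ k ∧ k' ≠ -k ∧ Supports k' C) :
    ∃ k k', Supports k C ∧ Supports k' C ∧
      π - InnerProductGeometry.angle (k : E3) (k' : E3) < θ := by
  obtain ⟨k, hk⟩ := h0
  obtain ⟨_, ⟨k, hk, rfl⟩, hlt⟩ := exists_lt_of_csInf_lt (by exact ⟨_, k, hk, rfl⟩) hθ
  obtain ⟨k', h1, h2, h3⟩ := h k hk
  obtain ⟨_, ⟨k', h1, h2, h3, rfl⟩, hlt⟩ := exists_lt_of_csInf_lt (by exact ⟨_, k', h1, h2, h3, rfl⟩) hlt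
  exact ⟨k, k', hk, h3, by rwa [← luneThickness_eq h1 h2]⟩

theorem angle_S2 (a b : S2) :
    InnerProductGeometry.angle (a : E3) (b : E3) = arccos ⟪(a : E3), (b : E3)⟫_ℝ := by
  rw [InnerProductGeometry.angle, norm_eq_of_mem_sphere, norm_eq_of_mem_sphere]; norm_num

theorem mem_hemisphere_iff {k p : S2} : p ∈ hemisphere k ↔ 0 ≤ ⟪(p : E3), (k : E3)⟫_ℝ := by
  change InnerProductGeometry.angle (p : E3) (k : E3) ≤ π / 2 ↔ _
  rw [angle_S2, Real.arccos_le_pi_div_two]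

theorem mem_greatCircle_iff {k p : S2} : p ∈ greatCircle k ↔ ⟪(p : E3), (k : E3)⟫_ℝ = 0 :=
  (InnerProductGeometry.inner_eq_zero_iff_angle_eq_pi_div_two _ _).symm

theorem cos_angle_S2 (a b : S2) :
    cos (InnerProductGeometry.angle (a : E3) (b : E3)) = ⟪(a : E3), (b : E3)⟫_ℝ := by
  rw [InnerProductGeometry.cos_angle, norm_eq_of_mem_sphere, norm_eq_of_mem_sphere]; norm_num

/-- A lower bound for the thickness of a set with an inner point and two supporting
hemispheres. -/
theorem exists_inner_lt_of_thickness_lt {C : Set S2} {θ : ℝ} (hθ : thickness C < θ)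
    (hπ : θ ≤ π) {k₁ k₂ : S2} (h12 : k₁ ≠ k₂)
    (h1 : Supports k₁ C) (h2 : Supports k₂ C) {p : E3}
    (hp : ∀ k, Supports k C → 0 < ⟪p, (k : E3)⟫_ℝ) :
    ∃ k k', Supports k C ∧ Supports k' C ∧ ⟪(k : E3), (k' : E3)⟫_ℝ < -cos θ := by
  have hne : ∀ k k', Supports k C → Supports k' C → k' ≠ -k := by
    rintro k k' hk hk' rfl
    have a1 := hp _ hk
    have a2 := hp _ hk'
    rw [show ((-k : S2) : E3) = -(k : E3) from rfl, inner_neg_right] at a2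
    linarith
  obtain ⟨k, k', hk, hk', hlt⟩ := exists_of_thickness_lt hθ ⟨_, h1⟩ (fun k hk => by
    by_cases e1 : k₁ = k
    · exact ⟨k₂, by rw [← e1]; exact h12.symm, hne _ _ hk h2, h2⟩
    · exact ⟨k₁, e1, hne _ _ hk h1, h1⟩)
  refine ⟨k, k', hk, hk', ?_⟩
  rw [← cos_angle_S2, ← Real.cos_pi_sub]
  have h0 := thickness_nonneg C
  exact Real.cos_lt_cos_of_nonneg_of_le_pi (by linarith)
    (InnerProductGeometry.angle_le_pi _ _) (by linarith)

section Polygon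

variable {n : ℕ} [NeZero n] {v : ZMod n → S2} {w : ZMod n → E3}

theorem PolarPair.mem_hull (h : PolarPair n (fun i => (v i : E3)) w) (j : ZMod n) :
    v j ∈ hull (range v) := by
  rw [h.hull_eq]; exact fun i => h.inner_nonneg i j

theorem PolarPair.supports_of (h : PolarPair n (fun i => (v i : E3)) w) {k : S2}
    (hk : ∀ i, 0 ≤ ⟪(k : E3), (v i : E3)⟫_ℝ) {i : ZMod n} (hi : ⟪(k : E3), (v i : E3)⟫_ℝ = 0) :
    Supports k (hull (range v)) := by
  refine ⟨fun p hp => ?_, v i, ?_, h.mem_hull i⟩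
  · rw [h.hull_eq] at hp
    exact mem_hemisphere_iff.2 (h.inner_cone_nonneg hp hk)
  · rw [mem_greatCircle_iff, real_inner_comm]; exact hi

theorem PolarPair.nonneg_of_supports (h : PolarPair n (fun i => (v i : E3)) w) {k : S2}
    (hk : Supports k (hull (range v))) (i : ZMod n) : 0 ≤ ⟪(k : E3), (v i : E3)⟫_ℝ := by
  rw [real_inner_comm]; exact mem_hemisphere_iff.1 (hk.1 (h.mem_hull i))

theorem PolarPair.exists_eq_zero (h : PolarPair n (fun i => (v i : E3)) w) {k : S2}
    (hk : Supports k (hull (range v))) : ∃ i, ⟪(k : E3), (v i : E3)⟫_ℝ = 0 := by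
  obtain ⟨p, hp1, hp2⟩ := hk.2
  rw [h.hull_eq] at hp2
  obtain ⟨a, ha, e⟩ := h.mem_cone hp2
  by_contra! hne
  have hpos : ∀ i, 0 < ⟪(k : E3), (v i : E3)⟫_ℝ := fun i =>
    lt_of_le_of_ne (h.nonneg_of_supports hk i) (hne i).symm
  rw [mem_greatCircle_iff, e, sum_inner, Finset.sum_eq_zero_iff_of_nonneg (fun i _ => by
    rw [real_inner_smul_left, real_inner_comm]; exact mul_nonneg (ha i) (hpos i).le)] at hp1
  refine S2_ne_zero p (e.trans (Finset.sum_eq_zero fun i hi => ?_))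
  have := hp1 i hi
  rw [real_inner_smul_left, real_inner_comm] at this
  rw [(mul_eq_zero.1 this).resolve_right (hpos i).ne', zero_smul]

omit [NeZero n] in
theorem PolarPair.w_ne (h : PolarPair n (fun i => (v i : E3)) w) {i j : ZMod n} (hij : i ≠ j) :
    w i ≠ w j := by
  intro e
  obtain ⟨hn1, hn2, hn3⟩ := h.ne_aux i
  have h1 : ⟪(v i : E3), w j⟫_ℝ = 0 := by rw [← e]; exact h.inner_left i
  have h2 : ⟪(v (i + 1) : E3), w j⟫_ℝ = 0 := by rw [← e]; exact h.inner_right i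
  have h1 := (h.inner_eq_zero_iff _ _).1 h1
  have h2 := (h.inner_eq_zero_iff _ _).1 h2
  rcases h1 with h1 | h1
  · exact hij h1
  · rcases h2 with h2 | h2
    · exact (h.ne_aux j).2.1 (by linear_combination h2 - h1)
    · exact hij (by simpa using h2)

theorem PolarPair.thickness_le_pi (h : PolarPair n (fun i => (v i : E3)) w) :
    thickness (hull (range v)) ≤ π := by
  let W : ZMod n → S2 := fun l => ⟨w l, by simp [h.norm_w]⟩
  have hs : ∀ l, Supports (W l) (hull (range v)) := fun l =>
    h.supports_of (i := l) (fun i => by rw [real_inner_comm]; exact h.inner_nonneg l i)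
      (by rw [real_inner_comm]; exact h.inner_left l)
  refine (thickness_le (k := W 0) (k' := W (0 + 1)) ?_ ?_ (hs _) (hs _)).trans
    (sub_le_self _ (InnerProductGeometry.angle_nonneg _ _))
  · exact fun e => h.w_ne (h.ne_aux 0).1 (congrArg Subtype.val e)
  · intro e
    have e' : w (0 + 1) = -w 0 := congrArg Subtype.val e
    have h1 := h.sum_inner_pos 0
    have h2 := h.sum_inner_pos (0 + 1)
    rw [e', inner_neg_right] at h2
    linarith

/-- The inner product of two vectors of the polar cone is bounded by the thickness. -/
theorem PolarPair.thickness_bound (h : PolarPair n (fun i => (v i : E3)) w) {k k' : E3}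
    (hk : ∀ i, 0 ≤ ⟪k, (v i : E3)⟫_ℝ) (hk' : ∀ i, 0 ≤ ⟪k', (v i : E3)⟫_ℝ) :
    -cos (thickness (hull (range v))) * (‖k‖ * ‖k'‖) ≤ ⟪k, k'⟫_ℝ := by
  classical
  set Δ := thickness (hull (range v)) with hΔ
  have hboundary : ∀ k k' : E3, (∀ i, 0 ≤ ⟪k, (v i : E3)⟫_ℝ) → (∀ i, 0 ≤ ⟪k', (v i : E3)⟫_ℝ) →
      (∃ i, ⟪k, (v i : E3)⟫_ℝ = 0) → (∃ i, ⟪k', (v i : E3)⟫_ℝ = 0) →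
      -cos Δ * (‖k‖ * ‖k'‖) ≤ ⟪k, k'⟫_ℝ := by
    rintro k k' hk hk' ⟨i, hi⟩ ⟨j, hj⟩
    by_cases hk0 : k = 0
    · simp [hk0]
    by_cases hk0' : k' = 0
    · simp [hk0']
    have hu : ∀ (x : E3) (hx : x ≠ 0) (y : E3), ⟪(normalizeS2 x hx : E3), y⟫_ℝ = ‖x‖⁻¹ * ⟪x, y⟫_ℝ :=
      fun x hx y => by rw [normalizeS2, real_inner_smul_left]
    have hs := h.supports_of (k := normalizeS2 k hk0) (fun i => by
      rw [hu]; exact mul_nonneg (by positivity) (hk i)) (i := i) (by rw [hu, hi, mul_zero])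
    have hs' := h.supports_of (k := normalizeS2 k' hk0') (fun i => by
      rw [hu]; exact mul_nonneg (by positivity) (hk' i)) (i := j) (by rw [hu, hj, mul_zero])
    have hnk := norm_pos_iff.2 hk0
    have hnk' := norm_pos_iff.2 hk0'
    have key : -cos Δ ≤ ⟪(normalizeS2 k hk0 : E3), (normalizeS2 k' hk0' : E3)⟫_ℝ := by
      by_cases e1 : normalizeS2 k' hk0' = normalizeS2 k hk0
      · rw [e1, inner_self_S2]; linarith [Real.neg_one_le_cos Δ]
      · have e2 : normalizeS2 k' hk0' ≠ -normalizeS2 k hk0 := by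
          intro e2
          have a1 := h.sum_inner_pos' hk0 hk
          have a2 := h.sum_inner_pos' hk0' hk'
          have e2 := congrArg (Subtype.val) e2
          change ‖k'‖⁻¹ • k' = -(‖k‖⁻¹ • k) at e2
          have a3 := congrArg (fun x => ⟪∑ i, (v i : E3), x⟫_ℝ) e2
          simp only [inner_neg_right, real_inner_smul_right] at a3
          have b1 := mul_pos (inv_pos.2 hnk) a1
          have b2 := mul_pos (inv_pos.2 hnk') a2
          linarith
        have ht := thickness_le e1 e2 hs hs'
        rw [← cos_angle_S2, ← Real.cos_pi_sub]
        exact Real.cos_le_cos_of_nonneg_of_le_pi (InnerProductGeometry.angle_nonneg _ _)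
          (by linarith [thickness_nonneg (hull (range v))]) (by linarith)
    rw [hu, real_inner_comm, hu, real_inner_comm] at key
    have h2 := mul_le_mul_of_nonneg_right key (mul_pos hnk hnk').le
    calc _ ≤ _ := h2
      _ = _ := by field_simp
  -- Subtracting the right multiple of `k'` moves `k` to the boundary of the polar cone. The bound
  -- survives: the norm changes by at most `t * ‖k'‖`, and `|cos Δ| ≤ 1`.
  have hreduce : ∀ k k' : E3, (∀ i, 0 ≤ ⟪k, (v i : E3)⟫_ℝ) → (∀ i, 0 ≤ ⟪k', (v i : E3)⟫_ℝ) →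
      (∀ k₀ : E3, (∀ i, 0 ≤ ⟪k₀, (v i : E3)⟫_ℝ) → (∃ i, ⟪k₀, (v i : E3)⟫_ℝ = 0) →
        -cos Δ * (‖k₀‖ * ‖k'‖) ≤ ⟪k₀, k'⟫_ℝ) → -cos Δ * (‖k‖ * ‖k'‖) ≤ ⟪k, k'⟫_ℝ := by
    intro k k' hk hk' H
    by_cases hk0' : k' = 0
    · simp [hk0']
    let F : Finset (ZMod n) := Finset.univ.filter fun i => 0 < ⟪k', (v i : E3)⟫_ℝ
    have hF : F.Nonempty := by
      by_contra hne
      rw [Finset.not_nonempty_iff_eq_empty, Finset.filter_eq_empty_iff] at hne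
      have := h.sum_inner_pos' hk0' hk'
      rw [sum_inner] at this
      exact this.ne' (Finset.sum_eq_zero fun i hi => by
        rw [real_inner_comm]; exact le_antisymm (not_lt.1 (hne hi)) (hk' i))
    obtain ⟨i, hiF, hmin⟩ := F.exists_min_image
      (fun i => ⟪k, (v i : E3)⟫_ℝ / ⟪k', (v i : E3)⟫_ℝ) hF
    have hi : 0 < ⟪k', (v i : E3)⟫_ℝ := by simpa [F] using hiF
    set t := ⟪k, (v i : E3)⟫_ℝ / ⟪k', (v i : E3)⟫_ℝ with ht
    have ht0 : 0 ≤ t := div_nonneg (hk i) hi.le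
    have H1 := H (k - t • k') (fun j => by
      rw [inner_sub_left, real_inner_smul_left]
      by_cases hj : 0 < ⟪k', (v j : E3)⟫_ℝ
      · have := hmin j (by simpa [F] using hj)
        rw [le_div_iff₀ hj] at this
        linarith
      · have : ⟪k', (v j : E3)⟫_ℝ = 0 := le_antisymm (not_lt.1 hj) (hk' j)
        rw [this]; simpa using hk j) ⟨i, by
      rw [inner_sub_left, real_inner_smul_left, ht, div_mul_cancel₀ _ hi.ne', sub_self]⟩
    rw [inner_sub_left, real_inner_smul_left, real_inner_self_eq_norm_sq] at H1
    have n1 : |‖k‖ - ‖k - t • k'‖| ≤ t * ‖k'‖ := by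
      have := abs_norm_sub_norm_le k (k - t • k')
      rwa [sub_sub_cancel, norm_smul, norm_of_nonneg ht0] at this
    have n2 : -cos Δ * (‖k‖ - ‖k - t • k'‖) ≤ t * ‖k'‖ := by
      calc _ ≤ |-cos Δ * (‖k‖ - ‖k - t • k'‖)| := le_abs_self _
        _ = |cos Δ| * |‖k‖ - ‖k - t • k'‖| := by rw [abs_mul, abs_neg]
        _ ≤ 1 * (t * ‖k'‖) := by gcongr; exact Real.abs_cos_le_one _
        _ = _ := one_mul _
    have n3 := mul_le_mul_of_nonneg_right n2 (norm_nonneg k')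
    nlinarith
  refine hreduce k k' hk hk' fun k₀ h1 h2 => ?_
  rw [real_inner_comm, mul_comm ‖k₀‖]
  refine hreduce k' k₀ hk' h1 fun k₁ h3 h4 => ?_
  rw [real_inner_comm, mul_comm ‖k₁‖]
  exact hboundary k₀ k₁ h1 h3 h2 h4

/-- The part of the sphere in the cone `{p | ∀ l, 0 ≤ ⟪p, w l⟫}` cut off by a further plane. -/
def cutoff (w : ZMod n → E3) (z : E3) : Set S2 :=
  {p : S2 | (∀ l, 0 ≤ ⟪(p : E3), w l⟫_ℝ) ∧ 0 ≤ ⟪(p : E3), z⟫_ℝ}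

theorem PolarPair.isConvexBody_cutoff (h : PolarPair n (fun i => (v i : E3)) w) {z : E3}
    (hz : 0 < ⟪∑ j, (v j : E3), z⟫_ℝ) : IsConvexBody (cutoff w z) := by
  have hcont : ∀ y : E3, Continuous fun p : S2 => ⟪(p : E3), y⟫_ℝ := fun y => by fun_prop
  refine ⟨?_, ?_, ?_⟩
  · convert isConvex_of_inner (fun o : Option (ZMod n) => o.elim z w) (∑ i, w i) using 1
    ext p
    constructor
    · intro hp
      refine ⟨?_, ?_⟩
      · rw [real_inner_comm]
        exact h.dual.sum_inner_pos' (S2_ne_zero p) hp.1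
      · rintro (_ | l)
        · exact hp.2
        · exact hp.1 l
    · exact fun hp => ⟨fun l => hp.2 (some l), hp.2 none⟩
  · refine IsClosed.inter ?_ (isClosed_le continuous_const (hcont z))
    have : {p : S2 | ∀ l, 0 ≤ ⟪(p : E3), w l⟫_ℝ} = ⋂ l, {p : S2 | 0 ≤ ⟪(p : E3), w l⟫_ℝ} := by
      ext; simp
    change IsClosed {p : S2 | ∀ l, 0 ≤ ⟪(p : E3), w l⟫_ℝ}
    rw [this]
    exact isClosed_iInter fun l => isClosed_le continuous_const (hcont _)
  · have hs0 : ∑ j, (v j : E3) ≠ 0 := by rintro h0; simp [h0] at hz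
    have hop : IsOpen {p : S2 | (∀ l, 0 < ⟪(p : E3), w l⟫_ℝ) ∧ 0 < ⟪(p : E3), z⟫_ℝ} := by
      refine IsOpen.inter ?_ (isOpen_lt continuous_const (hcont z))
      have : {p : S2 | ∀ l, 0 < ⟪(p : E3), w l⟫_ℝ} = ⋂ l, {p : S2 | 0 < ⟪(p : E3), w l⟫_ℝ} := by
        ext; simp
      change IsOpen {p : S2 | ∀ l, 0 < ⟪(p : E3), w l⟫_ℝ}
      rw [this]
      exact isOpen_iInter_of_finite fun l => isOpen_lt continuous_const (hcont _)
    have hsub : {p : S2 | (∀ l, 0 < ⟪(p : E3), w l⟫_ℝ) ∧ 0 < ⟪(p : E3), z⟫_ℝ} ⊆ cutoff w z :=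
      fun p hp => ⟨fun l => (hp.1 l).le, hp.2.le⟩
    refine ⟨normalizeS2 _ hs0, interior_maximal hsub hop ?_⟩
    constructor
    · intro l
      rw [normalizeS2, real_inner_smul_left]
      exact mul_pos (by positivity) (h.sum_inner_pos l)
    · rw [normalizeS2, real_inner_smul_left]
      exact mul_pos (by positivity) hz

theorem PolarPair.cutoff_ssubset (h : PolarPair n (fun i => (v i : E3)) w) {z : E3} {i : ZMod n}
    (hz : ⟪z, (v i : E3)⟫_ℝ < 0) : cutoff w z ⊂ hull (range v) := by
  rw [h.hull_eq]
  refine ⟨fun p hp => hp.1, fun hsub => ?_⟩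
  have := (hsub (show v i ∈ _ from fun l => h.inner_nonneg l i)).2
  rw [real_inner_comm] at this
  linarith

/-- The polar cone of a polygon from which a neighbourhood of a vertex has been cut off. -/
theorem PolarPair.polar_cutoff (h : PolarPair n (fun i => (v i : E3)) w) {z : E3} {i : ZMod n}
    (hzi : ⟪z, (v i : E3)⟫_ℝ < 0) (hz : ∀ j, j ≠ i → 0 < ⟪z, (v j : E3)⟫_ℝ) {k : E3}
    (hk : ∀ p ∈ cutoff w z, 0 ≤ ⟪(p : E3), k⟫_ℝ) :
    (∀ j, 0 ≤ ⟪k, (v j : E3)⟫_ℝ) ∨ ∃ t : ℝ, 0 < t ∧ ∃ k₀ : E3, (∀ j, 0 ≤ ⟪k₀, (v j : E3)⟫_ℝ) ∧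
      ⟪k₀, (v i : E3)⟫_ℝ = 0 ∧ k = k₀ + t • z := by
  have hj : ∀ j, j ≠ i → 0 ≤ ⟪k, (v j : E3)⟫_ℝ := by
    intro j hji
    rw [real_inner_comm]
    refine hk (v j) ⟨fun l => h.inner_nonneg l j, ?_⟩
    rw [real_inner_comm]; exact (hz j hji).le
  by_cases hi : 0 ≤ ⟪k, (v i : E3)⟫_ℝ
  · left
    intro j
    by_cases hji : j = i
    · rwa [hji]
    · exact hj j hji
  · right
    rw [not_le] at hi
    have ht : 0 < ⟪k, (v i : E3)⟫_ℝ / ⟪z, (v i : E3)⟫_ℝ := div_pos_of_neg_of_neg hi hzi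
    set t := ⟪k, (v i : E3)⟫_ℝ / ⟪z, (v i : E3)⟫_ℝ with ht'
    have hti : t * ⟪z, (v i : E3)⟫_ℝ = ⟪k, (v i : E3)⟫_ℝ := div_mul_cancel₀ _ hzi.ne
    refine ⟨t, ht, k - t • z, fun j => ?_, ?_, by abel⟩
    · rw [inner_sub_left, real_inner_smul_left]
      by_cases hji : j = i
      · rw [hji, hti, sub_self]
      have hzj := hz j hji
      let a : E3 := ⟪z, (v j : E3)⟫_ℝ • (v i : E3) + (-⟪z, (v i : E3)⟫_ℝ) • (v j : E3)
      -- The point where the arc from `v i` to `v j` crosses the cutting plane belongs to the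
      -- truncated body; testing `k` there gives the sign at `v j`.
      obtain ⟨r, hr, d, hd, e⟩ := h.isConvex.cone_add (a := v i) (b := v j)
        (fun l => h.inner_nonneg l i) (fun l => h.inner_nonneg l j) hzj (neg_pos.2 hzi)
      have hde : ∀ y : E3, r * ⟪(d : E3), y⟫_ℝ =
          ⟪z, (v j : E3)⟫_ℝ * ⟪(v i : E3), y⟫_ℝ - ⟪z, (v i : E3)⟫_ℝ * ⟪(v j : E3), y⟫_ℝ := by
        intro y
        rw [← real_inner_smul_left, ← e, inner_add_left, real_inner_smul_left,
          real_inner_smul_left]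
        ring
      have hdz : ⟪(d : E3), z⟫_ℝ = 0 := by
        have := hde z
        rw [real_inner_comm z (v i : E3), real_inner_comm z (v j : E3)] at this
        have h0 : r * ⟪(d : E3), z⟫_ℝ = 0 := by rw [this]; ring
        exact (mul_eq_zero.1 h0).resolve_left hr.ne'
      have h1 := mul_nonneg hr.le (hk d ⟨hd, hdz.ge⟩)
      rw [hde, real_inner_comm k (v i : E3), real_inner_comm k (v j : E3), ← hti] at h1
      have h2 : 0 ≤ -⟪z, (v i : E3)⟫_ℝ * (⟪k, (v j : E3)⟫_ℝ - t * ⟪z, (v j : E3)⟫_ℝ) := by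
        linarith
      exact nonneg_of_mul_nonneg_right h2 (neg_pos.2 hzi)
    · rw [inner_sub_left, real_inner_smul_left, hti, sub_self]

/-- If a neighbourhood of a vertex of a reduced polygon is cut off, then the polar cone contains
vectors at a distance greater than allowed by the thickness of the polygon. -/
theorem PolarPair.exists_lt_of_isReduced (h : PolarPair n (fun i => (v i : E3)) w)
    (hred : IsReduced (hull (range v)))
    {z : E3} {i : ZMod n} (hzi : ⟪z, (v i : E3)⟫_ℝ < 0)
    (hz : ∀ j, j ≠ i → 0 < ⟪z, (v j : E3)⟫_ℝ) (hzs : 0 < ⟪∑ j, (v j : E3), z⟫_ℝ) :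
    ∃ k k' : S2, (∀ p ∈ cutoff w z, 0 ≤ ⟪(p : E3), (k : E3)⟫_ℝ) ∧
      (∀ p ∈ cutoff w z, 0 ≤ ⟪(p : E3), (k' : E3)⟫_ℝ) ∧
      ⟪(k : E3), (k' : E3)⟫_ℝ < -cos (thickness (hull (range v))) := by
  have hlt := hred.2 _ (h.isConvexBody_cutoff hzs) (h.cutoff_ssubset hzi)
  have hmem : ∀ k, Supports k (cutoff w z) → ∀ p ∈ cutoff w z, 0 ≤ ⟪(p : E3), (k : E3)⟫_ℝ :=
    fun k hk p hp => mem_hemisphere_iff.1 (hk.1 hp)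
  let W : ZMod n → S2 := fun l => ⟨w l, by simp [h.norm_w]⟩
  have hW : ∀ l, Supports (W l) (cutoff w z) := by
    intro l
    refine ⟨fun p hp => mem_hemisphere_iff.2 (hp.1 l), ?_⟩
    by_cases hl : l = i
    · refine ⟨v (l + 1), mem_greatCircle_iff.2 (h.inner_right l), fun m => h.inner_nonneg m _, ?_⟩
      rw [real_inner_comm]
      exact (hz _ (by rw [← hl]; exact (h.ne_aux l).1)).le
    · refine ⟨v l, mem_greatCircle_iff.2 (h.inner_left l), fun m => h.inner_nonneg m _, ?_⟩
      rw [real_inner_comm]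
      exact (hz _ hl).le
  have hWne : ∀ a b : ZMod n, a ≠ b → W a ≠ W b := fun a b hab e =>
    h.w_ne hab (congrArg Subtype.val e)
  obtain ⟨a1, -, -⟩ := h.ne_aux 0
  obtain ⟨k, k', hk, hk', hkk⟩ := exists_inner_lt_of_thickness_lt hlt h.thickness_le_pi
    (hWne 0 (0 + 1) a1.symm) (hW _) (hW _) (p := ∑ j, (v j : E3)) (fun k hk => by
      rcases h.polar_cutoff hzi hz (hmem k hk) with hK | ⟨t, ht, k₀, hk₀, -, e⟩
      · exact h.sum_inner_pos' (S2_ne_zero k) hK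
      · rw [e, inner_add_right, real_inner_smul_right]
        by_cases h0 : k₀ = 0
        · rw [h0, inner_zero_right, zero_add]; positivity
        · have := h.sum_inner_pos' h0 hk₀; positivity)
  exact ⟨k, k', hmem k hk, hmem k' hk', hkk⟩

end Polygon

end

section

open Filter Topology

/-! ### The diametral chords of a reduced polygon -/

section Chords

variable {n : ℕ} [NeZero n] {v : ZMod n → S2} {w : ZMod n → E3}

/-- The vectors cutting off a neighbourhood of the vertex `v i`. -/
theorem PolarPair.eventually_cut (h : PolarPair n (fun i => (v i : E3)) w) (i : ZMod n) :
    ∀ᶠ ε in 𝓝[>] (0 : ℝ), ⟪w (i - 1) + w i - ε • (v i : E3), (v i : E3)⟫_ℝ < 0 ∧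
      (∀ j, j ≠ i → 0 < ⟪w (i - 1) + w i - ε • (v i : E3), (v j : E3)⟫_ℝ) ∧
      0 < ⟪∑ j, (v j : E3), w (i - 1) + w i - ε • (v i : E3)⟫_ℝ := by
  have h1 : ∀ᶠ ε in 𝓝[>] (0 : ℝ), ⟪w (i - 1) + w i - ε • (v i : E3), (v i : E3)⟫_ℝ < 0 := by
    filter_upwards [self_mem_nhdsWithin] with ε hε
    have a1 := h.inner_right (i - 1)
    have a2 := h.inner_left i
    simp only [sub_add_cancel] at a1
    rw [inner_sub_left, inner_add_left, real_inner_comm, a1, real_inner_comm, a2,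
      real_inner_smul_left, inner_self_S2]
    have : (0 : ℝ) < ε := hε
    linarith
  have hpos : ∀ j, j ≠ i → 0 < ⟪w (i - 1) + w i, (v j : E3)⟫_ℝ := by
    intro j hj
    rw [inner_add_left, real_inner_comm, real_inner_comm (v j : E3) (w i)]
    have a1 := h.inner_nonneg (i - 1) j
    have a2 := h.inner_nonneg i j
    refine lt_of_le_of_ne (add_nonneg a1 a2) fun h0 => ?_
    have b1 := (h.inner_eq_zero_iff (i - 1) j).1 (by linarith)
    have b2 := (h.inner_eq_zero_iff i j).1 (by linarith)
    rcases b2 with b2 | b2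
    · exact hj b2
    · rcases b1 with b1 | b1
      · exact (h.ne_aux i).2.1 (by linear_combination b1 - b2)
      · exact hj (by simpa using b1)
  have h2 : ∀ j, j ≠ i → ∀ᶠ ε in 𝓝[>] (0 : ℝ),
      0 < ⟪w (i - 1) + w i - ε • (v i : E3), (v j : E3)⟫_ℝ := by
    intro j hj
    have : Tendsto (fun ε : ℝ => ⟪w (i - 1) + w i - ε • (v i : E3), (v j : E3)⟫_ℝ) (𝓝[>] 0)
        (𝓝 ⟪w (i - 1) + w i - (0 : ℝ) • (v i : E3), (v j : E3)⟫_ℝ) :=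
      (Continuous.tendsto (by fun_prop) 0).mono_left nhdsWithin_le_nhds
    refine this.eventually (lt_mem_nhds ?_)
    rw [zero_smul, sub_zero]; exact hpos j hj
  have h3 : ∀ᶠ ε in 𝓝[>] (0 : ℝ), 0 < ⟪∑ j, (v j : E3), w (i - 1) + w i - ε • (v i : E3)⟫_ℝ := by
    have : Tendsto (fun ε : ℝ => ⟪∑ j, (v j : E3), w (i - 1) + w i - ε • (v i : E3)⟫_ℝ) (𝓝[>] 0)
        (𝓝 ⟪∑ j, (v j : E3), w (i - 1) + w i - (0 : ℝ) • (v i : E3)⟫_ℝ) :=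
      (Continuous.tendsto (by fun_prop) 0).mono_left nhdsWithin_le_nhds
    refine this.eventually (lt_mem_nhds ?_)
    rw [zero_smul, sub_zero, inner_add_right]
    exact add_pos (h.sum_inner_pos _) (h.sum_inner_pos _)
  have h2' : ∀ᶠ ε in 𝓝[>] (0 : ℝ), ∀ j, j ≠ i →
      0 < ⟪w (i - 1) + w i - ε • (v i : E3), (v j : E3)⟫_ℝ := by
    rw [eventually_all]
    intro j
    by_cases hj : j = i
    · simp [hj]
    · filter_upwards [h2 j hj] with ε hε _ using hε
  filter_upwards [h1, h2', h3] with ε a b c using ⟨a, b, c⟩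

/-- The thickness of a reduced polygon is at most `π / 2`. -/
theorem PolarPair.thickness_le_pi_div_two (h : PolarPair n (fun i => (v i : E3)) w)
    (hred : IsReduced (hull (range v))) : thickness (hull (range v)) ≤ π / 2 := by
  by_contra! hlt
  set Δ := thickness (hull (range v)) with hΔ
  have hm : 0 < -cos Δ :=
    neg_pos.2 (Real.cos_neg_of_pi_div_two_lt_of_lt hlt (by linarith [h.thickness_le_pi, pi_pos]))
  set m := -cos Δ with hm'
  set x := w (0 - 1) + w 0 with hx
  -- The strict inequality is the room for the cut: if all unit vectors of the polar cone have inner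
  -- products at least `m > 0`, then `x` has inner product at least `2 * m` with each of them, more
  -- than the required `m * ‖x‖`.
  have hx2 : ‖x‖ < 2 := by
    have hne : w (0 - 1) ≠ w 0 := h.w_ne (by
      have := (h.ne_aux (0 - 1)).1; rw [sub_add_cancel] at this; exact this.symm)
    have := (inner_lt_one_iff_real_of_norm_eq_one (h.norm_w (0 - 1)) (h.norm_w 0)).2 hne
    have e : ‖x‖ ^ 2 = 2 + 2 * ⟪w (0 - 1), w 0⟫_ℝ := by
      rw [hx, norm_add_sq_real, h.norm_w, h.norm_w]; ring
    nlinarith [norm_nonneg x]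
  have hev : ∀ᶠ ε in 𝓝[>] (0 : ℝ), m * (‖x‖ + ε) ≤ 2 * m - ε := by
    have : Tendsto (fun ε : ℝ => 2 * m - ε - m * (‖x‖ + ε)) (𝓝[>] 0)
        (𝓝 (2 * m - 0 - m * (‖x‖ + 0))) :=
      (Continuous.tendsto (by fun_prop) 0).mono_left nhdsWithin_le_nhds
    filter_upwards [this.eventually (lt_mem_nhds (a := 0) (by nlinarith))] with ε hε
    linarith
  obtain ⟨ε, ⟨⟨hz1, hz2, hz3⟩, hε⟩, hε0⟩ :=
    ((h.eventually_cut 0).and hev |>.and self_mem_nhdsWithin).exists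
  have hε0 : 0 < ε := hε0
  obtain ⟨k, k', hk, hk', hlt'⟩ := h.exists_lt_of_isReduced hred hz1 hz2 hz3
  rw [← hx] at hz1 hz2 hz3 hk hk'
  rw [← hΔ, ← hm'] at hlt'
  set z := x - ε • (v 0 : E3) with hz
  have hwK : ∀ l i, 0 ≤ ⟪w l, (v i : E3)⟫_ℝ := fun l i => by
    rw [real_inner_comm]; exact h.inner_nonneg l i
  -- For small `ε` the added vector `z` satisfies the old bound against the polar cone. By
  -- bilinearity the whole enlarged cone does, so the cut has not lowered the thickness.
  have hzk : ∀ y : E3, (∀ i, 0 ≤ ⟪y, (v i : E3)⟫_ℝ) → m * (‖z‖ * ‖y‖) ≤ ⟪z, y⟫_ℝ := by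
    intro y hy
    have a1 := h.thickness_bound (hwK (0 - 1)) hy
    have a2 := h.thickness_bound (hwK 0) hy
    rw [← hΔ, ← hm', h.norm_w, one_mul] at a1 a2
    have a3 : ⟪(v 0 : E3), y⟫_ℝ ≤ ‖y‖ := by
      have := real_inner_le_norm (v 0 : E3) y
      rwa [norm_eq_of_mem_sphere, one_mul] at this
    have a4 : ‖z‖ ≤ ‖x‖ + ε := by
      refine (norm_sub_le _ _).trans ?_
      rw [norm_smul, norm_eq_of_mem_sphere, norm_of_nonneg hε0.le, mul_one]
    have a5 : ⟪z, y⟫_ℝ = ⟪w (0 - 1), y⟫_ℝ + ⟪w 0, y⟫_ℝ - ε * ⟪(v 0 : E3), y⟫_ℝ := by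
      rw [hz, hx, inner_sub_left, inner_add_left, real_inner_smul_left]
    have a6 := mul_le_mul_of_nonneg_left a3 hε0.le
    have a7 := mul_le_mul_of_nonneg_left a4 hm.le
    have a8 := mul_le_mul_of_nonneg_right (a7.trans hε) (norm_nonneg y)
    rw [a5]
    linarith
  have hdec : ∀ y : S2, (∀ p ∈ cutoff w z, 0 ≤ ⟪(p : E3), (y : E3)⟫_ℝ) → ∃ t : ℝ, 0 ≤ t ∧
      ∃ y₀ : E3, (∀ j, 0 ≤ ⟪y₀, (v j : E3)⟫_ℝ) ∧ (y : E3) = y₀ + t • z := by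
    intro y hy
    rcases h.polar_cutoff hz1 hz2 hy with hK | ⟨t, ht, y₀, hy₀, -, e⟩
    · exact ⟨0, le_rfl, y, hK, by simp⟩
    · exact ⟨t, ht.le, y₀, hy₀, e⟩
  obtain ⟨t, ht, k₀, hk₀, e⟩ := hdec k hk
  obtain ⟨t', ht', k₀', hk₀', e'⟩ := hdec k' hk'
  have hm1 : m ≤ 1 := by rw [hm']; linarith [Real.neg_one_le_cos Δ]
  have b0 := h.thickness_bound hk₀ hk₀'
  rw [← hΔ, ← hm'] at b0
  have b1 := mul_le_mul_of_nonneg_left (hzk k₀' hk₀') ht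
  have b2 := mul_le_mul_of_nonneg_left (hzk k₀ hk₀) ht'
  have b3 : t * t' * (m * (‖z‖ * ‖z‖)) ≤ t * t' * (‖z‖ * ‖z‖) := by
    apply mul_le_mul_of_nonneg_left _ (mul_nonneg ht ht')
    nlinarith [mul_self_nonneg ‖z‖]
  have b4 : ⟪(k : E3), (k' : E3)⟫_ℝ = ⟪k₀, k₀'⟫_ℝ + t' * ⟪z, k₀⟫_ℝ + t * ⟪z, k₀'⟫_ℝ +
      t * t' * (‖z‖ * ‖z‖) := by
    rw [e, e', inner_add_left, inner_add_right, inner_add_right, real_inner_smul_left,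
      real_inner_smul_left, real_inner_smul_right, real_inner_smul_right,
      real_inner_self_eq_norm_mul_norm, real_inner_comm z k₀]
    ring
  have c1 : 1 ≤ ‖k₀‖ + t * ‖z‖ := by
    have := norm_add_le k₀ (t • z)
    rwa [← e, norm_eq_of_mem_sphere, norm_smul, norm_of_nonneg ht] at this
  have c2 : 1 ≤ ‖k₀'‖ + t' * ‖z‖ := by
    have := norm_add_le k₀' (t' • z)
    rwa [← e', norm_eq_of_mem_sphere, norm_smul, norm_of_nonneg ht'] at this
  have c3 : 1 ≤ (‖k₀‖ + t * ‖z‖) * (‖k₀'‖ + t' * ‖z‖) := one_le_mul_of_one_le_of_one_le c1 c2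
  have c4 := mul_le_mul_of_nonneg_left c3 hm.le
  rw [b4] at hlt'
  nlinarith

/-- The first order condition at a pair of points of the polar cone at maximum distance. -/
theorem inner_nonneg_of_min {K : Set E3} {c : ℝ} (hc : 0 ≤ c)
    (hK : ∀ k ∈ K, ∀ k' ∈ K, -c * (‖k‖ * ‖k'‖) ≤ ⟪k, k'⟫_ℝ) {x y k : E3} (hx : x ∈ K)
    (hnx : ‖x‖ = 1) (hny : ‖y‖ = 1) (hxy : ⟪x, y⟫_ℝ = -c)
    (hk : ∀ t : ℝ, 0 < t → y + t • k ∈ K) : 0 ≤ ⟪x + c • y, k⟫_ℝ := by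
  have key : ∀ t : ℝ, 0 < t → 0 ≤ ⟪x + c • y, k⟫_ℝ + t * (c * ‖k‖ ^ 2 / 2) := by
    intro t ht
    have h1 := hK x hx _ (hk t ht)
    rw [hnx, one_mul, inner_add_right, real_inner_smul_right, hxy] at h1
    have h2 : ‖y + t • k‖ ≤ 1 + t * ⟪y, k⟫_ℝ + t ^ 2 * ‖k‖ ^ 2 / 2 := by
      have e : ‖y + t • k‖ ^ 2 = 1 + 2 * (t * ⟪y, k⟫_ℝ) + t ^ 2 * ‖k‖ ^ 2 := by
        rw [norm_add_sq_real, hny, real_inner_smul_right, norm_smul, mul_pow, Real.norm_eq_abs,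
          sq_abs]; ring
      nlinarith [sq_nonneg (‖y + t • k‖ - 1)]
    have h3 := mul_le_mul_of_nonneg_left h2 hc
    rw [inner_add_left, real_inner_smul_left]
    have h4 : 0 ≤ t * (⟪x, k⟫_ℝ + c * ⟪y, k⟫_ℝ + t * (c * ‖k‖ ^ 2 / 2)) := by nlinarith
    exact nonneg_of_mul_nonneg_right h4 ht
  by_contra! hneg
  set A := c * ‖k‖ ^ 2 / 2
  have hA : 0 ≤ A := by positivity
  have := key (-⟪x + c • y, k⟫_ℝ / (2 * (A + 1))) (div_pos (by linarith) (by linarith))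
  have e : -⟪x + c • y, k⟫_ℝ / (2 * (A + 1)) * A ≤ -⟪x + c • y, k⟫_ℝ / 2 := by
    rw [div_mul_eq_mul_div, div_le_div_iff₀ (by linarith) (by norm_num)]
    nlinarith
  linarith

/-- The second order condition at a pair of points of the polar cone at maximum distance: the two
points cannot be moved apart. -/
theorem false_of_min_of_move {K : Set E3} {c : ℝ} (hc1 : c < 1) (hcv : Convex ℝ K)
    (hK : ∀ k ∈ K, ∀ k' ∈ K, -c * (‖k‖ * ‖k'‖) ≤ ⟪k, k'⟫_ℝ) {x y z : E3} (hx : x ∈ K)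
    (hy : y ∈ K) (hnx : ‖x‖ = 1) (hny : ‖y‖ = 1) (hxy : ⟪x, y⟫_ℝ = -c) (hxz : ⟪x, z⟫_ℝ = 0)
    (hyz : ⟪y, z⟫_ℝ = 0) (hz : z ≠ 0) {t t' : ℝ} (ht : 0 < t) (ht' : 0 < t')
    (h1 : x + t • z ∈ K) (h2 : y - t' • z ∈ K) : False := by
  have hr : ∀ (x z : E3) (t r : ℝ), 0 < r → r ≤ t → x ∈ K → x + t • z ∈ K → x + r • z ∈ K := by
    intro x z t r hr hrt hx hxt
    have ht : 0 < t := hr.trans_le hrt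
    have := hcv hx hxt (a := 1 - r / t) (b := r / t)
      (by rw [sub_nonneg, div_le_one ht]; exact hrt) (by positivity) (by ring)
    convert this using 1
    rw [smul_add, smul_smul, div_mul_cancel₀ _ ht.ne', sub_smul, one_smul]; abel
  set r := min t t'
  have hr0 : 0 < r := lt_min ht ht'
  have a1 := hr x z t r hr0 (min_le_left _ _) hx h1
  have a2 := hr y (-z) t' r hr0 (min_le_right _ _) hy (by rwa [smul_neg, ← sub_eq_add_neg])
  -- Moving the two points by `r • z` in opposite directions lowers their inner product by `r ^ 2 *
  -- ‖z‖ ^ 2`, whereas the bound allows only `c` times this amount.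
  have b := hK _ a1 _ a2
  have n1 : ‖x + r • z‖ ^ 2 = 1 + r ^ 2 * ‖z‖ ^ 2 := by
    rw [norm_add_sq_real, hnx, real_inner_smul_right, hxz, norm_smul, mul_pow, Real.norm_eq_abs,
      sq_abs]; ring
  have n2 : ‖y + r • -z‖ ^ 2 = 1 + r ^ 2 * ‖z‖ ^ 2 := by
    rw [norm_add_sq_real, hny, real_inner_smul_right, inner_neg_right, hyz, norm_smul, norm_neg,
      mul_pow, Real.norm_eq_abs, sq_abs]; ring
  have n3 : ‖x + r • z‖ = ‖y + r • -z‖ := by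
    rw [← sq_eq_sq₀ (norm_nonneg _) (norm_nonneg _), n1, n2]
  rw [n3, ← pow_two, n2] at b
  have e : ⟪x + r • z, y + r • -z⟫_ℝ = -c - r ^ 2 * ‖z‖ ^ 2 := by
    rw [inner_add_left, inner_add_right, inner_add_right, real_inner_smul_left,
      real_inner_smul_left, real_inner_smul_right, real_inner_smul_right, inner_neg_right,
      inner_neg_right, hxy, hxz, real_inner_comm, hyz, real_inner_self_eq_norm_sq]; ring
  rw [e] at b
  have hq : 0 < r ^ 2 * ‖z‖ ^ 2 := by
    have := norm_pos_iff.2 hz; positivity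
  nlinarith

omit [NeZero n] in
theorem add_mem_polar {k k' : E3} {s t : ℝ} (hs : 0 ≤ s) (ht : 0 ≤ t)
    (hk : ∀ i, 0 ≤ ⟪k, (v i : E3)⟫_ℝ) (hk' : ∀ i, 0 ≤ ⟪k', (v i : E3)⟫_ℝ) (i : ZMod n) :
    0 ≤ ⟪s • k + t • k', (v i : E3)⟫_ℝ := by
  rw [inner_add_left, real_inner_smul_left, real_inner_smul_left]
  exact add_nonneg (mul_nonneg hs (hk i)) (mul_nonneg ht (hk' i))

end Chords

end

section

open Filter Topology

section Chords

variable {n : ℕ} [NeZero n] {v : ZMod n → S2} {w : ZMod n → E3}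

/-- Near an end point of a side of the polar polygon at which the distance to `y` has a non-zero
derivative, vectors slightly outside the polar cone are not at a greater distance. -/
theorem neg_le_inner_of_close {k k' w₁ w₂ u : E3} {a b τ ε c g : ℝ} (hc : 0 ≤ c)
    (hτ : 0 ≤ τ) (hτa : τ ≤ a) (hb : 0 ≤ b) (hε : 0 ≤ ε) (hk : k = a • w₁ + b • w₂ - (τ * ε) • u)
    (hk1 : ‖a • w₁ + b • w₂‖ ≤ 1) (hw₂ : ‖w₂‖ = 1) (hu : ⟪u, k'⟫_ℝ ≤ 1)
    (h2 : -c ≤ ⟪w₂, k'⟫_ℝ) (h1 : g ≤ ⟪w₁, k'⟫_ℝ + c * ⟪w₁, w₂⟫_ℝ) (hg : ε ≤ g) :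
    -c ≤ ⟪k, k'⟫_ℝ := by
  have e : ⟪k, k'⟫_ℝ = a * ⟪w₁, k'⟫_ℝ + b * ⟪w₂, k'⟫_ℝ - τ * ε * ⟪u, k'⟫_ℝ := by
    rw [hk, inner_sub_left, inner_add_left, real_inner_smul_left, real_inner_smul_left,
      real_inner_smul_left]
  have e2 : a * ⟪w₁, w₂⟫_ℝ + b ≤ 1 := by
    have := real_inner_le_norm (a • w₁ + b • w₂) w₂
    rw [hw₂, mul_one, inner_add_left, real_inner_smul_left, real_inner_smul_left,
      real_inner_self_eq_norm_sq, hw₂] at this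
    linarith
  have ha : 0 ≤ a := hτ.trans hτa
  have e3 := mul_le_mul_of_nonneg_left e2 hc
  have e4 := mul_le_mul_of_nonneg_left h1 ha
  have e5 := mul_le_mul_of_nonneg_left h2 hb
  have e6 := mul_le_mul_of_nonneg_left hu (mul_nonneg hτ hε)
  have e7 := mul_le_mul_of_nonneg_right hτa hε
  have e8 := mul_le_mul_of_nonneg_left hg ha
  rw [e]
  nlinarith

/-- After cutting off a neighbourhood of a vertex of a reduced polygon there is a pair of points
at large distance, only the first of which is outside the polar cone. -/
theorem PolarPair.exists_far_pair (h : PolarPair n (fun i => (v i : E3)) w)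
    (hred : IsReduced (hull (range v))) {c : ℝ} (hc : c = cos (thickness (hull (range v))))
    (hc0 : 0 ≤ c) (i : ZMod n) : ∀ᶠ ε in 𝓝[>] (0 : ℝ), ∃ (a b τ : ℝ) (k' : S2), 0 < τ ∧ τ ≤ a ∧
      τ ≤ b ∧ ‖a • w (i - 1) + b • w i - (τ * ε) • (v i : E3)‖ = 1 ∧
      ‖a • w (i - 1) + b • w i‖ ≤ 1 ∧ (∀ j, 0 ≤ ⟪(k' : E3), (v j : E3)⟫_ℝ) ∧
      ⟪a • w (i - 1) + b • w i - (τ * ε) • (v i : E3), (k' : E3)⟫_ℝ < -c := by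
  filter_upwards [h.eventually_cut i, self_mem_nhdsWithin] with ε ⟨hz1, hz2, hz3⟩ hε
  have hε : 0 < ε := hε
  have hwK : ∀ l i, 0 ≤ ⟪w l, (v i : E3)⟫_ℝ := fun l i => by
    rw [real_inner_comm]; exact h.inner_nonneg l i
  obtain ⟨k, k', hk, hk', hlt⟩ := h.exists_lt_of_isReduced hred hz1 hz2 hz3
  rw [← hc] at hlt
  set z := w (i - 1) + w i - ε • (v i : E3) with hz
  have hwi : ∀ s t : ℝ, ⟪s • w (i - 1) + t • w i, (v i : E3)⟫_ℝ = 0 := by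
    intro s t
    have a1 := h.inner_right (i - 1)
    have a2 := h.inner_left i
    simp only [sub_add_cancel] at a1
    rw [inner_add_left, real_inner_smul_left, real_inner_smul_left, real_inner_comm, a1,
      real_inner_comm, a2]; ring
  have hform : ∀ y : S2, (∀ p ∈ cutoff w z, 0 ≤ ⟪(p : E3), (y : E3)⟫_ℝ) →
      (∀ j, 0 ≤ ⟪(y : E3), (v j : E3)⟫_ℝ) ∨ ∃ a b τ : ℝ, 0 < τ ∧ τ ≤ a ∧ τ ≤ b ∧
        (y : E3) = a • w (i - 1) + b • w i - (τ * ε) • (v i : E3) ∧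
        ‖a • w (i - 1) + b • w i‖ ≤ 1 := by
    intro y hy
    rcases h.polar_cutoff hz1 hz2 hy with hK | ⟨t, ht, y₀, hy₀, hy0, e⟩
    · exact Or.inl hK
    · obtain ⟨s, s', hs, hs', e'⟩ := h.mem_polar_side hy₀ hy0
      have e2 : (y : E3) = (s + t) • w (i - 1) + (s' + t) • w i - (t * ε) • (v i : E3) := by
        rw [e, e', hz, smul_sub, smul_add, add_smul, add_smul, smul_smul]; abel
      refine Or.inr ⟨s + t, s' + t, t, ht, by linarith, by linarith, e2, ?_⟩
      have hn := norm_eq_of_mem_sphere y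
      have : ‖(y : E3)‖ ^ 2 = ‖(s + t) • w (i - 1) + (s' + t) • w i‖ ^ 2 + (t * ε) ^ 2 := by
        rw [e2, norm_sub_sq_real, real_inner_smul_right, hwi, norm_smul, norm_eq_of_mem_sphere,
          mul_one, Real.norm_eq_abs, sq_abs]; ring
      rw [hn] at this
      nlinarith [norm_nonneg ((s + t) • w (i - 1) + (s' + t) • w i), sq_nonneg (t * ε)]
  have hKK : ∀ x y : E3, (∀ j, 0 ≤ ⟪x, (v j : E3)⟫_ℝ) → (∀ j, 0 ≤ ⟪y, (v j : E3)⟫_ℝ) →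
      ‖x‖ ≤ 1 → ‖y‖ ≤ 1 → -c ≤ ⟪x, y⟫_ℝ := by
    intro x y hx hy hnx hny
    have := h.thickness_bound hx hy
    rw [← hc] at this
    have h2 := mul_le_one₀ hnx (norm_nonneg y) hny
    nlinarith
  rcases hform k hk with h1 | ⟨a, b, τ, hτ, hτa, hτb, e, hn⟩
  · rcases hform k' hk' with h2 | ⟨a, b, τ, hτ, hτa, hτb, e, hn⟩
    · exact absurd hlt (not_lt.2 (hKK _ _ h1 h2 (norm_eq_of_mem_sphere k).le
        (norm_eq_of_mem_sphere k').le))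
    · refine ⟨a, b, τ, k, hτ, hτa, hτb, ?_, hn, h1, ?_⟩
      · rw [← e]; exact norm_eq_of_mem_sphere k'
      · rw [← e, real_inner_comm]; exact hlt
  · rcases hform k' hk' with h2 | ⟨a', b', τ', hτ', hτa', hτb', e', hn'⟩
    · refine ⟨a, b, τ, k', hτ, hτa, hτb, ?_, hn, h2, ?_⟩
      · rw [← e]; exact norm_eq_of_mem_sphere k
      · rw [← e]; exact hlt
    -- If both points are outside, both are displaced in the direction `-v i`, orthogonally to the
    -- plane of the side; the displacements add the positive term `τ * ε * (τ' * ε)` to the inner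
    -- product and so bring the points closer.
    · exfalso
      have e3 := hKK _ _ (add_mem_polar (hτ.le.trans hτa) (hτ.le.trans hτb) (hwK _) (hwK _))
        (add_mem_polar (hτ'.le.trans hτa') (hτ'.le.trans hτb') (hwK _) (hwK _)) hn hn'
      have hwi' : ∀ s t : ℝ, ⟪(v i : E3), s • w (i - 1) + t • w i⟫_ℝ = 0 := fun s t => by
        rw [real_inner_comm, hwi]
      rw [e, e', inner_sub_left, inner_sub_right, inner_sub_right, real_inner_smul_left (v i : E3),
        real_inner_smul_left (v i : E3), real_inner_smul_right _ (v i : E3),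
        real_inner_smul_right _ (v i : E3), hwi, hwi', inner_self_S2] at hlt
      have : 0 ≤ τ * ε * (τ' * ε) := by positivity
      linarith

/-- Every side of the polar polygon of a reduced polygon contains a point of a diametral chord
perpendicular to that side. -/
theorem PolarPair.exists_perp_chord (h : PolarPair n (fun i => (v i : E3)) w)
    (hred : IsReduced (hull (range v))) {c s : ℝ} (hc : c = cos (thickness (hull (range v))))
    (hs : s = sin (thickness (hull (range v)))) (hc0 : 0 ≤ c) (i : ZMod n) :
    ∃ x y : E3, (∃ a b : ℝ, 0 ≤ a ∧ 0 ≤ b ∧ x = a • w (i - 1) + b • w i) ∧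
      (∀ j, 0 ≤ ⟪y, (v j : E3)⟫_ℝ) ∧ ‖x‖ = 1 ∧ ‖y‖ = 1 ∧ ⟪x, y⟫_ℝ = -c ∧
      s • (v i : E3) = y + c • x ∧ ∀ k : E3, (∀ j, 0 ≤ ⟪k, (v j : E3)⟫_ℝ) → 0 ≤ ⟪x + c • y, k⟫_ℝ := by
  have hwK : ∀ l i, 0 ≤ ⟪w l, (v i : E3)⟫_ℝ := fun l i => by
    rw [real_inner_comm]; exact h.inner_nonneg l i
  have hnorm : ∀ l, ‖w l‖ = 1 := h.norm_w
  have hs0 : 0 ≤ s := hs ▸ Real.sin_nonneg_of_nonneg_of_le_pi (thickness_nonneg _) h.thickness_le_pi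
  have hsc : s ^ 2 + c ^ 2 = 1 := by rw [hs, hc]; exact Real.sin_sq_add_cos_sq _
  have hK : ∀ x y : E3, (∀ j, 0 ≤ ⟪x, (v j : E3)⟫_ℝ) → (∀ j, 0 ≤ ⟪y, (v j : E3)⟫_ℝ) →
      -c * (‖x‖ * ‖y‖) ≤ ⟪x, y⟫_ℝ := by
    intro x y hx hy
    rw [hc]; exact h.thickness_bound hx hy
  have hseq : Tendsto (fun m : ℕ => 1 / ((m : ℝ) + 1)) atTop (𝓝[>] 0) :=
    tendsto_nhdsWithin_iff.2 ⟨tendsto_one_div_add_atTop_nhds_zero_nat,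
      Eventually.of_forall fun m => by simp only [mem_Ioi]; positivity⟩
  obtain ⟨N, hN⟩ := eventually_atTop.1 (hseq.eventually (h.exists_far_pair hred hc hc0 i))
  choose a b τ k' hτ hτa hτb hn1 hn2 hk' hlt using fun m : ℕ => hN (m + N) (Nat.le_add_left N m)
  let ε : ℕ → ℝ := fun m => 1 / (((m + N : ℕ) : ℝ) + 1)
  have hε : Tendsto ε atTop (𝓝 0) :=
    (hseq.comp (tendsto_add_atTop_nat N)).mono_right nhdsWithin_le_nhds
  have hε0 : ∀ m, 0 < ε m := fun m => by positivity
  -- bounds for the coefficients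
  have hκ1 : 0 < ⟪w (i - 1), (v (i + 1) : E3)⟫_ℝ := by
    rw [real_inner_comm]
    refine h.inner_pos _ _ ?_ ?_
    · intro e; exact (h.ne_aux i).2.1 (by linear_combination e)
    · rw [sub_add_cancel]; exact (h.ne_aux i).1
  have hκ2 : 0 < ⟪w i, (v (i - 1) : E3)⟫_ℝ := by
    rw [real_inner_comm]
    refine h.inner_pos _ _ ?_ ?_
    · intro e; exact (h.ne_aux i).1 (by linear_combination -e)
    · intro e; exact (h.ne_aux i).2.1 (by linear_combination -e)
  have hle1 : ∀ (x : E3) (p : S2), ‖x‖ ≤ 1 → ⟪x, (p : E3)⟫_ℝ ≤ 1 := by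
    intro x p hx
    have := real_inner_le_norm x (p : E3)
    rw [norm_eq_of_mem_sphere, mul_one] at this
    exact this.trans hx
  have hab : ∀ m, a m ∈ Icc 0 (1 / ⟪w (i - 1), (v (i + 1) : E3)⟫_ℝ) ∧
      b m ∈ Icc 0 (1 / ⟪w i, (v (i - 1) : E3)⟫_ℝ) := by
    intro m
    have a0 : 0 ≤ a m := (hτ m).le.trans (hτa m)
    have b0 : 0 ≤ b m := (hτ m).le.trans (hτb m)
    refine ⟨⟨a0, ?_⟩, b0, ?_⟩
    · rw [le_div_iff₀ hκ1]
      have := hle1 _ (v (i + 1)) (hn2 m)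
      rw [inner_add_left, real_inner_smul_left, real_inner_smul_left] at this
      have := mul_nonneg b0 (hwK i (i + 1))
      linarith
    · rw [le_div_iff₀ hκ2]
      have := hle1 _ (v (i - 1)) (hn2 m)
      rw [inner_add_left, real_inner_smul_left, real_inner_smul_left] at this
      have := mul_nonneg a0 (hwK (i - 1) (i - 1))
      linarith
  -- The coefficients are bounded, so the far pairs subconverge as the cut shrinks. The displacement
  -- `τ * ε` disappears in the limit because `τ ≤ a`.
  obtain ⟨⟨A, B, Y⟩, hmem, φ, hφ, hlim⟩ := (isCompact_Icc.prod (isCompact_Icc.prod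
    (isCompact_univ (X := S2)))).tendsto_subseq (x := fun m => (a m, b m, k' m))
    (fun m => ⟨(hab m).1, (hab m).2, mem_univ _⟩)
  obtain ⟨hA, hB, -⟩ := hmem
  have hA0 : 0 ≤ A := hA.1
  have hB0 : 0 ≤ B := hB.1
  have limA : Tendsto (fun m => a (φ m)) atTop (𝓝 A) := (continuous_fst.tendsto _).comp hlim
  have limB : Tendsto (fun m => b (φ m)) atTop (𝓝 B) :=
    ((continuous_fst.comp continuous_snd).tendsto _).comp hlim
  have limY : Tendsto (fun m => (k' (φ m) : E3)) atTop (𝓝 (Y : E3)) :=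
    ((continuous_subtype_val.comp (continuous_snd.comp continuous_snd)).tendsto _).comp hlim
  have limε : Tendsto (fun m => ε (φ m)) atTop (𝓝 0) := hε.comp hφ.tendsto_atTop
  have limτ : Tendsto (fun m => τ (φ m) * ε (φ m)) atTop (𝓝 0) := by
    refine squeeze_zero (fun m => mul_nonneg (hτ _).le (hε0 _).le)
      (fun m => mul_le_mul_of_nonneg_right (hτa _) (hε0 _).le) ?_
    simpa using limA.mul limε
  set x : E3 := A • w (i - 1) + B • w i with hx
  have limX : Tendsto (fun m => a (φ m) • w (i - 1) + b (φ m) • w i -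
      (τ (φ m) * ε (φ m)) • (v i : E3)) atTop (𝓝 x) := by
    have := ((limA.smul_const (w (i - 1))).add (limB.smul_const (w i))).sub
      (limτ.smul_const (v i : E3))
    simpa using this
  have hnx : ‖x‖ = 1 := tendsto_nhds_unique limX.norm (by
    simp only [ε, hn1]; exact tendsto_const_nhds)
  have hYK : ∀ j, 0 ≤ ⟪(Y : E3), (v j : E3)⟫_ℝ := fun j =>
    ge_of_tendsto' (limY.inner tendsto_const_nhds) fun m => hk' _ j
  have hxK : ∀ j, 0 ≤ ⟪x, (v j : E3)⟫_ℝ := add_mem_polar hA0 hB0 (hwK _) (hwK _)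
  have hnY : ‖(Y : E3)‖ = 1 := norm_eq_of_mem_sphere Y
  have hxY : ⟪x, (Y : E3)⟫_ℝ = -c := by
    apply le_antisymm
    · exact le_of_tendsto' (limX.inner limY) fun m => (hlt _).le
    · have := hK _ _ hxK hYK
      rwa [hnx, hnY, one_mul, mul_one] at this
  have hfo : ∀ x y : E3, (∀ j, 0 ≤ ⟪x, (v j : E3)⟫_ℝ) → (∀ j, 0 ≤ ⟪y, (v j : E3)⟫_ℝ) → ‖x‖ = 1 →
      ‖y‖ = 1 → ⟪x, y⟫_ℝ = -c → ∀ k : E3, (∀ j, 0 ≤ ⟪k, (v j : E3)⟫_ℝ) → 0 ≤ ⟪x + c • y, k⟫_ℝ := by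
    intro x y hx hy hnx hny hxy k hk
    refine inner_nonneg_of_min (K := {k : E3 | ∀ j, 0 ≤ ⟪k, (v j : E3)⟫_ℝ}) hc0
      (fun k hk k' hk' => hK k k' hk hk') hx hnx hny hxy fun t ht => ?_
    have := add_mem_polar zero_le_one ht.le hy hk
    simpa using this
  have hq := hfo Y x hYK hxK hnY hnx (by rw [real_inner_comm]; exact hxY)
  -- By the first order condition `q` is non-negative on the polar cone, and it is orthogonal to
  -- `x`. Once it is orthogonal to both ends of the side it must be a multiple of `v i`.
  set q : E3 := (Y : E3) + c • x with hqd
  have hqx : ⟪q, x⟫_ℝ = 0 := by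
    rw [hqd, inner_add_left, real_inner_smul_left, real_inner_comm, hxY,
      real_inner_self_eq_norm_sq, hnx]; ring
  have hβ1 := hq _ (hwK (i - 1))
  have hβ2 := hq _ (hwK i)
  have hsum : A * ⟪q, w (i - 1)⟫_ℝ + B * ⟪q, w i⟫_ℝ = 0 := by
    rw [hx, inner_add_right, real_inner_smul_right, real_inner_smul_right] at hqx
    exact hqx
  have hz1 : A * ⟪q, w (i - 1)⟫_ℝ = 0 := by
    have := mul_nonneg hA0 hβ1
    have := mul_nonneg hB0 hβ2
    linarith
  have hz2 : B * ⟪q, w i⟫_ℝ = 0 := by linarith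
  have hwY : ∀ l m, -c ≤ ⟪w l, (k' m : E3)⟫_ℝ := by
    intro l m
    have := hK _ _ (hwK l) (hk' m)
    rwa [hnorm, norm_eq_of_mem_sphere, one_mul, mul_one] at this
  -- For `A ≠ 0` this is `hz1`. For `A = 0` the limit point is the end `w i` of the side; a positive
  -- derivative towards `w (i - 1)` would then keep the nearby pairs from being far, by
  -- `neg_le_inner_of_close`.
  have hq1 : ⟪q, w (i - 1)⟫_ℝ = 0 := by
    by_contra hne
    have hpos := lt_of_le_of_ne hβ1 (Ne.symm hne)
    have hA1 : A = 0 := (mul_eq_zero.1 hz1).resolve_right hne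
    have hxw : x = w i := by
      rw [hx, hA1, zero_smul, zero_add, norm_smul, hnorm, norm_of_nonneg hB0, mul_one] at hnx
      rw [hx, hA1, hnx]; simp
    have hl : Tendsto (fun m => ⟪w (i - 1), (k' (φ m) : E3)⟫_ℝ + c * ⟪w (i - 1), w i⟫_ℝ) atTop
        (𝓝 ⟪q, w (i - 1)⟫_ℝ) := by
      have := (tendsto_const_nhds (x := w (i - 1))).inner (𝕜 := ℝ) limY |>.add_const
        (c * ⟪w (i - 1), w i⟫_ℝ)
      convert this using 2
      rw [hqd, inner_add_left, real_inner_smul_left, hxw, real_inner_comm, real_inner_comm (w i)]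
    obtain ⟨m, hm1, hm2⟩ := ((hl.eventually (lt_mem_nhds (half_lt_self hpos))).and
      (limε.eventually (gt_mem_nhds (half_pos hpos)))).exists
    exact (hlt (φ m)).not_ge (neg_le_inner_of_close hc0 (hτ _).le (hτa _)
      ((hτ _).le.trans (hτb _)) (hε0 (φ m)).le rfl (hn2 _) (hnorm _)
      (by rw [real_inner_comm]; exact hle1 _ _ (norm_eq_of_mem_sphere _).le)
      (hwY _ _) hm1.le hm2.le)
  have hq2 : ⟪q, w i⟫_ℝ = 0 := by
    by_contra hne
    have hpos := lt_of_le_of_ne hβ2 (Ne.symm hne)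
    have hB1 : B = 0 := (mul_eq_zero.1 hz2).resolve_right hne
    have hxw : x = w (i - 1) := by
      rw [hx, hB1, zero_smul, add_zero, norm_smul, hnorm, norm_of_nonneg hA0, mul_one] at hnx
      rw [hx, hB1, hnx]; simp
    have hl : Tendsto (fun m => ⟪w i, (k' (φ m) : E3)⟫_ℝ + c * ⟪w i, w (i - 1)⟫_ℝ) atTop
        (𝓝 ⟪q, w i⟫_ℝ) := by
      have := (tendsto_const_nhds (x := w i)).inner (𝕜 := ℝ) limY |>.add_const
        (c * ⟪w i, w (i - 1)⟫_ℝ)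
      convert this using 2
      rw [hqd, inner_add_left, real_inner_smul_left, hxw, real_inner_comm,
        real_inner_comm (w (i - 1))]
    obtain ⟨m, hm1, hm2⟩ := ((hl.eventually (lt_mem_nhds (half_lt_self hpos))).and
      (limε.eventually (gt_mem_nhds (half_pos hpos)))).exists
    exact (hlt (φ m)).not_ge (neg_le_inner_of_close hc0 (hτ _).le (hτb _)
      ((hτ _).le.trans (hτa _)) (hε0 (φ m)).le (by rw [add_comm (b (φ m) • w i)])
      (by rw [add_comm]; exact hn2 _) (hnorm _)
      (by rw [real_inner_comm]; exact hle1 _ _ (norm_eq_of_mem_sphere _).le)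
      (hwY _ _) hm1.le hm2.le)
  have hqv : q = s • (v i : E3) := by
    obtain ⟨a', b', ha', -, e⟩ := h.mem_side (p := q) (fun l => hq _ (hwK l)) hq2
    have hb' : b' = 0 := by
      have a1 := h.inner_right (i - 1)
      simp only [sub_add_cancel] at a1
      rw [e, inner_add_left, real_inner_smul_left, real_inner_smul_left, a1, mul_zero, zero_add,
        real_inner_comm] at hq1
      exact (mul_eq_zero.1 hq1).resolve_right hκ1.ne'
    rw [hb', zero_smul, add_zero] at e
    have hqq : ‖q‖ ^ 2 = s ^ 2 := by
      rw [← real_inner_self_eq_norm_sq, hqd, inner_add_left, inner_add_right, inner_add_right,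
        real_inner_smul_left, real_inner_smul_left, real_inner_smul_right, real_inner_smul_right,
        inner_self_S2, real_inner_self_eq_norm_sq, hnx, hxY, real_inner_comm, hxY]
      linear_combination -hsc
    rw [e, norm_smul, norm_eq_of_mem_sphere, mul_one, norm_of_nonneg ha',
      sq_eq_sq₀ ha' hs0] at hqq
    rw [e, hqq]
  exact ⟨x, Y, ⟨A, B, hA0, hB0, rfl⟩, hYK, hnx, hnY, hxY, hqv.symm,
    hfo x Y hxK hYK hnx hnY hxY⟩

end Chords

end

/-! ### Chord systems of reduced polygons -/

section

open Filter Topology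

section Structure

variable {n : ℕ} [NeZero n]

/-- The diametral chords of a reduced polygon: `x i` is the point, on the side of the polar polygon
dual to `v i`, of a pair of points of the polar polygon at maximum distance, whose second point is
the vertex `w (σ i)`. -/
structure ChordSystem (n : ℕ) (v w x : ZMod n → E3) (σ : ZMod n → ZMod n) (c s : ℝ) : Prop where
  pair : PolarPair n v w
  c_nonneg : 0 ≤ c
  c_lt : c < 1
  s_pos : 0 < s
  sq : s ^ 2 + c ^ 2 = 1
  bound : ∀ k, (∀ i, 0 ≤ ⟪k, v i⟫_ℝ) → ∀ k', (∀ i, 0 ≤ ⟪k', v i⟫_ℝ) →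
    -c * (‖k‖ * ‖k'‖) ≤ ⟪k, k'⟫_ℝ
  edge : ∀ i, ∃ a b : ℝ, 0 ≤ a ∧ 0 ≤ b ∧ (c = 0 → 0 < a ∧ 0 < b) ∧ x i = a • w (i - 1) + b • w i
  norm_x : ∀ i, ‖x i‖ = 1
  inner_eq : ∀ i, ⟪x i, w (σ i)⟫_ℝ = -c
  eq_v : ∀ i, s • v i = w (σ i) + c • x i
  foot : ∀ i, ∃ a b : ℝ, 0 ≤ a ∧ 0 ≤ b ∧ x i + c • w (σ i) = a • v (σ i) + b • v (σ i + 1)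

theorem exists_small (a b p q : ℝ) (ha : 0 < a) (hb : 0 < b) :
    ∃ t : ℝ, 0 < t ∧ 0 ≤ a + t * p ∧ 0 ≤ b + t * q := by
  have key : ∀ t : ℝ, 0 < t → ∀ a p : ℝ, t ≤ a / (|p| + 1) → 0 ≤ a + t * p := by
    intro t ht a p h
    rw [le_div_iff₀ (by positivity)] at h
    nlinarith [neg_abs_le p]
  refine ⟨min (a / (|p| + 1)) (b / (|q| + 1)), lt_min (by positivity) (by positivity),
    key _ (lt_min (by positivity) (by positivity)) _ _ (min_le_left _ _),
    key _ (lt_min (by positivity) (by positivity)) _ _ (min_le_right _ _)⟩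

theorem norm_cross_sq (a b : E3) : ‖cross a b‖ ^ 2 = ‖a‖ ^ 2 * ‖b‖ ^ 2 - ⟪a, b⟫_ℝ ^ 2 := by
  rw [← real_inner_self_eq_norm_sq, ← real_inner_self_eq_norm_sq, ← real_inner_self_eq_norm_sq,
    inner_cross_cross, real_inner_comm b a]; ring

theorem inner_cross_self_left (a b : E3) : ⟪a, cross a b⟫_ℝ = 0 := by
  rw [inner_cross, det3_self_left]

theorem inner_cross_self_right (a b : E3) : ⟪b, cross a b⟫_ℝ = 0 := by
  rw [inner_cross, det3_self_outer]

/-- The second point of a perpendicular diametral chord is a vertex of the polar polygon. -/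
theorem PolarPair.exists_eq_vertex {v w : ZMod n → E3} (h : PolarPair n v w) {c s : ℝ}
    (hc1 : c < 1) (hsc : s ^ 2 + c ^ 2 = 1) (hs : 0 < s)
    (hK : ∀ k, (∀ i, 0 ≤ ⟪k, v i⟫_ℝ) → ∀ k', (∀ i, 0 ≤ ⟪k', v i⟫_ℝ) →
      -c * (‖k‖ * ‖k'‖) ≤ ⟪k, k'⟫_ℝ) {i : ZMod n} {x y : E3} {a b : ℝ} (ha : 0 ≤ a) (hb : 0 ≤ b)
    (hx : x = a • w (i - 1) + b • w i) (hy : ∀ j, 0 ≤ ⟪y, v j⟫_ℝ) (hnx : ‖x‖ = 1) (hny : ‖y‖ = 1)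
    (hxy : ⟪x, y⟫_ℝ = -c) (hv : s • v i = y + c • x)
    (hp : ∀ k : E3, (∀ j, 0 ≤ ⟪k, v j⟫_ℝ) → 0 ≤ ⟪x + c • y, k⟫_ℝ) : ∃ j, y = w j := by
  have hwK : ∀ l i, 0 ≤ ⟪w l, v i⟫_ℝ := fun l i => by
    rw [real_inner_comm]; exact h.inner_nonneg l i
  have hcomb : ∀ (a b : ℝ) (l m : ZMod n), 0 ≤ a → 0 ≤ b → ∀ j, 0 ≤ ⟪a • w l + b • w m, v j⟫_ℝ := by
    intro a b l m ha hb j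
    rw [inner_add_left, real_inner_smul_left, real_inner_smul_left]
    exact add_nonneg (mul_nonneg ha (hwK _ _)) (mul_nonneg hb (hwK _ _))
  -- The first order condition puts `x + c • y` into the cone over the polygon. It is orthogonal to
  -- `y`, so `y` is orthogonal to some vertex `v l`, i.e. lies on the side of the polar polygon dual
  -- to it.
  obtain ⟨μ, hμ, e⟩ := h.mem_cone (p := x + c • y) fun l => hp _ (hwK l)
  have hpy : ⟪x + c • y, y⟫_ℝ = 0 := by
    rw [inner_add_left, real_inner_smul_left, hxy, real_inner_self_eq_norm_sq, hny]; ring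
  have hpx : ⟪x + c • y, x⟫_ℝ = s ^ 2 := by
    rw [inner_add_left, real_inner_smul_left, real_inner_comm x y, hxy, real_inner_self_eq_norm_sq,
      hnx]
    linear_combination -hsc
  have hp0 : x + c • y ≠ 0 := by
    intro h0; rw [h0, inner_zero_left] at hpx
    exact (by positivity : s ^ 2 ≠ 0) hpx.symm
  have hzero : ∀ j, μ j * ⟪y, v j⟫_ℝ = 0 := by
    rw [e, sum_inner] at hpy
    intro j
    have := (Finset.sum_eq_zero_iff_of_nonneg (fun j _ => by
      rw [real_inner_smul_left, real_inner_comm]; exact mul_nonneg (hμ j) (hy j))).1 hpy j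
      (Finset.mem_univ _)
    rwa [real_inner_smul_left, real_inner_comm] at this
  obtain ⟨l, hl⟩ : ∃ l, μ l ≠ 0 := by
    by_contra! h0
    exact hp0 (by rw [e]; simp [h0])
  have hyl : ⟪y, v l⟫_ℝ = 0 := (mul_eq_zero.1 (hzero l)).resolve_left hl
  obtain ⟨α, β, hα, hβ, ey⟩ := h.mem_polar_side hy hyl
  have hunit : ∀ (t : ℝ) (m : ZMod n), 0 ≤ t → y = t • w m → y = w m := by
    intro t m ht e
    have : t = 1 := by
      rw [e, norm_smul, h.norm_w, mul_one, norm_of_nonneg ht] at hny; exact hny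
    rw [e, this, one_smul]
  rcases hα.eq_or_lt with hα0 | hα
  · exact ⟨l, hunit β l hβ (by rw [ey, ← hα0]; simp)⟩
  rcases hβ.eq_or_lt with hβ0 | hβ
  · exact ⟨l - 1, hunit α _ hα.le (by rw [ey, ← hβ0]; simp)⟩
  exfalso
  have hpos : ∀ j, j ≠ l → 0 < ⟪y, v j⟫_ℝ := by
    intro j hj
    refine lt_of_le_of_ne (hy j) fun h0 => ?_
    rw [ey, inner_add_left, real_inner_smul_left, real_inner_smul_left, real_inner_comm,
      real_inner_comm (v j)] at h0
    have a1 := mul_nonneg hα.le (h.inner_nonneg (l - 1) j)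
    have a2 := mul_nonneg hβ.le (h.inner_nonneg l j)
    have b1 := (h.inner_eq_zero_iff (l - 1) j).1
      ((mul_eq_zero.1 (by linarith : α * _ = 0)).resolve_left hα.ne')
    have b2 := (h.inner_eq_zero_iff l j).1
      ((mul_eq_zero.1 (by linarith : β * _ = 0)).resolve_left hβ.ne')
    rcases b2 with b2 | b2
    · exact hj b2
    · rcases b1 with b1 | b1
      · exact (h.ne_aux l).2.1 (by linear_combination b1 - b2)
      · exact hj (by simpa using b1)
  have ep : x + c • y = μ l • v l := by
    rw [e]
    refine Finset.sum_eq_single l (fun j _ hj => ?_) (by simp)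
    rw [(mul_eq_zero.1 (hzero j)).resolve_right (hpos j hj).ne', zero_smul]
  -- Now `y` is interior to its side and the chord is perpendicular to the sides at both ends. Hence
  -- `z` is a direction of both sides, along which the ends can be moved apart.
  set z := cross x y with hz
  have hxz : ⟪x, z⟫_ℝ = 0 := inner_cross_self_left x y
  have hyz : ⟪y, z⟫_ℝ = 0 := inner_cross_self_right x y
  have hz0 : z ≠ 0 := by
    rw [← norm_pos_iff]
    have : ‖z‖ ^ 2 = s ^ 2 := by
      rw [norm_cross_sq, hnx, hny, hxy]; linear_combination -hsc
    rw [sq_eq_sq₀ (norm_nonneg _) hs.le] at this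
    rw [this]; exact hs
  have hzi : ⟪z, v i⟫_ℝ = 0 := by
    have : ⟪s • v i, z⟫_ℝ = 0 := by
      rw [hv, inner_add_left, real_inner_smul_left, hxz, hyz]; ring
    rw [real_inner_smul_left] at this
    rw [real_inner_comm]
    exact (mul_eq_zero.1 this).resolve_left hs.ne'
  have hzl : ⟪z, v l⟫_ℝ = 0 := by
    have : ⟪μ l • v l, z⟫_ℝ = 0 := by
      rw [← ep, inner_add_left, real_inner_smul_left, hxz, hyz]; ring
    rw [real_inner_smul_left] at this
    rw [real_inner_comm]
    exact (mul_eq_zero.1 this).resolve_left hl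
  have hcoord : ∀ m, ⟪z, v m⟫_ℝ = 0 → ∃ p q : ℝ, z = p • w (m - 1) + q • w m := by
    intro m hm
    obtain ⟨r₁, r₂, -, -, e⟩ := h.dual.exists_side_coords (m - 1)
    have := e z (by simpa using hm)
    rw [sub_add_cancel] at this
    exact ⟨_, _, this⟩
  obtain ⟨p, q, ez⟩ := hcoord i hzi
  obtain ⟨p', q', ez'⟩ := hcoord l hzl
  have hKc : Convex ℝ {k : E3 | ∀ i, 0 ≤ ⟪k, v i⟫_ℝ} := by
    intro a ha b hb s t hs ht _ i
    rw [inner_add_left, real_inner_smul_left, real_inner_smul_left]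
    exact add_nonneg (mul_nonneg hs (ha i)) (mul_nonneg ht (hb i))
  -- moving in the direction `σ • z`
  have hmove : ∀ σ t : ℝ, σ ≠ 0 → 0 < t → 0 ≤ a + t * (σ * p) → 0 ≤ b + t * (σ * q) → False := by
    intro σ t hσ ht h1 h2
    obtain ⟨t', ht', h3, h4⟩ := exists_small α β (-(σ * p')) (-(σ * q')) hα hβ
    refine false_of_min_of_move hc1 hKc (fun k hk k' hk' => hK k hk k' hk')
      (x := x) (y := y) (z := σ • z) (t := t) (t' := t') (by rw [hx]; exact hcomb _ _ _ _ ha hb) hy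
      hnx hny hxy (by rw [real_inner_smul_right, hxz, mul_zero])
      (by rw [real_inner_smul_right, hyz, mul_zero]) (smul_ne_zero hσ hz0) ht ht' ?_ ?_
    · have : x + t • σ • z = (a + t * (σ * p)) • w (i - 1) + (b + t * (σ * q)) • w i := by
        rw [hx, ez]; module
      rw [this]; exact hcomb _ _ _ _ h1 h2
    · have : y - t' • σ • z = (α + t' * -(σ * p')) • w (l - 1) + (β + t' * -(σ * q')) • w l := by
        rw [ez']; nth_rw 1 [ey]; module
      rw [this]; exact hcomb _ _ _ _ h3 h4
  -- If `x` is an end point of its side it can move along the side in one sense only; `σ` is the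
  -- sign that selects it.
  have hsgn : ∀ r : ℝ, ∃ σ : ℝ, σ ≠ 0 ∧ 0 ≤ σ * r := fun r => by
    rcases le_total 0 r with h | h
    · exact ⟨1, one_ne_zero, by linarith⟩
    · exact ⟨-1, by norm_num, by linarith⟩
  rcases ha.eq_or_lt with ha0 | ha
  · have hb : 0 < b := by
      refine lt_of_le_of_ne hb fun hb0 => ?_
      rw [hx, ← ha0, ← hb0] at hnx; simp at hnx
    obtain ⟨σ, hσ, hσp⟩ := hsgn p
    obtain ⟨t, ht, h1, -⟩ := exists_small b 1 (σ * q) 0 hb one_pos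
    exact hmove σ t hσ ht (by have := mul_nonneg ht.le hσp; linarith) h1
  · obtain ⟨σ, hσ, hσq⟩ := hsgn q
    obtain ⟨t, ht, h1, -⟩ := exists_small a 1 (σ * p) 0 ha one_pos
    exact hmove σ t hσ ht h1 (by have := mul_nonneg ht.le hσq; linarith)

/-- The thickness of a reduced polygon is positive. -/
theorem PolarPair.thickness_pos {v : ZMod n → S2} {w : ZMod n → E3}
    (h : PolarPair n (fun i => (v i : E3)) w) (hred : IsReduced (hull (range v))) :
    0 < thickness (hull (range v)) := by
  obtain ⟨ε, hz1, hz2, hz3⟩ := (h.eventually_cut 0).exists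
  exact (thickness_nonneg _).trans_lt
    (hred.2 _ (h.isConvexBody_cutoff hz3) (h.cutoff_ssubset hz1))

theorem PolarPair.exists_chordSystem {v : ZMod n → S2} {w : ZMod n → E3}
    (h : PolarPair n (fun i => (v i : E3)) w) (hred : IsReduced (hull (range v))) :
    ∃ x σ, ChordSystem n (fun i => (v i : E3)) w x σ (cos (thickness (hull (range v))))
      (sin (thickness (hull (range v)))) := by
  set Δ := thickness (hull (range v)) with hΔ
  have h0 : 0 < Δ := h.thickness_pos hred
  have h1 : Δ ≤ π / 2 := h.thickness_le_pi_div_two hred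
  have hs : 0 < sin Δ := Real.sin_pos_of_pos_of_lt_pi h0 (by linarith [pi_pos])
  have hc0 : 0 ≤ cos Δ := Real.cos_nonneg_of_neg_pi_div_two_le_of_le (by linarith) h1
  have hsc : sin Δ ^ 2 + cos Δ ^ 2 = 1 := Real.sin_sq_add_cos_sq _
  have hc1 : cos Δ < 1 := by nlinarith
  have hK : ∀ k, (∀ i, 0 ≤ ⟪k, (v i : E3)⟫_ℝ) → ∀ k', (∀ i, 0 ≤ ⟪k', (v i : E3)⟫_ℝ) →
      -cos Δ * (‖k‖ * ‖k'‖) ≤ ⟪k, k'⟫_ℝ := fun k hk k' hk' => h.thickness_bound hk hk'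
  have hwK : ∀ l i, 0 ≤ ⟪w l, (v i : E3)⟫_ℝ := fun l i => by
    rw [real_inner_comm]; exact h.inner_nonneg l i
  have key : ∀ i, ∃ (x : E3) (j : ZMod n), (∃ a b : ℝ, 0 ≤ a ∧ 0 ≤ b ∧ (cos Δ = 0 → 0 < a ∧ 0 < b) ∧
      x = a • w (i - 1) + b • w i) ∧ ‖x‖ = 1 ∧ ⟪x, w j⟫_ℝ = -cos Δ ∧
      sin Δ • (v i : E3) = w j + cos Δ • x ∧
      ∃ a b : ℝ, 0 ≤ a ∧ 0 ≤ b ∧ x + cos Δ • w j = a • (v j : E3) + b • (v (j + 1) : E3) := by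
    intro i
    obtain ⟨x, y, ⟨a, b, ha, hb, hx⟩, hy, hnx, hny, hxy, hv, hp⟩ :=
      h.exists_perp_chord hred rfl rfl hc0 i
    rw [← hΔ] at hxy hv hp
    obtain ⟨j, rfl⟩ := h.exists_eq_vertex hc1 hsc hs hK ha hb hx hy hnx hny hxy hv hp
    -- For thickness `π / 2` the vertex `v i` is `w j` itself, and every point of the dual side is
    -- at the same distance from it. The midpoint is chosen for `x`, so that `x` is never a vertex
    -- of the polar polygon.
    by_cases hc : cos Δ = 0
    · have hs1 : sin Δ = 1 := by
        have : sin Δ ^ 2 = 1 := by rw [hc] at hsc; linarith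
        nlinarith
      rw [hc, hs1, zero_smul, add_zero, one_smul] at hv
      have hne : w (i - 1) + w i ≠ 0 := by
        intro h0
        have := h.inner_pos (i - 1) (i + 1) (fun e => (h.ne_aux i).2.1 (by linear_combination e))
          (by rw [sub_add_cancel]; exact (h.ne_aux i).1)
        have h2 := h.inner_nonneg i (i + 1)
        have h3 : ⟪(v (i + 1) : E3), w (i - 1) + w i⟫_ℝ = 0 := by rw [h0, inner_zero_right]
        rw [inner_add_right] at h3
        linarith
      have hpos : 0 < ‖w (i - 1) + w i‖⁻¹ := inv_pos.2 (norm_pos_iff.2 hne)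
      set r := ‖w (i - 1) + w i‖⁻¹ with hr
      have hxK : ∀ j, 0 ≤ ⟪r • w (i - 1) + r • w i, (v j : E3)⟫_ℝ :=
        add_mem_polar hpos.le hpos.le (hwK _) (hwK _)
      have hxw : ⟪r • w (i - 1) + r • w i, w j⟫_ℝ = 0 := by
        have a1 := h.inner_right (i - 1)
        have a2 := h.inner_left i
        simp only [sub_add_cancel] at a1
        rw [← hv, inner_add_left, real_inner_smul_left, real_inner_smul_left, real_inner_comm, a1,
          real_inner_comm, a2]; ring
      refine ⟨r • w (i - 1) + r • w i, j, ⟨r, r, hpos.le, hpos.le, fun _ => ⟨hpos, hpos⟩, rfl⟩,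
        ?_, ?_, ?_, ?_⟩
      · rw [← smul_add, norm_smul, hr, norm_inv, norm_norm, inv_mul_cancel₀ (norm_ne_zero_iff.2 hne)]
      · rw [hxw, hc, neg_zero]
      · rw [hc, hs1, zero_smul, add_zero, one_smul, hv]
      · rw [hc, zero_smul, add_zero]
        refine h.mem_side (fun l => ?_) hxw
        have := hK _ hxK _ (hwK l)
        rwa [hc, neg_zero, zero_mul] at this
    · refine ⟨x, j, ⟨a, b, ha, hb, fun h => absurd h hc, hx⟩, hnx, hxy, hv,
        h.mem_side (fun l => hp _ (hwK l)) ?_⟩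
      rw [inner_add_left, real_inner_smul_left, hxy, h.inner_self_w]; ring
  choose x σ h1 h2 h3 h4 h5 using key
  exact ⟨x, σ, h, hc0, hc1, hs, hsc, hK, h1, h2, h3, h4, h5⟩

end Structure

end

/-! ### Diametral chords that do not cross -/

section

section Combinatorics

variable {n : ℕ} [NeZero n]

theorem CyclicPos.det3_nonneg {v : ZMod n → E3} (h : CyclicPos n v) (i : ZMod n) {p q r : ℕ}
    (hpq : p ≤ q) (hqr : q ≤ r) (hr : r ≤ p + n) : 0 ≤ det3 (v (i + p)) (v (i + q)) (v (i + r)) := by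
  rcases hpq.eq_or_lt with rfl | hpq
  · rw [det3_self_left]
  rcases hqr.eq_or_lt with rfl | hqr
  · rw [det3_self_right]
  rcases hr.eq_or_lt with rfl | hr
  · rw [Nat.cast_add, ZMod.natCast_self, add_zero, det3_self_outer]
  · have := h (i + p) (q - p) (r - p) (by omega) (by omega) (by omega)
    rw [Nat.cast_sub hpq.le, Nat.cast_sub (hpq.trans hqr).le, add_assoc, add_assoc,
      add_sub_cancel, add_sub_cancel] at this
    exact this.le

theorem CyclicPos.det3_pos {v : ZMod n → E3} (h : CyclicPos n v) (i : ZMod n) {p q r : ℕ}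
    (hpq : p < q) (hqr : q < r) (hr : r < p + n) : 0 < det3 (v (i + p)) (v (i + q)) (v (i + r)) := by
  have := h (i + p) (q - p) (r - p) (by omega) (by omega) (by omega)
  rwa [Nat.cast_sub hpq.le, Nat.cast_sub (hpq.trans hqr).le, add_assoc, add_assoc,
    add_sub_cancel, add_sub_cancel] at this

/-- Chords of maximum length which do not cross have common end points. -/
theorem eq_of_not_crossing {x y p q : E3} {c : ℝ} (hx : ‖x‖ = 1) (hy : ‖y‖ = 1) (hp : ‖p‖ = 1)
    (hq : ‖q‖ = 1) (hxy : ⟪x, y⟫_ℝ = -c) (hpq : ⟪p, q⟫_ℝ = -c) (hxq : -c ≤ ⟪x, q⟫_ℝ)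
    (hpy : -c ≤ ⟪p, y⟫_ℝ) (ha : 0 ≤ det3 p q y) (hb : 0 ≤ det3 x p y) (ha' : 0 ≤ det3 x q y)
    (hb' : 0 ≤ det3 x p q) :
    (0 < det3 p q y ∨ 0 < det3 x q y → p = x) ∧ (0 < det3 x p y ∨ 0 < det3 x p q → q = y) := by
  -- This relation expresses that the diagonals of the quadrilateral `x p q y` meet. Its inner
  -- products with `x - p` and `q - y` are sums of non-negative terms equal to zero, so each term
  -- vanishes.
  have e : det3 p q y • x + det3 x p y • q = det3 x q y • p + det3 x p q • y := by
    apply ext3 <;> simp [det3_eq] <;> ring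
  have n1 : ∀ a : E3, ‖a‖ = 1 → ⟪a, a⟫_ℝ = 1 := fun a h => by
    rw [real_inner_self_eq_norm_sq, h]; norm_num
  have hle : ∀ a b : E3, ‖a‖ = 1 → ‖b‖ = 1 → ⟪a, b⟫_ℝ ≤ 1 := fun a b h1 h2 => by
    have := real_inner_le_norm a b; rwa [h1, h2, one_mul] at this
  have e1 := congrArg (fun u => ⟪u, x - p⟫_ℝ) e
  have e2 := congrArg (fun u => ⟪u, q - y⟫_ℝ) e
  simp only [inner_add_left, inner_sub_right, real_inner_smul_left, n1 _ hx, n1 _ hy, n1 _ hp,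
    n1 _ hq, hxy, hpq, real_inner_comm x q, real_inner_comm p q, real_inner_comm x p,
    real_inner_comm p y, real_inner_comm x y, real_inner_comm q y] at e1 e2
  have h1 := hle x p hx hp
  have h2 := hle q y hq hy
  rw [real_inner_comm] at h1 h2
  have q1 := mul_nonneg ha (sub_nonneg.2 h1)
  have q2 := mul_nonneg ha' (sub_nonneg.2 h1)
  have q3 := mul_nonneg hb (sub_nonneg.2 h2)
  have q4 := mul_nonneg hb' (sub_nonneg.2 h2)
  have r1 := mul_nonneg ha (neg_le_iff_add_nonneg.1 hxq)
  have r2 := mul_nonneg hb (neg_le_iff_add_nonneg.1 hxq)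
  have r3 := mul_nonneg ha' (neg_le_iff_add_nonneg.1 hpy)
  have r4 := mul_nonneg hb' (neg_le_iff_add_nonneg.1 hpy)
  have heq : ∀ (t : ℝ) (a b : E3), ‖a‖ = 1 → ‖b‖ = 1 → 0 < t → t * (1 - ⟪a, b⟫_ℝ) = 0 → a = b := by
    intro t a b h1 h2 ht h0
    have := (mul_eq_zero.1 h0).resolve_left ht.ne'
    exact (inner_eq_one_iff_of_norm_eq_one (𝕜 := ℝ) h1 h2).1 (by linarith)
  simp only [real_inner_comm p x, real_inner_comm y q] at *
  refine ⟨?_, ?_⟩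
  · rintro (h | h)
    · exact heq _ _ _ hp hx h (by linarith)
    · exact heq _ _ _ hp hx h (by linarith)
  · rintro (h | h)
    · exact (heq _ _ _ hy hq h (by linarith)).symm
    · exact (heq _ _ _ hy hq h (by linarith)).symm

namespace ChordSystem

variable {v w x : ZMod n → E3} {σ : ZMod n → ZMod n} {c s : ℝ}

theorem inner_w_nonneg (h : ChordSystem n v w x σ c s) (l i : ZMod n) : 0 ≤ ⟪w l, v i⟫_ℝ := by
  rw [real_inner_comm]; exact h.pair.inner_nonneg l i

theorem inner_x_nonneg (h : ChordSystem n v w x σ c s) (k i : ZMod n) : 0 ≤ ⟪x k, v i⟫_ℝ := by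
  obtain ⟨a, b, ha, hb, -, e⟩ := h.edge k
  rw [e, inner_add_left, real_inner_smul_left, real_inner_smul_left]
  exact add_nonneg (mul_nonneg ha (h.inner_w_nonneg _ _)) (mul_nonneg hb (h.inner_w_nonneg _ _))

theorem inner_x_self (h : ChordSystem n v w x σ c s) (i : ZMod n) : ⟪x i, v i⟫_ℝ = 0 := by
  obtain ⟨a, b, -, -, -, e⟩ := h.edge i
  have a1 := h.pair.inner_right (i - 1)
  have a2 := h.pair.inner_left i
  rw [sub_add_cancel] at a1
  rw [e, inner_add_left, real_inner_smul_left, real_inner_smul_left, real_inner_comm, a1,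
    real_inner_comm, a2]; ring

theorem inner_v_w (h : ChordSystem n v w x σ c s) (i : ZMod n) : ⟪v i, w (σ i)⟫_ℝ = s := by
  have := congrArg (fun u => ⟪u, w (σ i)⟫_ℝ) (h.eq_v i)
  simp only [inner_add_left, real_inner_smul_left, h.pair.inner_self_w, h.inner_eq] at this
  have h2 := h.s_pos
  have h3 := h.sq
  have : s * (⟪v i, w (σ i)⟫_ℝ - s) = 0 := by linear_combination this - h3
  linarith [(mul_eq_zero.1 this).resolve_left h2.ne']

/-- Two diametral chords with the same end `w (σ i)` coincide: pairing the equation for `v k` with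
`x i` gives `c * ⟪x i, x k⟫ ≥ c`. By `eq_v` a chord determines its vertex. -/
theorem injective (h : ChordSystem n v w x σ c s) : Function.Injective σ := by
  have hv : ∀ i k, v i = v k → i = k := by
    intro i k hv
    have h1 := (h.pair.inner_eq_zero_iff i k).1 (by rw [← hv]; exact h.pair.inner_left i)
    have h2 := (h.pair.inner_eq_zero_iff (i - 1) k).1 (by
      rw [← hv]; simpa using h.pair.inner_right (i - 1))
    rcases h1 with h1 | h1
    · exact h1.symm
    · rcases h2 with h2 | h2
      · exact absurd (by linear_combination h2 - h1) (h.pair.ne_aux i).2.1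
      · rw [h2]; ring
  intro i k hik
  apply hv
  have e1 := h.eq_v i
  have e2 := h.eq_v k
  rw [← hik] at e2
  have hxx : c • x i = c • x k := by
    by_cases hc : c = 0
    · rw [hc, zero_smul, zero_smul]
    have hc : 0 < c := lt_of_le_of_ne h.c_nonneg (Ne.symm hc)
    have := congrArg (fun u => ⟪x i, u⟫_ℝ) e2
    simp only [inner_add_right, real_inner_smul_right, h.inner_eq] at this
    have h0 := mul_nonneg h.s_pos.le (h.inner_x_nonneg i k)
    have hle := real_inner_le_norm (x i) (x k)
    rw [h.norm_x, h.norm_x, one_mul] at hle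
    rw [(inner_eq_one_iff_of_norm_eq_one (h.norm_x i) (h.norm_x k)).1
      (le_antisymm hle (by nlinarith))]
  have : s • v i = s • v k := by rw [e1, e2, hxx]
  exact smul_right_injective E3 h.s_pos.ne' this

theorem neg_c_le (h : ChordSystem n v w x σ c s) {k k' : E3} (hk : ∀ i, 0 ≤ ⟪k, v i⟫_ℝ)
    (hk' : ∀ i, 0 ≤ ⟪k', v i⟫_ℝ) (h1 : ‖k‖ = 1) (h2 : ‖k'‖ = 1) : -c ≤ ⟪k, k'⟫_ℝ := by
  have := h.bound k hk k' hk'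
  rwa [h1, h2, one_mul, mul_one] at this

/-- No chord both of whose end points are vertices can be moved apart in opposite directions. -/
theorem false_of_rotate (h : ChordSystem n v w x σ c s) {i k j j' l l' : ZMod n}
    (hjl : ⟪w j, w l⟫_ℝ = -c) (hi : s • v i = w j + c • w l) (hk : s • v k = w l + c • w j)
    (hj : (j = k ∧ j' = k - 1) ∨ (j = k - 1 ∧ j' = k))
    (hl : (l = i ∧ l' = i - 1) ∨ (l = i - 1 ∧ l' = i))
    {ε : ℝ} (hε : ε ^ 2 = 1) (h1 : 0 ≤ ε * det3 (w j') (w j) (w l))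
    (h2 : ε * det3 (w l') (w j) (w l) ≤ 0) : False := by
  have hP := h.pair
  set z := ε • cross (w j) (w l) with hz
  have hxz : ⟪w j, z⟫_ℝ = 0 := by
    rw [hz, real_inner_smul_right, inner_cross_self_left, mul_zero]
  have hyz : ⟪w l, z⟫_ℝ = 0 := by
    rw [hz, real_inner_smul_right, inner_cross_self_right, mul_zero]
  have hz2 : ⟪z, z⟫_ℝ = s ^ 2 := by
    rw [real_inner_self_eq_norm_sq, hz, norm_smul, mul_pow, Real.norm_eq_abs, sq_abs, hε,
      norm_cross_sq, hP.norm_w, hP.norm_w, hjl]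
    linear_combination -h.sq
  have hs := h.s_pos
  have hz0 : z ≠ 0 := by
    intro h0; rw [h0, inner_zero_left] at hz2
    exact (by positivity : s ^ 2 ≠ 0) hz2.symm
  have hcoord : ∀ m, ⟪z, v m⟫_ℝ = 0 → ∀ a b, ((a = m ∧ b = m - 1) ∨ (a = m - 1 ∧ b = m)) →
      ∃ p q : ℝ, z = p • w a + q • w b := by
    intro m hm a b hab
    obtain ⟨r₁, r₂, -, -, e⟩ := hP.dual.exists_side_coords (m - 1)
    have := e z (by simpa using hm)
    rw [sub_add_cancel] at this
    rcases hab with ⟨rfl, rfl⟩ | ⟨rfl, rfl⟩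
    · exact ⟨_, _, this.trans (add_comm _ _)⟩
    · exact ⟨_, _, this⟩
  have hzv : ∀ m, s • v m = w j + c • w l ∨ s • v m = w l + c • w j → ⟪z, v m⟫_ℝ = 0 := by
    intro m hm
    have : ⟪s • v m, z⟫_ℝ = 0 := by
      rcases hm with hm | hm <;>
      · rw [hm, inner_add_left, real_inner_smul_left, hxz, hyz]; ring
    rw [real_inner_smul_left] at this
    rw [real_inner_comm]
    exact (mul_eq_zero.1 this).resolve_left hs.ne'
  obtain ⟨p, q, e⟩ := hcoord k (hzv k (Or.inr hk)) j j' hj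
  obtain ⟨p', q', e'⟩ := hcoord i (hzv i (Or.inl hi)) l l' hl
  rw [← inner_cross, ← real_inner_smul_right, ← hz] at h1 h2
  have hq : 0 < q := by
    have : q * ⟪w j', z⟫_ℝ = s ^ 2 := by
      have := congrArg (fun u => ⟪u, z⟫_ℝ) e
      simp only [inner_add_left, real_inner_smul_left, hxz, hz2] at this
      linarith
    have h3 : 0 < q * ⟪w j', z⟫_ℝ := by rw [this]; positivity
    exact pos_of_mul_pos_left h3 h1
  have hq' : q' < 0 := by
    have : q' * ⟪w l', z⟫_ℝ = s ^ 2 := by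
      have := congrArg (fun u => ⟪u, z⟫_ℝ) e'
      simp only [inner_add_left, real_inner_smul_left, hyz, hz2] at this
      linarith
    have h3 : 0 < q' * ⟪w l', z⟫_ℝ := by rw [this]; positivity
    nlinarith
  have hcomb : ∀ (a b : ℝ) (l m : ZMod n), 0 ≤ a → 0 ≤ b → ∀ j, 0 ≤ ⟪a • w l + b • w m, v j⟫_ℝ := by
    intro a b l m ha hb j
    rw [inner_add_left, real_inner_smul_left, real_inner_smul_left]
    exact add_nonneg (mul_nonneg ha (h.inner_w_nonneg _ _)) (mul_nonneg hb (h.inner_w_nonneg _ _))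
  have hKc : Convex ℝ {k : E3 | ∀ i, 0 ≤ ⟪k, v i⟫_ℝ} := by
    intro a ha b hb s t hs ht _ i
    rw [inner_add_left, real_inner_smul_left, real_inner_smul_left]
    exact add_nonneg (mul_nonneg hs (ha i)) (mul_nonneg ht (hb i))
  obtain ⟨t, ht, a1, -⟩ := exists_small 1 1 p 0 one_pos one_pos
  obtain ⟨t', ht', a2, -⟩ := exists_small 1 1 (-p') 0 one_pos one_pos
  refine false_of_min_of_move h.c_lt hKc (fun k hk k' hk' => h.bound k hk k' hk')
    (x := w j) (y := w l) (z := z) (t := t) (t' := t') (h.inner_w_nonneg j) (h.inner_w_nonneg l)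
    (hP.norm_w _) (hP.norm_w _) hjl hxz hyz hz0 ht ht' ?_ ?_
  · have : w j + t • z = (1 + t * p) • w j + (t * q) • w j' := by rw [e]; module
    rw [this]; exact hcomb _ _ _ _ a1 (mul_pos ht hq).le
  · have : w l - t' • z = (1 + t' * -p') • w l + (t' * -q') • w l' := by rw [e']; module
    rw [this]; exact hcomb _ _ _ _ a2 (mul_pos ht' (neg_pos.2 hq')).le

/-- If an end point of a chord is a vertex at which another chord ends, then the chords coincide. -/
theorem both_eq (h : ChordSystem n v w x σ c s) {i k : ZMod n} (hx : x i = w (σ k)) :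
    0 < c ∧ x k = w (σ i) ∧ (σ k = i ∨ σ k = i - 1) ∧ (σ i = k ∨ σ i = k - 1) := by
  have hP := h.pair
  have hc : 0 < c := by
    -- For `c = 0` the point `x i` is interior to its side by `edge`, so it cannot be a vertex.
    refine lt_of_le_of_ne h.c_nonneg fun hc => ?_
    obtain ⟨a, b, -, -, hab, e⟩ := h.edge i
    obtain ⟨ha, hb⟩ := hab hc.symm
    have hz : ∀ m, ⟪v m, w (σ k)⟫_ℝ = 0 → m = i := by
      intro m hm
      rw [← hx, e, inner_add_right, real_inner_smul_right, real_inner_smul_right] at hm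
      have a1 := mul_nonneg ha.le (hP.inner_nonneg (i - 1) m)
      have a2 := mul_nonneg hb.le (hP.inner_nonneg i m)
      have b1 := (hP.inner_eq_zero_iff (i - 1) m).1
        ((mul_eq_zero.1 (by linarith : a * _ = 0)).resolve_left ha.ne')
      have b2 := (hP.inner_eq_zero_iff i m).1
        ((mul_eq_zero.1 (by linarith : b * _ = 0)).resolve_left hb.ne')
      rcases b2 with b2 | b2
      · exact b2
      · rcases b1 with b1 | b1
        · exact absurd (by linear_combination b1 - b2) (hP.ne_aux i).2.1
        · simpa using b1
    have h1 := hz _ (hP.inner_left _)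
    have h2 := hz _ (hP.inner_right _)
    exact (hP.ne_aux (σ k)).1 (h2.trans h1.symm)
  have hmem : ∀ {i k : ZMod n}, x i = w (σ k) → σ k = i ∨ σ k = i - 1 := by
    intro i k hx
    have := (hP.inner_eq_zero_iff (σ k) i).1 (by rw [real_inner_comm, ← hx]; exact h.inner_x_self i)
    rcases this with h1 | h1
    · exact Or.inl h1.symm
    · exact Or.inr (by rw [h1]; ring)
  -- Both `x k` and `w (σ i)` are then at maximum distance from `w (σ k)`, and the chord
  -- perpendicular to the side of `x k` admits no second such point.
  have hxk : x k = w (σ i) := by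
    have e := congrArg (fun u => ⟪w (σ i), u⟫_ℝ) (h.eq_v k)
    have e2 : ⟪w (σ i), w (σ k)⟫_ℝ = -c := by rw [← hx, real_inner_comm]; exact h.inner_eq i
    simp only [inner_add_right, real_inner_smul_right, e2] at e
    have h0 := mul_nonneg h.s_pos.le (h.inner_w_nonneg (σ i) k)
    have hle := real_inner_le_norm (w (σ i)) (x k)
    rw [h.norm_x, hP.norm_w, one_mul] at hle
    exact ((inner_eq_one_iff_of_norm_eq_one (hP.norm_w _) (h.norm_x k)).1
      (le_antisymm hle (by nlinarith))).symm
  exact ⟨hc, hxk, hmem hx, hmem hxk⟩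

end ChordSystem

end Combinatorics

end

/-! ### The chord of a vertex ends at the opposite side -/

section

section Shift

variable {n : ℕ} [NeZero n]

theorem offset_inj {a b : ℕ} {i : ZMod n} (ha : a < n) (hb : b < n) (h : i + (a : ZMod n) = i + b) :
    a = b := by
  rcases lt_trichotomy a b with hab | hab | hab
  · exact absurd h (offset_ne hab hb)
  · exact hab
  · exact absurd h.symm (offset_ne hab ha)

namespace ChordSystem

variable {v w x : ZMod n → E3} {σ : ZMod n → ZMod n} {c s : ℝ}

/-- The normals `w`, numbered from the normal of the side which ends at `v i`. -/
theorem numbering (h : ChordSystem n v w x σ c s) (i : ZMod n) : ∃ u : ℕ → E3,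
    (∀ p q r, p ≤ q → q ≤ r → r ≤ p + n → 0 ≤ det3 (u p) (u q) (u r)) ∧
    (∀ p q r, p < q → q < r → r < p + n → 0 < det3 (u p) (u q) (u r)) ∧
    (∀ a : ℕ, u a = w (i - 1 + a)) ∧ (∀ m : ℕ, u (m + 1) = w (i + m)) ∧
    ∀ a : ℕ, ∃ α β : ℝ, 0 ≤ α ∧ 0 ≤ β ∧ 0 < α + β ∧ x (i + a) = α • u a + β • u (a + 1) := by
  have e : ∀ m : ℕ, w (i - 1 + (m + 1 : ℕ)) = w (i + m) := fun m => by
    congr 1; push_cast; ring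
  refine ⟨fun t => w (i - 1 + t), fun p q r => h.pair.pos_w.det3_nonneg _,
    fun p q r => h.pair.pos_w.det3_pos _, fun _ => rfl, e, fun a => ?_⟩
  obtain ⟨α, β, hα, hβ, -, ex⟩ := h.edge (i + a)
  refine ⟨α, β, hα, hβ, ?_, ?_⟩
  · refine lt_of_le_of_ne (add_nonneg hα hβ) fun h0 => ?_
    have := h.norm_x (i + a)
    rw [ex, show α = 0 by linarith, show β = 0 by linarith] at this
    simp at this
  · rw [ex]
    simp only [e]
    congr 3; ring

/-- The vertex `v i` has the positive height `s` over the side `σ i`, so it is not an end of that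
side. -/
theorem sigma_offset (h : ChordSystem n v w x σ c s) {i : ZMod n} {m : ℕ} (hm : m < n)
    (hi : σ i = i + m) : 0 < m ∧ m + 1 < n := by
  have h1 := h.inner_v_w i
  have hs := h.s_pos
  rw [hi] at h1
  constructor
  · rcases Nat.eq_zero_or_pos m with rfl | h0
    · rw [Nat.cast_zero, add_zero, h.pair.inner_left] at h1; linarith
    · exact h0
  · by_contra hcon
    have : m + 1 = n := by omega
    have h2 : (i + m : ZMod n) + 1 = i := by
      rw [add_assoc, ← Nat.cast_one, ← Nat.cast_add, this, ZMod.natCast_self, add_zero]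
    have h3 := h.pair.inner_right (i + m)
    rw [h2] at h3
    linarith

/-- A chord is not on the near side of another one which it faces in the same direction. -/
theorem not_nested (h : ChordSystem n v w x σ c s) {i : ZMod n} {a r m : ℕ} (ha : 0 < a)
    (har : a ≤ r) (hrm : r < m) (hmn : m < n) (hi : σ i = i + m) (hk : σ (i + a) = i + r) :
    False := by
  have hP := h.pair
  obtain ⟨-, hm1⟩ := h.sigma_offset hmn hi
  obtain ⟨u, D, D', hu0, hu, hux⟩ := h.numbering i
  obtain ⟨α, β, hα, hβ, hαβ, e⟩ := hux 0
  obtain ⟨α', β', hα', hβ', hαβ', e'⟩ := hux a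
  rw [Nat.cast_zero, add_zero, zero_add] at e
  have ej := hu m
  have el := hu r
  rw [← hi] at ej
  rw [← hk] at el
  have hpos : 0 < det3 (x i) (w (σ (i + a))) (w (σ i)) := by
    rw [← ej, ← el, e, det3_add_left, det3_smul_left, det3_smul_left]
    have d1 := D' 0 (r + 1) (m + 1) (by omega) (by omega) (by omega)
    have d2 := D' 1 (r + 1) (m + 1) (by omega) (by omega) (by omega)
    rcases hα.eq_or_lt with h0 | h0
    · rw [← h0, zero_mul, zero_add]; exact mul_pos (by linarith) d2
    · exact add_pos_of_pos_of_nonneg (mul_pos h0 d1) (mul_nonneg hβ d2.le)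
  have hx := (eq_of_not_crossing (h.norm_x i) (hP.norm_w (σ i)) (h.norm_x (i + a))
    (hP.norm_w (σ (i + a))) (h.inner_eq i) (h.inner_eq _)
    (h.neg_c_le (h.inner_x_nonneg _) (h.inner_w_nonneg _) (h.norm_x _) (hP.norm_w _))
    (h.neg_c_le (h.inner_x_nonneg _) (h.inner_w_nonneg _) (h.norm_x _) (hP.norm_w _))
    (by
      rw [← ej, ← el, e', det3_add_left, det3_smul_left, det3_smul_left]
      exact add_nonneg (mul_nonneg hα' (D _ _ _ (by omega) (by omega) (by omega)))
        (mul_nonneg hβ' (D _ _ _ (by omega) (by omega) (by omega))))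
    (by
      rw [← ej, e, e']
      simp only [det3_add_left, det3_smul_left, det3_add_mid, det3_smul_mid]
      exact add_nonneg (mul_nonneg hα' (add_nonneg
        (mul_nonneg hα (D _ _ _ (by omega) (by omega) (by omega)))
        (mul_nonneg hβ (D _ _ _ (by omega) (by omega) (by omega))))) (mul_nonneg hβ' (add_nonneg
        (mul_nonneg hα (D _ _ _ (by omega) (by omega) (by omega)))
        (mul_nonneg hβ (D _ _ _ (by omega) (by omega) (by omega))))))
    hpos.le (by
      rw [← el, e, e']
      simp only [det3_add_left, det3_smul_left, det3_add_mid, det3_smul_mid]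
      exact add_nonneg (mul_nonneg hα' (add_nonneg
        (mul_nonneg hα (D _ _ _ (by omega) (by omega) (by omega)))
        (mul_nonneg hβ (D _ _ _ (by omega) (by omega) (by omega))))) (mul_nonneg hβ' (add_nonneg
        (mul_nonneg hα (D _ _ _ (by omega) (by omega) (by omega)))
        (mul_nonneg hβ (D _ _ _ (by omega) (by omega) (by omega))))))).1 (Or.inr hpos)
  -- The chords now share the point `x i`, which lies on two different sides of the polar polygon;
  -- it must be the vertex `w i`, and the sides are adjacent. The determinant of `s • v i`, `s • v
  -- (i + 1)`, `w i`, computed in two ways, then has contradictory signs.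
  have u0 : u 0 = w (i - 1) := by rw [hu0]; simp
  have u1 : u 1 = w i := by simpa using hu 0
  have hzero := h.inner_x_self (i + a)
  have hn1 : i + (a : ZMod n) ≠ i := by
    simpa using offset_ne_self (i := i) (b := a) ha (by omega)
  have hn2 : i + (a : ZMod n) ≠ i - 1 := by
    intro h'
    have := offset_ne_self (n := n) (i := i) (b := a + 1) (by omega) (by omega)
    apply this; push_cast; linear_combination h'
  have hw1 : 0 < ⟪w (i - 1), v (i + a)⟫_ℝ := by
    rw [real_inner_comm]; exact hP.inner_pos _ _ hn2 (by simpa using hn1)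
  rw [hx, e, u0, u1, inner_add_left, real_inner_smul_left, real_inner_smul_left] at hzero
  have hα0 : α = 0 := by
    have := mul_nonneg hβ (h.inner_w_nonneg i (i + a))
    have := mul_nonneg hα hw1.le
    exact (mul_eq_zero.1 (by linarith : α * _ = 0)).resolve_right hw1.ne'
  rw [hα0] at hαβ hzero
  have hβ0 : 0 < β := by linarith
  have hk1 : i + (a : ZMod n) = i + 1 := by
    have : ⟪v (i + a), w i⟫_ℝ = 0 := by
      rw [real_inner_comm]
      exact (mul_eq_zero.1 (by linarith : β * _ = 0)).resolve_left hβ0.ne'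
    exact ((hP.inner_eq_zero_iff _ _).1 this).resolve_left hn1
  have hxi : x i = w i := by
    have hn := h.norm_x i
    rw [e, u1, hα0, zero_smul, zero_add, norm_smul, hP.norm_w, mul_one, norm_of_nonneg hβ] at hn
    rw [e, u1, hα0, hn]; simp
  have e1 := h.eq_v i
  have e2 := h.eq_v (i + a)
  rw [hx, hxi] at e2
  rw [hxi] at e1
  rw [hk1] at e2
  obtain ⟨R, hR, eR⟩ := hP.cross_v i
  have d1 : det3 (s • v i) (s • v (i + 1)) (w i) = s * (s * R) := by
    rw [det3_smul_left, det3_smul_mid, ← cross_inner, eR, real_inner_smul_left, hP.inner_self_w,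
      mul_one]
  rw [e1, e2] at d1
  simp only [det3_add_left, det3_smul_left, det3_add_mid, det3_smul_mid, det3_self_right,
    det3_self_outer, mul_zero, add_zero] at d1
  have d2 := D' 1 (r + 1) (m + 1) (by omega) (by omega) (by omega)
  rw [u1, ej, el, hk1] at d2
  rw [det3_swap, det3_rotate (w i)] at d1
  have : 0 < s * (s * R) := by have := h.s_pos; positivity
  linarith

/-- The two end points of a chord do not both follow the end points of another chord. -/
theorem not_separated (h : ChordSystem n v w x σ c s) {i : ZMod n} {a r m : ℕ} (hma : m < a)
    (har : a ≤ r) (hrn : r < n) (hi : σ i = i + m) (hk : σ (i + a) = i + r) : False := by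
  have hP := h.pair
  obtain ⟨hm0, hm1⟩ := h.sigma_offset (by omega) hi
  obtain ⟨u, D, D', hu0, hu, hux⟩ := h.numbering i
  obtain ⟨α, β, hα, hβ, hαβ, e⟩ := hux 0
  obtain ⟨α', β', hα', hβ', hαβ', e'⟩ := hux a
  rw [Nat.cast_zero, add_zero, zero_add] at e
  have ej := hu m
  have el := hu r
  rw [← hi] at ej
  rw [← hk] at el
  have u0 : u 0 = w (i - 1) := by rw [hu0]; simp
  have u1 : u 1 = w i := by simpa using hu 0
  have hor : x i = w (σ (i + a)) ∨ x (i + a) = w (σ i) := by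
    by_cases hpos : 0 < det3 (w (σ i)) (w (σ (i + a))) (x i)
    · refine Or.inr ((eq_of_not_crossing (hP.norm_w (σ i)) (h.norm_x i) (h.norm_x (i + a))
        (hP.norm_w (σ (i + a))) (by rw [real_inner_comm]; exact h.inner_eq i) (h.inner_eq _)
        (h.neg_c_le (h.inner_w_nonneg _) (h.inner_w_nonneg _) (hP.norm_w _) (hP.norm_w _))
        (h.neg_c_le (h.inner_x_nonneg _) (h.inner_x_nonneg _) (h.norm_x _) (h.norm_x _))
        ?_ ?_ hpos.le ?_).1 (Or.inr hpos))
      · rw [det3_rotate, ← el, e, e']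
        simp only [det3_add_left, det3_smul_left, det3_add_mid, det3_smul_mid]
        exact add_nonneg (mul_nonneg hα' (add_nonneg
          (mul_nonneg hα (D _ _ _ (by omega) (by omega) (by omega)))
          (mul_nonneg hβ (D _ _ _ (by omega) (by omega) (by omega))))) (mul_nonneg hβ' (add_nonneg
          (mul_nonneg hα (D _ _ _ (by omega) (by omega) (by omega)))
          (mul_nonneg hβ (D _ _ _ (by omega) (by omega) (by omega)))))
      · rw [det3_rotate, ← ej, e, e']
        simp only [det3_add_left, det3_smul_left, det3_add_right, det3_smul_right]
        exact add_nonneg (mul_nonneg hα' (add_nonneg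
          (mul_nonneg hα (D _ _ _ (by omega) (by omega) (by omega)))
          (mul_nonneg hβ (D _ _ _ (by omega) (by omega) (by omega))))) (mul_nonneg hβ' (add_nonneg
          (mul_nonneg hα (D _ _ _ (by omega) (by omega) (by omega)))
          (mul_nonneg hβ (D _ _ _ (by omega) (by omega) (by omega)))))
      · rw [← ej, ← el, e']
        simp only [det3_add_mid, det3_smul_mid]
        exact add_nonneg (mul_nonneg hα' (D _ _ _ (by omega) (by omega) (by omega)))
          (mul_nonneg hβ' (D _ _ _ (by omega) (by omega) (by omega)))
    · left
      rw [det3_rotate, ← ej, ← el, e, det3_add_left, det3_smul_left, det3_smul_left] at hpos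
      have d1 := D 0 (m + 1) (r + 1) (by omega) (by omega) (by omega)
      have d2 := D' 1 (m + 1) (r + 1) (by omega) (by omega) (by omega)
      have q1 := mul_nonneg hα d1
      have q2 := mul_nonneg hβ d2.le
      have hβ0 : β = 0 := (mul_eq_zero.1 (by linarith : β * _ = 0)).resolve_right d2.ne'
      have hr : r + 1 = n := by
        by_contra hr
        have d3 := D' 0 (m + 1) (r + 1) (by omega) (by omega) (by omega)
        have : α = 0 := (mul_eq_zero.1 (by linarith : α * _ = 0)).resolve_right d3.ne'
        linarith
      have hn := h.norm_x i
      rw [e, u0, hβ0, zero_smul, add_zero, norm_smul, hP.norm_w, mul_one, norm_of_nonneg hα] at hn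
      rw [e, ← el, hu0 (r + 1), hr, u0, hn, hβ0, ZMod.natCast_self]; simp
  obtain ⟨hc, hxi, hxk, hl, hj⟩ : 0 < c ∧ x i = w (σ (i + a)) ∧ x (i + a) = w (σ i) ∧
      (σ (i + a) = i ∨ σ (i + a) = i - 1) ∧ (σ i = i + a ∨ σ i = i + a - 1) := by
    rcases hor with hx | hx
    · obtain ⟨h1, h2, h3, h4⟩ := h.both_eq hx
      exact ⟨h1, hx, h2, h3, h4⟩
    · obtain ⟨h1, h2, h3, h4⟩ := h.both_eq hx
      exact ⟨h1, h2, hx, h4, h3⟩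
  have hl' : σ (i + a) = i - 1 := hl.resolve_left fun h' => by
    rw [hk] at h'
    exact offset_ne_self (n := n) (i := i) (b := r) (by omega) hrn h'
  have hj' : σ i = i + a - 1 := hj.resolve_left fun h' => by
    rw [hi] at h'
    have := offset_inj (by omega) (by omega) h'
    omega
  -- Both chords are now the segment from `w (σ i)` to `w (σ (i + a))`, perpendicular to a side at
  -- either end; the positions of the sides allow the ends to be moved apart.
  have e1 := h.eq_v i
  have e2 := h.eq_v (i + a)
  have e3 := h.inner_eq i
  rw [hxi] at e1 e3
  rw [hxk] at e2
  refine h.false_of_rotate (i := i) (k := i + a) (j' := i + a) (l' := i)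
    (by rw [real_inner_comm]; exact e3) e1 e2
    (Or.inr ⟨hj', rfl⟩) (Or.inr ⟨hl', rfl⟩) (ε := -1) (by norm_num) ?_ ?_
  · have hma' : m + 1 = a := by
      have := offset_inj (n := n) (i := i) (a := m + 1) (b := a) (by omega) (by omega)
        (by push_cast; rw [← add_assoc, ← hi, hj']; ring)
      exact this
    have := D (m + 1) (a + 1) (r + 1) (by omega) (by omega) (by omega)
    rw [ej, el, hu a] at this
    rw [det3_swap]; linarith
  · have := D 1 (m + 1) (r + 1) (by omega) (by omega) (by omega)
    rw [ej, el, u1] at this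
    linarith

/-- The two end points of a chord do not both precede the end points of another chord. -/
theorem not_separated' (h : ChordSystem n v w x σ c s) {i : ZMod n} {a r m : ℕ} (hra : r < a)
    (ham : a ≤ m) (hmn : m < n) (hi : σ i = i + m) (hk : σ (i + a) = i + r) : False := by
  have hP := h.pair
  obtain ⟨hm0, hm1⟩ := h.sigma_offset (by omega) hi
  obtain ⟨u, D, D', hu0, hu, hux⟩ := h.numbering i
  obtain ⟨α, β, hα, hβ, hαβ, e⟩ := hux 0
  obtain ⟨α', β', hα', hβ', hαβ', e'⟩ := hux a
  rw [Nat.cast_zero, add_zero, zero_add] at e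
  have ej := hu m
  have el := hu r
  rw [← hi] at ej
  rw [← hk] at el
  have u0 : u 0 = w (i - 1) := by rw [hu0]; simp
  have u1 : u 1 = w i := by simpa using hu 0
  have hor : x i = w (σ (i + a)) ∨ x (i + a) = w (σ i) := by
    by_cases hpos : 0 < det3 (x i) (w (σ (i + a))) (w (σ i))
    · refine Or.inr ((eq_of_not_crossing (h.norm_x i) (hP.norm_w (σ i)) (hP.norm_w (σ (i + a)))
        (h.norm_x (i + a)) (h.inner_eq i) (by rw [real_inner_comm]; exact h.inner_eq _)
        (h.neg_c_le (h.inner_x_nonneg _) (h.inner_x_nonneg _) (h.norm_x _) (h.norm_x _))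
        (h.neg_c_le (h.inner_w_nonneg _) (h.inner_w_nonneg _) (hP.norm_w _) (hP.norm_w _))
        ?_ hpos.le ?_ ?_).2 (Or.inl hpos))
      · rw [← ej, ← el, e']
        simp only [det3_add_mid, det3_smul_mid]
        exact add_nonneg (mul_nonneg hα' (D _ _ _ (by omega) (by omega) (by omega)))
          (mul_nonneg hβ' (D _ _ _ (by omega) (by omega) (by omega)))
      · rw [← ej, e, e']
        simp only [det3_add_left, det3_smul_left, det3_add_mid, det3_smul_mid]
        exact add_nonneg (mul_nonneg hα' (add_nonneg
          (mul_nonneg hα (D _ _ _ (by omega) (by omega) (by omega)))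
          (mul_nonneg hβ (D _ _ _ (by omega) (by omega) (by omega))))) (mul_nonneg hβ' (add_nonneg
          (mul_nonneg hα (D _ _ _ (by omega) (by omega) (by omega)))
          (mul_nonneg hβ (D _ _ _ (by omega) (by omega) (by omega)))))
      · rw [← el, e, e']
        simp only [det3_add_left, det3_smul_left, det3_add_right, det3_smul_right]
        exact add_nonneg (mul_nonneg hα' (add_nonneg
          (mul_nonneg hα (D _ _ _ (by omega) (by omega) (by omega)))
          (mul_nonneg hβ (D _ _ _ (by omega) (by omega) (by omega))))) (mul_nonneg hβ' (add_nonneg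
          (mul_nonneg hα (D _ _ _ (by omega) (by omega) (by omega)))
          (mul_nonneg hβ (D _ _ _ (by omega) (by omega) (by omega)))))
    · left
      rw [← ej, ← el, e, det3_add_left, det3_smul_left, det3_smul_left] at hpos
      have d1 := D' 0 (r + 1) (m + 1) (by omega) (by omega) (by omega)
      have d2 := D 1 (r + 1) (m + 1) (by omega) (by omega) (by omega)
      have q1 := mul_nonneg hα d1.le
      have q2 := mul_nonneg hβ d2
      have hα0 : α = 0 := (mul_eq_zero.1 (by linarith : α * _ = 0)).resolve_right d1.ne'
      have hr : r = 0 := by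
        by_contra hr
        have d3 := D' 1 (r + 1) (m + 1) (by omega) (by omega) (by omega)
        have : β = 0 := (mul_eq_zero.1 (by linarith : β * _ = 0)).resolve_right d3.ne'
        linarith
      have hn := h.norm_x i
      rw [e, u1, hα0, zero_smul, zero_add, norm_smul, hP.norm_w, mul_one, norm_of_nonneg hβ] at hn
      rw [e, ← el, hr, hn, hα0]; simp
  obtain ⟨hc, hxi, hxk, hl, hj⟩ : 0 < c ∧ x i = w (σ (i + a)) ∧ x (i + a) = w (σ i) ∧
      (σ (i + a) = i ∨ σ (i + a) = i - 1) ∧ (σ i = i + a ∨ σ i = i + a - 1) := by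
    rcases hor with hx | hx
    · obtain ⟨h1, h2, h3, h4⟩ := h.both_eq hx
      exact ⟨h1, hx, h2, h3, h4⟩
    · obtain ⟨h1, h2, h3, h4⟩ := h.both_eq hx
      exact ⟨h1, h2, hx, h4, h3⟩
  have hl' : σ (i + a) = i := hl.resolve_right fun h' => by
    rw [hk] at h'
    refine offset_ne_self (n := n) (i := i) (b := r + 1) (by omega) (by omega) ?_
    push_cast; linear_combination h'
  have hj' : σ i = i + a := hj.resolve_right fun h' => by
    rw [hi] at h'
    have := offset_inj (n := n) (i := i) (a := m + 1) (b := a) (by omega) (by omega) (by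
      push_cast; linear_combination h')
    omega
  have e1 := h.eq_v i
  have e2 := h.eq_v (i + a)
  have e3 := h.inner_eq i
  rw [hxi] at e1 e3
  rw [hxk] at e2
  have hma' : m = a := offset_inj (n := n) (i := i) (by omega) (by omega) (by rw [← hi, hj'])
  have hr0 : r = 0 := offset_inj (n := n) (i := i) (by omega) (by omega) (by
    rw [← hk, hl', Nat.cast_zero, add_zero])
  refine h.false_of_rotate (i := i) (k := i + a) (j' := i + a - 1) (l' := i - 1)
    (by rw [real_inner_comm]; exact e3) e1 e2
    (Or.inl ⟨hj', rfl⟩) (Or.inl ⟨hl', rfl⟩) (ε := 1) (by norm_num) ?_ ?_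
  · have := D a (m + 1) (n + 1) (by omega) (by omega) (by omega)
    rw [ej, hu n, hu0 a, ZMod.natCast_self, add_zero, show i - 1 + (a : ZMod n) = i + a - 1 by ring]
      at this
    rw [hl', one_mul]; exact this
  · have := D 0 (r + 1) (m + 1) (by omega) (by omega) (by omega)
    rw [ej, el, u0] at this
    rw [det3_swap']; linarith

/-- The side to which the chord of a vertex is perpendicular is opposite to that vertex. -/
theorem exists_shift (h : ChordSystem n v w x σ c s) :
    ∃ g : ℕ, n = 2 * g + 1 ∧ ∀ i, σ i = i + g := by
  have key : ∀ (i : ZMod n) (m : ℕ), m < n → σ i = i + m → n = 2 * m + 1 := by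
    intro i m hm hi
    obtain ⟨hm0, hm1⟩ := h.sigma_offset hm hi
    choose f hf hf' using fun a : ℕ => exists_offset i (σ (i + a))
    have hinj : ∀ a b, a < n → b < n → f a = f b → a = b := fun a b ha hb hab =>
      offset_inj ha hb (h.injective (by rw [hf', hf', hab]))
    have hne : ∀ a, 0 < a → a < n → f a ≠ m := by
      intro a ha han hfa
      have : σ (i + a) = σ i := by rw [hf', hfa, hi]
      exact offset_ne_self ha han (h.injective this)
    have h1 : ∀ a, 0 < a → a ≤ m → m < f a := by
      intro a ha ham
      by_contra hcon
      have := hne a ha (by omega)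
      rcases le_or_gt a (f a) with h2 | h2
      · exact h.not_nested ha h2 (by omega) hm hi (hf' a)
      · exact h.not_separated' h2 ham hm hi (hf' a)
    have h2 : ∀ a, m < a → a < n → f a < m := by
      intro a ham han
      by_contra hcon
      have := hne a (by omega) (by omega)
      have hfn := hf a
      rcases le_or_gt a (f a) with h2 | h2
      · exact h.not_separated ham h2 (hf a) hi (hf' a)
      -- Numbering from `i + a` instead of `i`, the chord of `i` becomes the one nested behind the
      -- chord of `i + a`; the offsets wrap around by `n`.
      · have cast : ∀ b : ℕ, a ≤ b + n → i + (a : ZMod n) + (b + n - a : ℕ) = i + b := by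
          intro b hb
          rw [Nat.cast_sub hb]; push_cast; rw [ZMod.natCast_self]; ring
        refine h.not_nested (i := i + a) (a := n - a) (r := m + n - a) (m := f a + n - a)
          (by omega) (by omega) (by omega) (by omega) ?_ ?_
        · rw [cast _ (by omega)]; exact hf' a
        · rw [cast _ (by omega)]
          have := cast 0 (by omega)
          rw [zero_add, Nat.cast_zero, add_zero] at this
          rw [this, hi]
    -- The chords of the `m` vertices following `i` end beyond `i + m`, those of the remaining `n -
    -- m - 1` vertices end before it. By injectivity `m ≤ n - m - 1 ≤ m`.
    have c1 : (Finset.Icc 1 m).card ≤ (Finset.Ioo m n).card := by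
      refine Finset.card_le_card_of_injOn f (fun a ha => ?_) (fun a ha b hb hab => ?_)
      · simp only [Finset.coe_Icc, mem_Icc] at ha
        simp only [Finset.coe_Ioo, mem_Ioo]
        exact ⟨h1 a ha.1 ha.2, hf a⟩
      · simp only [Finset.coe_Icc, mem_Icc] at ha hb
        exact hinj a b (by omega) (by omega) hab
    have c2 : (Finset.Ioo m n).card ≤ (Finset.range m).card := by
      refine Finset.card_le_card_of_injOn f (fun a ha => ?_) (fun a ha b hb hab => ?_)
      · simp only [Finset.coe_Ioo, mem_Ioo] at ha
        simp only [Finset.coe_range, mem_Iio]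
        exact h2 a ha.1 ha.2
      · simp only [Finset.coe_Ioo, mem_Ioo] at ha hb
        exact hinj a b (by omega) (by omega) hab
    simp only [Nat.card_Icc, Nat.card_Ioo, Finset.card_range] at c1 c2
    omega
  obtain ⟨g, hg, hg'⟩ := exists_offset (0 : ZMod n) (σ 0)
  have hn := key 0 g hg hg'
  refine ⟨g, hn, fun i => ?_⟩
  obtain ⟨m, hm, hm'⟩ := exists_offset i (σ i)
  have := key i m hm hm'
  rw [hm', show m = g by omega]

end ChordSystem

end Shift

end

/-! ### Concavity of the angle between consecutive chords -/

section

section Trigonometry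

/-- The angle between two consecutive diametral chords, as a function of half an exterior angle. -/
def chordAngle (c ψ : ℝ) : ℝ := arccos (cos ψ * (c + cos ψ) / (1 + c * cos ψ))

variable {c : ℝ}

theorem one_add_mul_pos (hc0 : 0 ≤ c) (hc1 : c < 1) {C : ℝ} (hC : -1 ≤ C) : 0 < 1 + c * C := by
  nlinarith

theorem sq_add_pos (hc0 : 0 ≤ c) (hc1 : c < 1) (C : ℝ) : 0 < 1 + 2 * c * C + C ^ 2 := by
  nlinarith [sq_nonneg (c + C)]

/-- The derivative of `chordAngle c` as a function of the cosine. -/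
def chordSlope (c C : ℝ) : ℝ := (c + 2 * C + c * C ^ 2) / ((1 + c * C) * √(1 + 2 * c * C + C ^ 2))

/-- The quotient rule leaves a numerator whose two terms carry the factors `1 - c ^ 2` and `1 - C ^
2`, so the derivative is positive in the open interval. -/
theorem strictMonoOn_chordSlope (hc0 : 0 ≤ c) (hc1 : c < 1) :
    StrictMonoOn (chordSlope c) (Icc (-1) 1) := by
  have hd : ∀ C ∈ Icc (-1 : ℝ) 1, HasDerivAt (chordSlope c)
      (((1 - c ^ 2) * (1 + 2 * c * C + C ^ 2) + (1 + c * C) * ((1 - c ^ 2) * (1 - C ^ 2))) /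
        ((1 + c * C) ^ 2 * √(1 + 2 * c * C + C ^ 2) ^ 3)) C := by
    intro C hC
    have ha := one_add_mul_pos hc0 hc1 hC.1
    have hr := sq_add_pos hc0 hc1 C
    have hR : 0 < √(1 + 2 * c * C + C ^ 2) := Real.sqrt_pos.2 hr
    have hR2 := Real.sq_sqrt hr.le
    have d1 : HasDerivAt (fun C => c + 2 * C + c * C ^ 2) (2 + c * (2 * C)) C := by
      exact ((((hasDerivAt_id C).const_mul 2).const_add c).add
        ((hasDerivAt_pow 2 C).const_mul c)).congr_deriv (by simp)
    have d2 : HasDerivAt (fun C => 1 + c * C) c C := by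
      simpa using ((hasDerivAt_id C).const_mul c).const_add 1
    have d3 : HasDerivAt (fun C => 1 + 2 * c * C + C ^ 2) (2 * c + 2 * C) C := by
      exact ((((hasDerivAt_id C).const_mul (2 * c)).const_add 1).add
        (hasDerivAt_pow 2 C)).congr_deriv (by simp)
    have d4 := d1.div (d2.mul (d3.sqrt hr.ne')) (mul_pos ha hR).ne'
    refine d4.congr_deriv ?_
    simp only [Pi.mul_apply]
    rw [div_eq_div_iff (by positivity) (by positivity)]
    set R := √(1 + 2 * c * C + C ^ 2) with hRdef
    have e : (2 * c + 2 * C) / (2 * R) = (c + C) / R := by field_simp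
    rw [e]
    field_simp
    rw [hR2]
    ring
  refine strictMonoOn_of_deriv_pos (convex_Icc _ _)
    (fun C hC => (hd C hC).continuousAt.continuousWithinAt) fun C hC => ?_
  rw [interior_Icc] at hC
  rw [(hd C ⟨hC.1.le, hC.2.le⟩).deriv]
  have ha := one_add_mul_pos hc0 hc1 hC.1.le
  have hr := sq_add_pos hc0 hc1 C
  have hR : 0 < √(1 + 2 * c * C + C ^ 2) := Real.sqrt_pos.2 hr
  have h1 : 0 < 1 - c ^ 2 := by nlinarith
  have h2 : 0 < 1 - C ^ 2 := by nlinarith [hC.1, hC.2]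
  positivity

theorem continuous_chordAngle (hc0 : 0 ≤ c) (hc1 : c < 1) : Continuous (chordAngle c) := by
  unfold chordAngle
  refine Real.continuous_arccos.comp (Continuous.div (by fun_prop) (by fun_prop) fun ψ => ?_)
  exact (one_add_mul_pos hc0 hc1 (Real.neg_one_le_cos ψ)).ne'

theorem hasDerivAt_chordAngle (hc0 : 0 ≤ c) (hc1 : c < 1) {ψ : ℝ} (hψ : ψ ∈ Ioo 0 π) :
    HasDerivAt (chordAngle c) (chordSlope c (cos ψ)) ψ := by
  have hS : 0 < sin ψ := Real.sin_pos_of_mem_Ioo hψ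
  have hSC := Real.sin_sq_add_cos_sq ψ
  have ha := one_add_mul_pos hc0 hc1 (Real.neg_one_le_cos ψ)
  have hr := sq_add_pos hc0 hc1 (cos ψ)
  have hR : 0 < √(1 + 2 * c * cos ψ + cos ψ ^ 2) := Real.sqrt_pos.2 hr
  have hR2 := Real.sq_sqrt hr.le
  have d1 : HasDerivAt (fun ψ => cos ψ * (c + cos ψ)) (-sin ψ * (c + cos ψ) + cos ψ * -sin ψ) ψ :=
    (Real.hasDerivAt_cos ψ).mul ((Real.hasDerivAt_cos ψ).const_add c)
  have d2 : HasDerivAt (fun ψ => 1 + c * cos ψ) (c * -sin ψ) ψ :=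
    ((Real.hasDerivAt_cos ψ).const_mul c).const_add 1
  have d3 := d1.div d2 ha.ne'
  -- The sine of `chordAngle` has a closed form because, with `C = cos ψ`, the difference of squares
  -- `(1 + c * C) ^ 2 - (C * (c + C)) ^ 2` factors as `(1 - C ^ 2) * (1 + 2 * c * C + C ^ 2)`.
  have e : 1 - (cos ψ * (c + cos ψ) / (1 + c * cos ψ)) ^ 2 =
      (sin ψ * √(1 + 2 * c * cos ψ + cos ψ ^ 2) / (1 + c * cos ψ)) ^ 2 := by
    rw [div_pow, div_pow, mul_pow (sin ψ), hR2, eq_div_iff (pow_ne_zero 2 ha.ne'),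
      sub_mul, div_mul_cancel₀ _ (pow_ne_zero 2 ha.ne')]
    linear_combination (-(1 + 2 * c * cos ψ + cos ψ ^ 2)) * hSC
  have hpos : 0 < sin ψ * √(1 + 2 * c * cos ψ + cos ψ ^ 2) / (1 + c * cos ψ) := by positivity
  have hlt : (cos ψ * (c + cos ψ) / (1 + c * cos ψ)) ^ 2 < 1 := by
    have : 0 < (sin ψ * √(1 + 2 * c * cos ψ + cos ψ ^ 2) / (1 + c * cos ψ)) ^ 2 := by positivity
    linarith
  have d4 := (Real.hasDerivAt_arccos (x := cos ψ * (c + cos ψ) / (1 + c * cos ψ))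
    (by intro h; rw [h] at hlt; norm_num at hlt) (by intro h; rw [h] at hlt; norm_num at hlt)).comp ψ d3
  refine d4.congr_deriv ?_
  rw [e, Real.sqrt_sq hpos.le, chordSlope]
  field_simp
  ring

/-- The derivative at `ψ` is the increasing function `chordSlope c` of the decreasing function `cos
ψ`. -/
theorem strictConcaveOn_chordAngle (hc0 : 0 ≤ c) (hc1 : c < 1) :
    StrictConcaveOn ℝ (Icc 0 π) (chordAngle c) := by
  refine StrictAntiOn.strictConcaveOn_of_deriv (convex_Icc _ _)
    (continuous_chordAngle hc0 hc1).continuousOn ?_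
  rw [interior_Icc]
  intro a ha b hb hab
  rw [(hasDerivAt_chordAngle hc0 hc1 ha).deriv, (hasDerivAt_chordAngle hc0 hc1 hb).deriv]
  exact strictMonoOn_chordSlope hc0 hc1 ⟨Real.neg_one_le_cos _, Real.cos_le_one _⟩
    ⟨Real.neg_one_le_cos _, Real.cos_le_one _⟩
    (Real.strictAntiOn_cos ⟨ha.1.le, ha.2.le⟩ ⟨hb.1.le, hb.2.le⟩ hab)

theorem chordAngle_zero (hc0 : 0 ≤ c) : chordAngle c 0 = 0 := by
  rw [chordAngle, Real.cos_zero, one_mul, mul_one, add_comm c 1, div_self (by linarith), arccos_one]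

theorem strictMonoOn_chordAngle (hc0 : 0 ≤ c) (hc1 : c < 1) :
    StrictMonoOn (chordAngle c) (Icc 0 (π / 2)) := by
  refine strictMonoOn_of_deriv_pos (convex_Icc _ _)
    (continuous_chordAngle hc0 hc1).continuousOn fun ψ hψ => ?_
  rw [interior_Icc] at hψ
  rw [(hasDerivAt_chordAngle hc0 hc1 ⟨hψ.1, by linarith [hψ.2, pi_pos]⟩).deriv, chordSlope]
  have hC := Real.cos_pos_of_mem_Ioo ⟨by linarith [hψ.1, pi_pos], hψ.2⟩
  have := sq_add_pos hc0 hc1 (cos ψ)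
  have := Real.sqrt_pos.2 this
  positivity

/-- If the angles of a closed chain of chords add up to at least `π`, then the mean of the
arguments is at least the argument at which `chordAngle` takes the mean value. -/
theorem le_sum_of_pi_le {ι : Type*} [Fintype ι] [Nonempty ι] (hc0 : 0 ≤ c) (hc1 : c < 1)
    {ψ : ι → ℝ} (hψ : ∀ i, ψ i ∈ Icc 0 π) {ψ₀ : ℝ} (h0 : ψ₀ ∈ Icc 0 (π / 2))
    (hψ₀ : chordAngle c ψ₀ = π / Fintype.card ι) (hsum : π ≤ ∑ i, chordAngle c (ψ i)) :
    Fintype.card ι * ψ₀ ≤ ∑ i, ψ i ∧ ((∃ i j, ψ i ≠ ψ j) → Fintype.card ι * ψ₀ < ∑ i, ψ i) := by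
  have hn : (0 : ℝ) < Fintype.card ι := by exact_mod_cast Fintype.card_pos
  set N : ℝ := (Fintype.card ι : ℝ) with hN
  have hw : ∑ _i : ι, (1 / N) = 1 := by
    rw [Finset.sum_const, Finset.card_univ, nsmul_eq_mul, ← hN, mul_one_div, div_self hn.ne']
  set m := ∑ i, (1 / N) • ψ i with hm
  have hmsum : N * m = ∑ i, ψ i := by
    rw [hm, ← Finset.smul_sum, smul_eq_mul, ← mul_assoc, mul_one_div, div_self hn.ne', one_mul]
  have hmem : m ∈ Icc 0 π := (convex_Icc 0 π).sum_mem (fun i _ => by positivity) hw fun i _ => hψ i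
  have hG : chordAngle c ψ₀ ≤ ∑ i, (1 / N) • chordAngle c (ψ i) := by
    rw [hψ₀, ← Finset.smul_sum, smul_eq_mul, div_eq_inv_mul, one_div]
    exact mul_le_mul_of_nonneg_left hsum (by positivity)
  -- Monotonicity is available only up to `π / 2`, which suffices: a point below `ψ₀` is in that
  -- range.
  have hle : ∀ t, t ∈ Icc 0 π → chordAngle c ψ₀ ≤ chordAngle c t → ψ₀ ≤ t := by
    intro t ht h
    by_contra! hlt
    exact absurd (strictMonoOn_chordAngle hc0 hc1 ⟨ht.1, by linarith [h0.2]⟩ h0 hlt) (not_lt.2 h)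
  constructor
  · rw [← hmsum]
    refine mul_le_mul_of_nonneg_left (hle m hmem (hG.trans ?_)) hn.le
    exact (strictConcaveOn_chordAngle hc0 hc1).concaveOn.le_map_sum (fun i _ => by positivity) hw
      fun i _ => hψ i
  · rintro ⟨i, j, hij⟩
    have hlt := hG.trans_lt ((strictConcaveOn_chordAngle hc0 hc1).lt_map_sum
      (fun i _ => by positivity) hw (fun i _ => hψ i)
      ⟨i, Finset.mem_univ _, j, Finset.mem_univ _, hij⟩)
    rw [← hm] at hlt
    rw [← hmsum]
    refine mul_lt_mul_of_pos_left (lt_of_le_of_ne (hle m hmem hlt.le) ?_) hn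
    intro h
    rw [h] at hlt
    exact hlt.false

end Trigonometry

end

/-! ### The sum of the angles between consecutive chords -/

section

open InnerProductGeometry

section ChordAngles

theorem sum_range_zmod {M : Type*} [AddCommMonoid M] {n : ℕ} [NeZero n] (F : ZMod n → M) :
    ∑ j ∈ Finset.range n, F (j : ZMod n) = ∑ i, F i := by
  refine Finset.sum_bij (fun j _ => (j : ZMod n)) (fun _ _ => Finset.mem_univ _)
    (fun a ha b hb hab => ?_) (fun i _ => ⟨i.val, ?_, ?_⟩) fun _ _ => rfl
  · exact offset_inj (i := 0) (Finset.mem_range.1 ha) (Finset.mem_range.1 hb) (by simpa using hab)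
  · exact Finset.mem_range.2 (ZMod.val_lt i)
  · simp

theorem angle_le_sum (M : ℕ → E3) (hM : M 0 ≠ 0) (k : ℕ) :
    angle (M 0) (M k) ≤ ∑ j ∈ Finset.range k, angle (M j) (M (j + 1)) := by
  induction k with
  | zero => simp [angle_self hM]
  | succ k ih =>
    rw [Finset.sum_range_succ]
    exact (angle_le_angle_add_angle _ (M k) _).trans (by linarith)

/-- A polygonal line on the sphere joining antipodes has length at least `π`. -/
theorem pi_le_sum_angle (M : ℕ → E3) (hM : M 0 ≠ 0) {k : ℕ} (hk : M k = -M 0) :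
    π ≤ ∑ j ∈ Finset.range k, angle (M j) (M (j + 1)) := by
  refine le_trans (le_of_eq ?_) (angle_le_sum M hM k)
  rw [hk, angle_neg_right, angle_self hM, sub_zero]

/-- With alternating signs the closed sequence becomes a path which, `n` being odd, ends at the
antipode of its start; the sign changes turn its steps into the angles in the sum. -/
theorem pi_le_sum_angle_neg {n g : ℕ} [NeZero n] (hn : n = 2 * g + 1) (N : ℕ → E3) (hN : N 0 ≠ 0)
    (hper : N n = N 0) : π ≤ ∑ j ∈ Finset.range n, angle (N j) (-N (j + 1)) := by
  have := pi_le_sum_angle (fun k => (-1 : ℝ) ^ k • N k) (by simpa using hN) (k := n) (by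
    rw [hper, hn, pow_succ, pow_mul]; simp)
  refine this.trans (le_of_eq (Finset.sum_congr rfl fun j _ => ?_))
  rcases neg_one_pow_eq_or ℝ j with h | h
  · simp [h, pow_succ]
  · simp only [h, pow_succ, neg_smul, one_smul, neg_mul_neg, mul_one]
    rw [← angle_neg_neg, neg_neg]

theorem det3_mul_det3 (a b c d : E3) : det3 a b c * det3 a b d =
    ⟪a, a⟫_ℝ * (⟪b, b⟫_ℝ * ⟪c, d⟫_ℝ - ⟪b, d⟫_ℝ * ⟪c, b⟫_ℝ)
    - ⟪a, b⟫_ℝ * (⟪b, a⟫_ℝ * ⟪c, d⟫_ℝ - ⟪b, d⟫_ℝ * ⟪c, a⟫_ℝ)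
    + ⟪a, d⟫_ℝ * (⟪b, a⟫_ℝ * ⟪c, b⟫_ℝ - ⟪b, b⟫_ℝ * ⟪c, a⟫_ℝ) := by
  simp only [det3_eq, inner_eq_coord]; ring

namespace ChordSystem

variable {n : ℕ} [NeZero n] {v w x : ZMod n → E3} {σ : ZMod n → ZMod n} {c s : ℝ} {g : ℕ}

theorem cast_shift (hn : n = 2 * g + 1) : (g : ZMod n) + g + 1 = 0 := by
  have : ((2 * g + 1 : ℕ) : ZMod n) = 0 := by rw [← hn, ZMod.natCast_self]
  push_cast at this
  linear_combination this

theorem sigma_shift (hn : n = 2 * g + 1) (hσ : ∀ i, σ i = i + g) (i : ZMod n) :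
    σ (i + g + 1) = i := by
  rw [hσ]; linear_combination cast_shift hn

theorem mul_inner_x_w (h : ChordSystem n v w x σ c s) (hσ : ∀ i, σ i = i + g) (i : ZMod n) :
    c * ⟪x i, w i⟫_ℝ = -⟪w (i + g), w i⟫_ℝ := by
  have := congrArg (fun u => ⟪u, w i⟫_ℝ) (h.eq_v i)
  simp only [inner_add_left, real_inner_smul_left, h.pair.inner_left, hσ] at this
  linarith

/-- The chords of `v i` and `v (i + g)` cut equal angles off at the ends of the chord-like pair `w
(i + g)`, `w (i - 1)`: multiplied by `c`, both sides equal `-⟪w (i + g), w (i - 1)⟫`. Thus a single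
family of angles describes both parts of every exterior angle. -/
theorem inner_x_w_prev (h : ChordSystem n v w x σ c s) (hn : n = 2 * g + 1)
    (hσ : ∀ i, σ i = i + g) (hc : 0 < c) (i : ZMod n) :
    ⟪x i, w (i - 1)⟫_ℝ = ⟪x (i + g), w (i + g)⟫_ℝ := by
  have h1 := congrArg (fun u => ⟪u, w (i - 1)⟫_ℝ) (h.eq_v i)
  have h0 := h.pair.inner_right (i - 1)
  rw [sub_add_cancel] at h0
  simp only [inner_add_left, real_inner_smul_left, h0, hσ] at h1
  have h2 := h.mul_inner_x_w hσ (i + g)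
  rw [show i + (g : ZMod n) + g = i - 1 by linear_combination cast_shift hn,
    real_inner_comm (w (i + g)) (w (i - 1))] at h2
  exact mul_left_cancel₀ hc.ne' (by linarith)

/-- The two parts of an exterior angle of the polygon. -/
theorem angle_w_w (h : ChordSystem n v w x σ c s) (hn : n = 2 * g + 1)
    (hσ : ∀ i, σ i = i + g) (hc : 0 < c) (i : ZMod n) :
    angle (w (i - 1)) (w i) = angle (x (i + g)) (w (i + g)) + angle (x i) (w i) := by
  obtain ⟨a, b, ha, hb, -, e⟩ := h.edge i
  have hx : x i ≠ 0 := by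
    rw [← norm_ne_zero_iff, h.norm_x]; exact one_ne_zero
  rw [angle_eq_angle_add_add_angle_add_of_mem_span hx (z := w i) (x := w (i - 1))
    (by
      rw [Submodule.mem_span_pair]
      exact ⟨⟨a, ha⟩, ⟨b, hb⟩, by rw [e]; rfl⟩)]
  congr 1
  rw [angle_comm, angle, angle, h.inner_x_w_prev hn hσ hc]
  simp only [h.norm_x, h.pair.norm_w]

/-- The angle between the foot of the chord at `v i` and the chord at `v (i + g + 1)`. -/
theorem chord_pair (h : ChordSystem n v w x σ c s) (hn : n = 2 * g + 1)
    (hσ : ∀ i, σ i = i + g) (i : ZMod n) :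
    ⟪v i, v (i + g + 1)⟫_ℝ * (1 + c * ⟪x i, w i⟫_ℝ) = c * (c + ⟪x i, w i⟫_ℝ) := by
  have hP := h.pair
  have i1 : ⟪v i, w (i + g)⟫_ℝ = s := by have := h.inner_v_w i; rwa [hσ] at this
  have i2 : ⟪v (i + g + 1), w i⟫_ℝ = s := by
    have := h.inner_v_w (i + g + 1); rwa [sigma_shift hn hσ] at this
  have i3 : ⟪v (i + g + 1), w (i + g)⟫_ℝ = 0 := hP.inner_right _
  have i4 := hP.inner_left i
  have hs := h.s_pos
  have hsc := h.sq
  have hc0 := h.c_nonneg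
  set p := ⟪v i, v (i + g + 1)⟫_ℝ with hp
  set q := ⟪w (i + g), w i⟫_ℝ with hq
  -- The sign comes from the foot of the perpendicular from `v i`, which lies between the ends of
  -- the opposite side. `D2` is the same for the perpendicular from `v (i + g + 1)`.
  have D1 : 0 ≤ det3 (v i) (v (i + g + 1)) (w (i + g)) := by
    obtain ⟨a, b, ha, -, e⟩ := h.foot i
    obtain ⟨r, hr, er⟩ := hP.cross_v (i + g)
    rw [hσ] at e
    have e1 : s • v i = c • (a • v (i + g) + b • v (i + g + 1)) + s ^ 2 • w (i + g) := by
      rw [← e, h.eq_v, hσ, show s ^ 2 = 1 - c ^ 2 by linarith]; module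
    have : s * det3 (v i) (v (i + g + 1)) (w (i + g)) = c * (a * r) := by
      rw [← det3_smul_left, e1]
      simp only [det3_add_left, det3_smul_left, det3_self_left, det3_self_outer, mul_zero, add_zero]
      rw [← cross_inner, er, real_inner_smul_left, hP.inner_self_w, mul_one]
    have h2 : 0 ≤ s * det3 (v i) (v (i + g + 1)) (w (i + g)) := by rw [this]; positivity
    exact nonneg_of_mul_nonneg_right h2 hs
  have D2 : 0 ≤ det3 (v i) (v (i + g + 1)) (w i) := by
    obtain ⟨a, b, -, hb, e⟩ := h.foot (i + g + 1)
    obtain ⟨r, hr, er⟩ := hP.cross_v i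
    rw [sigma_shift hn hσ] at e
    have e1 : s • v (i + g + 1) = c • (a • v i + b • v (i + 1)) + s ^ 2 • w i := by
      rw [← e, h.eq_v, sigma_shift hn hσ, show s ^ 2 = 1 - c ^ 2 by linarith]; module
    have : s * det3 (v i) (v (i + g + 1)) (w i) = c * (b * r) := by
      rw [← det3_smul_mid, e1]
      simp only [det3_add_mid, det3_smul_mid, det3_self_left, det3_self_right, mul_zero, add_zero,
        zero_add]
      rw [← cross_inner, er, real_inner_smul_left, hP.inner_self_w, mul_one]
    have h2 : 0 ≤ s * det3 (v i) (v (i + g + 1)) (w i) := by rw [this]; positivity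
    exact nonneg_of_mul_nonneg_right h2 hs
  have g1 := det3_mul_det3 (v i) (v (i + g + 1)) (w (i + g)) (w (i + g))
  have g2 := det3_mul_det3 (v i) (v (i + g + 1)) (w i) (w i)
  have g3 := det3_mul_det3 (v i) (v (i + g + 1)) (w (i + g)) (w i)
  simp only [hP.inner_self_v, hP.inner_self_w, real_inner_comm (v i) (v (i + g + 1)), i1, i2, i3, i4,
    real_inner_comm (v i) (w i), real_inner_comm (v i) (w (i + g)),
    real_inner_comm (v (i + g + 1)) (w i), real_inner_comm (v (i + g + 1)) (w (i + g)),
    ← hp, ← hq] at g1 g2 g3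
  -- Both vertices have height `s` over the opposite side, so the squares of the determinants agree.
  -- Expanding their product then gives an equation for `p` from which the factor `1 + p` can be
  -- cancelled.
  have hD : det3 (v i) (v (i + g + 1)) (w (i + g)) = det3 (v i) (v (i + g + 1)) (w i) := by
    rw [← sq_eq_sq₀ D1 D2, pow_two, pow_two, g1, g2]; ring
  rw [hD, g2] at g3
  have hp1 : 0 < 1 + p := by
    have : 0 ≤ c ^ 2 - p ^ 2 := by
      have := mul_self_nonneg (det3 (v i) (v (i + g + 1)) (w i))
      rw [g2] at this
      linarith
    have : p ^ 2 < 1 := by nlinarith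
    nlinarith
  have hC := h.mul_inner_x_w hσ i
  rw [← hq] at hC
  have : (1 + p) * (p * (1 + c * ⟪x i, w i⟫_ℝ) - c * (c + ⟪x i, w i⟫_ℝ)) = 0 := by
    linear_combination (-1 - p + p * (1 + p)) * hC - g3 + (-1 - p) * hsc
  linarith [(mul_eq_zero.1 this).resolve_left hp1.ne']

theorem angle_x_w (h : ChordSystem n v w x σ c s) (i : ZMod n) :
    cos (angle (x i) (w i)) = ⟪x i, w i⟫_ℝ := by
  rw [cos_angle, h.norm_x, h.pair.norm_w, mul_one, div_one]

/-- The cross products are normals of the planes of two consecutive chords, both of length `c`;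
`chord_pair` evaluates their inner product in terms of the angle at `x i`. -/
theorem angle_cross_cross (h : ChordSystem n v w x σ c s) (hn : n = 2 * g + 1)
    (hσ : ∀ i, σ i = i + g) (hc : 0 < c) (i : ZMod n) :
    angle (cross (v i) (w (i + g))) (-cross (v (i + g + 1)) (w i)) =
      chordAngle c (angle (x i) (w i)) := by
  have hP := h.pair
  have i1 : ⟪v i, w (i + g)⟫_ℝ = s := by have := h.inner_v_w i; rwa [hσ] at this
  have i2 : ⟪v (i + g + 1), w i⟫_ℝ = s := by
    have := h.inner_v_w (i + g + 1); rwa [sigma_shift hn hσ] at this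
  have nrm : ∀ a b : E3, ‖a‖ = 1 → ‖b‖ = 1 → ⟪a, b⟫_ℝ = s → ‖cross a b‖ = c := by
    intro a b h1 h2 h3
    rw [← sq_eq_sq₀ (norm_nonneg _) hc.le, norm_cross_sq, h1, h2, h3]
    linear_combination -h.sq
  have hpair := h.chord_pair hn hσ i
  have hC := h.mul_inner_x_w hσ i
  have hpos := one_add_mul_pos h.c_nonneg h.c_lt (C := ⟪x i, w i⟫_ℝ) (by
    rw [← h.angle_x_w]; exact Real.neg_one_le_cos _)
  rw [chordAngle, h.angle_x_w, angle, inner_neg_right, norm_neg,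
    nrm _ _ (hP.norm_v _) (hP.norm_w _) i1, nrm _ _ (hP.norm_v _) (hP.norm_w _) i2,
    inner_cross_cross, hP.inner_left, hP.dual.inner_left (i + g)]
  congr 1
  rw [div_eq_div_iff (by positivity) hpos.ne']
  linear_combination (c * ⟪x i, w i⟫_ℝ) * hpair -
    ⟪v i, v (i + g + 1)⟫_ℝ * (1 + c * ⟪x i, w i⟫_ℝ) * hC

/-- The chords are run through in steps of `g + 1`, which is a permutation of the indices since `2 *
(g + 1) = 1` modulo `n`. The assumption `0 < c` keeps the normals of their planes from vanishing. -/
theorem pi_le_sum_chordAngle (h : ChordSystem n v w x σ c s) (hn : n = 2 * g + 1)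
    (hσ : ∀ i, σ i = i + g) (hc : 0 < c) : π ≤ ∑ i, chordAngle c (angle (x i) (w i)) := by
  have hg := cast_shift hn
  have hne : ∀ i, cross (v i) (w (i + g)) ≠ 0 := by
    intro i h0
    have i1 : ⟪v i, w (i + g)⟫_ℝ = s := by have := h.inner_v_w i; rwa [hσ] at this
    have := norm_cross_sq (v i) (w (i + g))
    rw [h0, h.pair.norm_v, h.pair.norm_w, i1, norm_zero] at this
    have := h.sq
    nlinarith
  have key := pi_le_sum_angle_neg hn
    (fun k => cross (v (k * (g + 1))) (w (k * (g + 1) + g))) (hne _) (by simp)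
  refine key.trans (le_of_eq ?_)
  have e : ∀ j : ℕ, angle (cross (v (j * (g + 1))) (w (j * (g + 1) + g)))
      (-cross (v ((j + 1 : ℕ) * (g + 1))) (w ((j + 1 : ℕ) * (g + 1) + g))) =
      chordAngle c (angle (x (j * (g + 1))) (w (j * (g + 1)))) := by
    intro j
    rw [← h.angle_cross_cross hn hσ hc]
    congr 3
    · push_cast; ring_nf
    · push_cast; congr 1; linear_combination hg
  rw [Finset.sum_congr rfl fun j _ => e j,
    sum_range_zmod fun i : ZMod n => chordAngle c (angle (x (i * (g + 1))) (w (i * (g + 1))))]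
  let e : ZMod n ≃ ZMod n :=
    { toFun := fun i => i * (g + 1)
      invFun := fun i => i * 2
      left_inv := fun i => by linear_combination i * hg
      right_inv := fun i => by linear_combination i * hg }
  exact e.sum_comp (fun i => chordAngle c (angle (x i) (w i)))

theorem sum_angle_w_w (h : ChordSystem n v w x σ c s) (hn : n = 2 * g + 1)
    (hσ : ∀ i, σ i = i + g) (hc : 0 < c) :
    ∑ i, angle (w (i - 1)) (w i) = 2 * ∑ i, angle (x i) (w i) := by
  have := Equiv.sum_comp (Equiv.addRight (g : ZMod n)) fun i => angle (x i) (w i)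
  simp only [Equiv.coe_addRight] at this
  rw [Finset.sum_congr rfl fun i _ => h.angle_w_w hn hσ hc i, Finset.sum_add_distrib, this]
  ring

end ChordSystem

end ChordAngles

end

/-! ### The case of equality -/

section

open InnerProductGeometry

section Regular

variable {n : ℕ} [NeZero n]

/-- The vector product with `p` turns the tangent plane at `p` by a right angle, which preserves
inner products. -/
theorem angle_tangentTo (p a b : S2) : angle (tangentTo p a) (tangentTo p b) =
    angle (cross (p : E3) (a : E3)) (cross (p : E3) (b : E3)) := by
  have key : ∀ a b : S2, ⟪tangentTo p a, tangentTo p b⟫_ℝ =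
      ⟪cross (p : E3) (a : E3), cross (p : E3) (b : E3)⟫_ℝ := by
    intro a b
    rw [tangentTo, tangentTo, inner_cross_cross, inner_sub_left, inner_sub_right, inner_sub_right,
      real_inner_smul_left, real_inner_smul_right, real_inner_smul_right, real_inner_smul_left,
      inner_self_S2, real_inner_comm (p : E3) (a : E3)]
    ring
  have hn : ∀ a : S2, ‖tangentTo p a‖ = ‖cross (p : E3) (a : E3)‖ := by
    intro a
    rw [← sq_eq_sq₀ (norm_nonneg _) (norm_nonneg _), ← real_inner_self_eq_norm_sq, key,
      real_inner_self_eq_norm_sq]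
  rw [angle, angle, key, hn, hn]

/-- The interior angle of a polygon in terms of the angle between the normals of its sides. -/
theorem PolarPair.sphAngle_eq {v : ZMod n → S2} {w : ZMod n → E3}
    (h : PolarPair n (fun i => (v i : E3)) w) (i : ZMod n) :
    sphAngle (v (i - 1)) (v i) (v (i + 1)) = π - angle (w (i - 1)) (w i) := by
  obtain ⟨r, hr, e⟩ := h.cross_v (i - 1)
  obtain ⟨r', hr', e'⟩ := h.cross_v i
  simp only [sub_add_cancel] at e
  have e2 : cross (v i : E3) (v (i - 1) : E3) = r • -w (i - 1) := by
    rw [smul_neg, ← e]; apply ext3 <;> simp <;> ring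
  rw [sphAngle, angle_tangentTo, e2, e', angle_smul_left_of_pos _ _ hr,
    angle_smul_right_of_pos _ _ hr', angle_neg_left]

theorem PolarPair.isCounterclockwise {v : ZMod n → S2} {w : ZMod n → E3}
    (h : PolarPair n (fun i => (v i : E3)) w) : IsCounterclockwise n v := fun i j h1 h2 =>
  h.pos_v.local (by have := h.three_le; omega) i j h1 h2

namespace ChordSystem

variable {v w x : ZMod n → E3} {σ : ZMod n → ZMod n} {c s : ℝ} {g : ℕ}

/-- The two parts into which the foot of a chord divides a side. -/
theorem angle_v_v (h : ChordSystem n v w x σ c s) (hn : n = 2 * g + 1)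
    (hσ : ∀ i, σ i = i + g) (hc : 0 < c) (i : ZMod n) :
    angle (v (i + g)) (v (i + g + 1)) = arccos (⟪v (i + g), v (i + g + g + 1)⟫_ℝ / c) +
      arccos (⟪v i, v (i + g + 1)⟫_ℝ / c) := by
  have hP := h.pair
  have hs := h.s_pos
  obtain ⟨a, b, ha, hb, e⟩ := h.foot i
  rw [hσ] at e
  set t := x i + c • w (i + g) with ht
  have hix := h.inner_eq i
  rw [hσ] at hix
  have hnt : ‖t‖ = s := by
    rw [← sq_eq_sq₀ (norm_nonneg _) hs.le, ht, norm_add_sq_real, real_inner_smul_right, hix,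
      norm_smul, h.norm_x, hP.norm_w, norm_of_nonneg hc.le]
    linear_combination -h.sq
  have ht0 : t ≠ 0 := by rw [← norm_ne_zero_iff, hnt]; exact hs.ne'
  -- So `t` points to the foot of the perpendicular from `v i` on the opposite side.
  have hct : c • t = s • v i - s ^ 2 • w (i + g) := by
    rw [h.eq_v, hσ, show s ^ 2 = 1 - c ^ 2 by linarith [h.sq], ht]; module
  have key : ∀ j, ⟪v j, w (i + g)⟫_ℝ = 0 → angle t (v j) = arccos (⟪v i, v j⟫_ℝ / c) := by
    intro j hj
    have := congrArg (fun u => ⟪u, v j⟫_ℝ) hct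
    simp only [inner_sub_left, real_inner_smul_left, real_inner_comm (v j) (w (i + g)), hj] at this
    rw [angle, hnt, hP.norm_v]
    congr 1
    rw [div_eq_div_iff (by positivity) hc.ne']
    linarith
  rw [angle_eq_angle_add_add_angle_add_of_mem_span ht0 (z := v (i + g + 1)) (x := v (i + g))
    (by
      rw [Submodule.mem_span_pair]
      exact ⟨⟨a, ha⟩, ⟨b, hb⟩, by rw [e]; rfl⟩), key _ (hP.inner_right _), angle_comm,
    key _ (hP.inner_left _), real_inner_comm,
    show i + (g : ZMod n) + g + 1 = i by linear_combination cast_shift hn]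

end ChordSystem

/-- If all the angles at the feet of the chords are equal, the polygon is regular. -/
theorem ChordSystem.isRegularPolygon {v : ZMod n → S2} {w x : ZMod n → E3}
    {σ : ZMod n → ZMod n} {c s : ℝ} {g : ℕ} (h : ChordSystem n (fun i => (v i : E3)) w x σ c s)
    (hn : n = 2 * g + 1) (hσ : ∀ i, σ i = i + g) (hc : 0 < c)
    (hψ : ∀ i j, angle (x i) (w i) = angle (x j) (w j)) :
    IsRegularPolygon n (hull (range v)) := by
  have hcc : ∀ i j, ⟪x i, w i⟫_ℝ = ⟪x j, w j⟫_ℝ := fun i j => by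
    rw [← h.angle_x_w, hψ i j, h.angle_x_w]
  have hp : ∀ i j, ⟪(v i : E3), (v (i + g + 1) : E3)⟫_ℝ = ⟪(v j : E3), (v (j + g + 1) : E3)⟫_ℝ := by
    intro i j
    have h1 := h.chord_pair hn hσ i
    have h2 := h.chord_pair hn hσ j
    have hpos := one_add_mul_pos h.c_nonneg h.c_lt (C := ⟪x i, w i⟫_ℝ) (by
      rw [← h.angle_x_w]; exact Real.neg_one_le_cos _)
    rw [hcc j i] at h2
    exact mul_right_cancel₀ hpos.ne' (h1.trans h2.symm)
  refine ⟨v, h.pair.inConvexPosition, rfl, h.pair.isCounterclockwise, fun i j => ?_, fun i j => ?_⟩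
  · have key : ∀ i, sphDist (v i) (v (i + 1)) = arccos (⟪(v 0 : E3), (v (0 + g + 1) : E3)⟫_ℝ / c) +
        arccos (⟪(v 0 : E3), (v (0 + g + 1) : E3)⟫_ℝ / c) := by
      intro i
      have := h.angle_v_v hn hσ hc (i - g)
      rw [sub_add_cancel, hp i 0] at this
      have h2 := hp (i - g) 0
      rw [sub_add_cancel] at h2
      rw [h2] at this
      exact this
    rw [key i, key j]
  · rw [h.pair.sphAngle_eq, h.pair.sphAngle_eq, h.angle_w_w hn hσ hc, h.angle_w_w hn hσ hc,
      hψ (i + g) (j + g), hψ i j]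

end Regular

end

/-! ### Solid angles of lunes and Girard's formula -/

section

open InnerProductGeometry
open scoped Pointwise

section Area

/-- Lebesgue measure on the unit ball, by which solid angles are measured. -/
def ballMeasure : Measure E3 := volume.restrict (ball 0 1)

instance : IsFiniteMeasure ballMeasure := by
  unfold ballMeasure
  exact ⟨by rw [Measure.restrict_apply_univ]; exact measure_ball_lt_top⟩

theorem measurePreserving_ballMeasure (Φ : E3 ≃ₗᵢ[ℝ] E3) :
    MeasurePreserving Φ ballMeasure ballMeasure := by
  have := Φ.measurePreserving.restrict_preimage (s := ball (0 : E3) 1) measurableSet_ball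
  have e : Φ ⁻¹' ball (0 : E3) 1 = ball 0 1 := by
    ext y; simp
  rwa [e] at this

theorem ballMeasure_plane {a : E3} (ha : a ≠ 0) : ballMeasure {y | ⟪a, y⟫_ℝ = 0} = 0 := by
  have hne : (ℝ ∙ a)ᗮ ≠ ⊤ := by
    intro h
    have : a ∈ (ℝ ∙ a)ᗮ := by rw [h]; trivial
    exact ha (inner_self_eq_zero.1 (Submodule.mem_orthogonal_singleton_iff_inner_right.1 this))
  have h0 : volume ({y | ⟪a, y⟫_ℝ = 0} : Set E3) = 0 := by
    have := Measure.addHaar_submodule (volume : Measure E3) _ hne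
    convert this using 2
    ext y
    simp [Submodule.mem_orthogonal_singleton_iff_inner_right]
  exact le_antisymm ((Measure.restrict_apply_le _ _).trans h0.le) (zero_le)

/-- The points on the positive side of `a` and on the negative side of `b`. -/
def lune (a b : E3) : Set E3 := {y | 0 < ⟪a, y⟫_ℝ ∧ ⟪b, y⟫_ℝ < 0}

theorem measurableSet_lune (a b : E3) : MeasurableSet (lune a b) := by
  have h1 : IsOpen {y : E3 | 0 < ⟪a, y⟫_ℝ} := isOpen_lt (by fun_prop) (by fun_prop)
  have h2 : IsOpen {y : E3 | ⟪b, y⟫_ℝ < 0} := isOpen_lt (by fun_prop) (by fun_prop)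
  exact (h1.inter h2).measurableSet

/-- Two pairs of unit vectors at the same angle are congruent. -/
theorem exists_isometry {a b a' b' : E3} (ha : ‖a‖ = 1) (hb : ‖b‖ = 1) (ha' : ‖a'‖ = 1)
    (hb' : ‖b'‖ = 1) (h : ⟪a, b⟫_ℝ = ⟪a', b'⟫_ℝ) : ∃ Φ : E3 ≃ₗᵢ[ℝ] E3, Φ a = a' ∧ Φ b = b' := by
  let Φ₁ : E3 ≃ₗᵢ[ℝ] E3 := (ℝ ∙ (a - a'))ᗮ.reflection
  have h1 : Φ₁ a = a' := Submodule.reflection_sub (ha.trans ha'.symm)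
  let Φ₂ : E3 ≃ₗᵢ[ℝ] E3 := (ℝ ∙ (Φ₁ b - b'))ᗮ.reflection
  have h2 : Φ₂ (Φ₁ b) = b' := Submodule.reflection_sub (by rw [Φ₁.norm_map, hb, hb'])
  have h3 : Φ₂ a' = a' := by
    refine Submodule.reflection_mem_subspace_eq_self ?_
    rw [Submodule.mem_orthogonal_singleton_iff_inner_left, inner_sub_right, ← h, sub_eq_zero]
    nth_rw 1 [← h1]
    exact Φ₁.inner_map_map a b
  exact ⟨Φ₁.trans Φ₂, by simp [h1, h3], by simp [h2]⟩

theorem ballMeasure_lune_congr {a b a' b' : E3} (ha : ‖a‖ = 1) (hb : ‖b‖ = 1) (ha' : ‖a'‖ = 1)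
    (hb' : ‖b'‖ = 1) (h : ⟪a, b⟫_ℝ = ⟪a', b'⟫_ℝ) :
    ballMeasure.real (lune a b) = ballMeasure.real (lune a' b') := by
  obtain ⟨Φ, rfl, rfl⟩ := exists_isometry ha hb ha' hb' h
  rw [← (measurePreserving_ballMeasure Φ).measureReal_preimage
    (measurableSet_lune (Φ a) (Φ b)).nullMeasurableSet]
  congr 1
  ext y
  show _ ↔ 0 < ⟪Φ a, Φ y⟫_ℝ ∧ ⟪Φ b, Φ y⟫_ℝ < 0
  rw [Φ.inner_map_map, Φ.inner_map_map]
  rfl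

theorem ballMeasure_pos : 0 < ballMeasure.real univ := by
  rw [measureReal_def, ENNReal.toReal_pos_iff]
  refine ⟨?_, measure_lt_top _ _⟩
  rw [ballMeasure, Measure.restrict_apply_univ]
  exact measure_ball_pos _ _ one_pos

theorem ballMeasure_halfSpace {a : E3} (ha : ‖a‖ = 1) :
    ballMeasure.real (lune a (-a)) = ballMeasure.real univ / 2 := by
  have ha0 : a ≠ 0 := by rw [← norm_ne_zero_iff, ha]; exact one_ne_zero
  have h1 := ballMeasure_lune_congr ha (by rwa [norm_neg]) (a' := -a) (b' := - -a)
    (by rwa [norm_neg]) (by rwa [norm_neg, norm_neg]) (by simp)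
  have hd : Disjoint (lune a (-a)) (lune (-a) (- -a)) := by
    rw [Set.disjoint_left]
    rintro y ⟨hy, -⟩ ⟨hy', -⟩
    rw [inner_neg_left] at hy'
    linarith
  have h2 := measureReal_union (μ := ballMeasure) hd (measurableSet_lune _ _)
  have h3 : (lune a (-a) ∪ lune (-a) (- -a) : Set E3) =ᵐ[ballMeasure] univ := by
    rw [ae_eq_univ]
    refine measure_mono_null (fun y hy => ?_) (ballMeasure_plane ha0)
    by_contra hne
    apply hy
    rcases lt_or_gt_of_ne (show ⟪a, y⟫_ℝ ≠ 0 from hne) with h | h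
    · right; constructor <;> rw [inner_neg_left] <;> [skip; rw [inner_neg_left]] <;> linarith
    · left; exact ⟨h, by rw [inner_neg_left]; linarith⟩
  rw [measureReal_congr h3, ← h1] at h2
  linarith

/-- A non-negative additive function on an interval is linear. -/
theorem eq_mul_of_additive {m : ℝ → ℝ} {L : ℝ} (hL : 0 < L) (h0 : ∀ t, 0 ≤ t → t ≤ L → 0 ≤ m t)
    (hadd : ∀ s t, 0 ≤ s → 0 ≤ t → s + t ≤ L → m (s + t) = m s + m t) {t : ℝ} (ht : 0 ≤ t)
    (htL : t ≤ L) : m t = t / L * m L := by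
  have hmul : ∀ (k : ℕ) (r : ℝ), 0 ≤ r → k * r ≤ L → m (k * r) = k * m r := by
    intro k r hr
    induction k with
    | zero =>
      intro _
      have := hadd 0 0 le_rfl le_rfl (by linarith)
      simp only [add_zero] at this
      simp only [Nat.cast_zero, zero_mul]
      linarith
    | succ k ih =>
      intro hk
      push_cast at hk ⊢
      rw [add_mul, one_mul] at hk ⊢
      rw [hadd _ _ (by positivity) hr hk, ih (by linarith)]
      ring
  have hmono : ∀ s t, 0 ≤ s → s ≤ t → t ≤ L → m s ≤ m t := by
    intro s t hs hst htL
    have := hadd s (t - s) hs (by linarith) (by linarith)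
    rw [add_sub_cancel] at this
    linarith [h0 (t - s) (by linarith) (by linarith)]
  have hmL := h0 L hL.le le_rfl
  -- Both quantities lie between the same two consecutive multiples of `m L / N`.
  have key : ∀ N : ℕ, 0 < N → |m t - t / L * m L| ≤ m L / N := by
    intro N hN
    have hN' : (0 : ℝ) < N := by exact_mod_cast hN
    have hu : m (L / N) = m L / N := by
      have := hmul N (L / N) (by positivity) (by rw [mul_div_cancel₀ _ hN'.ne'])
      rw [mul_div_cancel₀ _ hN'.ne'] at this
      rw [this]; field_simp
    set k := ⌊N * (t / L)⌋₊ with hk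
    have hk1 : (k : ℝ) ≤ N * (t / L) := Nat.floor_le (by positivity)
    have hk2 : N * (t / L) < k + 1 := Nat.lt_floor_add_one _
    have e1 : k * (L / N) ≤ t := by
      have := mul_le_mul_of_nonneg_right hk1 (by positivity : 0 ≤ L / N)
      refine this.trans (le_of_eq ?_); field_simp
    have a1 := hmono _ _ (by positivity) e1 htL
    rw [hmul k _ (by positivity) (e1.trans htL), hu] at a1
    have a2 : m t ≤ (k + 1) * (m L / N) := by
      rcases le_or_gt ((k + 1 : ℕ) * (L / N)) L with h | h
      · have := hmono t ((k + 1 : ℕ) * (L / N)) ht (by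
          have := mul_le_mul_of_nonneg_right hk2.le (by positivity : 0 ≤ L / N)
          push_cast
          refine le_trans (le_of_eq ?_) this; field_simp) h
        rw [hmul _ _ (by positivity) h, hu] at this
        exact_mod_cast this
      · have hkN : (N : ℝ) ≤ k + 1 := by
          push_cast at h
          have := mul_lt_mul_of_pos_right h (by positivity : 0 < N / L)
          have e : ((k : ℝ) + 1) * (L / N) * (N / L) = k + 1 := by field_simp
          rw [e, mul_div_cancel₀ _ hL.ne'] at this
          exact this.le
        refine (hmono t L ht htL le_rfl).trans ?_
        rw [mul_div_assoc', le_div_iff₀ hN']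
        nlinarith
    have b1 : N * (t / L) * (m L / N) = t / L * m L := by field_simp
    have b2 := mul_le_mul_of_nonneg_right hk1 (by positivity : 0 ≤ m L / N)
    have b3 := mul_le_mul_of_nonneg_right hk2.le (by positivity : 0 ≤ m L / N)
    rw [abs_le]
    constructor <;> linarith
  by_contra hne
  have hpos : 0 < |m t - t / L * m L| := abs_pos.2 (sub_ne_zero.2 hne)
  obtain ⟨N, hN⟩ := exists_nat_gt (m L / |m t - t / L * m L|)
  have hN0 : 0 < N := by
    have : 0 ≤ m L / |m t - t / L * m L| := by positivity
    exact_mod_cast this.trans_lt hN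
  have := key N hN0
  rw [div_lt_iff₀ hpos] at hN
  rw [le_div_iff₀ (by exact_mod_cast hN0)] at this
  linarith

/-- The solid angle of a lune is proportional to its angle. -/
theorem ballMeasure_lune {a b : E3} (ha : ‖a‖ = 1) (hb : ‖b‖ = 1) :
    ballMeasure.real (lune a b) = angle a b / π * (ballMeasure.real univ / 2) := by
  let e : E3 := !₂[1, 0, 0]
  let f : E3 := !₂[0, 1, 0]
  let d : ℝ → E3 := fun t => cos t • e + sin t • f
  have hdd : ∀ s t, ⟪d s, d t⟫_ℝ = cos (t - s) := by
    intro s t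
    simp [d, e, f, inner_eq_coord, Real.cos_sub]; ring
  have hd : ∀ t, ‖d t‖ = 1 := by
    intro t
    rw [← sq_eq_sq₀ (norm_nonneg _) zero_le_one, ← real_inner_self_eq_norm_sq, hdd]; simp
  have hd0 : ∀ t, d t ≠ 0 := fun t => by rw [← norm_ne_zero_iff, hd]; exact one_ne_zero
  let m : ℝ → ℝ := fun t => ballMeasure.real (lune (d 0) (d t))
  have hm0 : m 0 = 0 := by
    have : lune (d 0) (d 0) = ∅ := by
      ext y; simp only [lune, Set.mem_ofPred_eq, mem_empty_iff_false, iff_false]; intro h; linarith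
    simp only [m, this, measureReal_empty]
  have hadd : ∀ s t, 0 ≤ s → 0 ≤ t → s + t ≤ π → m (s + t) = m s + m t := by
    intro s t hs ht hst
    rcases hs.eq_or_lt with rfl | hs
    · rw [hm0, zero_add, zero_add]
    rcases ht.eq_or_lt with rfl | ht
    · rw [hm0, add_zero, add_zero]
    have s1 : 0 < sin s := Real.sin_pos_of_pos_of_lt_pi hs (by linarith)
    have s2 : 0 < sin t := Real.sin_pos_of_pos_of_lt_pi ht (by linarith)
    have s3 : 0 ≤ sin (s + t) := Real.sin_nonneg_of_nonneg_of_le_pi (by linarith) hst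
    -- For `0 < s`, `0 < t` and `s + t ≤ π` the direction `d s` lies between `d 0` and `d (s + t)`;
    -- the relation tells which combinations of signs on the three planes occur, and the lune splits
    -- along the middle plane.
    have hlin : ∀ y, sin (s + t) * ⟪d s, y⟫_ℝ = sin s * ⟪d (s + t), y⟫_ℝ + sin t * ⟪d 0, y⟫_ℝ := by
      intro y
      have : sin (s + t) • d s = sin s • d (s + t) + sin t • d 0 := by
        have h1 := Real.sin_sq_add_cos_sq s
        apply ext3 <;> simp [d, e, f, Real.sin_add, Real.cos_add]
        · linear_combination (sin t) * h1
        · ring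
      have := congrArg (fun u => ⟪u, y⟫_ℝ) this
      simpa only [inner_add_left, real_inner_smul_left] using this
    have h1 : ballMeasure.real (lune (d s) (d (s + t))) = m t :=
      ballMeasure_lune_congr (hd _) (hd _) (hd _) (hd _) (by rw [hdd, hdd]; congr 1; ring)
    have hdis : Disjoint (lune (d 0) (d s)) (lune (d s) (d (s + t))) := by
      rw [Set.disjoint_left]
      rintro y ⟨-, hy⟩ ⟨hy', -⟩
      linarith
    have h2 := measureReal_union (μ := ballMeasure) hdis (measurableSet_lune _ _)
    rw [h1] at h2
    rw [← show m s = ballMeasure.real (lune (d 0) (d s)) from rfl] at h2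
    rw [← h2]
    refine measureReal_congr ?_
    have hp : ∀ᵐ y ∂ballMeasure, ⟪d s, y⟫_ℝ ≠ 0 := by
      rw [ae_iff]; simpa using ballMeasure_plane (hd0 s)
    filter_upwards [hp] with y hy
    apply propext
    show (0 < ⟪d 0, y⟫_ℝ ∧ ⟪d (s + t), y⟫_ℝ < 0) ↔
      (0 < ⟪d 0, y⟫_ℝ ∧ ⟪d s, y⟫_ℝ < 0) ∨ (0 < ⟪d s, y⟫_ℝ ∧ ⟪d (s + t), y⟫_ℝ < 0)
    have hl := hlin y
    constructor
    · rintro ⟨h1, h2⟩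
      rcases lt_or_gt_of_ne hy with h | h
      · exact Or.inl ⟨h1, h⟩
      · exact Or.inr ⟨h, h2⟩
    · rintro (⟨h1, h2⟩ | ⟨h1, h2⟩)
      · refine ⟨h1, ?_⟩
        have q1 := mul_nonneg s3 (neg_nonneg.2 h2.le)
        have q2 := mul_pos s2 h1
        by_contra! hcon
        have q3 := mul_nonneg s1.le hcon
        linarith
      · refine ⟨?_, h2⟩
        have q1 := mul_nonneg s3 h1.le
        have q2 := mul_pos s1 (neg_pos.2 h2)
        by_contra! hcon
        have q3 := mul_nonneg s2.le (neg_nonneg.2 hcon)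
        linarith
  have hpi : m π = ballMeasure.real univ / 2 := by
    have : d π = -d 0 := by apply ext3 <;> simp [d, e, f]
    simp only [m, this]
    exact ballMeasure_halfSpace (hd 0)
  have h1 : ballMeasure.real (lune a b) = m (angle a b) :=
    ballMeasure_lune_congr ha hb (hd _) (hd _) (by rw [hdd, sub_zero, cos_angle, ha, hb]; simp)
  rw [h1, eq_mul_of_additive (m := m) pi_pos (fun _ _ _ => measureReal_nonneg) hadd (angle_nonneg _ _)
    (angle_le_pi _ _), hpi]

section Polygon

variable {n : ℕ} [NeZero n] {v w : ZMod n → E3}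

/-- The cone over a polygon. -/
def polygonCone (w : ZMod n → E3) : Set E3 := {p | ∀ i, 0 < ⟪w i, p⟫_ℝ}

theorem measurableSet_polygonCone (w : ZMod n → E3) : MeasurableSet (polygonCone w) := by
  unfold polygonCone
  rw [Set.ofPred_forall]
  exact MeasurableSet.iInter fun i => (isOpen_lt (by fun_prop) (by fun_prop)).measurableSet

/-- Going around a polygon, one passes only once from the positive to the negative side of a
plane. -/
theorem PolarPair.disjoint_lune (h : PolarPair n v w) {i j : ZMod n} (hij : i ≠ j) :
    Disjoint (lune (w i) (w (i + 1))) (lune (w j) (w (j + 1))) := by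
  rw [Set.disjoint_left]
  rintro y ⟨h1, h2⟩ ⟨h3, h4⟩
  obtain ⟨a, ha, rfl⟩ := exists_offset i j
  have ha0 : a ≠ 0 := by rintro rfl; simp at hij
  have ha1 : a ≠ 1 := by rintro rfl; rw [Nat.cast_one] at h3; linarith
  have han : a + 1 ≠ n := by
    intro e
    have : i + (a : ZMod n) + 1 = i := by
      rw [add_assoc, ← Nat.cast_one, ← Nat.cast_add, e, ZMod.natCast_self, add_zero]
    rw [this] at h4; linarith
  have D : ∀ p q r : ℕ, p < q → q < r → r < p + n →
      0 < det3 (w (i + p)) (w (i + q)) (w (i + r)) := fun p q r => h.pos_w.det3_pos i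
  have e : ∀ x p q y : E3, det3 p q y • x + det3 x p y • q = det3 x q y • p + det3 x p q • y := by
    intro x p q y
    apply ext3 <;> simp [det3_eq] <;> ring
  -- Two sign changes from positive to negative at different places would make the left-hand side of
  -- the relation positive and the right-hand side negative.
  have := congrArg (fun u => ⟪u, y⟫_ℝ) (e (w (i + (0 : ℕ))) (w (i + (1 : ℕ))) (w (i + a))
    (w (i + (a + 1 : ℕ))))
  simp only [inner_add_left, real_inner_smul_left] at this
  have d1 := D 1 a (a + 1) (by omega) (by omega) (by omega)
  have d2 := D 0 1 (a + 1) (by omega) (by omega) (by omega)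
  have d3 := D 0 a (a + 1) (by omega) (by omega) (by omega)
  have d4 := D 0 1 a (by omega) (by omega) (by omega)
  simp only [Nat.cast_zero, Nat.cast_one, add_zero, Nat.cast_add, ← add_assoc] at this d1 d2 d3 d4
  have q1 := mul_pos d1 h1
  have q2 := mul_pos d2 h3
  have q3 := mul_pos d3 (neg_pos.2 h2)
  have q4 := mul_pos d4 (neg_pos.2 h4)
  linarith

/-- Up to the planes of the sides, a vector is in the cone, in its opposite, or in exactly one lune
of consecutive normals, according to the signs met in going once around. The cone and its opposite
have equal measure, and the lunes are measured by the exterior angles. -/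
theorem PolarPair.measure_cone (h : PolarPair n v w) : ballMeasure.real (polygonCone w) =
    ballMeasure.real univ / 2 * (1 - (∑ i, angle (w i) (w (i + 1))) / (2 * π)) := by
  have hneg : ballMeasure.real (-polygonCone w) = ballMeasure.real (polygonCone w) := by
    have := (measurePreserving_ballMeasure (LinearIsometryEquiv.neg ℝ)).measureReal_preimage
      (measurableSet_polygonCone w).nullMeasurableSet
    rw [← this]; rfl
  have hd1 : Disjoint (polygonCone w) (-polygonCone w) := by
    rw [Set.disjoint_left]
    intro y h1 h2
    have a1 := h1 0
    have a2 := h2 0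
    rw [inner_neg_right] at a2
    linarith
  have hd2 : Disjoint (polygonCone w ∪ -polygonCone w) (⋃ i, lune (w i) (w (i + 1))) := by
    rw [Set.disjoint_left]
    rintro y (h1 | h1) h2
    · obtain ⟨i, h2⟩ := mem_iUnion.1 h2
      have := h1 (i + 1)
      linarith [h2.2]
    · obtain ⟨i, h2⟩ := mem_iUnion.1 h2
      have := h1 i
      rw [inner_neg_right] at this
      linarith [h2.1]
  have hU : (polygonCone w ∪ -polygonCone w ∪ ⋃ i, lune (w i) (w (i + 1)) : Set E3)
      =ᵐ[ballMeasure] univ := by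
    have hp : ∀ᵐ y ∂ballMeasure, ∀ i, ⟪w i, y⟫_ℝ ≠ 0 := by
      rw [ae_all_iff]
      intro i
      rw [ae_iff]
      simpa using ballMeasure_plane (a := w i) (by
        rw [← norm_ne_zero_iff, h.norm_w]; exact one_ne_zero)
    filter_upwards [hp] with y hy
    apply propext
    refine ⟨fun _ => trivial, fun _ => ?_⟩
    by_cases hex : ∃ i, y ∈ lune (w i) (w (i + 1))
    · exact Or.inr (mem_iUnion.2 hex)
    · left
      by_cases hpos : ∃ i, 0 < ⟪w i, y⟫_ℝ
      · left
        obtain ⟨i, hi⟩ := hpos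
        have : ∀ k : ℕ, 0 < ⟪w (i + k), y⟫_ℝ := by
          intro k
          induction k with
          | zero => simpa using hi
          | succ k ih =>
            by_contra hcon
            have hle := lt_of_le_of_ne (not_lt.1 hcon) (hy _)
            exact hex ⟨i + k, ih, by rw [add_assoc, ← Nat.cast_one, ← Nat.cast_add]; exact hle⟩
        intro j
        obtain ⟨k, -, rfl⟩ := exists_offset i j
        exact this k
      · right
        push Not at hpos
        intro j
        rw [inner_neg_right]
        have := lt_of_le_of_ne (hpos j) (hy j)
        linarith
  have m1 := measureReal_congr hU
  rw [measureReal_union hd2 (MeasurableSet.iUnion fun i => measurableSet_lune _ _),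
    measureReal_union hd1 (measurableSet_polygonCone w).neg, hneg,
    measureReal_iUnion_fintype (fun i j hij => h.disjoint_lune hij)
      (fun i => measurableSet_lune _ _)] at m1
  simp only [ballMeasure_lune (h.norm_w _) (h.norm_w _), ← Finset.sum_mul, ← Finset.sum_div] at m1
  have hπ := pi_ne_zero
  field_simp at m1 ⊢
  linarith

/-- The factor is the dimension: the part of a cone in the unit ball has a third of the area which
the cone cuts from the sphere. -/
theorem area_eq {V : Set S2} {A : Set E3} (hA : MeasurableSet A)
    (hcone : ∀ y ∈ A, ∀ t : ℝ, 0 < t → t • y ∈ A) (hV : V = {p : S2 | (p : E3) ∈ A}) :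
    area V = 3 * ballMeasure.real A := by
  have hVm : MeasurableSet V := by rw [hV]; exact measurable_subtype_coe hA
  have e : Ioo (0 : ℝ) 1 • ((↑) '' V : Set E3) = (A ∩ ball 0 1) \ {0} := by
    ext y
    constructor
    · rintro ⟨t, ht, -, ⟨p, hp, rfl⟩, rfl⟩
      rw [hV] at hp
      refine ⟨⟨hcone _ hp t ht.1, ?_⟩, ?_⟩
      · simp only [mem_ball_zero_iff, norm_smul, norm_eq_of_mem_sphere, mul_one,
          norm_of_nonneg ht.1.le]
        exact ht.2
      · exact smul_ne_zero ht.1.ne' (S2_ne_zero p)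
    · rintro ⟨⟨hy, hy1⟩, hy0⟩
      have hy0 : y ≠ 0 := hy0
      have hn : 0 < ‖y‖ := norm_pos_iff.2 hy0
      refine ⟨‖y‖, ⟨hn, by simpa using hy1⟩, ‖y‖⁻¹ • y, ⟨normalizeS2 y hy0, ?_, rfl⟩, ?_⟩
      · rw [hV]; exact hcone y hy _ (inv_pos.2 hn)
      · simp only [smul_smul, mul_inv_cancel₀ hn.ne', one_smul]
  rw [area, Measure.toSphere_apply' _ hVm, e, measure_sdiff_null (measure_singleton _),
    ENNReal.toReal_mul, measureReal_def, ballMeasure, Measure.restrict_apply hA]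
  simp

/-- Girard's formula, in terms of the angles between the normals of consecutive sides. -/
theorem PolarPair.area_hull {v : ZMod n → S2} (h : PolarPair n (fun i => (v i : E3)) w) :
    area (hull (range v)) =
      3 / 2 * ballMeasure.real univ * (1 - (∑ i, angle (w (i - 1)) (w i)) / (2 * π)) := by
  have hw0 : ∀ i, w i ≠ 0 := fun i => by
    rw [← norm_ne_zero_iff, h.norm_w]; exact one_ne_zero
  have hm : MeasurableSet {p : E3 | ∀ i, 0 ≤ ⟪p, w i⟫_ℝ} := by
    rw [Set.ofPred_forall]
    exact MeasurableSet.iInter fun i => (isClosed_le (by fun_prop) (by fun_prop)).measurableSet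
  have e1 := area_eq (V := hull (range v)) hm (fun y hy t ht i => by
      rw [real_inner_smul_left]; exact mul_nonneg ht.le (hy i)) (by rw [h.hull_eq]; rfl)
  have e2 : ({p : E3 | ∀ i, 0 ≤ ⟪p, w i⟫_ℝ} : Set E3) =ᵐ[ballMeasure] polygonCone w := by
    have hp : ∀ᵐ y ∂ballMeasure, ∀ i, ⟪w i, y⟫_ℝ ≠ 0 := by
      rw [ae_all_iff]
      intro i
      rw [ae_iff]
      simpa using ballMeasure_plane (hw0 i)
    filter_upwards [hp] with y hy
    apply propext
    refine forall_congr' fun i => ?_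
    rw [real_inner_comm]
    exact ⟨fun h => lt_of_le_of_ne h (hy i).symm, le_of_lt⟩
  have e3 := Equiv.sum_comp (Equiv.addRight (1 : ZMod n)) fun i => angle (w (i - 1)) (w i)
  simp only [Equiv.coe_addRight, add_sub_cancel_right] at e3
  rw [e1, measureReal_congr e2, h.measure_cone, e3]
  ring

end Polygon

end Area

end

/-! ### Regular polygons in an orthonormal frame -/

section

open InnerProductGeometry

section RegularPolygons

/-- A diametral chord which is perpendicular to the opposite side at its midpoint is longest among
those starting at the same side of the polar polygon. -/
theorem neg_mul_le_inner_of_edge {x w' y₁ y₂ u k k' : E3} {c s C lam τ₀ α β : ℝ} (hc : 0 < c)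
    (hs : 0 < s) (hsc : s ^ 2 + c ^ 2 = 1) (hC : 0 < C) (hlam : s ≤ 2 * lam) (hτ₀ : 0 < τ₀)
    (hα : 0 ≤ α) (hβ : 0 ≤ β) (hnx : ‖x‖ = 1) (hnw : ‖w'‖ = 1) (hny : ‖y₁‖ = 1) (hnu : ‖u‖ = 1)
    (hx : x = -c • w' + lam • (y₁ + y₂)) (hu : u = C • x + τ₀ • (y₁ - y₂)) (huy : ⟪u, y₁⟫_ℝ = s)
    (hwy : ⟪w', y₁⟫_ℝ = 0) (hxy : ⟪x, y₁ - y₂⟫_ℝ = 0) (hk : k = α • x + β • u)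
    (h1 : 0 ≤ ⟪y₁, k'⟫_ℝ) (h2 : 0 ≤ ⟪y₂, k'⟫_ℝ) : -c * (‖k‖ * ‖k'‖) ≤ ⟪k, k'⟫_ℝ := by
  set A := α + β * C with hA
  set τ := β * τ₀ with hτ
  have hA0 : 0 ≤ A := by positivity
  have hτ0 : 0 ≤ τ := by positivity
  have ek : k = A • x + τ • (y₁ - y₂) := by rw [hk, hu, hA, hτ]; module
  have hnk : A ≤ ‖k‖ := by
    have := real_inner_le_norm x k
    rw [hnx, one_mul, ek, inner_add_right, real_inner_smul_right, real_inner_smul_right, hxy,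
      real_inner_self_eq_norm_sq, hnx, ← ek] at this
    linarith
  -- In the first case `k` is a combination of `-w'`, `y₁`, `y₂` with non-negative coefficients, and
  -- only the term with `w'` counts. In the second the coefficient of `y₂` would be negative; there
  -- `k` is a non-negative combination of `-c • w' + (2 * lam) • y₁` and `u`, so its component along
  -- `y₁` is at least `s * ‖k‖` and the orthogonal part is at most `c * ‖k‖`.
  rcases le_or_gt τ (A * lam) with hcase | hcase
  · have e : ⟪k, k'⟫_ℝ = -(c * A) * ⟪w', k'⟫_ℝ + (A * lam + τ) * ⟪y₁, k'⟫_ℝ +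
        (A * lam - τ) * ⟪y₂, k'⟫_ℝ := by
      have : k = (-(c * A)) • w' + (A * lam + τ) • y₁ + (A * lam - τ) • y₂ := by
        rw [ek]; nth_rw 1 [hx]; module
      rw [this]
      simp only [inner_add_left, real_inner_smul_left]
    have a1 := mul_nonneg (by linarith : 0 ≤ A * lam + τ) h1
    have a2 := mul_nonneg (sub_nonneg.2 hcase) h2
    have a3 := real_inner_le_norm w' k'
    rw [hnw, one_mul] at a3
    have a4 := mul_le_mul_of_nonneg_left a3 (by positivity : 0 ≤ c * A)
    have a5 := mul_le_mul_of_nonneg_right hnk (by positivity : 0 ≤ c * ‖k'‖)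
    rw [e]; linarith
  · have hA1 : 0 < A := by
      refine lt_of_le_of_ne hA0 fun h0 => ?_
      have : β = 0 := by
        have h3 := mul_nonneg hβ hC.le
        exact (mul_eq_zero.1 (by linarith : β * C = 0)).resolve_right hC.ne'
      rw [hτ, this, ← h0] at hcase; simp at hcase
    have hτC : τ * C ≤ τ₀ * A := by
      rw [hτ, hA]; nlinarith [mul_nonneg hα hτ₀.le]
    have hden : 0 < τ₀ - lam * C := by
      have := mul_lt_mul_of_pos_right hcase hC
      have : 0 < A * (τ₀ - lam * C) := by linarith
      exact pos_of_mul_pos_right this hA0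
    set D := τ₀ - lam * C with hD
    set p := (A * τ₀ - τ * C) / D with hp
    set q := (τ - A * lam) / D with hq
    have hp0 : 0 ≤ p := div_nonneg (by linarith) hden.le
    have hq0 : 0 ≤ q := div_nonneg (by linarith) hden.le
    have ek2 : k = p • (-c • w' + (2 * lam) • y₁) + q • u := by
      have e1 : p + q * C = A := by rw [hp, hq]; field_simp; rw [hD]; ring
      have e2 : p * lam + q * τ₀ = τ := by rw [hp, hq]; field_simp; rw [hD]; ring
      have e3 : -c • w' + (2 * lam) • y₁ = x + lam • (y₁ - y₂) := by rw [hx]; module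
      rw [ek, e3, hu, ← e1, ← e2]; module
    have n1 : ‖-c • w' + (2 * lam) • y₁‖ ^ 2 = c ^ 2 + (2 * lam) ^ 2 := by
      rw [norm_add_sq_real, real_inner_smul_left, real_inner_smul_right, hwy, norm_smul, norm_smul,
        hnw, hny, mul_one, mul_one, Real.norm_eq_abs, Real.norm_eq_abs, sq_abs, sq_abs]; ring
    have n2 : s * ‖-c • w' + (2 * lam) • y₁‖ ≤ 2 * lam := by
      rw [← sq_le_sq₀ (by positivity) (by linarith), mul_pow, n1]
      have : s ^ 2 ≤ (2 * lam) ^ 2 := by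
        rw [sq_le_sq₀ hs.le (by linarith)]; exact hlam
      nlinarith [sq_nonneg c]
    have i1 : ⟪-c • w' + (2 * lam) • y₁, y₁⟫_ℝ = 2 * lam := by
      rw [inner_add_left, real_inner_smul_left, real_inner_smul_left, hwy,
        real_inner_self_eq_norm_sq, hny]; ring
    have i2 : s * ‖k‖ ≤ ⟪k, y₁⟫_ℝ := by
      have b1 : ‖k‖ ≤ p * ‖-c • w' + (2 * lam) • y₁‖ + q := by
        rw [ek2]
        refine (norm_add_le _ _).trans (le_of_eq ?_)
        rw [norm_smul, norm_smul, hnu, norm_of_nonneg hp0, norm_of_nonneg hq0, mul_one]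
      have b2 := mul_le_mul_of_nonneg_left b1 hs.le
      have b3 := mul_le_mul_of_nonneg_left n2 hp0
      have b4 : ⟪k, y₁⟫_ℝ = p * (2 * lam) + q * s := by
        rw [ek2, inner_add_left, real_inner_smul_left, i1, real_inner_smul_left, huy]
      rw [b4]; linarith
    set t := ⟪k, y₁⟫_ℝ with ht
    have n3 : ‖k - t • y₁‖ ≤ c * ‖k‖ := by
      rw [← sq_le_sq₀ (norm_nonneg _) (by positivity), norm_sub_sq_real, real_inner_smul_right, ← ht,
        norm_smul, hny, mul_one, Real.norm_eq_abs, sq_abs]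
      have : (s * ‖k‖) ^ 2 ≤ t ^ 2 := by
        rw [sq_le_sq₀ (by positivity) (le_trans (by positivity) i2)]; exact i2
      nlinarith
    have n4 := abs_real_inner_le_norm (k - t • y₁) k'
    rw [inner_sub_left, real_inner_smul_left, abs_le] at n4
    have n5 := mul_le_mul_of_nonneg_right n3 (norm_nonneg k')
    have n6 := mul_nonneg (le_trans (by positivity) i2 : 0 ≤ t) h1
    linarith [n4.1]

/-- A unit vector orthogonal to a side and pointing inwards is its normal. -/
theorem PolarPair.eq_w {n : ℕ} [NeZero n] {v w : ZMod n → E3} (h : PolarPair n v w) {i : ZMod n}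
    {u : E3} (hu : ‖u‖ = 1) (h1 : ⟪v i, u⟫_ℝ = 0) (h2 : ⟪v (i + 1), u⟫_ℝ = 0)
    (h3 : 0 < ⟪v (i + 2), u⟫_ℝ) : w i = u := by
  obtain ⟨r, hr, e⟩ := h.cross_v i
  have hd : det3 (v i) (v (i + 1)) (w i) ≠ 0 := by
    rw [← cross_inner, e, real_inner_smul_left, h.inner_self_w, mul_one]; exact hr.ne'
  have hz : u - ⟪u, w i⟫_ℝ • w i = 0 := by
    refine eq_zero_of_det3_ne_zero hd ?_ ?_ ?_
    · rw [inner_sub_left, real_inner_smul_left, real_inner_comm (v i) u, h1,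
        real_inner_comm (v i) (w i), h.inner_left]
      ring
    · rw [inner_sub_left, real_inner_smul_left, real_inner_comm (v (i + 1)) u, h2,
        real_inner_comm (v (i + 1)) (w i), h.inner_right]
      ring
    · rw [inner_sub_left, real_inner_smul_left, h.inner_self_w]; ring
  have hu' : u = ⟪u, w i⟫_ℝ • w i := sub_eq_zero.1 hz
  set t := ⟪u, w i⟫_ℝ with ht
  have habs : |t| = 1 := by
    rw [hu', norm_smul, h.norm_w, mul_one, Real.norm_eq_abs] at hu; exact hu
  have hpos := h.inner_pos i (i + 2) (h.ne_aux i).2.1 (h.ne_aux i).2.2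
  rw [hu', real_inner_smul_right] at h3
  have : 0 < t := pos_of_mul_pos_left h3 hpos.le
  rw [abs_of_pos this] at habs
  rw [hu', habs, one_smul]

/-- An orthonormal frame, and the sines and cosines of the radii of the circumscribed and the
inscribed circle of a regular polygon centered at `o`. -/
structure RegularFrame (n : ℕ) (e₁ e₂ o : E3) (κ μ S Q : ℝ) : Prop where
  three_le : 3 ≤ n
  n₁ : ⟪e₁, e₁⟫_ℝ = 1
  n₂ : ⟪e₂, e₂⟫_ℝ = 1
  n₃ : ⟪o, o⟫_ℝ = 1
  h₁₂ : ⟪e₁, e₂⟫_ℝ = 0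
  h₁₃ : ⟪e₁, o⟫_ℝ = 0
  h₂₃ : ⟪e₂, o⟫_ℝ = 0
  det : det3 e₁ e₂ o = 1
  κ_pos : 0 < κ
  μ_pos : 0 < μ
  S_pos : 0 < S
  Q_pos : 0 < Q
  circum : κ ^ 2 + μ ^ 2 = 1
  inscr : S ^ 2 + Q ^ 2 = 1
  rel : κ * S = μ * Q * cos (π / n)

/-- The point with longitude `t` on a circle around `o`. -/
def circlePoint (e₁ e₂ o : E3) (κ μ t : ℝ) : E3 := κ • o + μ • (cos t • e₁ + sin t • e₂)

/-- The longitude of a vertex of a regular polygon. -/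
def longitude (n : ℕ) (i : ZMod n) : ℝ := i.val * (2 * π / n)

/-- As `longitude` uses the representative of `i` below `n`, passing from `n - 1` to `0` loses a
full turn. -/
theorem longitude_add {n : ℕ} [NeZero n] (i : ZMod n) (a : ℕ) :
    ∃ m : ℤ, longitude n (i + a) = longitude n i + a * (2 * π / n) - m * (2 * π) := by
  have hn : (n : ℝ) ≠ 0 := by exact_mod_cast NeZero.ne n
  refine ⟨((i.val + a) / n : ℕ), ?_⟩
  have h1 : (i + a).val = (i.val + a) % n := by
    rw [ZMod.val_add, ZMod.val_natCast, Nat.add_mod_mod]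
  have h2 := Nat.mod_add_div (i.val + a) n
  have h3 : (((i.val + a) % n : ℕ) : ℝ) = i.val + a - n * ((i.val + a) / n : ℕ) := by
    have : (((i.val + a) % n + n * ((i.val + a) / n) : ℕ) : ℝ) = ((i.val + a : ℕ) : ℝ) := by rw [h2]
    push_cast at this
    linarith
  rw [longitude, longitude, h1, h3, Int.cast_natCast]
  field_simp

theorem circlePoint_longitude_add {n : ℕ} [NeZero n] (e₁ e₂ o : E3) (κ μ t : ℝ) (i : ZMod n)
    (a : ℕ) : circlePoint e₁ e₂ o κ μ (longitude n (i + a) + t) =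
      circlePoint e₁ e₂ o κ μ (longitude n i + (a * (2 * π / n) + t)) := by
  obtain ⟨m, hm⟩ := longitude_add i a
  rw [hm, circlePoint, circlePoint, show longitude n i + a * (2 * π / n) - m * (2 * π) + t =
    longitude n i + (a * (2 * π / n) + t) - m * (2 * π) by ring, Real.cos_sub_int_mul_two_pi,
    Real.sin_sub_int_mul_two_pi]

namespace RegularFrame

variable {n : ℕ} [NeZero n] {e₁ e₂ o : E3} {κ μ S Q : ℝ}

theorem inner_circlePoint (h : RegularFrame n e₁ e₂ o κ μ S Q) (a b a' b' t t' : ℝ) :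
    ⟪circlePoint e₁ e₂ o a b t, circlePoint e₁ e₂ o a' b' t'⟫_ℝ = a * a' + b * b' * cos (t - t') := by
  simp only [circlePoint, inner_add_left, inner_add_right, real_inner_smul_left,
    real_inner_smul_right, h.n₁, h.n₂, h.n₃, h.h₁₂, h.h₁₃, h.h₂₃, real_inner_comm e₁ e₂,
    real_inner_comm e₁ o, real_inner_comm e₂ o, Real.cos_sub]
  ring

/-- With `A = t₂ - t₁` and `B = t₃ - t₂` this rests on `sin A + sin B - sin (A + B) = 4 * sin (A /
2) * sin (B / 2) * sin ((A + B) / 2)`; the product form shows the sign. -/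
theorem det3_circlePoint (h : RegularFrame n e₁ e₂ o κ μ S Q) (a b t₁ t₂ t₃ : ℝ) :
    det3 (circlePoint e₁ e₂ o a b t₁) (circlePoint e₁ e₂ o a b t₂) (circlePoint e₁ e₂ o a b t₃) =
      a * b ^ 2 * (4 * (sin ((t₂ - t₁) / 2) * sin ((t₃ - t₂) / 2) * sin ((t₃ - t₁) / 2))) := by
  have hd := h.det
  have e : det3 (circlePoint e₁ e₂ o a b t₁) (circlePoint e₁ e₂ o a b t₂)
      (circlePoint e₁ e₂ o a b t₃) = a * b ^ 2 * det3 e₁ e₂ o *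
        (sin (t₂ - t₁) + sin (t₃ - t₂) - sin (t₃ - t₁)) := by
    simp only [Real.sin_sub]
    simp only [circlePoint, det3_eq, PiLp.add_apply, PiLp.smul_apply, smul_eq_mul]
    ring
  rw [e, hd]
  have hA : t₃ - t₁ = 2 * ((t₂ - t₁) / 2) + 2 * ((t₃ - t₂) / 2) := by ring
  have hB : (t₃ - t₁) / 2 = (t₂ - t₁) / 2 + (t₃ - t₂) / 2 := by ring
  have hC : sin (t₂ - t₁) = sin (2 * ((t₂ - t₁) / 2)) := by congr 1; ring
  have hD : sin (t₃ - t₂) = sin (2 * ((t₃ - t₂) / 2)) := by congr 1; ring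
  rw [hB, hC, hD, hA]
  set p := (t₂ - t₁) / 2
  set q := (t₃ - t₂) / 2
  rw [Real.sin_add (2 * p), Real.sin_two_mul, Real.sin_two_mul, Real.cos_two_mul, Real.cos_two_mul,
    Real.sin_add]
  have h1 := Real.sin_sq_add_cos_sq p
  have h2 := Real.sin_sq_add_cos_sq q
  linear_combination (-4 * a * b ^ 2 * sin q * cos q) * h1 - (4 * a * b ^ 2 * sin p * cos p) * h2

end RegularFrame

end RegularPolygons

end

/-! ### The thickness of regular polygons -/

section

open InnerProductGeometry

theorem PolarPair.le_thickness {n : ℕ} [NeZero n] {v : ZMod n → S2} {w : ZMod n → E3}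
    (h : PolarPair n (fun i => (v i : E3)) w) {θ : ℝ} (hθ : θ ≤ π)
    (hk : ∀ k k' : S2, (∀ i, 0 ≤ ⟪(k : E3), (v i : E3)⟫_ℝ) → (∃ i, ⟪(k : E3), (v i : E3)⟫_ℝ = 0) →
      (∀ i, 0 ≤ ⟪(k' : E3), (v i : E3)⟫_ℝ) → -cos θ ≤ ⟪(k : E3), (k' : E3)⟫_ℝ) :
    θ ≤ thickness (hull (range v)) := by
  by_contra! hlt
  let W : ZMod n → S2 := fun l => ⟨w l, by simp [h.norm_w]⟩
  have hs : ∀ l, Supports (W l) (hull (range v)) := fun l =>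
    h.supports_of (i := l) (fun i => by rw [real_inner_comm]; exact h.inner_nonneg l i)
      (by rw [real_inner_comm]; exact h.inner_left l)
  obtain ⟨k, k', h1, h2, h3⟩ := exists_inner_lt_of_thickness_lt hlt hθ (k₁ := W (0 + 1)) (k₂ := W 0)
    (fun e => h.w_ne (h.ne_aux 0).1 (congrArg Subtype.val e)) (hs _) (hs _)
    (p := ∑ j, (v j : E3)) (fun k hk => h.sum_inner_pos' (S2_ne_zero k) (h.nonneg_of_supports hk))
  have := hk k k' (h.nonneg_of_supports h1) (h.exists_eq_zero h1) (h.nonneg_of_supports h2)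
  linarith

/-- A lower bound for the inner products of the normals of the sides carries over to the polar
cone. -/
theorem PolarPair.mul_le_inner {n : ℕ} [NeZero n] {v w : ZMod n → E3} (h : PolarPair n v w) {m : ℝ}
    (hm0 : 0 ≤ m) (hm : ∀ i j, m ≤ ⟪w i, w j⟫_ℝ) {k k' : E3} (hk : ∀ i, 0 ≤ ⟪k, v i⟫_ℝ)
    (hk' : ∀ i, 0 ≤ ⟪k', v i⟫_ℝ) : m * (‖k‖ * ‖k'‖) ≤ ⟪k, k'⟫_ℝ := by
  obtain ⟨a, ha, e⟩ := h.dual.mem_cone (p := k) fun i => hk _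
  obtain ⟨b, hb, e'⟩ := h.dual.mem_cone (p := k') fun i => hk' _
  have hnorm : ∀ a : ZMod n → ℝ, (∀ i, 0 ≤ a i) → ‖∑ i, a i • w i‖ ≤ ∑ i, a i := fun a ha =>
    (norm_sum_le _ _).trans (le_of_eq (Finset.sum_congr rfl fun i _ => by
      rw [norm_smul, h.norm_w, mul_one, norm_of_nonneg (ha i)]))
  have h1 : ‖k‖ * ‖k'‖ ≤ (∑ i, a i) * ∑ i, b i := by
    rw [e, e']
    exact mul_le_mul (hnorm a ha) (hnorm b hb) (norm_nonneg _)
      (Finset.sum_nonneg fun i _ => ha i)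
  refine (mul_le_mul_of_nonneg_left h1 hm0).trans ?_
  rw [e, e', sum_inner, Finset.sum_mul, Finset.mul_sum]
  refine Finset.sum_le_sum fun i _ => ?_
  rw [inner_sum, Finset.mul_sum, Finset.mul_sum]
  refine Finset.sum_le_sum fun j _ => ?_
  rw [real_inner_smul_left, real_inner_smul_right]
  have := mul_le_mul_of_nonneg_left (hm i j) (mul_nonneg (ha i) (hb j))
  linarith

namespace RegularFrame

variable {n : ℕ} [NeZero n] {e₁ e₂ o : E3} {κ μ S Q : ℝ}

theorem norm_circlePoint (h : RegularFrame n e₁ e₂ o κ μ S Q) {a b : ℝ} (hab : a ^ 2 + b ^ 2 = 1)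
    (t : ℝ) : ‖circlePoint e₁ e₂ o a b t‖ = 1 := by
  have := h.inner_circlePoint a b a b t t
  rw [sub_self, Real.cos_zero, mul_one, ← sq, ← sq, hab, real_inner_self_eq_norm_sq] at this
  nlinarith [norm_nonneg (circlePoint e₁ e₂ o a b t)]

/-- The vertices of a regular polygon. -/
def vertex (h : RegularFrame n e₁ e₂ o κ μ S Q) (i : ZMod n) : S2 :=
  ⟨circlePoint e₁ e₂ o κ μ (longitude n i), by simp [h.norm_circlePoint h.circum]⟩

/-- The normals of the sides of a regular polygon. -/
def normal (_ : RegularFrame n e₁ e₂ o κ μ S Q) (i : ZMod n) : E3 :=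
  circlePoint e₁ e₂ o S (-Q) (longitude n i + π / n)

theorem n_pos (h : RegularFrame n e₁ e₂ o κ μ S Q) : (0 : ℝ) < n := by
  have := h.three_le
  exact_mod_cast (by omega : 0 < n)

theorem three_mul_le (h : RegularFrame n e₁ e₂ o κ μ S Q) : 3 * (π / n) ≤ π := by
  have h3 : (3 : ℝ) ≤ n := by exact_mod_cast h.three_le
  rw [← mul_div_assoc, div_le_iff₀ h.n_pos]
  nlinarith [Real.pi_pos]

theorem cos_pos (h : RegularFrame n e₁ e₂ o κ μ S Q) : 0 < cos (π / n) := by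
  have := h.three_mul_le
  have h0 := div_pos Real.pi_pos h.n_pos
  exact Real.cos_pos_of_mem_Ioo ⟨by linarith [Real.pi_pos], by linarith [Real.pi_pos]⟩

theorem cos_lt_one (h : RegularFrame n e₁ e₂ o κ μ S Q) : cos (π / n) < 1 := by
  have := h.three_mul_le
  have h0 := div_pos Real.pi_pos h.n_pos
  rw [← Real.cos_zero]
  exact Real.cos_lt_cos_of_nonneg_of_le_pi le_rfl (by linarith) h0

theorem vertex_add (h : RegularFrame n e₁ e₂ o κ μ S Q) (i : ZMod n) (a : ℕ) :
    (h.vertex (i + a) : E3) = circlePoint e₁ e₂ o κ μ (longitude n i + a * (2 * π / n)) := by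
  have := circlePoint_longitude_add e₁ e₂ o κ μ 0 i a
  rwa [add_zero, add_zero] at this

theorem normal_add (h : RegularFrame n e₁ e₂ o κ μ S Q) (i : ZMod n) (a : ℕ) :
    h.normal (i + a) = circlePoint e₁ e₂ o S (-Q) (longitude n i + (a * (2 * π / n) + π / n)) :=
  circlePoint_longitude_add e₁ e₂ o S (-Q) (π / n) i a

theorem cyclicPos (h : RegularFrame n e₁ e₂ o κ μ S Q) :
    CyclicPos n (fun i => (h.vertex i : E3)) := by
  intro i a b ha hab hb
  have hn := h.n_pos
  have hpos : ∀ m : ℕ, 0 < m → m < n → 0 < sin (m * (2 * π / n) / 2) := fun m h0 h1 => by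
    have e : (m : ℝ) * (2 * π / n) / 2 = m / n * π := by ring
    have h1' : (m : ℝ) / n < 1 := by rw [div_lt_one hn]; exact_mod_cast h1
    have h0' : (0 : ℝ) < m / n := div_pos (by exact_mod_cast h0) hn
    rw [e]
    exact Real.sin_pos_of_pos_of_lt_pi (mul_pos h0' Real.pi_pos) (by nlinarith [Real.pi_pos])
  show 0 < det3 (circlePoint e₁ e₂ o κ μ (longitude n i)) (h.vertex (i + a)) (h.vertex (i + b))
  rw [h.vertex_add, h.vertex_add, h.det3_circlePoint]
  have e1 : longitude n i + a * (2 * π / n) - longitude n i = a * (2 * π / n) := by ring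
  have e2 : longitude n i + b * (2 * π / n) - (longitude n i + a * (2 * π / n)) =
      (b - a : ℕ) * (2 * π / n) := by rw [Nat.cast_sub hab.le]; ring
  have e3 : longitude n i + b * (2 * π / n) - longitude n i = b * (2 * π / n) := by ring
  rw [e1, e2, e3]
  have := hpos a ha (hab.trans hb)
  have := hpos b (ha.trans hab) hb
  have := hpos (b - a) (by omega) (by omega)
  have := h.κ_pos
  have := h.μ_pos
  positivity

theorem inner_vertex_normal (h : RegularFrame n e₁ e₂ o κ μ S Q) (i : ZMod n) (a : ℕ) :
    ⟪(h.vertex (i + a) : E3), h.normal i⟫_ℝ =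
      μ * Q * (cos (π / n) - cos (a * (2 * π / n) - π / n)) := by
  rw [h.vertex_add, normal, h.inner_circlePoint, h.rel]
  rw [show longitude n i + a * (2 * π / n) - (longitude n i + π / n) = a * (2 * π / n) - π / n by
    ring]
  ring

theorem polarPair (h : RegularFrame n e₁ e₂ o κ μ S Q) :
    PolarPair n (fun i => (h.vertex i : E3)) h.normal := by
  have hP := h.cyclicPos.polarPair h.three_le fun i => by simp
  have e : h.normal = sideNormal fun i => (h.vertex i : E3) := by
    funext i
    refine (hP.eq_w (h.norm_circlePoint (by rw [neg_sq]; exact h.inscr) _) ?_ ?_ ?_).symm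
    · have := h.inner_vertex_normal i 0
      simpa [normal] using this
    · have := h.inner_vertex_normal i 1
      rw [Nat.cast_one, Nat.cast_one, show 1 * (2 * π / n) - π / n = π / n by ring, sub_self,
        mul_zero] at this
      exact this
    · have := h.inner_vertex_normal i 2
      rw [Nat.cast_ofNat, Nat.cast_ofNat, show 2 * (2 * π / n) - π / n = 3 * (π / n) by ring] at this
      show 0 < ⟪(h.vertex (i + 2) : E3), h.normal i⟫_ℝ
      rw [this]
      have h0 := div_pos Real.pi_pos h.n_pos
      have h1 : cos (3 * (π / n)) < cos (π / n) :=
        Real.cos_lt_cos_of_nonneg_of_le_pi h0.le h.three_mul_le (by linarith)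
      exact mul_pos (mul_pos h.μ_pos h.Q_pos) (sub_pos.2 h1)
  rw [e]
  exact hP

/-- The cosine of half the exterior angle of a regular polygon. -/
theorem κ_mul (h : RegularFrame n e₁ e₂ o κ μ S Q) :
    κ * (μ * S + κ * Q * cos (π / n)) = Q * cos (π / n) := by
  linear_combination μ * h.rel + Q * cos (π / n) * h.circum

theorem μ_mul (h : RegularFrame n e₁ e₂ o κ μ S Q) : μ * (μ * S + κ * Q * cos (π / n)) = S := by
  linear_combination -κ * h.rel + S * h.circum

theorem sq_eq (h : RegularFrame n e₁ e₂ o κ μ S Q) :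
    (μ * S + κ * Q * cos (π / n)) ^ 2 = S ^ 2 + (Q * cos (π / n)) ^ 2 := by
  linear_combination S * h.μ_mul + (Q * cos (π / n)) * h.κ_mul

theorem exterior_pos (h : RegularFrame n e₁ e₂ o κ μ S Q) : 0 < μ * S + κ * Q * cos (π / n) := by
  have := h.κ_pos
  have := h.μ_pos
  have := h.S_pos
  have := h.Q_pos
  have := h.cos_pos
  positivity

theorem exterior_le_one (h : RegularFrame n e₁ e₂ o κ μ S Q) :
    μ * S + κ * Q * cos (π / n) ≤ 1 := by
  have h1 := h.sq_eq
  have h2 := h.cos_pos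
  have h3 := h.cos_lt_one
  have h4 : Q ^ 2 * cos (π / n) ^ 2 ≤ Q ^ 2 * 1 :=
    mul_le_mul_of_nonneg_left (by nlinarith) (sq_nonneg _)
  nlinarith [h.inscr, h.exterior_pos]

theorem normal_sub_one (h : RegularFrame n e₁ e₂ o κ μ S Q) (i : ZMod n) :
    h.normal (i - 1) = circlePoint e₁ e₂ o S (-Q) (longitude n i - π / n) := by
  have := circlePoint_longitude_add e₁ e₂ o S (-Q) (-(π / n)) (i - 1) 1
  rw [Nat.cast_one, Nat.cast_one, sub_add_cancel,
    show 1 * (2 * π / n) + -(π / n) = π / n by ring] at this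
  rw [normal, ← this, ← sub_eq_add_neg]

theorem angle_normal (h : RegularFrame n e₁ e₂ o κ μ S Q) (i : ZMod n) :
    angle (h.normal (i - 1)) (h.normal i) = 2 * arccos (μ * S + κ * Q * cos (π / n)) := by
  have hC := h.exterior_pos
  have hC1 := h.exterior_le_one
  have h1 : ⟪h.normal (i - 1), h.normal i⟫_ℝ = cos (2 * arccos (μ * S + κ * Q * cos (π / n))) := by
    rw [Real.cos_two_mul, Real.cos_arccos (by linarith) hC1, h.normal_sub_one, normal,
      h.inner_circlePoint, show longitude n i - π / n - (longitude n i + π / n) = -(2 * (π / n)) by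
        ring, Real.cos_neg, Real.cos_two_mul]
    linear_combination -2 * h.sq_eq - h.inscr
  rw [angle, h.polarPair.norm_w, h.polarPair.norm_w, h1, mul_one, div_one, Real.arccos_cos]
  · linarith [Real.arccos_nonneg (μ * S + κ * Q * cos (π / n))]
  · linarith [Real.arccos_le_pi_div_two.2 hC.le]

theorem isRegularPolygon (h : RegularFrame n e₁ e₂ o κ μ S Q) :
    IsRegularPolygon n (hull (range h.vertex)) := by
  refine ⟨h.vertex, h.polarPair.inConvexPosition, rfl, h.polarPair.isCounterclockwise,
    fun i j => ?_, fun i j => ?_⟩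
  · have hi : ∀ i, ⟪(h.vertex i : E3), (h.vertex (i + 1) : E3)⟫_ℝ =
        κ * κ + μ * μ * cos (2 * π / n) := fun i => by
      have e := h.vertex_add i 1
      rw [Nat.cast_one, Nat.cast_one] at e
      rw [e, vertex, h.inner_circlePoint, show longitude n i - (longitude n i + 1 * (2 * π / n)) =
        -(2 * π / n) by ring, Real.cos_neg]
    rw [sphDist, sphDist, angle_S2, angle_S2, hi, hi]
  · rw [h.polarPair.sphAngle_eq, h.polarPair.sphAngle_eq, h.angle_normal, h.angle_normal]

/-- The relation between the thickness of a regular polygon and its exterior angle. -/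
theorem exterior_eq (h : RegularFrame n e₁ e₂ o κ μ S Q) :
    (μ * S + κ * Q * cos (π / n)) * (κ * Q - μ * S) = Q ^ 2 * cos (π / n) - S ^ 2 := by
  linear_combination Q * h.κ_mul - S * h.μ_mul

/-- The regular polygon is the case of equality in Jensen's inequality: its `n` equal angles between
consecutive chords add up to exactly `π`. -/
theorem chordAngle_exterior (h : RegularFrame n e₁ e₂ o κ μ S Q) (hc : 0 ≤ κ * Q - μ * S) :
    chordAngle (κ * Q - μ * S) (arccos (μ * S + κ * Q * cos (π / n))) = π / n := by
  have hC := h.exterior_pos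
  have hC1 := h.exterior_le_one
  have h0 := div_pos Real.pi_pos h.n_pos
  rw [chordAngle, Real.cos_arccos (by linarith) hC1]
  have : (μ * S + κ * Q * cos (π / n)) * (κ * Q - μ * S + (μ * S + κ * Q * cos (π / n))) /
      (1 + (κ * Q - μ * S) * (μ * S + κ * Q * cos (π / n))) = cos (π / n) := by
    rw [div_eq_iff (by positivity)]
    linear_combination (1 - cos (π / n)) * h.exterior_eq + h.sq_eq + cos (π / n) * h.inscr
  rw [this, Real.arccos_cos h0.le (by linarith [h.three_mul_le])]

section Odd

variable {g : ℕ}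

theorem angle_odd (hn : n = 2 * g + 1) (h : RegularFrame n e₁ e₂ o κ μ S Q) :
    (g : ℝ) * (2 * π / n) = π - π / n := by
  have := h.n_pos.ne'
  have e : (n : ℝ) = 2 * g + 1 := by exact_mod_cast hn
  field_simp
  rw [e]; ring

theorem circlePoint_add_pi (a b t : ℝ) :
    circlePoint e₁ e₂ o a b (t + π) = circlePoint e₁ e₂ o a (-b) t := by
  rw [circlePoint, circlePoint, Real.cos_add_pi, Real.sin_add_pi]
  module

theorem normal_opposite (h : RegularFrame n e₁ e₂ o κ μ S Q) (hn : n = 2 * g + 1) (i : ZMod n) :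
    h.normal (i + g) = circlePoint e₁ e₂ o S Q (longitude n i) := by
  rw [h.normal_add, angle_odd hn h, sub_add_cancel, circlePoint_add_pi, neg_neg]

theorem vertex_opposite (h : RegularFrame n e₁ e₂ o κ μ S Q) (hn : n = 2 * g + 1) (i : ZMod n) :
    (h.vertex (i + g) : E3) = circlePoint e₁ e₂ o κ (-μ) (longitude n i - π / n) := by
  rw [h.vertex_add, angle_odd hn h, ← circlePoint_add_pi]
  congr 1; ring

theorem vertex_opposite' (h : RegularFrame n e₁ e₂ o κ μ S Q) (hn : n = 2 * g + 1) (i : ZMod n) :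
    (h.vertex (i + g + 1) : E3) = circlePoint e₁ e₂ o κ (-μ) (longitude n i + π / n) := by
  have := h.vertex_add i (g + 1)
  rw [Nat.cast_add, Nat.cast_add, Nat.cast_one, Nat.cast_one, ← add_assoc, add_mul,
    angle_odd hn h] at this
  rw [this, ← circlePoint_add_pi]
  congr 1; ring

/-- The inner products of the normals of the sides are at least that of two opposite ones. -/
theorem le_inner_normal (h : RegularFrame n e₁ e₂ o κ μ S Q) (hn : n = 2 * g + 1) (i j : ZMod n) :
    S ^ 2 - Q ^ 2 * cos (π / n) ≤ ⟪h.normal i, h.normal j⟫_ℝ := by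
  obtain ⟨a, ha, rfl⟩ := exists_offset i j
  rw [h.normal_add, normal, h.inner_circlePoint,
    show longitude n i + π / n - (longitude n i + (a * (2 * π / n) + π / n)) =
      -(a * (2 * π / n)) by ring, Real.cos_neg]
  have hn0 := h.n_pos
  have e : cos (a * (2 * π / n)) = -cos (|(n : ℝ) - 2 * a| * (π / n)) := by
    rw [show |(n : ℝ) - 2 * a| * (π / n) = |(n - 2 * a) * (π / n)| by
      rw [abs_mul, abs_of_pos (div_pos Real.pi_pos hn0)],
      show ((n : ℝ) - 2 * a) * (π / n) = π - a * (2 * π / n) by field_simp, Real.cos_abs,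
      Real.cos_pi_sub, neg_neg]
  have h1 : (1 : ℝ) ≤ |(n : ℝ) - 2 * a| := by
    have : (1 : ℤ) ≤ |(n : ℤ) - 2 * a| := Int.one_le_abs (by omega)
    exact_mod_cast this
  have h2 : |(n : ℝ) - 2 * a| ≤ n := by
    have : (a : ℝ) ≤ n := by exact_mod_cast ha.le
    rw [abs_le]; constructor <;> linarith [Nat.cast_nonneg (α := ℝ) a]
  have hp := div_pos Real.pi_pos hn0
  have h3 : cos (|(n : ℝ) - 2 * a| * (π / n)) ≤ cos (π / n) :=
    Real.cos_le_cos_of_nonneg_of_le_pi hp.le (by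
      calc |(n : ℝ) - 2 * a| * (π / n) ≤ n * (π / n) := mul_le_mul_of_nonneg_right h2 hp.le
        _ = π := by field_simp) (by nlinarith)
  rw [e]
  nlinarith [mul_le_mul_of_nonneg_left h3 (sq_nonneg Q)]

/-- The side normal to the chord from a vertex. -/
theorem inner_chord (h : RegularFrame n e₁ e₂ o κ μ S Q) (hn : n = 2 * g + 1) (i : ZMod n) :
    ⟪circlePoint e₁ e₂ o μ (-κ) (longitude n i), h.normal (i + g)⟫_ℝ = -(κ * Q - μ * S) := by
  rw [h.normal_opposite hn, h.inner_circlePoint, sub_self, Real.cos_zero]; ring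

theorem inner_chord_nonneg (h : RegularFrame n e₁ e₂ o κ μ S Q) (i j : ZMod n) :
    0 ≤ ⟪circlePoint e₁ e₂ o μ (-κ) (longitude n i), (h.vertex j : E3)⟫_ℝ := by
  rw [vertex, h.inner_circlePoint]
  have := mul_pos h.κ_pos h.μ_pos
  nlinarith [Real.cos_le_one (longitude n i - longitude n j)]

/-- The lune is bounded by the great circle of a side and the great circle through the opposite
vertex perpendicular to the axis of symmetry. Its thickness is the sum of the radii of the inscribed
and the circumscribed circle, and `κ * Q - μ * S` is the cosine of that sum. -/
theorem thickness_le_arccos (h : RegularFrame n e₁ e₂ o κ μ S Q) (hn : n = 2 * g + 1) :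
    thickness (hull (range h.vertex)) ≤ arccos (κ * Q - μ * S) := by
  have hP := h.polarPair
  let k : S2 := ⟨circlePoint e₁ e₂ o μ (-κ) (longitude n 0), by
    simp [h.norm_circlePoint (show μ ^ 2 + (-κ) ^ 2 = 1 by linarith [h.circum])]⟩
  let k' : S2 := ⟨h.normal (0 + g), by simp [hP.norm_w]⟩
  have hk : Supports k (hull (range h.vertex)) := hP.supports_of (i := 0)
    (h.inner_chord_nonneg 0) (by
      show ⟪circlePoint e₁ e₂ o μ (-κ) (longitude n 0), circlePoint e₁ e₂ o κ μ (longitude n 0)⟫_ℝ = 0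
      rw [h.inner_circlePoint, sub_self, Real.cos_zero]; ring)
  have hk' : Supports k' (hull (range h.vertex)) := hP.supports_of (i := 0 + g)
    (fun i => by rw [real_inner_comm]; exact hP.inner_nonneg _ i)
      (by rw [real_inner_comm]; exact hP.inner_left _)
  have hin : ⟪(k : E3), (k' : E3)⟫_ℝ = -(κ * Q - μ * S) := h.inner_chord hn 0
  have hc : |κ * Q - μ * S| < 1 := by
    have : (κ * Q - μ * S) ^ 2 + (κ * S + μ * Q) ^ 2 = 1 := by
      linear_combination (Q ^ 2 + S ^ 2) * h.circum + h.inscr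
    have h1 := mul_pos h.κ_pos h.S_pos
    have h2 := mul_pos h.μ_pos h.Q_pos
    rw [← sq_lt_one_iff_abs_lt_one]
    nlinarith [sq_pos_of_pos (add_pos h1 h2)]
  rw [abs_lt] at hc
  refine (thickness_le (k := k) (k' := k') ?_ ?_ hk hk').trans (le_of_eq ?_)
  · intro e
    rw [e, inner_self_S2] at hin; linarith
  · intro e
    rw [e, show ((-k : S2) : E3) = -(k : E3) from rfl, inner_neg_right, inner_self_S2] at hin
    linarith
  · rw [angle_S2, hin, Real.arccos_neg]; ring

/-- By symmetry about the great circle through `v i` and the centre, each half of the polar side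
containing `k` is covered by `neg_mul_le_inner_of_edge`, with `x` the midpoint of the side and `w'`
the opposite polar vertex. -/
theorem bound_of_pos (h : RegularFrame n e₁ e₂ o κ μ S Q) (hn : n = 2 * g + 1)
    (hc : 0 < κ * Q - μ * S) (k k' : S2) (hk : ∀ i, 0 ≤ ⟪(k : E3), (h.vertex i : E3)⟫_ℝ)
    (hk0 : ∃ i, ⟪(k : E3), (h.vertex i : E3)⟫_ℝ = 0)
    (hk' : ∀ i, 0 ≤ ⟪(k' : E3), (h.vertex i : E3)⟫_ℝ) :
    -(κ * Q - μ * S) ≤ ⟪(k : E3), (k' : E3)⟫_ℝ := by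
  have hP := h.polarPair
  obtain ⟨i, hi⟩ := hk0
  obtain ⟨a, b, ha, hb, e⟩ := hP.mem_polar_side hk hi
  set T := longitude n i with hT
  set K := cos (π / n) with hK
  set c := κ * Q - μ * S with hcdef
  set s := κ * S + μ * Q with hs
  set C := μ * S + κ * Q * K with hC
  have hκ := h.κ_pos
  have hμ := h.μ_pos
  have hS := h.S_pos
  have hQ := h.Q_pos
  have hC0 : 0 < C := h.exterior_pos
  have hs0 : 0 < s := by positivity
  have hrel : κ * S = μ * Q * K := h.rel
  have hκC : κ * C = Q * K := h.κ_mul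
  have hμC : μ * C = S := h.μ_mul
  have hcirc := h.circum
  have hins := h.inscr
  -- The inscribed circle is not larger than the circumscribed one; this yields the hypothesis `s ≤
  -- 2 * lam`.
  have hκQ : κ ≤ Q := by
    have h1 : κ * S ≤ μ * Q := by
      rw [hrel]; exact mul_le_of_le_one_right (by positivity) h.cos_lt_one.le
    have h2 : (κ * S) ^ 2 ≤ (μ * Q) ^ 2 := pow_le_pow_left₀ (by positivity) h1 2
    have h3 : κ ^ 2 ≤ Q ^ 2 := by nlinarith
    exact (sq_le_sq₀ hκ.le hQ.le).1 h3
  set x := circlePoint e₁ e₂ o μ (-κ) T with hx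
  set w' := circlePoint e₁ e₂ o S Q T with hw'
  set y₁ := circlePoint e₁ e₂ o κ (-μ) (T + π / n) with hy₁
  set y₂ := circlePoint e₁ e₂ o κ (-μ) (T - π / n) with hy₂
  set u₁ := circlePoint e₁ e₂ o S (-Q) (T + π / n) with hu₁
  set u₂ := circlePoint e₁ e₂ o S (-Q) (T - π / n) with hu₂
  have hny : ∀ t, ‖circlePoint e₁ e₂ o κ (-μ) t‖ = 1 :=
    h.norm_circlePoint (by rw [neg_sq]; exact hcirc)
  have hnu : ∀ t, ‖circlePoint e₁ e₂ o S (-Q) t‖ = 1 :=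
    h.norm_circlePoint (by rw [neg_sq]; exact hins)
  have hnx : ‖x‖ = 1 := h.norm_circlePoint (by linarith) _
  have hnw : ‖w'‖ = 1 := h.norm_circlePoint hins _
  have hsc : s ^ 2 + c ^ 2 = 1 := by
    rw [hs, hcdef]; linear_combination (Q ^ 2 + S ^ 2) * hcirc + hins
  have hlam : s ≤ 2 * (s * Q / (2 * κ)) := by
    rw [show 2 * (s * Q / (2 * κ)) = s * (Q / κ) by field_simp]
    exact le_mul_of_one_le_right hs0.le ((one_le_div hκ).2 hκQ)
  have hex : x = -c • w' + (s * Q / (2 * κ)) • (y₁ + y₂) := by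
    have a1 : μ = -c * S + 2 * (s * Q / (2 * κ)) * κ := by
      rw [hcdef, hs]; field_simp; linear_combination (-μ) * hins
    have a2 : -κ = -c * Q - 2 * (s * Q / (2 * κ)) * (μ * K) := by
      rw [hcdef, hs]; field_simp
      linear_combination κ ^ 2 * hins - (κ * S + μ * Q) * hrel
    simp only [hx, hw', hy₁, hy₂, circlePoint, Real.cos_add, Real.cos_sub, Real.sin_add,
      Real.sin_sub, ← hK]
    linear_combination (norm := module) a1 • o + a2 • (cos T • e₁ + sin T • e₂)
  have hcu₁ : u₁ = C • x + (Q / (2 * μ)) • (y₁ - y₂) := by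
    have a3 : Q = 2 * (Q / (2 * μ)) * μ := by field_simp
    simp only [hx, hu₁, hy₁, hy₂, circlePoint, Real.cos_add, Real.cos_sub, Real.sin_add,
      Real.sin_sub, ← hK]
    linear_combination (norm := module) (-hμC) • o + hκC • (cos T • e₁ + sin T • e₂) +
      (-sin (π / n)) • a3 • (cos T • e₂ - sin T • e₁)
  have hcu₂ : u₂ = C • x + (Q / (2 * μ)) • (y₂ - y₁) := by
    have a3 : Q = 2 * (Q / (2 * μ)) * μ := by field_simp
    simp only [hx, hu₂, hy₁, hy₂, circlePoint, Real.cos_add, Real.cos_sub, Real.sin_add,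
      Real.sin_sub, ← hK]
    linear_combination (norm := module) (-hμC) • o + hκC • (cos T • e₁ + sin T • e₂) +
      (sin (π / n)) • a3 • (cos T • e₂ - sin T • e₁)
  have huy₁ : ⟪u₁, y₁⟫_ℝ = s := by
    rw [hu₁, hy₁, h.inner_circlePoint, sub_self, Real.cos_zero]; ring
  have huy₂ : ⟪u₂, y₂⟫_ℝ = s := by
    rw [hu₂, hy₂, h.inner_circlePoint, sub_self, Real.cos_zero]; ring
  have hwy₁ : ⟪w', y₁⟫_ℝ = 0 := by
    rw [hw', hy₁, h.inner_circlePoint, show T - (T + π / n) = -(π / n) by ring, Real.cos_neg, ← hK]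
    linear_combination hrel
  have hwy₂ : ⟪w', y₂⟫_ℝ = 0 := by
    rw [hw', hy₂, h.inner_circlePoint, show T - (T - π / n) = π / n by ring, ← hK]
    linear_combination hrel
  have hxy : ⟪x, y₁⟫_ℝ = ⟪x, y₂⟫_ℝ := by
    rw [hx, hy₁, hy₂, h.inner_circlePoint, h.inner_circlePoint, show T - (T + π / n) = -(π / n) by ring,
      show T - (T - π / n) = π / n by ring, Real.cos_neg]
  have hyk₁ : 0 ≤ ⟪y₁, (k' : E3)⟫_ℝ := by
    have := hk' (i + g + 1)
    rw [h.vertex_opposite' hn, real_inner_comm] at this; exact this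
  have hyk₂ : 0 ≤ ⟪y₂, (k' : E3)⟫_ℝ := by
    have := hk' (i + g)
    rw [h.vertex_opposite hn, real_inner_comm] at this; exact this
  have e' : (k : E3) = a • u₂ + b • u₁ := by
    rw [e, h.normal_sub_one]; rfl
  have hfin : -c * (‖(k : E3)‖ * ‖(k' : E3)‖) ≤ ⟪(k : E3), (k' : E3)⟫_ℝ := by
    -- The smaller coefficient is taken out: as `u₁ + u₂ = (2 * C) • x`, what remains is a
    -- combination of the midpoint direction and one end of the side.
    rcases le_total a b with hab | hab
    · refine neg_mul_le_inner_of_edge (u := u₁) hc hs0 hsc hC0 hlam (τ₀ := Q / (2 * μ)) (by positivity)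
        (by positivity : 0 ≤ a * (2 * C)) (sub_nonneg.2 hab) hnx hnw (hny _) (hnu _) hex hcu₁ huy₁ hwy₁
        (by rw [inner_sub_right, hxy, sub_self]) ?_ hyk₁ hyk₂
      rw [e', hcu₁, hcu₂]; module
    · refine neg_mul_le_inner_of_edge (u := u₂) hc hs0 hsc hC0 hlam (τ₀ := Q / (2 * μ)) (by positivity)
        (by positivity : 0 ≤ b * (2 * C)) (sub_nonneg.2 hab) hnx hnw (hny _) (hnu _)
        (by rw [add_comm y₂]; exact hex) hcu₂ huy₂ hwy₂
        (by rw [inner_sub_right, hxy, sub_self]) ?_ hyk₂ hyk₁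
      rw [e', hcu₁, hcu₂]; module
  have hnk : ‖(k : E3)‖ = 1 := by simp
  have hnk' : ‖(k' : E3)‖ = 1 := by simp
  rw [hnk, hnk'] at hfin
  linarith

/-- The assumption makes all inner products of normals non-negative, and such a bound passes to the
whole polar cone by `mul_le_inner`. It gives the thickness when `κ * Q = μ * S` and excludes a
thickness of at most `π / 2` when the difference is negative. -/
theorem bound_of_nonpos (h : RegularFrame n e₁ e₂ o κ μ S Q) (hn : n = 2 * g + 1)
    (hc : κ * Q - μ * S ≤ 0) : arccos (Q ^ 2 * cos (π / n) - S ^ 2) ≤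
      thickness (hull (range h.vertex)) := by
  have hP := h.polarPair
  have hm : Q ^ 2 * cos (π / n) - S ^ 2 ≤ 0 := by
    rw [← h.exterior_eq]; exact mul_nonpos_of_nonneg_of_nonpos h.exterior_pos.le hc
  have hm1 : -1 ≤ Q ^ 2 * cos (π / n) - S ^ 2 := by
    nlinarith [h.inscr, mul_nonneg (sq_nonneg Q) h.cos_pos.le, sq_nonneg Q]
  refine hP.le_thickness (Real.arccos_le_pi _) fun k k' hk _ hk' => ?_
  rw [Real.cos_arccos hm1 (by linarith)]
  have := hP.mul_le_inner (m := S ^ 2 - Q ^ 2 * cos (π / n)) (by linarith)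
    (h.le_inner_normal hn) hk hk'
  have hnk : ‖(k : E3)‖ = 1 := by simp
  have hnk' : ‖(k' : E3)‖ = 1 := by simp
  rw [hnk, hnk'] at this
  linarith

theorem thickness_eq (h : RegularFrame n e₁ e₂ o κ μ S Q) (hn : n = 2 * g + 1)
    (hc : 0 ≤ κ * Q - μ * S) : thickness (hull (range h.vertex)) = arccos (κ * Q - μ * S) := by
  refine le_antisymm (h.thickness_le_arccos hn) ?_
  rcases hc.eq_or_lt with hc | hc
  · have := h.bound_of_nonpos hn hc.ge
    rw [← h.exterior_eq, ← hc, mul_zero] at this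
    rwa [← hc]
  · refine h.polarPair.le_thickness (Real.arccos_le_pi _) fun k k' hk hk0 hk' => ?_
    have h1 : κ * Q - μ * S ≤ 1 := by
      nlinarith [h.circum, h.inscr, sq_nonneg (κ - Q), mul_pos h.μ_pos h.S_pos, sq_nonneg μ,
        sq_nonneg S]
    rw [Real.cos_arccos (by linarith) h1]
    exact h.bound_of_pos hn hc k k' hk hk0 hk'

theorem nonneg_of_thickness_le (h : RegularFrame n e₁ e₂ o κ μ S Q) (hn : n = 2 * g + 1)
    (ht : thickness (hull (range h.vertex)) ≤ π / 2) : 0 ≤ κ * Q - μ * S := by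
  by_contra! hc
  have h1 := (h.bound_of_nonpos hn hc.le).trans ht
  rw [Real.arccos_le_pi_div_two, ← h.exterior_eq] at h1
  exact absurd (mul_neg_of_pos_of_neg h.exterior_pos hc) (not_lt.2 h1)

end Odd

end RegularFrame

end

/-! ### Equal sides and angles yield a frame -/

section

open InnerProductGeometry

theorem cross_add_right (a b c : E3) : cross a (b + c) = cross a b + cross a c := by
  apply ext3 <;> simp <;> ring

theorem cross_smul_right (a b : E3) (r : ℝ) : cross a (r • b) = r • cross a b := by
  apply ext3 <;> simp <;> ring

theorem cross_cross (a b c : E3) : cross a (cross b c) = ⟪a, c⟫_ℝ • b - ⟪a, b⟫_ℝ • c := by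
  apply ext3 <;> simp [inner_eq_coord] <;> ring

/-- A sequence of unit vectors turning about an axis `o` by a constant angle. -/
theorem exists_circlePoint_eq {p : ℕ → E3} {o : E3} {κ g E : ℝ} (ho : ⟪o, o⟫_ℝ = 1)
    (hκ : ∀ k, ⟪o, p k⟫_ℝ = κ) (hp : ∀ k, ⟪p k, p k⟫_ℝ = 1) (hg : ∀ k, ⟪p k, p (k + 1)⟫_ℝ = g)
    (hE : ∀ k, det3 o (p k) (p (k + 1)) = E) (hE0 : 0 < E) :
    ∃ (e₁ e₂ : E3) (μ θ : ℝ), ⟪e₁, e₁⟫_ℝ = 1 ∧ ⟪e₂, e₂⟫_ℝ = 1 ∧ ⟪e₁, e₂⟫_ℝ = 0 ∧ ⟪e₁, o⟫_ℝ = 0 ∧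
      ⟪e₂, o⟫_ℝ = 0 ∧ det3 e₁ e₂ o = 1 ∧ 0 < μ ∧ κ ^ 2 + μ ^ 2 = 1 ∧ 0 < θ ∧ θ < π ∧
      ∀ k : ℕ, p k = circlePoint e₁ e₂ o κ μ (k * θ) := by
  have hsq : E ^ 2 + (g - κ ^ 2) ^ 2 = (1 - κ ^ 2) ^ 2 := by
    rw [← hE 0, det3_sq, ho, hp, hp, hκ, hκ, hg]; ring
  have hpos : 0 < 1 - κ ^ 2 := by
    have h1 : κ ^ 2 ≤ 1 := by
      have := real_inner_mul_inner_self_le o (p 0)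
      rw [ho, hp, hκ] at this
      linarith
    refine lt_of_le_of_ne (by linarith) fun h0 => ?_
    rw [← h0] at hsq
    nlinarith [sq_nonneg (g - κ ^ 2)]
  set μ := √(1 - κ ^ 2) with hμ
  have hμ0 : 0 < μ := Real.sqrt_pos.2 hpos
  have hμ2 : μ ^ 2 = 1 - κ ^ 2 := Real.sq_sqrt hpos.le
  set r : ℕ → E3 := fun k => p k - κ • o with hr
  have hro : ∀ k, ⟪o, r k⟫_ℝ = 0 := fun k => by
    rw [hr, inner_sub_right, real_inner_smul_right, hκ, ho]; ring
  have hrr : ∀ k, ⟪r k, r k⟫_ℝ = μ ^ 2 := fun k => by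
    simp only [hr, inner_sub_right, inner_sub_left, real_inner_smul_right, real_inner_smul_left,
      hκ, ho, hp, real_inner_comm o (p k)]
    rw [hμ2]; ring
  have hrg : ∀ k, ⟪r k, r (k + 1)⟫_ℝ = g - κ ^ 2 := fun k => by
    simp only [hr, inner_sub_right, inner_sub_left, real_inner_smul_right, real_inner_smul_left,
      hκ, ho, hg, real_inner_comm o (p k)]
    ring
  have hrE : ∀ k, det3 o (r k) (r (k + 1)) = E := fun k => by
    rw [← hE k]
    simp only [hr, det3_eq, PiLp.sub_apply, PiLp.smul_apply, smul_eq_mul]; ring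
  have hcr : ∀ k, ⟪cross o (r k), cross o (r k)⟫_ℝ = μ ^ 2 := fun k => by
    rw [inner_cross_cross, ho, hro, hrr]; ring
  set θ := arccos ((g - κ ^ 2) / μ ^ 2) with hθ
  have habs : |(g - κ ^ 2) / μ ^ 2| < 1 := by
    rw [← sq_lt_one_iff_abs_lt_one, div_pow, div_lt_one (by positivity), hμ2]
    nlinarith
  rw [abs_lt] at habs
  have hcos : cos θ = (g - κ ^ 2) / μ ^ 2 := Real.cos_arccos habs.1.le habs.2.le
  have hsin : sin θ = E / μ ^ 2 := by
    rw [hθ, Real.sin_arccos, Real.sqrt_eq_iff_mul_self_eq_of_pos (by positivity)]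
    rw [div_mul_div_comm, div_pow, div_eq_iff (by positivity), sub_mul, div_mul_eq_mul_div,
      mul_div_assoc, show μ ^ 2 * μ ^ 2 = (μ ^ 2) ^ 2 by ring, div_self (by positivity), hμ2]
    linarith
  -- The next vector is determined by its inner products with `o`, `r k` and `cross o (r k)`; the
  -- sign of `E` fixes the sense of the rotation.
  have hstep : ∀ k, r (k + 1) = cos θ • r k + sin θ • cross o (r k) := fun k => by
    rw [← sub_eq_zero]
    have hd : det3 o (r k) (cross o (r k)) ≠ 0 := by
      rw [← cross_inner, hcr]; positivity
    refine eq_zero_of_det3_ne_zero hd ?_ ?_ ?_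
    · rw [inner_sub_left, inner_add_left, real_inner_smul_left, real_inner_smul_left,
        real_inner_comm, hro, real_inner_comm, hro, cross_inner, det3_self_outer]
      ring
    · rw [inner_sub_left, inner_add_left, real_inner_smul_left, real_inner_smul_left,
        real_inner_comm, hrg, hrr, cross_inner, det3_self_right, hcos]
      field_simp; ring
    · rw [inner_sub_left, inner_add_left, real_inner_smul_left, real_inner_smul_left,
        inner_cross, det3_rotate, det3_rotate, inner_cross, hcr, hsin, det3_self_outer]
      have := hrE k
      rw [← det3_rotate, ← det3_rotate] at this
      rw [det3_rotate, det3_rotate] at this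
      rw [this]
      field_simp; ring
  refine ⟨μ⁻¹ • r 0, cross o (μ⁻¹ • r 0), μ, θ, ?_, ?_, ?_, ?_, ?_, ?_, hμ0, by rw [hμ2]; ring,
    Real.arccos_pos.2 habs.2, ?_, fun k => ?_⟩
  · rw [real_inner_smul_left, real_inner_smul_right, hrr]; field_simp
  · rw [inner_cross_cross, real_inner_smul_left, real_inner_smul_right, real_inner_smul_right, hrr,
      ho, hro, mul_zero]
    field_simp; ring
  · rw [inner_cross, det3_self_outer]
  · rw [real_inner_smul_left, real_inner_comm, hro, mul_zero]
  · rw [cross_inner, det3_self_outer]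
  · rw [← det3_rotate, ← inner_cross, cross_smul_right, real_inner_smul_left,
      real_inner_smul_right, hcr]
    field_simp
  · refine lt_of_le_of_ne (Real.arccos_le_pi _) fun e => ?_
    exact absurd (Real.arccos_eq_pi.1 e) (not_le.2 habs.1)
  · have key : r k = cos (k * θ) • r 0 + sin (k * θ) • cross o (r 0) := by
      induction k with
      | zero => simp
      | succ k ih =>
        have e : cross o (cross o (r 0)) = -r 0 := by
          rw [cross_cross, hro, ho]; module
        rw [hstep, ih, cross_add_right, cross_smul_right, cross_smul_right, e,
          show ((k + 1 : ℕ) : ℝ) * θ = k * θ + θ by push_cast; ring, Real.cos_add, Real.sin_add]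
        module
    have e : p k = κ • o + r k := by rw [hr]; module
    have hμi : μ * μ⁻¹ = 1 := mul_inv_cancel₀ hμ0.ne'
    rw [e, key, circlePoint, cross_smul_right, smul_comm _ μ⁻¹, smul_comm _ μ⁻¹, ← smul_add,
      smul_smul, hμi, one_smul]

/-- A closed sequence on a circle in cyclic order runs once around the circle. -/
theorem eq_two_pi_div_of_sin_pos {n : ℕ} (hn : 3 ≤ n) {θ : ℝ} (h0 : 0 < θ) (hπ : θ < π)
    (hcos : cos (n * θ) = 1) (hpos : ∀ b : ℕ, 1 < b → b < n →
      0 < sin (θ / 2) * sin ((b - 1) * θ / 2) * sin (b * θ / 2)) : θ = 2 * π / n := by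
  have hsin : ∀ t, 0 < t → t < π → 0 < sin t := fun t => Real.sin_pos_of_pos_of_lt_pi
  have key : ∀ b : ℕ, 1 ≤ b → b < n → b * θ / 2 < π := by
    intro b hb
    induction b, hb using Nat.le_induction with
    | base => intro _; rw [Nat.cast_one]; linarith
    | succ b hb ih =>
      intro hbn
      have hb' : (1 : ℝ) ≤ b := by exact_mod_cast hb
      have h1 := ih (by omega)
      have h2 := hpos (b + 1) (by omega) hbn
      rw [Nat.cast_add, Nat.cast_one, add_sub_cancel_right] at h2
      rw [Nat.cast_add, Nat.cast_one]
      have h3 : 0 < sin (b * θ / 2) := hsin _ (by positivity) h1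
      have h4 : 0 < sin ((b + 1) * θ / 2) :=
        pos_of_mul_pos_right h2 (mul_pos (hsin _ (by linarith) (by linarith)) h3).le
      by_contra! h5
      have h6 : sin ((b + 1) * θ / 2 - π) ≥ 0 :=
        Real.sin_nonneg_of_nonneg_of_le_pi (by linarith) (by linarith)
      rw [Real.sin_sub_pi] at h6
      linarith
  have hlast := key (n - 1) (by omega) (by omega)
  rw [Nat.cast_sub (by omega), Nat.cast_one] at hlast
  have hn0 : (3 : ℝ) ≤ n := by exact_mod_cast hn
  obtain ⟨m, hm⟩ := (Real.cos_eq_one_iff _).1 hcos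
  have hm0 : (0 : ℝ) < m := by
    have : 0 < (m : ℝ) * (2 * π) := by rw [hm]; positivity
    exact pos_of_mul_pos_left this (by positivity)
  -- Since `(n - 1) * θ < 2 * π` and `n ≥ 3`, the total turn `n * θ` is less than two full turns.
  have hm2 : (m : ℝ) < 2 := by
    nlinarith [Real.pi_pos]
  have : m = 1 := by
    have a1 : 0 < m := by exact_mod_cast hm0
    have a2 : m < 2 := by exact_mod_cast hm2
    omega
  rw [this, Int.cast_one, one_mul] at hm
  rw [hm]; field_simp

/-- Equal sides and angles make the inner products of vertices at distance one and two constant, and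
with them the determinants of three consecutive vertices. Each vertex then follows from the previous
three by a fixed linear recurrence, the plane through three consecutive vertices is always the same,
and the vertices turn about its normal by a constant angle. -/
theorem IsRegularPolygon.exists_frame {n : ℕ} [NeZero n] {W : Set S2} (h : IsRegularPolygon n W) :
    ∃ (e₁ e₂ o : E3) (κ μ S Q : ℝ) (F : RegularFrame n e₁ e₂ o κ μ S Q),
      W = hull (range F.vertex) := by
  obtain ⟨v, hconv, rfl, hccw, hside, hangle⟩ := h
  have hn := hconv.1
  have hcyc : CyclicPos n fun i => (v i : E3) := cyclicPos_of_local hccw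
  have hpair := hcyc.polarPair hn fun i => by simp
  obtain ⟨g₁, hg₁⟩ : ∃ g₁, ∀ i, ⟪(v i : E3), (v (i + 1) : E3)⟫_ℝ = g₁ :=
    ⟨cos (sphDist (v 0) (v (0 + 1))), fun i => by
      rw [← cos_angle_S2]; exact congrArg cos (hside i 0)⟩
  have hd : ∀ i, 0 < det3 (v i) (v (i + 1)) (v (i + 2)) := fun i => by
    have := hcyc i 1 2 (by norm_num) (by norm_num) (by omega)
    simpa using this
  have hnorm : ∀ i, ‖(v i : E3)‖ = 1 := fun i => by simp
  have hlt : ∀ i, ⟪(v i : E3), (v (i + 1) : E3)⟫_ℝ < 1 := fun i => by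
    refine lt_of_le_of_ne ?_ fun e => ?_
    · have := real_inner_le_norm (v i : E3) (v (i + 1))
      rwa [hnorm, hnorm, one_mul] at this
    · have e := (inner_eq_one_iff_of_norm_eq_one (𝕜 := ℝ) (hnorm _) (hnorm _)).1 e
      have := hd i
      rw [← e, det3_self_left] at this
      exact lt_irrefl _ this
  have hlt₁ : g₁ < 1 := by rw [← hg₁ 0]; exact hlt 0
  have hgt₁ : -1 < g₁ := by
    rw [← hg₁ 0]
    refine lt_of_le_of_ne ?_ fun e => ?_
    · have := neg_le_of_abs_le (abs_real_inner_le_norm (v 0 : E3) (v (0 + 1)))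
      rwa [hnorm, hnorm, one_mul] at this
    · have e := (inner_eq_neg_one_iff_of_norm_eq_one (𝕜 := ℝ) (hnorm _) (hnorm _)).1 e.symm
      have := hd 0
      rw [e, ← neg_one_smul ℝ, det3_smul_left, det3_self_left, mul_zero] at this
      exact lt_irrefl _ this
  have ht : ∀ i, ‖tangentTo (v i) (v (i + 1))‖ ^ 2 = 1 - g₁ ^ 2 ∧
      ‖tangentTo (v i) (v (i - 1))‖ ^ 2 = 1 - g₁ ^ 2 ∧
      ⟪tangentTo (v i) (v (i - 1)), tangentTo (v i) (v (i + 1))⟫_ℝ =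
        ⟪(v (i - 1) : E3), (v (i + 1) : E3)⟫_ℝ - g₁ ^ 2 := fun i => by
    have h1 : ⟪(v i : E3), (v (i - 1) : E3)⟫_ℝ = g₁ := by
      have := hg₁ (i - 1)
      rw [sub_add_cancel] at this
      rw [real_inner_comm, this]
    have h2 := hg₁ i
    have h3 := inner_self_S2 (v i)
    have h4 := inner_self_S2 (v (i - 1))
    have h5 := inner_self_S2 (v (i + 1))
    simp only [tangentTo, ← real_inner_self_eq_norm_sq, inner_sub_left, inner_sub_right,
      real_inner_smul_left, real_inner_smul_right, real_inner_comm (v i : E3), h1, h2, h3, h4, h5]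
    refine ⟨by ring, by ring, ?_⟩
    rw [real_inner_comm]
    ring
  obtain ⟨g₂, hg₂⟩ : ∃ g₂, ∀ i, ⟪(v i : E3), (v (i + 2) : E3)⟫_ℝ = g₂ := by
    have hpos : 0 < 1 - g₁ ^ 2 := by nlinarith
    have hcos : ∀ i, ⟪(v (i - 1) : E3), (v (i + 1) : E3)⟫_ℝ = g₁ ^ 2 + (1 - g₁ ^ 2) *
        cos (sphAngle (v (i - 1)) (v i) (v (i + 1))) := fun i => by
      obtain ⟨h1, h2, h3⟩ := ht i
      have : ‖tangentTo (v i) (v (i - 1))‖ = ‖tangentTo (v i) (v (i + 1))‖ := by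
        rw [← sq_eq_sq₀ (norm_nonneg _) (norm_nonneg _), h1, h2]
      rw [sphAngle, cos_angle, h3, this, ← sq, h1]
      field_simp; ring
    refine ⟨⟪(v (0 - 1) : E3), (v (0 + 1) : E3)⟫_ℝ, fun i => ?_⟩
    have e := hcos (i + 1)
    rw [hangle (i + 1) 0, ← hcos 0, add_sub_cancel_right, add_assoc, one_add_one_eq_two] at e
    exact e
  have hlt₂ : g₂ < 1 := by
    rw [← hg₂ 0]
    refine lt_of_le_of_ne ?_ fun e => ?_
    · have := real_inner_le_norm (v 0 : E3) (v (0 + 2))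
      rwa [hnorm, hnorm, one_mul] at this
    · have e := (inner_eq_one_iff_of_norm_eq_one (𝕜 := ℝ) (hnorm _) (hnorm _)).1 e
      have := hd 0
      rw [← e, det3_self_outer] at this
      exact lt_irrefl _ this
  have hdet : ∀ i, det3 (v (i + 1)) (v (i + 2)) (v (i + 3)) = det3 (v i) (v (i + 1)) (v (i + 2)) :=
      fun i => by
    have e1 : ∀ i, det3 (v i) (v (i + 1)) (v (i + 2)) ^ 2 = 1 + 2 * g₁ * g₁ * g₂ - g₁ ^ 2 - g₂ ^ 2 -
        g₁ ^ 2 := fun i => by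
      have := hg₁ (i + 1)
      rw [add_assoc, one_add_one_eq_two] at this
      rw [det3_sq, inner_self_S2, inner_self_S2, inner_self_S2, hg₁, hg₂, this]; ring
    have h1 := hd (i + 1)
    have h2 := e1 (i + 1)
    rw [add_assoc, add_assoc, one_add_one_eq_two, show (1 : ZMod n) + 2 = 3 by norm_num] at h1 h2
    rw [← sq_eq_sq₀ h1.le (hd i).le, h2, e1]
  have hrec : ∀ i, (v (i + 3) : E3) = v i + ((g₂ - g₁) / (1 - g₁)) • ((v (i + 1) : E3) - v (i + 2)) :=
      fun i => by
    have h12 := hg₁ (i + 1)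
    have h23 := hg₁ (i + 2)
    have h13 := hg₂ (i + 1)
    rw [add_assoc, one_add_one_eq_two] at h12
    rw [add_assoc, show (2 : ZMod n) + 1 = 3 by norm_num] at h23
    rw [add_assoc, show (1 : ZMod n) + 2 = 3 by norm_num] at h13
    have hne : 1 - g₁ ≠ 0 := by linarith
    have hdd : det3 (v (i + 1)) (v (i + 2)) (cross (v (i + 1)) (v (i + 2))) ≠ 0 := by
      rw [← cross_inner, inner_cross_cross, inner_self_S2, inner_self_S2, h12, real_inner_comm, h12]
      nlinarith
    rw [← sub_eq_zero]
    refine eq_zero_of_det3_ne_zero hdd ?_ ?_ ?_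
    · rw [inner_sub_left, inner_add_left, real_inner_smul_left, inner_sub_left, hg₁, inner_self_S2,
        real_inner_comm, h13, real_inner_comm (v (i + 1) : E3), h12]
      field_simp; ring
    · rw [inner_sub_left, inner_add_left, real_inner_smul_left, inner_sub_left, hg₂, inner_self_S2,
        real_inner_comm, h23, h12]
      field_simp; ring
    · rw [inner_cross, ← sub_eq_zero.2 (hdet i)]
      simp only [det3_eq, PiLp.sub_apply, PiLp.add_apply, PiLp.smul_apply, smul_eq_mul]; ring
  -- `N i` is a normal of the plane through three consecutive vertices; by the recurrence it does
  -- not depend on `i` and serves as axis.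
  set N : ZMod n → E3 := fun i => cross (v i) (v (i + 1)) + cross (v (i + 1)) (v (i + 2)) +
    cross (v (i + 2)) (v i) with hN
  have hNstep : ∀ i, N (i + 1) = N i := fun i => by
    simp only [hN]
    rw [show i + 1 + 1 = i + 2 by ring, show i + 1 + 2 = i + 3 by ring, hrec]
    apply ext3 <;> simp <;> ring
  have hNk : ∀ k : ℕ, N k = N 0 := fun k => by
    induction k with
    | zero => rw [Nat.cast_zero]
    | succ k ih => rw [Nat.cast_succ, hNstep, ih]
  have hNd : ∀ i, ⟪N i, v i⟫_ℝ = det3 (v i) (v (i + 1)) (v (i + 2)) := fun i => by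
    simp only [hN, inner_add_left, cross_inner, det3_self_outer, det3_self_right]
    linear_combination det3_rotate (v i : E3) (v (i + 1)) (v (i + 2))
  have hNE : ∀ i, det3 (N i) (v i) (v (i + 1)) = (1 - g₁) * (1 - g₂) := fun i => by
    have h12 := hg₁ (i + 1)
    rw [add_assoc, one_add_one_eq_two] at h12
    rw [← inner_cross]
    simp only [hN, inner_add_left, inner_cross_cross, inner_self_S2, hg₁, hg₂, h12,
      real_inner_comm (v i : E3), real_inner_comm (v (i + 1) : E3) (v (i + 2) : E3)]
    ring
  have hdk : ∀ k : ℕ, ⟪N 0, v k⟫_ℝ = det3 (v 0) (v (0 + 1)) (v (0 + 2)) := fun k => by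
    induction k with
    | zero => rw [Nat.cast_zero, hNd]
    | succ k ih =>
      have a := hNd ((k + 1 : ℕ) : ZMod n)
      have b := hNd (k : ZMod n)
      rw [hNk] at a
      rw [hNk, ih] at b
      rw [a, b, Nat.cast_succ, ← hdet (k : ZMod n), add_assoc, add_assoc, one_add_one_eq_two,
        show (1 : ZMod n) + 2 = 3 by norm_num]
  have hN0 : 0 < ‖N 0‖ := norm_pos_iff.2 fun e => by
    have := hdk 0
    rw [e, inner_zero_left] at this
    exact (hd 0).ne this
  obtain ⟨e₁, e₂, μ, θ, n₁, n₂, n₁₂, n₁₃, n₂₃, hdet1, hμ, hκμ, hθ0, hθπ, hv⟩ :=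
    exists_circlePoint_eq (p := fun k : ℕ => (v k : E3)) (o := ‖N 0‖⁻¹ • N 0)
    (κ := ‖N 0‖⁻¹ * det3 (v 0) (v (0 + 1)) (v (0 + 2))) (g := g₁)
    (E := ‖N 0‖⁻¹ * ((1 - g₁) * (1 - g₂)))
    (by rw [real_inner_smul_left, real_inner_smul_right, real_inner_self_eq_norm_sq]; field_simp)
    (fun k => by rw [real_inner_smul_left, hdk]) (fun k => inner_self_S2 _)
    (fun k => by simp only [Nat.cast_succ]; exact hg₁ k)
    (fun k => by simp only [Nat.cast_succ]; rw [det3_smul_left, ← hNk k, hNE])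
    (mul_pos (inv_pos.2 hN0) (mul_pos (by linarith) (by linarith)))
  set o := ‖N 0‖⁻¹ • N 0
  set κ := ‖N 0‖⁻¹ * det3 (v 0) (v (0 + 1)) (v (0 + 2)) with hκdef
  have hκ : 0 < κ := mul_pos (inv_pos.2 hN0) (hd 0)
  set K := cos (π / n) with hK
  have hn3 : (3 : ℝ) ≤ n := by exact_mod_cast hn
  have hK0 : 0 < K := Real.cos_pos_of_mem_Ioo ⟨by
    have : 0 < π / n := by positivity
    linarith [Real.pi_pos], by
    rw [div_lt_div_iff_of_pos_left Real.pi_pos (by linarith) (by norm_num)]; linarith⟩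
  -- The relation `rel` fixes the ratio of `S` and `Q`; `R` normalizes them.
  set R := √(κ ^ 2 + (μ * K) ^ 2) with hR
  have hRpos : 0 < κ ^ 2 + (μ * K) ^ 2 := by positivity
  have hR0 : 0 < R := Real.sqrt_pos.2 hRpos
  have hR2 : R ^ 2 = κ ^ 2 + (μ * K) ^ 2 := Real.sq_sqrt hRpos.le
  have F : RegularFrame n e₁ e₂ o κ μ (μ * K / R) (κ / R) :=
    { three_le := hn, n₁ := n₁, n₂ := n₂, h₁₂ := n₁₂, h₁₃ := n₁₃, h₂₃ := n₂₃, det := hdet1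
      n₃ := by rw [real_inner_smul_left, real_inner_smul_right, real_inner_self_eq_norm_sq]; field_simp
      κ_pos := hκ, μ_pos := hμ, S_pos := by positivity, Q_pos := by positivity, circum := hκμ
      inscr := by rw [div_pow, div_pow, ← add_div, add_comm, ← hR2, div_self (by positivity)]
      rel := by rw [← hK]; ring }
  have hθ : θ = 2 * π / n := by
    refine eq_two_pi_div_of_sin_pos hn hθ0 hθπ ?_ fun b hb hbn => ?_
    · have a1 : ⟪(v (n : ℕ) : E3), (v (0 : ℕ) : E3)⟫_ℝ = 1 := by simp
      rw [hv, hv, F.inner_circlePoint, Nat.cast_zero, zero_mul, sub_zero] at a1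
      have : μ ^ 2 * (cos (n * θ) - 1) = 0 := by linear_combination a1 - hκμ
      rcases mul_eq_zero.1 this with h | h
      · exact absurd h (by positivity)
      · linarith
    · have a1 := hcyc 0 1 b (by norm_num) hb hbn
      have e2 : (v (0 : ZMod n) : E3) = v ((0 : ℕ) : ZMod n) := by rw [Nat.cast_zero]
      simp only [zero_add] at a1
      rw [e2, hv, hv, hv, F.det3_circlePoint] at a1
      have a2 := pos_of_mul_pos_right a1 (by positivity)
      have a3 := pos_of_mul_pos_right a2 (by norm_num)
      rw [Nat.cast_one, Nat.cast_zero, zero_mul, sub_zero, sub_zero, one_mul] at a3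
      rwa [show ((b : ℝ) - 1) * θ = b * θ - θ by ring]
  refine ⟨e₁, e₂, o, κ, μ, _, _, F, ?_⟩
  congr 2
  funext i
  refine Subtype.ext ?_
  have := hv i.val
  rw [ZMod.natCast_zmod_val, hθ] at this
  exact this

end

/-! ### Regular polygons of prescribed thickness -/

section

open InnerProductGeometry

/-- Regular polygons of given thickness. -/
theorem exists_regularFrame {n : ℕ} (hn : 3 ≤ n) {c : ℝ} (hc0 : 0 ≤ c) (hc1 : c < 1) :
    ∃ (e₁ e₂ o : E3) (κ μ S Q : ℝ), RegularFrame n e₁ e₂ o κ μ S Q ∧ κ * Q - μ * S = c := by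
  set K := cos (π / n) with hK
  have hn3 : (3 : ℝ) ≤ n := by exact_mod_cast hn
  have hp : 0 < π / n := by positivity
  have hp2 : π / n < π / 2 := by
    rw [div_lt_div_iff_of_pos_left Real.pi_pos (by linarith) (by norm_num)]; linarith
  have hK0 : 0 < K := Real.cos_pos_of_mem_Ioo ⟨by linarith, hp2⟩
  have hK1 : K < 1 := by
    rw [hK, ← Real.cos_zero]
    exact Real.cos_lt_cos_of_nonneg_of_le_pi le_rfl (by linarith [Real.pi_pos]) hp
  -- The parameter `u` is the squared cosine of the inradius, `D u` the squared cosine of half the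
  -- exterior angle, and `f u` the cosine of the sum of the two radii. It runs from `0` at `1 / (1 +
  -- K)` to `1` at `1`, so it takes the value `c`.
  set D : ℝ → ℝ := fun u => 1 - (1 - K ^ 2) * u with hD
  have hDpos : ∀ u ∈ Icc (1 / (1 + K)) 1, 0 < D u := fun u hu => by
    simp only [hD]
    have : 0 < 1 - K ^ 2 := by nlinarith
    nlinarith [mul_nonneg this.le (sub_nonneg.2 hu.2), mul_pos hK0 hK0]
  set f : ℝ → ℝ := fun u => ((1 + K) * u - 1) / √(D u) with hf
  have hcont : ContinuousOn f (Icc (1 / (1 + K)) 1) := by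
    refine ContinuousOn.div (by fun_prop) (by simp only [hD]; fun_prop) fun u hu =>
      (Real.sqrt_pos.2 (hDpos u hu)).ne'
  have hle : 1 / (1 + K) ≤ 1 := by rw [div_le_one (by linarith)]; linarith
  have f0 : f (1 / (1 + K)) = 0 := by
    simp only [hf]
    rw [mul_one_div_cancel (by linarith), sub_self, zero_div]
  have f1 : f 1 = 1 := by
    simp only [hf, hD]
    rw [show 1 - (1 - K ^ 2) * 1 = K ^ 2 by ring, Real.sqrt_sq hK0.le]
    field_simp; ring
  obtain ⟨u, hu, huc⟩ := intermediate_value_Icc hle hcont (by rw [f0, f1]; exact ⟨hc0, hc1.le⟩)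
  have hu1 : u < 1 := lt_of_le_of_ne hu.2 fun e => by
    rw [e, f1] at huc; exact hc1.ne huc.symm
  have hu0 : 0 < u := lt_of_lt_of_le (by positivity) hu.1
  set C := √(D u) with hC
  have hC0 : 0 < C := Real.sqrt_pos.2 (hDpos u hu)
  have hC2 : C ^ 2 = 1 - (1 - K ^ 2) * u := Real.sq_sqrt (hDpos u hu).le
  set Q := √u with hQ
  have hQ0 : 0 < Q := Real.sqrt_pos.2 hu0
  have hQ2 : Q ^ 2 = u := Real.sq_sqrt hu0.le
  set S := √(1 - u) with hS
  have hS0 : 0 < S := Real.sqrt_pos.2 (by linarith)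
  have hS2 : S ^ 2 = 1 - u := Real.sq_sqrt (by linarith)
  refine ⟨!₂[1, 0, 0], !₂[0, 1, 0], !₂[0, 0, 1], Q * K / C, S / C, S, Q, ?_, ?_⟩
  · exact
      { three_le := hn
        n₁ := by rw [inner_eq_coord]; simp
        n₂ := by rw [inner_eq_coord]; simp
        n₃ := by rw [inner_eq_coord]; simp
        h₁₂ := by rw [inner_eq_coord]; simp
        h₁₃ := by rw [inner_eq_coord]; simp
        h₂₃ := by rw [inner_eq_coord]; simp
        det := by simp [det3_eq]
        κ_pos := by positivity
        μ_pos := by positivity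
        S_pos := hS0
        Q_pos := hQ0
        circum := by
          rw [div_pow, div_pow, ← add_div, div_eq_one_iff_eq (by positivity), hC2, mul_pow, hQ2, hS2]
          ring
        inscr := by rw [hS2, hQ2]; ring
        rel := by rw [← hK]; ring }
  · rw [← huc]
    simp only [hf]
    rw [show Q * K / C * Q - S / C * S = (Q ^ 2 * K - S ^ 2) / C by ring, hQ2, hS2]
    congr 1; ring

end

/-! ### Cycles of quarter circles: the first variation -/

section

open InnerProductGeometry
open Filter Topology

section OrthogonalCycle

variable {n : ℕ} [NeZero n] {p : ZMod n → E3}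

/-- A closed polygon on the unit sphere all of whose sides are quarters of great circles. -/
def IsOrthogonalCycle (p : ZMod n → E3) : Prop :=
  (∀ k, ‖p k‖ = 1) ∧ ∀ k, ⟪p k, p (k + 1)⟫_ℝ = 0

/-- The sum of the angles at the vertices of a closed polygon with quarter circles as sides. -/
def turning (p : ZMod n → E3) : ℝ := ∑ k, arccos ⟪p k, p (k + 2)⟫_ℝ

theorem hasDerivAt_turning {q : ℝ → ZMod n → E3} {d : ZMod n → E3}
    (hq : ∀ j, HasDerivAt (fun t => q t j) (d j) 0) (hp : ∀ j, q 0 j = p j)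
    (he : ∀ j, |⟪p j, p (j + 2)⟫_ℝ| < 1) :
    HasDerivAt (fun t => turning (q t)) (-∑ j, ⟪d j, (√(1 - ⟪p j, p (j + 2)⟫_ℝ ^ 2))⁻¹ • p (j + 2) +
      (√(1 - ⟪p (j - 2), p j⟫_ℝ ^ 2))⁻¹ • p (j - 2)⟫_ℝ) 0 := by
  have h1 : ∀ j, HasDerivAt (fun t => arccos ⟪q t j, q t (j + 2)⟫_ℝ)
      (-(1 / √(1 - ⟪p j, p (j + 2)⟫_ℝ ^ 2)) * (⟪p j, d (j + 2)⟫_ℝ + ⟪d j, p (j + 2)⟫_ℝ)) 0 :=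
    fun j => by
      have := he j
      rw [abs_lt] at this
      have h2 := (hq j).inner ℝ (hq (j + 2))
      rw [hp, hp] at h2
      refine HasDerivAt.comp (h₂ := arccos) (0 : ℝ) ?_ h2
      rw [hp, hp]
      exact Real.hasDerivAt_arccos this.1.ne' this.2.ne
  have h3 := HasDerivAt.fun_sum (u := Finset.univ) fun j _ => h1 j
  have e : ∑ j, -(1 / √(1 - ⟪p j, p (j + 2)⟫_ℝ ^ 2)) * (⟪p j, d (j + 2)⟫_ℝ + ⟪d j, p (j + 2)⟫_ℝ) =
      -∑ j, ⟪d j, (√(1 - ⟪p j, p (j + 2)⟫_ℝ ^ 2))⁻¹ • p (j + 2) +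
      (√(1 - ⟪p (j - 2), p j⟫_ℝ ^ 2))⁻¹ • p (j - 2)⟫_ℝ := by
    have hs := Equiv.sum_comp (Equiv.addRight (2 : ZMod n)) fun j =>
      (√(1 - ⟪p (j - 2), p j⟫_ℝ ^ 2))⁻¹ * ⟪d j, p (j - 2)⟫_ℝ
    simp only [Equiv.coe_addRight, add_sub_cancel_right] at hs
    simp only [inner_add_right, real_inner_smul_right, Finset.sum_add_distrib]
    rw [← hs, ← Finset.sum_add_distrib, ← Finset.sum_neg_distrib]
    refine Finset.sum_congr rfl fun j _ => ?_
    rw [real_inner_comm (d (j + 2)) (p j), one_div]; ring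
  rw [e] at h3
  exact h3

theorem norm_cos_add_sin {x y : E3} (hx : ‖x‖ = 1) (hy : ‖y‖ = 1) (hxy : ⟪x, y⟫_ℝ = 0) (t : ℝ) :
    ‖cos t • x + sin t • y‖ = 1 := by
  have : ‖cos t • x + sin t • y‖ ^ 2 = 1 := by
    rw [norm_add_sq_real, real_inner_smul_left, real_inner_smul_right, hxy, norm_smul, norm_smul, hx,
      hy, mul_one, mul_one, Real.norm_eq_abs, Real.norm_eq_abs, sq_abs, sq_abs]
    linarith [Real.sin_sq_add_cos_sq t]
  nlinarith [norm_nonneg (cos t • x + sin t • y)]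

theorem norm_cross_of_orthogonal {a b : E3} (ha : ‖a‖ = 1) (hb : ‖b‖ = 1) (hab : ⟪a, b⟫_ℝ = 0) :
    ‖cross a b‖ = 1 := by
  have : ‖cross a b‖ ^ 2 = 1 := by
    rw [← real_inner_self_eq_norm_sq, inner_cross_cross, real_inner_self_eq_norm_sq,
      real_inner_self_eq_norm_sq, ha, hb, hab]; norm_num
  nlinarith [norm_nonneg (cross a b)]

theorem hasDerivAt_cos_add_sin {x y : E3} {f : ℝ → ℝ} {f' : ℝ} (hf : HasDerivAt f f' 0)
    (h0 : f 0 = 0) : HasDerivAt (fun t => cos (f t) • x + sin (f t) • y) (f' • y) 0 := by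
  have h1 := (hf.cos.smul_const x).fun_add (hf.sin.smul_const y)
  rw [h0, Real.sin_zero, Real.cos_zero] at h1
  have e : (-0 * f') • x + (1 * f') • y = f' • y := by module
  rwa [e] at h1

/-- The vertices `p k` and `p (k + 1)` can be moved so that all the sides remain quarter circles. -/
theorem IsOrthogonalCycle.exists_variation (hp : IsOrthogonalCycle p) (hn : 3 ≤ n) (k : ZMod n)
    (hB : det3 (p k) (p (k + 1)) (p (k + 2)) ≠ 0) :
    ∃ (q : ℝ → ZMod n → E3) (d : ZMod n → E3), (∀ j, HasDerivAt (fun t => q t j) (d j) 0) ∧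
      (∀ j, q 0 j = p j) ∧ (∀ᶠ t in 𝓝 0, IsOrthogonalCycle (q t)) ∧
      (∀ j, j ≠ k → j ≠ k + 1 → d j = 0) ∧ d k = cross (p (k - 1)) (p k) ∧
      d (k + 1) = (det3 (p (k - 1)) (p k) (p (k + 1)) / det3 (p k) (p (k + 1)) (p (k + 2))) •
        cross (p (k + 2)) (p (k + 1)) := by
  obtain ⟨hnorm, horth⟩ := hp
  have hk1 : k + 1 ≠ k := by simpa using offset_ne_self (i := k) (b := 1) (by omega) (by omega)
  have hk2 : k + 2 ≠ k := by simpa using offset_ne_self (i := k) (b := 2) (by omega) (by omega)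
  have hk21 : k + 2 ≠ k + 1 := by
    simpa using (offset_ne (i := k) (a := 1) (b := 2) (by omega) (by omega)).symm
  set a := p (k - 1) with ha
  set x := p k with hx
  set y := p (k + 1) with hy
  set b := p (k + 2) with hb
  have hax : ⟪a, x⟫_ℝ = 0 := by have := horth (k - 1); rwa [sub_add_cancel] at this
  have hxy : ⟪x, y⟫_ℝ = 0 := horth k
  have hyb : ⟪y, b⟫_ℝ = 0 := by
    have := horth (k + 1); rwa [add_assoc, one_add_one_eq_two] at this
  set A := det3 a x y with hA
  set B := det3 x y b with hBdef
  set D := ⟪cross a x, cross b y⟫_ℝ with hD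
  -- The vertex `x` is rotated about `a` by `arctan r`. For `y`, rotated about `b` by an angle with
  -- tangent `T`, orthogonality to the moved `x` reads `A * r = T * (B - D * r)`, which is solved
  -- here.
  set S : ℝ → ℝ := fun r => arctan (A * r / (B - D * r)) with hS
  have hS0 : S 0 = 0 := by simp [hS]
  have hSd : HasDerivAt S (A / B) 0 := by
    have h1 : HasDerivAt (fun r : ℝ => A * r / (B - D * r)) (A / B) 0 := by
      have h2 : HasDerivAt (fun r : ℝ => A * r) A 0 := by
        simpa using (hasDerivAt_id (0 : ℝ)).const_mul A
      have h3 : HasDerivAt (fun r : ℝ => B - D * r) (-D) 0 := by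
        simpa using ((hasDerivAt_id (0 : ℝ)).const_mul D).const_sub B
      have h4 := h2.fun_div h3 (by simpa using hB)
      rw [mul_zero, mul_zero, sub_zero, zero_mul, sub_zero, sq, mul_div_mul_right _ _ hB] at h4
      exact h4
    have h2 := h1.arctan
    simpa using h2
  have hTd : HasDerivAt arctan 1 0 := by simpa using Real.hasDerivAt_arctan 0
  set X : ℝ → E3 := fun r => cos (arctan r) • x + sin (arctan r) • cross a x with hX
  set Y : ℝ → E3 := fun r => cos (S r) • y + sin (S r) • cross b y with hY
  have hXd : HasDerivAt X (cross a x) 0 := by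
    simpa using hasDerivAt_cos_add_sin (x := x) (y := cross a x) hTd Real.arctan_zero
  have hYd : HasDerivAt Y ((A / B) • cross b y) 0 := hasDerivAt_cos_add_sin hSd hS0
  have hX0 : X 0 = x := by simp [hX]
  have hY0 : Y 0 = y := by simp [hY, hS0]
  have hXn : ∀ r, ‖X r‖ = 1 := fun r => norm_cos_add_sin (hnorm k)
    (norm_cross_of_orthogonal (hnorm _) (hnorm _) hax) (by rw [inner_cross, det3_self_outer]) _
  have hYn : ∀ r, ‖Y r‖ = 1 := fun r => norm_cos_add_sin (hnorm _)
    (norm_cross_of_orthogonal (hnorm _) (hnorm _) (by rw [real_inner_comm, hyb]))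
    (by rw [inner_cross, det3_self_outer]) _
  have haX : ∀ r, ⟪a, X r⟫_ℝ = 0 := fun r => by
    rw [hX, inner_add_right, real_inner_smul_right, real_inner_smul_right, hax, inner_cross,
      det3_self_left]; ring
  have hYb : ∀ r, ⟪Y r, b⟫_ℝ = 0 := fun r => by
    rw [hY, inner_add_left, real_inner_smul_left, real_inner_smul_left, hyb, cross_inner,
      det3_self_outer]; ring
  have hXY : ∀ᶠ r in 𝓝 (0 : ℝ), ⟪X r, Y r⟫_ℝ = 0 := by
    have hcont : ContinuousAt (fun r : ℝ => B - D * r) 0 := by fun_prop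
    have hev : ∀ᶠ r in 𝓝 (0 : ℝ), B - D * r ≠ 0 :=
      hcont.eventually_ne (by simpa using hB)
    filter_upwards [hev] with r hr
    have e1 : sin (arctan r) = r * cos (arctan r) := by
      rw [← Real.tan_mul_cos (Real.cos_arctan_pos r).ne', Real.tan_arctan]
    have e2 : sin (S r) = A * r / (B - D * r) * cos (S r) := by
      simp only [hS]
      rw [← Real.tan_mul_cos (Real.cos_arctan_pos _).ne', Real.tan_arctan]
    have e3 : ⟪x, cross b y⟫_ℝ = -B := by rw [inner_cross, det3_swap']
    simp only [hX, hY, inner_add_left, inner_add_right, real_inner_smul_left, real_inner_smul_right]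
    rw [hxy, e3, cross_inner, e1, e2, ← hA, ← hD]
    linear_combination (-(cos (S r) * cos (arctan r))) * div_mul_cancel₀ (A * r) hr
  refine ⟨fun r => Function.update (Function.update p k (X r)) (k + 1) (Y r),
    Function.update (Function.update 0 k (cross a x)) (k + 1) ((A / B) • cross b y), fun j => ?_,
    fun j => ?_, ?_, fun j h1 h2 => ?_, ?_, ?_⟩
  · by_cases h1 : j = k + 1
    · subst h1; simpa using hYd
    · by_cases h2 : j = k
      · subst h2; simpa [h1] using hXd
      · simpa [h1, h2] using hasDerivAt_const (0 : ℝ) (p j)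
  · by_cases h1 : j = k + 1
    · subst h1; simpa using hY0
    · by_cases h2 : j = k
      · subst h2; simpa [h1] using hX0
      · simp [h1, h2]
  · filter_upwards [hXY] with r hr
    refine ⟨fun j => ?_, fun j => ?_⟩
    · by_cases h1 : j = k + 1
      · subst h1; simpa using hYn r
      · by_cases h2 : j = k
        · subst h2; simpa [h1] using hXn r
        · simpa [h1, h2] using hnorm j
    · by_cases h1 : j = k + 1
      · subst h1
        have e : k + 1 + 1 = k + 2 := by ring
        simpa [e, hk2, hk21] using hYb r
      · by_cases h2 : j = k
        · subst h2; simpa [h1] using hr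
        · by_cases h3 : j + 1 = k
          · have h4 : j = k - 1 := eq_sub_of_add_eq h3
            have h5 : k ≠ k + 1 := hk1.symm
            rw [h3]
            simp only [Function.update_of_ne h1, Function.update_of_ne h2, Function.update_of_ne h5,
              Function.update_self]
            rw [h4]; exact haX r
          · have h4 : j + 1 ≠ k + 1 := fun e => h2 (add_right_cancel e)
            simpa [h1, h2, h3, h4] using horth j
  · simp [h1, h2]
  · simp [hk1.symm]
  · simp

/-- The equation satisfied by consecutive angles of a critical cycle. -/
theorem eq_of_critical {e e' s s' α β : ℝ} (hs : 0 < s) (hs' : 0 < s') (h : s ^ 2 + e ^ 2 = 1)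
    (h' : s' ^ 2 + e' ^ 2 = 1) (hα : α ^ 2 = 1) (hβ : β ^ 2 = 1) (heq : s' * (α - e) = s * (β - e')) :
    e = e' := by
  have h1 : -1 < e ∧ e < 1 := abs_lt.1 (by rw [← sq_lt_one_iff_abs_lt_one]; nlinarith)
  have h1' : -1 < e' ∧ e' < 1 := abs_lt.1 (by rw [← sq_lt_one_iff_abs_lt_one]; nlinarith)
  have hα' : α = 1 ∨ α = -1 := by
    rcases mul_eq_zero.1 (by linarith : (α - 1) * (α + 1) = 0) with h | h
    exacts [Or.inl (by linarith), Or.inr (by linarith)]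
  have hβ' : β = 1 ∨ β = -1 := by
    rcases mul_eq_zero.1 (by linarith : (β - 1) * (β + 1) = 0) with h | h
    exacts [Or.inl (by linarith), Or.inr (by linarith)]
  have hab : α = β := by
    rcases hα' with rfl | rfl <;> rcases hβ' with rfl | rfl
    · rfl
    · nlinarith [mul_pos hs' (sub_pos.2 h1.2), mul_pos hs (by linarith : 0 < 1 + e')]
    · nlinarith [mul_pos hs (sub_pos.2 h1'.2), mul_pos hs' (by linarith : 0 < 1 + e)]
    · rfl
  have hsq : s' ^ 2 * (α - e) ^ 2 = s ^ 2 * (α - e') ^ 2 := by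
    rw [← mul_pow, heq, hab, mul_pow]
  have h2 : (1 - e) * (1 - e') * ((1 + e) * (1 + e')) * (e - e') = 0 := by
    rcases hα' with rfl | rfl
    · linear_combination (-1 / 2) * (1 + e) * (1 + e') * hsq + (1 / 2) * (1 + e) * (1 + e') *
        (1 - e) ^ 2 * h' - (1 / 2) * (1 + e) * (1 + e') * (1 - e') ^ 2 * h
    · linear_combination (1 / 2) * (1 - e) * (1 - e') * hsq - (1 / 2) * (1 - e) * (1 - e') *
        (1 + e) ^ 2 * h' + (1 / 2) * (1 - e) * (1 - e') * (1 + e') ^ 2 * h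
  have h3 : 0 < (1 - e) * (1 - e') * ((1 + e) * (1 + e')) :=
    mul_pos (mul_pos (by linarith) (by linarith)) (mul_pos (by linarith) (by linarith))
  linarith [(mul_eq_zero.1 h2).resolve_left h3.ne']

/-- In the orthonormal basis `x`, `y`, `cross x y` the vector `a` has no first coordinate, `b` has
no second one, and the third coordinate of `b` is the determinant on the right. -/
theorem det3_eq_of_orthogonal {a x y b : E3} (hx : ⟪x, x⟫_ℝ = 1) (hy : ⟪y, y⟫_ℝ = 1)
    (hb : ⟪b, b⟫_ℝ = 1) (hax : ⟪a, x⟫_ℝ = 0) (hxy : ⟪x, y⟫_ℝ = 0) (hyb : ⟪y, b⟫_ℝ = 0)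
    (hD : det3 x y b ≠ 0) : det3 a x b = -det3 x y b * ⟪a, y⟫_ℝ := by
  have h1 := det3_mul_det3 x b y a
  have h2 := det3_sq x y b
  have h3 : det3 x b a = det3 a x b := det3_rotate _ _ _
  rw [det3_swap' x y b, h3, real_inner_comm x y, real_inner_comm x b, real_inner_comm a x,
    real_inner_comm a y, hax, hxy, hyb, hx, hb] at h1
  rw [hx, hy, hb, hxy, hyb] at h2
  refine mul_left_cancel₀ (neg_ne_zero.2 hD) ?_
  linear_combination h1 - ⟪a, y⟫_ℝ * h2

/-- The derivative of the turning under the variation of `p k` and `p (k + 1)` vanishes at a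
minimum. As the angles are neither zero nor straight, the turning is differentiable and the
determinants of consecutive triples are non-zero, so that the variation exists. -/
theorem IsOrthogonalCycle.inner_eq_of_min (hp : IsOrthogonalCycle p) (hn : 3 ≤ n)
    (hmin : ∀ q : ZMod n → E3, IsOrthogonalCycle q → turning p ≤ turning q)
    (he : ∀ j, |⟪p j, p (j + 2)⟫_ℝ| < 1) (k : ZMod n) :
    ⟪p (k - 1), p (k + 1)⟫_ℝ = ⟪p k, p (k + 2)⟫_ℝ := by
  have he' : ∀ j, |⟪p (j - 1), p (j + 1)⟫_ℝ| < 1 := fun j => by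
    have := he (j - 1)
    rwa [show j - 1 + 2 = j + 1 by ring] at this
  have hself : ∀ j, ⟪p j, p j⟫_ℝ = 1 := fun j => by
    rw [real_inner_self_eq_norm_sq, hp.1]; norm_num
  have hprev : ∀ j, ⟪p (j - 1), p j⟫_ℝ = 0 := fun j => by
    have := hp.2 (j - 1); rwa [sub_add_cancel] at this
  set s : ZMod n → ℝ := fun j => √(1 - ⟪p (j - 1), p (j + 1)⟫_ℝ ^ 2) with hs
  set D : ZMod n → ℝ := fun j => det3 (p (j - 1)) (p j) (p (j + 1)) with hD
  have hpos : ∀ j, 0 < 1 - ⟪p (j - 1), p (j + 1)⟫_ℝ ^ 2 := fun j => by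
    have := (sq_lt_one_iff_abs_lt_one _).2 (he' j)
    linarith
  have hs0 : ∀ j, 0 < s j := fun j => Real.sqrt_pos.2 (hpos j)
  have hs2 : ∀ j, s j ^ 2 = 1 - ⟪p (j - 1), p (j + 1)⟫_ℝ ^ 2 := fun j => Real.sq_sqrt (hpos j).le
  have hD2 : ∀ j, D j ^ 2 = s j ^ 2 := fun j => by
    simp only [hD]
    rw [hs2, det3_sq, hself, hself, hself, hprev, hp.2]; ring
  have hD0 : ∀ j, D j ≠ 0 := fun j e => by
    have := hD2 j
    rw [e] at this
    nlinarith [hs0 j]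
  have hη : ∀ j, (D j / s j) ^ 2 = 1 := fun j => by
    rw [div_pow, hD2, div_self (pow_pos (hs0 j) 2).ne']
  have hk0 : k + 1 - 1 = k := by ring
  have hk1 : k + 1 + 1 = k + 2 := by ring
  have hk2 : k + 2 - 1 = k + 1 := by ring
  have hk3 : k + 2 + 1 = k + 1 + 2 := by ring
  have hk4 : k - 1 - 1 = k - 2 := by ring
  have hk5 : k - 1 + 1 = k := by ring
  have hk6 : k + 1 - 2 = k - 1 := by ring
  have hDk1 : D (k + 1) = det3 (p k) (p (k + 1)) (p (k + 2)) := by simp only [hD, hk0, hk1]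
  have hDk2 : D (k + 2) = det3 (p (k + 1)) (p (k + 2)) (p (k + 1 + 2)) := by
    simp only [hD, hk2, hk3]
  have hDk' : D (k - 1) = det3 (p (k - 2)) (p (k - 1)) (p k) := by simp only [hD, hk4, hk5]
  obtain ⟨q, d, hq, hq0, hqe, hd0, hdk, hdk1⟩ := hp.exists_variation hn k (by
    rw [← hDk1]; exact hD0 _)
  have hq0' : q 0 = p := funext hq0
  have hloc : IsLocalMin (fun t => turning (q t)) 0 := by
    filter_upwards [hqe] with t ht
    rw [hq0']
    exact hmin _ ht
  have hderiv := hloc.hasDerivAt_eq_zero (hasDerivAt_turning hq hq0 he)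
  have hne : k ≠ k + 1 := by
    simpa using (offset_ne_self (i := k) (b := 1) (by omega) (by omega)).symm
  rw [neg_eq_zero, ← Finset.sum_subset (Finset.subset_univ {k, k + 1}) (fun j _ hj => by
    rw [Finset.mem_insert, Finset.mem_singleton, not_or] at hj
    rw [hd0 j hj.1 hj.2, inner_zero_left]), Finset.sum_pair hne, hdk, hdk1, hk6, ← hDk1] at hderiv
  have t1 : √(1 - ⟪p k, p (k + 2)⟫_ℝ ^ 2) = s (k + 1) := by simp only [hs, hk0, hk1]
  have t2 : √(1 - ⟪p (k - 2), p k⟫_ℝ ^ 2) = s (k - 1) := by simp only [hs, hk4, hk5]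
  have t3 : √(1 - ⟪p (k + 1), p (k + 1 + 2)⟫_ℝ ^ 2) = s (k + 2) := by simp only [hs, hk2, hk3]
  have t4 : √(1 - ⟪p (k - 1), p (k + 1)⟫_ℝ ^ 2) = s k := rfl
  rw [t1, t2, t3, t4] at hderiv
  simp only [inner_add_right, real_inner_smul_left, real_inner_smul_right, cross_inner] at hderiv
  have hb : ⟪p (k + 1), p (k + 2)⟫_ℝ = 0 := by
    have := hp.2 (k + 1); rwa [hk1] at this
  have d1 : det3 (p (k - 1)) (p k) (p (k + 2)) = -D (k + 1) * ⟪p (k - 1), p (k + 1)⟫_ℝ := by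
    rw [hDk1]
    exact det3_eq_of_orthogonal (hself _) (hself _) (hself _) (hprev _) (hp.2 _) hb
      (by rw [← hDk1]; exact hD0 _)
  have d2 : det3 (p (k + 2)) (p (k + 1)) (p (k - 1)) = D k * ⟪p k, p (k + 2)⟫_ℝ := by
    have e : det3 (p (k + 1)) (p k) (p (k - 1)) = -D k := by
      simp only [hD]
      rw [det3_swap, det3_rotate]
    rw [det3_eq_of_orthogonal (y := p k) (hself _) (hself _) (hself _) (by rw [real_inner_comm, hb])
      (by rw [real_inner_comm, hp.2]) (by rw [real_inner_comm, hprev])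
      (by rw [e]; exact neg_ne_zero.2 (hD0 _)), e, neg_neg, real_inner_comm]
  have d3 : det3 (p (k - 1)) (p k) (p (k - 2)) = D (k - 1) := by rw [hDk', det3_rotate]
  have d4 : det3 (p (k + 2)) (p (k + 1)) (p (k + 1 + 2)) = -D (k + 2) := by rw [hDk2, det3_swap]
  have d5 : det3 (p (k - 1)) (p k) (p (k + 1)) = D k := rfl
  rw [d1, d2, d3, d4, d5] at hderiv
  -- The determinant `D j` is `s j` up to sign, so the quotients are the orientations of consecutive
  -- triples; products of two of them are the signs `α` and `β`.
  refine eq_of_critical (hs0 k) (hs0 (k + 1)) (by rw [hs2]; ring)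
    (by rw [hs2, hk0, hk1]; ring) (α := D (k - 1) / s (k - 1) * (D (k + 1) / s (k + 1)))
    (β := D k / s k * (D (k + 2) / s (k + 2))) (by rw [mul_pow, hη, hη, one_mul])
    (by rw [mul_pow, hη, hη, one_mul]) ?_
  have u0 := (hs0 k).ne'
  have u1 := (hs0 (k + 1)).ne'
  have u2 := (hs0 (k + 2)).ne'
  have u3 := (hs0 (k - 1)).ne'
  have w0 := hD2 k
  have w1 := hD2 (k + 1)
  have x1 := hD0 (k + 1)
  field_simp at hderiv ⊢
  refine mul_left_cancel₀ (mul_ne_zero u0 u1) ?_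
  linear_combination hderiv + (s (k + 2) * s k * s (k - 1) * ⟪p (k - 1), p (k + 1)⟫_ℝ) * w1 -
    (s (k + 1) * s (k - 1) * s (k + 2) * ⟪p k, p (k + 2)⟫_ℝ) * w0

end OrthogonalCycle

end

/-! ### Cycles of quarter circles: the minimum of the turning -/

section

open InnerProductGeometry
open Filter Topology

section OrthogonalCycle

variable {n : ℕ} [NeZero n] {p : ZMod n → E3}

theorem angle_of_norm_eq_one {a b : E3} (ha : ‖a‖ = 1) (hb : ‖b‖ = 1) :
    angle a b = arccos ⟪a, b⟫_ℝ := by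
  rw [angle, ha, hb, mul_one, div_one]

theorem exists_forall_turning_le (h : ∃ p : ZMod n → E3, IsOrthogonalCycle p) :
    ∃ p : ZMod n → E3, IsOrthogonalCycle p ∧ ∀ q : ZMod n → E3, IsOrthogonalCycle q →
      turning p ≤ turning q := by
  have hclosed : IsClosed {p : ZMod n → E3 | IsOrthogonalCycle p} := by
    have e : {p : ZMod n → E3 | IsOrthogonalCycle p} =
        (⋂ k, {p : ZMod n → E3 | ‖p k‖ = 1}) ∩ ⋂ k, {p : ZMod n → E3 | ⟪p k, p (k + 1)⟫_ℝ = 0} := by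
      ext p; simp [IsOrthogonalCycle]
    rw [e]
    exact (isClosed_iInter fun k => isClosed_eq (by fun_prop) (by fun_prop)).inter
      (isClosed_iInter fun k => isClosed_eq (by fun_prop) (by fun_prop))
  have hcomp : IsCompact {p : ZMod n → E3 | IsOrthogonalCycle p} :=
    (isCompact_closedBall (0 : ZMod n → E3) 1).of_isClosed_subset hclosed fun p hp => by
      rw [mem_closedBall_zero_iff, pi_norm_le_iff_of_nonneg zero_le_one]
      exact fun k => (hp.1 k).le
  have hcont : Continuous fun p : ZMod n → E3 => turning p :=
    continuous_finsetSum _ fun k _ => Real.continuous_arccos.comp (by fun_prop)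
  obtain ⟨p, hp, hmin⟩ := hcomp.exists_isMinOn h hcont.continuousOn
  exact ⟨p, hp, fun q hq => hmin hq⟩

theorem chordAngle_zero_left (ψ : ℝ) : chordAngle 0 ψ = arccos (cos ψ ^ 2) := by
  rw [chordAngle, zero_add, zero_mul, add_zero, div_one, sq]

/-- The turning of a cycle all of whose angles are equal. -/
theorem IsOrthogonalCycle.le_turning_of_const {g : ℕ} (hp : IsOrthogonalCycle p)
    (hn : n = 2 * g + 1) {e : ℝ} (he : ∀ k, ⟪p k, p (k + 2)⟫_ℝ = e) (he1 : -1 < e) {β : ℝ}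
    (hβ : β ∈ Icc 0 (π / 2)) (hβn : chordAngle 0 β = π / n) : n * (2 * β) ≤ turning p := by
  have hself : ∀ j, ⟪p j, p j⟫_ℝ = 1 := fun j => by
    rw [real_inner_self_eq_norm_sq, hp.1]; norm_num
  have hle : e ≤ 1 := by
    have := real_inner_le_norm (p 0) (p (0 + 2))
    rwa [he, hp.1, hp.1, one_mul] at this
  set b := arccos e with hb
  have hcb : cos b = e := Real.cos_arccos he1.le hle
  have hhalf : cos (b / 2) ^ 2 = (1 + e) / 2 := by
    have := Real.cos_two_mul (b / 2)
    rw [mul_div_cancel₀ _ (two_ne_zero), hcb] at this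
    linarith
  -- `x k` bisects the angle between the two neighbours of `p k`. The normals of the planes through
  -- `p k` and `x k` play the part of the normals of the chord planes; they do not vanish because `e
  -- > -1`.
  set x : ZMod n → E3 := fun k => p (k - 1) + p (k + 1) with hx
  set N : ZMod n → E3 := fun k => cross (p k) (x k) with hN
  have he' : ∀ k, ⟪p (k - 1), p (k + 1)⟫_ℝ = e := fun k => by
    rw [← he (k - 1), show k - 1 + 2 = k + 1 by ring]
  have hprev : ∀ j, ⟪p (j - 1), p j⟫_ℝ = 0 := fun j => by
    have := hp.2 (j - 1); rwa [sub_add_cancel] at this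
  have hpx : ∀ k, ⟪p k, x k⟫_ℝ = 0 := fun k => by
    simp only [hx]
    rw [inner_add_right, real_inner_comm, hprev, hp.2, add_zero]
  have hxx : ∀ k, ⟪x k, x k⟫_ℝ = 2 + 2 * e := fun k => by
    simp only [hx]
    rw [real_inner_add_add_self, hself, hself, he']; ring
  have hNN : ∀ k, ‖N k‖ = √(2 + 2 * e) := fun k => by
    rw [eq_comm, Real.sqrt_eq_iff_mul_self_eq (by linarith) (norm_nonneg _),
      ← real_inner_self_eq_norm_mul_norm, inner_cross_cross, hself, hpx, hxx]
    ring
  have hNs : ∀ k, ⟪N k, N (k + 1)⟫_ℝ = -(1 + e) ^ 2 := fun k => by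
    simp only [hN]
    rw [inner_cross_cross, hp.2]
    have h1 : ⟪p k, x (k + 1)⟫_ℝ = 1 + e := by
      simp only [hx]
      rw [add_sub_cancel_right, inner_add_right, hself, add_assoc, one_add_one_eq_two, he]
    have h2 : ⟪x k, p (k + 1)⟫_ℝ = 1 + e := by
      simp only [hx]
      rw [inner_add_left, hself, he', add_comm]
    rw [h1, h2]; ring
  have hang : ∀ k, angle (N k) (-N (k + 1)) = chordAngle 0 (b / 2) := fun k => by
    rw [angle, norm_neg, hNN, hNN, inner_neg_right, hNs, chordAngle_zero_left, hhalf,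
      Real.mul_self_sqrt (by linarith)]
    congr 1
    have : 1 + e ≠ 0 := by linarith
    rw [show 2 + 2 * e = 2 * (1 + e) by ring]
    field_simp
  have hpi := pi_le_sum_angle_neg hn (fun j : ℕ => N (j : ZMod n))
    (norm_pos_iff.1 (by rw [hNN]; exact Real.sqrt_pos.2 (by linarith))) (by simp)
  simp only [Nat.cast_succ, hang, Finset.sum_const, Finset.card_range, nsmul_eq_mul] at hpi
  have hn0 : (0 : ℝ) < n := by exact_mod_cast Nat.pos_of_ne_zero (NeZero.ne n)
  have h1 : chordAngle 0 β ≤ chordAngle 0 (b / 2) := by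
    rw [hβn, div_le_iff₀ hn0]; linarith
  have h2 := ((strictMonoOn_chordAngle le_rfl zero_lt_one).le_iff_le hβ
    ⟨by linarith [Real.arccos_nonneg e], by linarith [Real.arccos_le_pi e]⟩).1 h1
  have h3 : turning p = n * b := by
    simp only [turning, he, Finset.sum_const, Finset.card_univ, ZMod.card, nsmul_eq_mul, hb]
  rw [h3]
  exact mul_le_mul_of_nonneg_left (by linarith) hn0.le

/-- Reindexing by multiples of two modulo an odd number. -/
theorem sum_two_mul {g : ℕ} (hn : n = 2 * g + 1) (F : ZMod n → ℝ) (k : ZMod n) :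
    ∑ i, F (k + 2 * i) = ∑ i, F i := by
  have h0 := ChordSystem.cast_shift hn
  let e : ZMod n ≃ ZMod n :=
    { toFun := fun i => k + 2 * i
      invFun := fun i => -g * (i - k)
      left_inv := fun i => by linear_combination (-i) * h0
      right_inv := fun i => by linear_combination (-(i - k)) * h0 }
  exact Equiv.sum_comp e F

/-- As `n` is odd, steps of two run through all vertices and form a closed path whose length is the
turning. A closed path through two antipodes has length at least `2 * π`. -/
theorem IsOrthogonalCycle.two_pi_le_turning {g : ℕ} (hp : IsOrthogonalCycle p)
    (hn : n = 2 * g + 1) {k : ZMod n} (hk : ⟪p k, p (k + 2)⟫_ℝ = -1) : 2 * π ≤ turning p := by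
  have h1 : ∀ i, arccos ⟪p i, p (i + 2)⟫_ℝ = angle (p i) (p (i + 2)) := fun i =>
    (angle_of_norm_eq_one (hp.1 _) (hp.1 _)).symm
  set M : ℕ → E3 := fun j => p (k + 2 + 2 * (j : ZMod n)) with hM
  have h2 : turning p = ∑ j ∈ Finset.range n, angle (M j) (M (j + 1)) := by
    rw [turning, ← sum_two_mul hn _ (k + 2),
      ← sum_range_zmod fun i : ZMod n => arccos ⟪p (k + 2 + 2 * i), p (k + 2 + 2 * i + 2)⟫_ℝ]
    refine Finset.sum_congr rfl fun j _ => ?_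
    rw [h1, hM]
    congr 2
    push_cast; ring
  have hne : M 0 ≠ 0 := by
    rw [← norm_pos_iff]; simp only [hM, hp.1]; norm_num
  have h3 := angle_le_sum M hne (2 * g)
  have h0 := ChordSystem.cast_shift hn
  have e1 : M 0 = p (k + 2) := by simp [hM]
  have e2 : M (2 * g) = p k := by
    simp only [hM]; congr 1; push_cast; linear_combination 2 * h0
  have e3 : M (2 * g + 1) = p (k + 2) := by
    simp only [hM]; congr 1; push_cast; linear_combination 2 * h0
  have h4 : angle (p k) (p (k + 2)) = π := by rw [← h1, hk, Real.arccos_neg_one]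
  rw [h2, hn, Finset.sum_range_succ, e2, e3, h4]
  rw [e1, e2, angle_comm, h4] at h3
  linarith

/-- Two consecutive vertices can be removed from a cycle if their neighbours coincide. -/
theorem IsOrthogonalCycle.exists_shorter {m : ℕ} [NeZero m] (hm : 2 ≤ m) {p : ZMod (m + 2) → E3}
    (hp : IsOrthogonalCycle p) {k : ZMod (m + 2)} (hk : p k = p (k + 2)) :
    ∃ p' : ZMod m → E3, IsOrthogonalCycle p' ∧ turning p' ≤ turning p := by
  have hmm : (m : ZMod (m + 2)) + 2 = 0 := by
    have := ZMod.natCast_self (m + 2); push_cast at this; exact this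
  set q : ℕ → E3 := fun j => p (k + 2 + j) with hq
  have q0 : q m = q 0 := by
    simp only [hq]
    rw [show k + 2 + (m : ZMod (m + 2)) = k by linear_combination hmm, hk]; simp
  have q3 : q (m + 3) = q 1 := by
    simp only [hq]; congr 1; push_cast; linear_combination hmm
  have qn : ∀ j, ‖q j‖ = 1 := fun j => hp.1 _
  have qo : ∀ j, ⟪q j, q (j + 1)⟫_ℝ = 0 := fun j => by
    simp only [hq]; rw [Nat.cast_succ, ← add_assoc]; exact hp.2 _
  set p' : ZMod m → E3 := fun i => q i.val with hp'
  have hpq : ∀ a : ℕ, a ≤ m → p' (a : ZMod m) = q a := fun a ha => by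
    simp only [hp', ZMod.val_natCast]
    rcases ha.eq_or_lt with rfl | ha
    · rw [Nat.mod_self, q0]
    · rw [Nat.mod_eq_of_lt ha]
  refine ⟨p', ⟨fun i => qn _, fun i => ?_⟩, ?_⟩
  · have h1 := ZMod.val_lt i
    have h2 : p' (i + 1) = q (i.val + 1) := by
      rw [← hpq _ (by omega), Nat.cast_succ, ZMod.natCast_zmod_val]
    rw [h2]; exact qo _
  · have t1 : turning p = ∑ j ∈ Finset.range (m + 2), angle (q j) (q (j + 2)) := by
      have hs := Equiv.sum_comp (Equiv.addLeft (k + 2)) fun i => arccos ⟪p i, p (i + 2)⟫_ℝ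
      simp only [Equiv.coe_addLeft] at hs
      rw [turning, ← hs,
        ← sum_range_zmod fun i : ZMod (m + 2) => arccos ⟪p (k + 2 + i), p (k + 2 + i + 2)⟫_ℝ]
      refine Finset.sum_congr rfl fun j _ => ?_
      rw [angle_of_norm_eq_one (qn _) (qn _)]
      simp only [hq]
      congr 3
      push_cast; ring
    obtain ⟨l, rfl⟩ : ∃ l, m = l + 1 := ⟨m - 1, by omega⟩
    have t2 : turning p' = ∑ j ∈ Finset.range l, angle (q j) (q (j + 2)) + angle (q l) (q 1) := by
      rw [turning, ← sum_range_zmod fun i : ZMod (l + 1) => arccos ⟪p' i, p' (i + 2)⟫_ℝ,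
        Finset.sum_range_succ]
      congr 1
      · refine Finset.sum_congr rfl fun j hj => ?_
        rw [Finset.mem_range] at hj
        have h2 : p' ((j : ZMod (l + 1)) + 2) = q (j + 2) := by
          rw [← hpq _ (by omega)]; push_cast; rfl
        rw [h2, hpq _ (by omega), angle_of_norm_eq_one (qn _) (qn _)]
      · have h2 : p' ((l : ZMod (l + 1)) + 2) = q 1 := by
          rw [← hpq 1 (by omega)]
          congr 1
          have := ZMod.natCast_self (l + 1); push_cast at this
          push_cast; linear_combination this
        rw [h2, hpq _ (by omega), angle_of_norm_eq_one (qn _) (qn _)]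
    rw [t1, t2, Finset.sum_range_succ, Finset.sum_range_succ, Finset.sum_range_succ]
    -- In the shorter cycle the angle from `q l` to `q 1` replaces two angles which meet at the
    -- removed vertex `q (l + 2)`, and another angle is dropped.
    have h1 := angle_le_angle_add_angle (q l) (q (l + 2)) (q 1)
    have h2 := angle_nonneg (q (l + 1)) (q (l + 1 + 2))
    have h3 : q (l + 1 + 1 + 2) = q 1 := q3
    rw [h3]
    linarith

theorem exists_chordAngle_zero_eq (hn : 2 ≤ n) :
    ∃ β ∈ Icc 0 (π / 2), chordAngle 0 β = π / n := by
  have hn2 : (2 : ℝ) ≤ n := by exact_mod_cast hn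
  have h1 : π / n ≤ π / 2 := div_le_div_of_nonneg_left Real.pi_pos.le two_pos hn2
  have h0 : 0 ≤ π / n := by positivity
  have hc : 0 ≤ cos (π / n) := Real.cos_nonneg_of_mem_Icc ⟨by linarith [Real.pi_pos], h1⟩
  refine ⟨arccos √(cos (π / n)), ⟨Real.arccos_nonneg _,
    Real.arccos_le_pi_div_two.2 (Real.sqrt_nonneg _)⟩, ?_⟩
  rw [chordAngle_zero_left, Real.cos_arccos (by linarith [Real.sqrt_nonneg (cos (π / n))])
    (Real.sqrt_le_one.2 (Real.cos_le_one _)), Real.sq_sqrt hc,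
    Real.arccos_cos h0 (by linarith [Real.pi_pos])]

theorem le_chordAngle_zero {β : ℝ} (hβ : β ∈ Icc 0 (π / 2)) : β ≤ chordAngle 0 β := by
  have hc := Real.cos_nonneg_of_mem_Icc (x := β) ⟨by linarith [hβ.1, Real.pi_pos], hβ.2⟩
  have h2 := Real.cos_le_one β
  calc β = arccos (cos β) := (Real.arccos_cos hβ.1 (by linarith [hβ.2, Real.pi_pos])).symm
    _ ≤ arccos (cos β ^ 2) := Real.antitone_arccos (by nlinarith)
    _ = _ := (chordAngle_zero_left β).symm

/-- Jensen's inequality for `m` arguments `β'` and two arguments `0`: the regular minimum does not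
increase when two vertices are added. This is what the induction on the number of vertices needs. -/
theorem add_two_mul_le {m : ℕ} (hm : 1 ≤ m) {β β' : ℝ} (hβ : β ∈ Icc 0 (π / 2))
    (hβn : chordAngle 0 β = π / (m + 2 : ℕ)) (hβ' : β' ∈ Icc 0 (π / 2))
    (hβn' : chordAngle 0 β' = π / m) : (m + 2 : ℕ) * β ≤ m * β' := by
  have hm0 : (m : ℝ) ≠ 0 := by positivity
  have := (le_sum_of_pi_le (ι := Fin m ⊕ Fin 2) le_rfl zero_lt_one
    (ψ := Sum.elim (fun _ => β') fun _ => 0) (fun i => by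
      rcases i with i | i
      · exact ⟨hβ'.1, by simp only [Sum.elim_inl]; linarith [hβ'.2, Real.pi_pos]⟩
      · exact ⟨le_rfl, Real.pi_pos.le⟩) hβ (by simpa using hβn) (by
      simp only [Fintype.sum_sum_type, Sum.elim_inl, Sum.elim_inr, chordAngle_zero le_rfl, hβn',
        Finset.sum_const, Finset.card_univ, Fintype.card_fin, nsmul_eq_mul, mul_zero, add_zero]
      rw [mul_div_cancel₀ _ hm0])).1
  simpa using this

/-- The angles of a shortest cycle are equal if they are neither zero nor straight. -/
theorem IsOrthogonalCycle.inner_eq_of_min' (hp : IsOrthogonalCycle p) (hn : 3 ≤ n)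
    (hmin : ∀ q : ZMod n → E3, IsOrthogonalCycle q → turning p ≤ turning q)
    (he : ∀ j, |⟪p j, p (j + 2)⟫_ℝ| < 1) (k : ZMod n) :
    ⟪p k, p (k + 2)⟫_ℝ = ⟪p 0, p (0 + 2)⟫_ℝ := by
  have key : ∀ j : ℕ, ⟪p j, p (j + 2)⟫_ℝ = ⟪p 0, p (0 + 2)⟫_ℝ := fun j => by
    induction j with
    | zero => rw [Nat.cast_zero]
    | succ j ih =>
      have := hp.inner_eq_of_min hn hmin he (j + 1)
      rw [add_sub_cancel_right, add_assoc, one_add_one_eq_two] at this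
      rw [Nat.cast_succ, ← this, ih]
  have := key k.val
  rwa [ZMod.natCast_zmod_val] at this

/-- A minimizer either has equal angles, or has a zero angle, which is left to `hshort`, or has a
straight angle. In the last case `2 * π` suffices, since `β ≤ chordAngle 0 β = π / n`. -/
theorem IsOrthogonalCycle.le_turning_of_shorter {g : ℕ} (hp : IsOrthogonalCycle p) (hn3 : 3 ≤ n)
    (hn : n = 2 * g + 1) {β : ℝ} (hβ : β ∈ Icc 0 (π / 2)) (hβn : chordAngle 0 β = π / n)
    (hshort : ∀ r : ZMod n → E3, IsOrthogonalCycle r → ∀ k, r k = r (k + 2) →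
      n * (2 * β) ≤ turning r) : n * (2 * β) ≤ turning p := by
  obtain ⟨r, hr, hmin⟩ := exists_forall_turning_le ⟨p, hp⟩
  refine le_trans ?_ (hmin p hp)
  by_cases he : ∀ j, |⟪r j, r (j + 2)⟫_ℝ| < 1
  · exact hr.le_turning_of_const hn (hr.inner_eq_of_min' hn3 hmin he)
      (abs_lt.1 (he 0)).1 hβ hβn
  · push Not at he
    obtain ⟨j, hj⟩ := he
    have hle := abs_real_inner_le_norm (r j) (r (j + 2))
    rw [hr.1, hr.1, one_mul] at hle
    rcases eq_or_eq_neg_of_abs_eq (le_antisymm hle hj) with h1 | h1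
    · exact hshort r hr j ((inner_eq_one_iff_of_norm_eq_one (𝕜 := ℝ) (hr.1 _) (hr.1 _)).1 h1)
    · refine le_trans ?_ (hr.two_pi_le_turning hn h1)
      have h2 := le_chordAngle_zero hβ
      have hn0 : (0 : ℝ) < n := by exact_mod_cast Nat.pos_of_ne_zero (NeZero.ne n)
      rw [hβn, le_div_iff₀ hn0] at h2
      linarith

/-- The turning of a cycle of quarter circles is at least that of the regular one. -/
theorem IsOrthogonalCycle.le_turning {g : ℕ} (hg : 1 ≤ g) {n : ℕ} [NeZero n] (hn : n = 2 * g + 1)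
    {p : ZMod n → E3} (hp : IsOrthogonalCycle p) {β : ℝ} (hβ : β ∈ Icc 0 (π / 2))
    (hβn : chordAngle 0 β = π / n) : n * (2 * β) ≤ turning p := by
  induction g, hg using Nat.le_induction generalizing n β with
  | base =>
    -- Modulo three, `k + 2` and `k` are neighbours in the cycle, so these vertices are orthogonal
    -- and cannot coincide.
    refine hp.le_turning_of_shorter (by omega) hn hβ hβn fun r hr k hk => ?_
    exfalso
    subst hn
    have h1 := hr.2 (k + 2)
    rw [show k + 2 + 1 = k from by
      rw [add_assoc, show (2 : ZMod (2 * 1 + 1)) + 1 = 0 from rfl, add_zero], ← hk,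
      real_inner_self_eq_norm_sq, hr.1] at h1
    norm_num at h1
  | succ g hg ih =>
    refine hp.le_turning_of_shorter (by omega) hn hβ hβn fun r hr k hk => ?_
    obtain rfl : n = 2 * g + 1 + 2 := by omega
    have : NeZero (2 * g + 1) := ⟨by omega⟩
    obtain ⟨p', hp', hle⟩ := hr.exists_shorter (by omega) hk
    obtain ⟨β', hβ', hβn'⟩ := exists_chordAngle_zero_eq (n := 2 * g + 1) (by omega)
    have h1 := ih rfl hp' hβ' hβn'
    have h2 := add_two_mul_le (by omega) hβ hβn hβ' hβn'
    linarith

end OrthogonalCycle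

namespace ChordSystem

/-- At thickness `π / 2` each vertex is the normal of the opposite side, so the normals taken in
steps of `g` form an orthogonal cycle whose turning is the sum of the exterior angles. If the bound
were not strict, this cycle would be a minimizer; its angles would be equal, and so would both the
exterior angles and the sides. -/
theorem sum_exterior_lt_of_eq_zero {n g : ℕ} [NeZero n] {v : ZMod n → S2}
    {w x : ZMod n → E3} {σ : ZMod n → ZMod n} {s : ℝ}
    (h : ChordSystem n (fun i => (v i : E3)) w x σ 0 s) (hn : n = 2 * g + 1)
    (hσ : ∀ i, σ i = i + g) (hreg : ¬ IsRegularPolygon n (hull (range v))) {β : ℝ}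
    (hβ : β ∈ Icc 0 (π / 2)) (hβn : chordAngle 0 β = π / n) :
    n * (2 * β) < ∑ i, angle (w (i - 1)) (w i) := by
  have hP := h.pair
  have hn3 := hP.three_le
  have h0 := cast_shift hn
  have hs : s = 1 := by
    have h1 := h.sq
    have h2 := h.s_pos
    nlinarith
  have hv : ∀ i, w (i + g) = v i := fun i => by
    have := h.eq_v i
    rw [hs, hσ, zero_smul, add_zero, one_smul] at this
    exact this.symm
  set u : ZMod n → E3 := fun k => w (k * g) with hu
  have hcyc : IsOrthogonalCycle u := by
    refine ⟨fun k => hP.norm_w _, fun k => ?_⟩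
    simp only [hu]
    rw [add_one_mul, hv, real_inner_comm]
    exact hP.inner_left _
  have hstep : ∀ k, u (k + 2) = w (k * g - 1) := fun k => by
    simp only [hu]; congr 1; linear_combination h0
  have hsum : turning u = ∑ i, angle (w (i - 1)) (w i) := by
    let e : ZMod n ≃ ZMod n :=
      { toFun := fun i => i * g
        invFun := fun i => -2 * i
        left_inv := fun i => by linear_combination (-i) * h0
        right_inv := fun i => by linear_combination (-i) * h0 }
    have h1 := Equiv.sum_comp e fun i => angle (w (i - 1)) (w i)
    rw [← h1, turning]
    refine Finset.sum_congr rfl fun k _ => ?_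
    rw [hstep, ← angle_of_norm_eq_one (hP.norm_w _) (hP.norm_w _), angle_comm]
    rfl
  by_contra! hle
  rw [← hsum] at hle
  have hmin : ∀ q : ZMod n → E3, IsOrthogonalCycle q → turning u ≤ turning q := fun q hq =>
    hle.trans (hq.le_turning (by omega) hn hβ hβn)
  have hlt : ∀ i, |⟪w i, w (i + 1)⟫_ℝ| < 1 := fun i => by
    obtain ⟨r, hr, e⟩ := hP.cross_w i
    have h1 := inner_cross_cross (w i) (w (i + 1)) (w i) (w (i + 1))
    rw [e, real_inner_smul_left, real_inner_smul_right, hP.inner_self_v, hP.inner_self_w,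
      hP.inner_self_w, real_inner_comm (w i) (w (i + 1))] at h1
    rw [← sq_lt_one_iff_abs_lt_one]
    nlinarith [mul_pos hr hr]
  have hw : ∀ i, ⟪w i, w (i + 1)⟫_ℝ = ⟪u (-2 * (i + 1)), u (-2 * (i + 1) + 2)⟫_ℝ := fun i => by
    rw [hstep]
    simp only [hu]
    rw [show -2 * (i + 1) * (g : ZMod n) = i + 1 by linear_combination (-(i + 1)) * h0,
      add_sub_cancel_right, real_inner_comm]
  have he : ∀ j, |⟪u j, u (j + 2)⟫_ℝ| < 1 := fun j => by
    rw [hstep, real_inner_comm]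
    have := hlt (j * g - 1)
    rwa [sub_add_cancel] at this
  have hconst : ∀ i, ⟪w i, w (i + 1)⟫_ℝ = ⟪u 0, u (0 + 2)⟫_ℝ := fun i => by
    rw [hw]; exact hcyc.inner_eq_of_min' hn3 hmin he _
  have hang : ∀ i j, angle (w i) (w (i + 1)) = angle (w j) (w (j + 1)) := fun i j => by
    rw [angle_of_norm_eq_one (hP.norm_w _) (hP.norm_w _),
      angle_of_norm_eq_one (hP.norm_w _) (hP.norm_w _), hconst, hconst]
  refine hreg ⟨v, hP.inConvexPosition, rfl, hP.isCounterclockwise, fun i j => ?_, fun i j => ?_⟩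
  · rw [sphDist, sphDist, ← hv, ← hv, ← hv, ← hv, add_right_comm i, add_right_comm j]
    exact hang _ _
  · rw [hP.sphAngle_eq, hP.sphAngle_eq]
    have := hang (i - 1) (j - 1)
    rw [sub_add_cancel, sub_add_cancel] at this
    rw [this]

end ChordSystem

end

/-! ### Comparison of the areas -/

section

open InnerProductGeometry

/-- The sum of the exterior angles of a reduced non-regular polygon exceeds that of the regular
polygon of the same thickness. -/
theorem RegularFrame.sum_exterior_lt {n g : ℕ} [NeZero n] {e₁ e₂ o : E3} {κ μ S Q : ℝ}
    (F : RegularFrame n e₁ e₂ o κ μ S Q) (hn : n = 2 * g + 1) {v : ZMod n → S2}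
    {w x : ZMod n → E3} {σ : ZMod n → ZMod n} {s : ℝ}
    (h : ChordSystem n (fun i => (v i : E3)) w x σ (κ * Q - μ * S) s) (hσ : ∀ i, σ i = i + g)
    (hreg : ¬ IsRegularPolygon n (hull (range v))) :
    n * (2 * arccos (μ * S + κ * Q * cos (π / n))) < ∑ i, angle (w (i - 1)) (w i) := by
  have hc0 := h.c_nonneg
  have hc1 := h.c_lt
  have hψ := F.chordAngle_exterior hc0
  have hmem : arccos (μ * S + κ * Q * cos (π / n)) ∈ Icc 0 (π / 2) :=
    ⟨Real.arccos_nonneg _, Real.arccos_le_pi_div_two.2 F.exterior_pos.le⟩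
  rcases hc0.eq_or_lt with hc | hc
  · rw [← hc] at h hψ
    exact h.sum_exterior_lt_of_eq_zero hn hσ hreg hmem hψ
  · have hcard : (Fintype.card (ZMod n) : ℝ) = n := by rw [ZMod.card]
    have := (le_sum_of_pi_le hc0 hc1 (ψ := fun i => angle (x i) (w i))
      (fun i => ⟨angle_nonneg _ _, angle_le_pi _ _⟩) hmem (by rw [hcard]; exact hψ)
      (h.pi_le_sum_chordAngle hn hσ hc)).2 (by
        by_contra! hall
        exact hreg (h.isRegularPolygon hn hσ hc hall))
    rw [h.sum_angle_w_w hn hσ hc]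
    rw [hcard] at this
    linarith

theorem area_lt_area {n : ℕ} [NeZero n] {V W : Set S2} (hpoly : IsPolygon n V) (hred : IsReduced V)
    (hreg : ¬ IsRegularPolygon n V) (hW : IsRegularPolygon n W) (ht : thickness W = thickness V) :
    area V < area W := by
  obtain ⟨v, hconv, rfl⟩ := hpoly
  obtain ⟨v', hv', hcyc⟩ := hconv.exists_cyclicPos
  rw [← hv'] at hred hreg ht ⊢
  have hP := hcyc.polarPair hconv.1 fun i => by simp
  obtain ⟨x, σ, hC⟩ := hP.exists_chordSystem hred
  obtain ⟨g, hn, hσ⟩ := hC.exists_shift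
  obtain ⟨e₁, e₂, o, κ, μ, S, Q, F, rfl⟩ := hW.exists_frame
  have hle := hP.thickness_le_pi_div_two hred
  -- The thickness being at most `π / 2`, the formula for odd regular polygons applies to `W`, and
  -- both polygons have the same `c`.
  have hc0 := F.nonneg_of_thickness_le hn (ht.trans_le hle)
  have hc : cos (thickness (hull (range v'))) = κ * Q - μ * S := by
    rw [← ht, F.thickness_eq hn hc0, Real.cos_arccos (by linarith)]
    nlinarith [F.circum, F.inscr, sq_nonneg (κ - Q), mul_pos F.μ_pos F.S_pos, sq_nonneg μ,
      sq_nonneg S]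
  rw [hc] at hC
  have hlt := F.sum_exterior_lt hn hC hσ hreg
  rw [hP.area_hull, F.polarPair.area_hull]
  have hsum : ∑ i, angle (F.normal (i - 1)) (F.normal i) =
      n * (2 * arccos (μ * S + κ * Q * cos (π / n))) := by
    simp only [F.angle_normal, Finset.sum_const, Finset.card_univ, ZMod.card, nsmul_eq_mul]
  rw [hsum]
  have hB := ballMeasure_pos
  have hpi := Real.pi_pos
  gcongr

theorem exists_regular_thickness_eq {n : ℕ} [NeZero n] {V : Set S2} (hpoly : IsPolygon n V)
    (hred : IsReduced V) :
    ∃ W, IsRegularPolygon n W ∧ thickness W = thickness V := by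
  obtain ⟨v, hconv, rfl⟩ := hpoly
  obtain ⟨v', hv', hcyc⟩ := hconv.exists_cyclicPos
  rw [← hv'] at hred ⊢
  have hP := hcyc.polarPair hconv.1 fun i => by simp
  obtain ⟨x, σ, hC⟩ := hP.exists_chordSystem hred
  obtain ⟨g, hn, hσ⟩ := hC.exists_shift
  have hle := hP.thickness_le_pi_div_two hred
  obtain ⟨e₁, e₂, o, κ, μ, S, Q, F, hc⟩ := exists_regularFrame hconv.1 hC.c_nonneg hC.c_lt
  refine ⟨_, F.isRegularPolygon, ?_⟩
  rw [F.thickness_eq hn (hc ▸ hC.c_nonneg), hc, Real.arccos_cos (thickness_nonneg _)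
    (by linarith [Real.pi_pos])]

end

end SphericalGeometry

end

theorem theorem4p4 (n : ℕ) (V : Set SphericalGeometry.S2)
    (hpoly : SphericalGeometry.IsPolygon n V)
    (hred : SphericalGeometry.IsReduced V)
    (hnonreg : ¬ SphericalGeometry.IsRegularPolygon n V) :
    (∃ W : Set SphericalGeometry.S2, SphericalGeometry.IsRegularPolygon n W ∧
      SphericalGeometry.thickness W = SphericalGeometry.thickness V) ∧
    ∀ W : Set SphericalGeometry.S2, SphericalGeometry.IsRegularPolygon n W →
      SphericalGeometry.thickness W = SphericalGeometry.thickness V →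
      SphericalGeometry.area V < SphericalGeometry.area W := by
  have : NeZero n := ⟨by
    obtain ⟨v, hv, -⟩ := hpoly
    have := hv.1
    omega⟩
  exact ⟨SphericalGeometry.exists_regular_thickness_eq hpoly hred, fun W hW ht =>
    SphericalGeometry.area_lt_area hpoly hred hnonreg hW ht⟩
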